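/- **Setting.** Let $\mathbb T^3=\mathbb R^3/\mathbb Z^3$, $0<T<\infty$, and consider on $(0,T)\times\mathbb T^3$ the Hall MHD equations $$u_t+u\cdot\nabla u-b\cdot\nabla b+\nabla\Pi=0,\qquad b_t+u\cdot\nabla b-b\cdot\nabla u+\nabla\times(j\times b)=0,\qquad \operatorname{div}u=\operatorname{div}b=0,\qquad j=\nabla\times b .$$ Here $(u,b)$ is a weak solution if $u,b\in L^2_{loc}$ and $j,\ j\times b\in L^1_{loc}$, and all the equations hold in the sense of distributions on $(0,T)\times\mathbb T^3$, with the products written in divergence form and with a pressure $\Pi\in L^1_{loc}$ (where $loc$ means: integrable over $[a,c]\times\mathbb T^3$ for all $[a,c]\subset(0,T)$). For vector fields $v,w,z$ put $\delta v(\ell)=v(t,x+\ell)-v(t,x)$. For a mollifier $\varphi$, that is, a smooth nonnegative compactly supported function on $\mathbb R^3$ with integral $1$, put $\varphi_\varepsilon(\ell)=\varepsilon^{-3}\varphi(\ell/\varepsilon)$. Let $$I_\varepsilon(v,w,z)=\int_{\mathbb R^3}\big(\nabla\varphi_\varepsilon(\ell)\cdot\delta v(\ell)\big)\big(\delta w(\ell)\cdot\delta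 z(\ell)\big)\,d\ell,$$ $$S(v,w,z;\lambda)=\frac1\lambda\int_{|\zeta|=1}\big(\zeta\cdot\delta v(\lambda\zeta)\big)\big(\delta w(\lambda\zeta)\cdot\delta z(\lambda\zeta)\big)\frac{d\sigma(\zeta)}{4\pi}$$ (functions of $(t,x)$), and $$D(u,b,j;\varepsilon)=-\tfrac14 I_\varepsilon(u,u,u)-\tfrac14 I_\varepsilon(u,b,b)+\tfrac12 I_\varepsilon(b,u,b)+\tfrac18 I_\varepsilon(j,b,b)-\tfrac14 I_\varepsilon(b,j,b).$$ **Theorem 1.4.** Let $1<p,q,m,n<\infty$ with $\frac2p+\frac1m=1$ and $\frac2q+\frac1n=1$. Let $(u,b)$ be a weak solution of the Hall MHD equations with current $j=\nabla\times b$ and pressure $\Pi$, such that $$u\in L^\infty(0,T;L^2(\mathbb T^3))\cap L^3(0,T;L^3(\mathbb T^3)),\quad b\in L^\infty(0,T;L^2(\mathbb T^3))\cap L^p(0,T;L^q(\mathbb T^3)),\quad j\in L^m(0,T;L^n(\mathbb T^3)).$$ Then there is a distribution $D=D(u,b,j)$ on $(0,T)\times\mathbb T^3$ with the following properties. 1.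 For every mollifier $\varphi$ and every $\varepsilon>0$, the five integrals in $D(u,b,j;\varepsilon)$ converge absolutely for a.e. $(t,x)$ and are integrable on $(0,T)\times\mathbb T^3$, and $D(u,b,j;\varepsilon)\to D$ in the sense of distributions as $\varepsilon\to0^+$. 2. The distribution $\operatorname{div}(b\otimes b)$ is a function in $L^1_{loc}$ whose cross product with $b$ is in $L^1_{loc}$, and the local energy equation $$\partial_t\Big(\frac{|u|^2+|b|^2}2\Big)+\operatorname{div}\Big[u\Big(\frac{|u|^2+|b|^2}2+\Pi\Big)-b(b\cdot u)\Big]+\tfrac12\operatorname{div}\big([\operatorname{div}(b\otimes b)]\times b\big)-\tfrac14\operatorname{div}(j|b|^2)+\tfrac12\operatorname{div}\big(b\,(j\cdot b)\big)=D$$ holds in the sense of distributions, the energy density and the total flux being in $L^1_{loc}$. 3. (4/3 law) For every $\lambda>0$ the five spherical integrals below converge absolutely for a.e. $(t,x)$ and define integrable functions on $(0,T)\times\mathbb T^3$, and, in the sense of distributions, $$-\lim_{\lambda\to0^+}\Big[S(u,u,u;\lambda)+S(u,b,b;\lambda)-2S(b,u,b;\lambda)-\tfrac12S(j,b,b;\lambda)+S(b,j,b;\lambda)\Big]=-\tfrac43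 D .$$ In particular, whenever the distributional limits $S_1(j,b,b)=-\lim_{\lambda\to0^+}S(j,b,b;\lambda)$, $S_2(b,j,b)=-\lim_{\lambda\to0^+}S(b,j,b;\lambda)$, $S_3(u,u,u)=-\lim_{\lambda\to0^+}S(u,u,u;\lambda)$, $S_4(u,b,b)=-\lim_{\lambda\to0^+}S(u,b,b;\lambda)$ and $S_5(b,u,b)=-\lim_{\lambda\to0^+}S(b,u,b;\lambda)$ exist individually, then $$S_3(u,u,u)+S_4(u,b,b)-2S_5(b,u,b)-\tfrac12S_1(j,b,b)+S_2(b,j,b)=-\tfrac43D(u,b,j).$$ -/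

import Mathlib

open MeasureTheory Filter Topology Set
open scoped ENNReal ContDiff

namespace HallMHD

noncomputable section

/-- Three-dimensional Euclidean space. -/
abbrev E3 : Type := EuclideanSpace ℝ (Fin 3)

/-- The torus `ℝ³ / ℤ³`; its `volume` is the Haar (Lebesgue) measure of total mass one. -/
abbrev T3 : Type := UnitAddTorus (Fin 3)

/-- The quotient map `ℝ³ → ℝ³ / ℤ³`. -/
def proj (l : E3) : T3 := fun i => ((l i : ℝ) : UnitAddCircle)

/-- The cross product of `ℝ³`. -/
def cross (v w : E3) : E3 := WithLp.toLp 2 (crossProduct v.ofLp w.ofLp)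

/-! ### Differential operators on the torus -/

/-- The partial derivative `∂ₖ f (x)` of a function on the torus. -/
def pd {V : Type*} [NormedAddCommGroup V] [NormedSpace ℝ V] (k : Fin 3) (f : T3 → V) (x : T3) : V :=
  fderiv ℝ (fun l : E3 => f (x + proj l)) 0 (EuclideanSpace.single k 1)

/-- The gradient of a scalar function on the torus. -/
def grad (f : T3 → ℝ) (x : T3) : E3 := WithLp.toLp 2 (fun k => pd k f x)

/-- The divergence of a vector field on the torus. -/
def dvg (f : T3 → E3) (x : T3) : ℝ := ∑ k, (pd k f x) k

/-- The curl of a vector field on the torus. -/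
def curl (f : T3 → E3) (x : T3) : E3 :=
  WithLp.toLp 2 ![(pd 1 f x) 2 - (pd 2 f x) 1, (pd 2 f x) 0 - (pd 0 f x) 2,
    (pd 0 f x) 1 - (pd 1 f x) 0]

/-! ### Test functions and distributions on `(0,T) × 𝕋³` -/

/-- A function on `ℝ × 𝕋³` seen as a periodic function on `ℝ × ℝ³`. -/
def lift {V : Type*} (f : ℝ → T3 → V) (z : ℝ × E3) : V := f z.1 (proj z.2)

/-- The space `C_c^∞((0,T) × 𝕋³; V)` of test functions (extended by zero in time). -/
def TestFn (T : ℝ) (V : Type*) [NormedAddCommGroup V] [NormedSpace ℝ V] :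
    Submodule ℝ (ℝ → T3 → V) where
  carrier := {f | ContDiff ℝ ∞ (lift f) ∧
    ∃ a c : ℝ, 0 < a ∧ c < T ∧ ∀ t, t ∉ Icc a c → ∀ x, f t x = 0}
  zero_mem' := by
    refine ⟨?_, 1, T - 1, by norm_num, by linarith, fun _ _ _ => rfl⟩
    exact contDiff_const (c := (0 : V))
  add_mem' := by
    rintro f g ⟨hf, a, c, ha, hc, hfs⟩ ⟨hg, a', c', ha', hc', hgs⟩
    refine ⟨hf.add hg, min a a', max c c', lt_min ha ha', max_lt hc hc', fun t ht x => ?_⟩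
    have h1 : t ∉ Icc a c := fun h => ht ⟨(min_le_left _ _).trans h.1, h.2.trans (le_max_left _ _)⟩
    have h2 : t ∉ Icc a' c' :=
      fun h => ht ⟨(min_le_right _ _).trans h.1, h.2.trans (le_max_right _ _)⟩
    change f t x + g t x = 0
    rw [hfs t h1 x, hgs t h2 x, add_zero]
  smul_mem' := by
    rintro r f ⟨hf, a, c, ha, hc, hfs⟩
    refine ⟨contDiff_const.smul hf, a, c, ha, hc, fun t ht x => ?_⟩
    change r • f t x = 0
    rw [hfs t ht x, smul_zero]

/-- A linear functional on test functions is a distribution if on every compact time interval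
`[a,c] ⊆ (0,T)` it is bounded by finitely many sup norms of derivatives. -/
def IsDistribution (T : ℝ) (L : TestFn T ℝ →ₗ[ℝ] ℝ) : Prop :=
  ∀ a c : ℝ, 0 < a → c < T → ∃ (N : ℕ) (C : ℝ), ∀ ψ : TestFn T ℝ,
    (∀ t, t ∉ Icc a c → ∀ x, ψ.1 t x = 0) →
    ∀ M : ℝ, (∀ i ≤ N, ∀ z, ‖iteratedFDeriv ℝ i (lift ψ.1) z‖ ≤ M) → |L ψ| ≤ C * M

/-- Lebesgue measure on `(0,T) × 𝕋³`. -/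
def stMeasure (T : ℝ) : Measure (ℝ × T3) := (volume.restrict (Ioo 0 T)).prod volume

/-- `∫₀ᵀ ∫_{𝕋³} f(t,x) dx dt`. -/
def stInt (T : ℝ) (f : ℝ → T3 → ℝ) : ℝ := ∫ z, f z.1 z.2 ∂(stMeasure T)

/-- The functions `f ε` converge to `L` in the sense of distributions on `(0,T) × 𝕋³` as
`ε → 0⁺`. -/
def TendstoDistr (T : ℝ) (f : ℝ → ℝ → T3 → ℝ) (L : TestFn T ℝ →ₗ[ℝ] ℝ) : Prop :=
  ∀ ψ : TestFn T ℝ,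
    Tendsto (fun ε => stInt T (fun t x => f ε t x * ψ.1 t x)) (𝓝[>] 0) (𝓝 (L ψ))

/-! ### Function spaces -/

/-- `f ∈ L^r_loc((0,T); L^r(𝕋³))`. -/
def MemLocLp {V : Type*} [NormedAddCommGroup V] (T : ℝ) (r : ℝ≥0∞) (f : ℝ → T3 → V) : Prop :=
  ∀ a c : ℝ, 0 < a → c < T →
    MemLp (Function.uncurry f) r ((volume.restrict (Icc a c)).prod volume)

/-- `f ∈ L^p(0,T; L^q(𝕋³))`. -/
def MemMixed (T : ℝ) (p q : ℝ≥0∞) (f : ℝ → T3 → E3) : Prop :=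
  AEStronglyMeasurable (Function.uncurry f) (stMeasure T) ∧
    eLpNorm (fun t => eLpNorm (f t) q volume) p (volume.restrict (Ioo 0 T)) < ⊤

/-! ### Weak derivatives and weak solutions -/

/-- `div v = 0` in the sense of distributions. -/
def IsWeakDivFree (T : ℝ) (v : ℝ → T3 → E3) : Prop :=
  ∀ ψ : TestFn T ℝ, stInt T (fun t x => inner ℝ (v t x) (grad (ψ.1 t) x)) = 0

/-- `w = ∇ × v` in the sense of distributions. -/
def IsWeakCurl (T : ℝ) (v w : ℝ → T3 → E3) : Prop :=
  ∀ η : TestFn T E3, stInt T (fun t x => inner ℝ (w t x) (η.1 t x)) =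
    stInt T (fun t x => inner ℝ (v t x) (curl (η.1 t) x))

/-- `F = div (v ⊗ v)`, that is `Fᵢ = ∑ₖ ∂ₖ (vₖ vᵢ)`, in the sense of distributions. -/
def IsWeakDivTensor (T : ℝ) (v F : ℝ → T3 → E3) : Prop :=
  ∀ η : TestFn T E3, stInt T (fun t x => inner ℝ (F t x) (η.1 t x)) =
    - stInt T (fun t x => ∑ i, ∑ k, v t x k * v t x i * (pd k (η.1 t) x) i)

/-- `(u, b)`, with electric current `j = ∇ × b` and pressure `P`, is a weak (distributional)
solution on `(0,T) × 𝕋³` of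
`∂ₜ u + u·∇u - b·∇b + ∇P = 0`, `∂ₜ b + u·∇b - b·∇u + ∇ × (j × b) = 0`, `div u = div b = 0`.
The integrability fields are those needed for every term to be a distribution. -/
structure IsWeakSolution (T : ℝ) (u b j : ℝ → T3 → E3) (P : ℝ → T3 → ℝ) : Prop where
  memLp_u : MemLocLp T 2 u
  memLp_b : MemLocLp T 2 b
  memLp_j : MemLocLp T 1 j
  memLp_hall : MemLocLp T 1 (fun t x => cross (j t x) (b t x))
  memLp_P : MemLocLp T 1 P
  div_u : IsWeakDivFree T u
  div_b : IsWeakDivFree T b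
  curl_b : IsWeakCurl T b j
  momentum : ∀ η : TestFn T E3,
    - stInt T (fun t x => inner ℝ (u t x) (deriv (fun s => η.1 s x) t))
    - stInt T (fun t x => ∑ i, ∑ k,
        (u t x k * u t x i - b t x k * b t x i) * (pd k (η.1 t) x) i)
    - stInt T (fun t x => P t x * dvg (η.1 t) x) = 0
  induction : ∀ η : TestFn T E3,
    - stInt T (fun t x => inner ℝ (b t x) (deriv (fun s => η.1 s x) t))
    - stInt T (fun t x => ∑ i, ∑ k,
        (u t x k * b t x i - b t x k * u t x i) * (pd k (η.1 t) x) i)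
    + stInt T (fun t x => inner ℝ (cross (j t x) (b t x)) (curl (η.1 t) x)) = 0

/-! ### Increments, Duchon–Robert integrals and structure functions -/

/-- The increment `δv(ℓ) = v(t, x + ℓ) - v(t, x)`. -/
def incr (v : ℝ → T3 → E3) (t : ℝ) (x : T3) (l : E3) : E3 := v t (x + proj l) - v t x

/-- Smooth, nonnegative, compactly supported kernels on `ℝ³` with unit integral. -/
structure IsMollifier (φ : E3 → ℝ) : Prop where
  smooth : ContDiff ℝ ∞ φ
  compact : HasCompactSupport φ
  nonneg : ∀ l, 0 ≤ φ l
  integral_eq_one : ∫ l, φ l = 1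

/-- `φ_ε(ℓ) = ε⁻³ φ(ℓ/ε)`. -/
def rescale (φ : E3 → ℝ) (ε : ℝ) (l : E3) : ℝ := (ε ^ 3)⁻¹ * φ (ε⁻¹ • l)

/-- `(∇φ_ε(ℓ) · δv(ℓ)) (δw(ℓ) · δz(ℓ))`. -/
def drIntegrand (φ : E3 → ℝ) (v w z : ℝ → T3 → E3) (ε t : ℝ) (x : T3) (l : E3) : ℝ :=
  inner ℝ (gradient (rescale φ ε) l) (incr v t x l) * inner ℝ (incr w t x l) (incr z t x l)

/-- `∫ (∇φ_ε(ℓ) · δv(ℓ)) (δw(ℓ) · δz(ℓ)) dℓ`. -/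
def drInt (φ : E3 → ℝ) (v w z : ℝ → T3 → E3) (ε t : ℝ) (x : T3) : ℝ :=
  ∫ l : E3, drIntegrand φ v w z ε t x l

/-- The dissipation term `D(u,b,j;ε)`. -/
def dissipation (φ : E3 → ℝ) (u b j : ℝ → T3 → E3) (ε t : ℝ) (x : T3) : ℝ :=
  -(1 / 4) * drInt φ u u u ε t x - (1 / 4) * drInt φ u b b ε t x + (1 / 2) * drInt φ b u b ε t x
    + (1 / 8) * drInt φ j b b ε t x - (1 / 4) * drInt φ b j b ε t x

/-- The surface measure of the unit sphere of `ℝ³`, of total mass `4π`. -/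
def sphereMeasure : Measure (Metric.sphere (0 : E3) 1) := (volume : Measure E3).toSphere

/-- `(ζ · δv(rζ)) (δw(rζ) · δz(rζ))` for `ζ` in the unit sphere. -/
def sfIntegrand (v w z : ℝ → T3 → E3) (r t : ℝ) (x : T3) (ζ : Metric.sphere (0 : E3) 1) : ℝ :=
  inner ℝ (ζ : E3) (incr v t x (r • (ζ : E3))) *
    inner ℝ (incr w t x (r • (ζ : E3))) (incr z t x (r • (ζ : E3)))

/-- The structure function
`S(v,w,z;r) = r⁻¹ ∫_{|ζ|=1} (ζ · δv(rζ)) (δw(rζ) · δz(rζ)) dσ(ζ)/(4π)`. -/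
def structFn (v w z : ℝ → T3 → E3) (r t : ℝ) (x : T3) : ℝ :=
  r⁻¹ * ((4 * Real.pi)⁻¹ * ∫ ζ, sfIntegrand v w z r t x ζ ∂sphereMeasure)

/-- `S` is the distribution `- lim_{r → 0⁺} S(v,w,z;r)`. -/
def IsStructLimit (T : ℝ) (v w z : ℝ → T3 → E3) (S : TestFn T ℝ →ₗ[ℝ] ℝ) : Prop :=
  IsDistribution T S ∧ TendstoDistr T (fun r t x => - structFn v w z r t x) S

/-- For every scale `ε > 0` the Duchon–Robert integral is absolutely convergent at almost every
point and defines an integrable function on `(0,T) × 𝕋³`. -/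
def DRWellDefined (T : ℝ) (φ : E3 → ℝ) (v w z : ℝ → T3 → E3) : Prop :=
  ∀ ε : ℝ, 0 < ε →
    (∀ᵐ y ∂(stMeasure T), Integrable (drIntegrand φ v w z ε y.1 y.2)) ∧
    Integrable (fun y : ℝ × T3 => drInt φ v w z ε y.1 y.2) (stMeasure T)

/-- For every scale `r > 0` the spherical integral is absolutely convergent at almost every point
and defines an integrable function on `(0,T) × 𝕋³`. -/
def SFWellDefined (T : ℝ) (v w z : ℝ → T3 → E3) : Prop :=
  ∀ r : ℝ, 0 < r →
    (∀ᵐ y ∂(stMeasure T), Integrable (sfIntegrand v w z r y.1 y.2) sphereMeasure) ∧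
    Integrable (fun y : ℝ × T3 => structFn v w z r y.1 y.2) (stMeasure T)

/-! ### The local energy equation -/

/-- The energy density `(|u|² + |b|²)/2`. -/
def energyDensity (u b : ℝ → T3 → E3) (t : ℝ) (x : T3) : ℝ :=
  (‖u t x‖ ^ 2 + ‖b t x‖ ^ 2) / 2

/-- The energy flux
`u ((|u|² + |b|²)/2 + P) - b (b·u) + ½ F × b - ¼ j |b|² + ½ b (j·b)`; here `F` stands for
`div (b ⊗ b)`. -/
def energyFlux (u b j F : ℝ → T3 → E3) (P : ℝ → T3 → ℝ) (t : ℝ) (x : T3) : E3 :=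
  (energyDensity u b t x + P t x) • u t x - (inner ℝ (b t x) (u t x) : ℝ) • b t x
    + (1 / 2 : ℝ) • cross (F t x) (b t x) - (1 / 4 * ‖b t x‖ ^ 2) • j t x
    + (1 / 2 * inner ℝ (j t x) (b t x)) • b t x

/-- `∂ₜ e + div q = L` in the sense of distributions. -/
def SatisfiesBalance (T : ℝ) (e : ℝ → T3 → ℝ) (q : ℝ → T3 → E3) (L : TestFn T ℝ →ₗ[ℝ] ℝ) : Prop :=
  ∀ ψ : TestFn T ℝ,
    - stInt T (fun t x => e t x * deriv (fun s => ψ.1 s x) t)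
      - stInt T (fun t x => inner ℝ (q t x) (grad (ψ.1 t) x)) = L ψ

end

end HallMHD

open MeasureTheory Filter Topology Set
open scoped ENNReal ContDiff

set_option linter.overlappingInstances false
set_option linter.unusedSectionVars false

namespace HallMHD

noncomputable section

section

/-! ### Mollification along a homomorphism from a vector space to a group -/

/-! Everything is derived from exact identities for space-time mollifications, rewritten as
identities between correlations of the fields and then evaluated at zero separation. Extend `u`,
`b`, `j` by zero in time. For a smooth compactly supported kernel κ on ℝ × ℝ³ the pairing ∫ f (κ *
g) equals ∫ κ(y) C(y) dy, where C(y) = ∫ f(z) g(z + y) dz (`bil_eq_corr`). If κ only sees time lags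
shorter than the distance from the support of the test function ψ to the ends of (0,T), mollified
fields localized by ψ are admissible test functions, and no commutator is left over.

Expanding ψ (δv · ∇κ)(δw · δz) gives pairings in which the derivative falls on κ. Those with a
divergence-free advecting field collapse onto derivatives of ψ (`sum_trilin`); what remains are the
antisymmetrized pairings `epair`. The momentum and induction equations evaluate most of them
(`HallData.epair_momentum`, `HallData.epair_induction`). The pairing of b ⊗ b with j is not produced
by either equation. It comes from the relation of b to its current: (b·∇)b − ∇|b|²/2 = j × b holds
at each of the two points separately, and (j × b)(z) · j(z + y) can be written in two ways
(`HallData.epair_current`). The outcome, `HallPairs.integral_dk_mul_dissForm`, is a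
Kármán–Howarth–Monin relation: the divergence in y of the vector V(y) of tested increments is, up to
sign, an explicit function A(y). Both are continuous, so the time lag can be set to zero
(`time_diagonal`), leaving ∑ₖ ∫ ∂ₖφ Vₖ = ∫ φ A for all φ in C_c^∞(ℝ³).

The three claims are three uses of this relation. With φ = φ_ε the left side is the tested
dissipation and the right side tends to A(0), whatever the mollifier. With φ radial it says that the
flux of V through the sphere of radius r is minus the integral of A over the ball (`sphere_flux`),
so the spherical mean of ζ · V(rζ), divided by r, tends to −A(0)/3; the coefficients of the
structure functions are four times those of the dissipation, whence −4/3. Finally A(0) is the weak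
form of the local energy equation (`Setting.khmRhs_zero`), after subtracting a curl from the Hall
flux.

Continuity of V and A is where integrability enters. Trilinear forms of translates are continuous in
the shifts when the three factors lie in mixed Lebesgue spaces with Hölder conjugate exponents
(`Tri.continuous`). For j, b, b these are the spaces in the hypotheses. For u, b, b one needs b in
L³, which is not assumed but follows: div b = 0 and curl b = j give Δb = −curl j, so ∇b has the
integrability of j; by Poincaré's inequality and the energy bound b itself lies in L^m L^n, and
Hölder with b, b in L^p L^q gives L³ (`Setting.mixB3`). The pressure minus its space average lies in
L^{3/2} because −ΔΠ = ∂ᵢ∂ₖ(uᵢuₖ − bᵢbₖ) (`Setting.mix_press`); the average depends on time only and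
drops out since div u = 0.

Both facts rest on a Calderón–Zygmund inequality on the torus, obtained by a Bellman function. For
trigonometric polynomials extended by the heat flow, the pairing of F with ∂ₘ∂ₖW is an integral of
∂ₘF ∂ₖΔW over all times, and this is bounded by the loss of ∫ B(F, ΔW) for a convex function B with
B ≲ |F|^p + |ΔW|^{p'} (`heat_bellman`). Duality, density and mollification extend the inequality to
integrable data, and countability of the Fourier modes transfers distributional relations to almost
every time slice (`ae_slice_relation`). -/

/-- The mollification `∫ κ(y) f(z + π y) dy`. -/
def conv {E Γ : Type*} [AddCommGroup E] [MeasureSpace E] [AddCommGroup Γ]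
    (π : E →+ Γ) (κ : E → ℝ) (f : Γ → ℝ) (z : Γ) : ℝ := ∫ y, κ y * f (z + π y)

/-- The correlation `∫ f(z) g(z + w) dz`. -/
def corr {Γ : Type*} [AddCommGroup Γ] [MeasureSpace Γ] (f g : Γ → ℝ) (w : Γ) : ℝ :=
  ∫ z, f z * g (z + w)

section Mollification

variable {E Γ : Type*} [NormedAddCommGroup E] [NormedSpace ℝ E] [FiniteDimensional ℝ E]
  [MeasureSpace E] [BorelSpace E] [(volume : Measure E).IsAddHaarMeasure]
  [AddCommGroup Γ] [TopologicalSpace Γ] [IsTopologicalAddGroup Γ] [T2Space Γ]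
  [SecondCountableTopology Γ] [LocallyCompactSpace Γ] [MeasureSpace Γ] [BorelSpace Γ]
  [(volume : Measure Γ).IsAddHaarMeasure] [SigmaFinite (volume : Measure Γ)]
  [(volume : Measure Γ).Regular]

/-- A continuous homomorphism which covers every set of positive measure finitely often, locally
uniformly. -/
structure IsCovering (π : E →+ Γ) : Prop where
  continuous : Continuous π
  dominated : ∀ R : ℝ, ∃ C : NNReal,
    ((volume : Measure E).restrict (Metric.closedBall 0 R)).map π ≤ C • (volume : Measure Γ)

lemma aesm_shift {V : Type*} [TopologicalSpace V] {f : Γ → V}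
    (hf : AEStronglyMeasurable f) (w : Γ) : AEStronglyMeasurable (fun z => f (z + w)) :=
  hf.comp_measurePreserving (measurePreserving_add_right volume w)

lemma integrable_shift {f : Γ → ℝ} (hf : Integrable f) (w : Γ) :
    Integrable (fun z => f (z + w)) :=
  (measurePreserving_add_right volume w).integrable_comp_of_integrable hf

variable {π : E →+ Γ} (hπ : IsCovering π)
include hπ

lemma IsCovering.measurable : Measurable π := hπ.continuous.measurable

/-- The push-forward of Lebesgue measure on a ball is dominated by a multiple of Haar measure, and
Haar measure absorbs the translation by `z`; hence the constant does not depend on `z`. -/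
lemma IsCovering.lintegral_le (R : ℝ) : ∃ C : NNReal, ∀ (f : Γ → ℝ≥0∞), AEMeasurable f → ∀ z,
    ∫⁻ y in Metric.closedBall 0 R, f (z + π y) ≤ C * ∫⁻ z, f z := by
  obtain ⟨C, hC⟩ := hπ.dominated R
  refine ⟨C, fun f hf z => ?_⟩
  have hg : AEMeasurable (fun w => f (z + w)) :=
    hf.comp_quasiMeasurePreserving (measurePreserving_add_left volume z).quasiMeasurePreserving
  have hg' : AEMeasurable (fun w => f (z + w))
      (((volume : Measure E).restrict (Metric.closedBall 0 R)).map π) := by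
    refine hg.mono_ac (Measure.AbsolutelyContinuous.trans (Measure.absolutelyContinuous_of_le hC) ?_)
    exact Measure.smul_absolutelyContinuous
  calc ∫⁻ y in Metric.closedBall 0 R, f (z + π y)
      = ∫⁻ w, f (z + w) ∂(((volume : Measure E).restrict (Metric.closedBall 0 R)).map π) := by
        rw [lintegral_map' hg' hπ.measurable.aemeasurable]
    _ ≤ ∫⁻ w, f (z + w) ∂(C • (volume : Measure Γ)) := lintegral_mono' hC le_rfl
    _ = C * ∫⁻ w, f (z + w) := by rw [lintegral_smul_measure]; rfl
    _ = C * ∫⁻ z, f z := by rw [lintegral_add_left_eq_self f z]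

/-- Exhaust the cover by balls: on each of them the preimage of a null set has measure at most a
constant times zero. -/
lemma IsCovering.quasiMeasurePreserving (z : Γ) :
    Measure.QuasiMeasurePreserving (fun y => z + π y) (volume : Measure E) volume := by
  refine ⟨(measurable_const.add hπ.measurable), ?_⟩
  refine Measure.AbsolutelyContinuous.mk fun s hs h0 => ?_
  rw [Measure.map_apply (by exact measurable_const.add hπ.measurable) hs]
  rw [← nonpos_iff_eq_zero]
  have hU : ((fun y => z + π y) ⁻¹' s) =
      ⋃ n : ℕ, ((fun y => z + π y) ⁻¹' s) ∩ Metric.closedBall 0 (n : ℝ) := by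
    rw [← inter_iUnion, Metric.iUnion_closedBall_nat, inter_univ]
  rw [hU, nonpos_iff_eq_zero, measure_iUnion_null_iff]
  intro n
  obtain ⟨C, hC⟩ := hπ.lintegral_le (n : ℝ)
  have h1 := hC (s.indicator 1) (aemeasurable_one.indicator hs) z
  rw [lintegral_indicator_one hs, h0, mul_zero, nonpos_iff_eq_zero] at h1
  have hm : MeasurableSet ((fun y => z + π y) ⁻¹' s) :=
    (measurable_const.add hπ.measurable) hs
  have h2 : (fun y => s.indicator (1 : Γ → ℝ≥0∞) (z + π y)) =
      ((fun y => z + π y) ⁻¹' s).indicator 1 := by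
    rfl
  rw [h2, lintegral_indicator_one hm, Measure.restrict_apply hm] at h1
  exact h1

lemma IsCovering.aesm_comp {V : Type*} [TopologicalSpace V] {f : Γ → V}
    (hf : AEStronglyMeasurable f) (z : Γ) :
    AEStronglyMeasurable (fun y => f (z + π y)) :=
  hf.comp_quasiMeasurePreserving (hπ.quasiMeasurePreserving z)

lemma IsCovering.locallyIntegrable {f : Γ → ℝ} (hf : Integrable f) (z : Γ) :
    LocallyIntegrable (fun y => f (z + π y)) := by
  rw [locallyIntegrable_iff]
  intro K hK
  obtain ⟨R, hR⟩ := hK.isBounded.subset_closedBall (0 : E)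
  obtain ⟨C, hC⟩ := hπ.lintegral_le R
  refine IntegrableOn.mono_set ⟨(hπ.aesm_comp hf.1 z).restrict, ?_⟩ hR
  refine (hC (fun z => ‖f z‖ₑ) hf.1.enorm z).trans_lt ?_
  exact ENNReal.mul_lt_top ENNReal.coe_lt_top hf.2

lemma IsCovering.integrable_conv_integrand {κ : E → ℝ} (hκ : Continuous κ)
    (hc : HasCompactSupport κ) {f : Γ → ℝ} (hf : Integrable f) (z : Γ) :
    Integrable (fun y => κ y * f (z + π y)) := by
  simpa using (hπ.locallyIntegrable hf z).integrable_smul_left_of_hasCompactSupport hκ hc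

/-- The kernel is bounded with support in a ball, so mollification is bounded from L¹ to L^∞. The
absolute value stays inside the integral because the bound serves Tonelli's theorem in
`integrable_prod`. -/
lemma IsCovering.lintegral_kernel_le {κ : E → ℝ} (hκ : Continuous κ)
    (hc : HasCompactSupport κ) : ∃ C : NNReal, ∀ (f : Γ → ℝ), Integrable f → ∀ z,
    ∫⁻ y, ‖κ y * f (z + π y)‖ₑ ≤ C * ∫⁻ z, ‖f z‖ₑ := by
  obtain ⟨M, hM⟩ := hc.exists_bound_of_continuous hκ
  obtain ⟨R, hR⟩ := hc.isCompact.isBounded.subset_closedBall (0 : E)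
  obtain ⟨C, hC⟩ := hπ.lintegral_le R
  refine ⟨M.toNNReal * C, fun f hf z => ?_⟩
  calc ∫⁻ y, ‖κ y * f (z + π y)‖ₑ
      = ∫⁻ y in Metric.closedBall 0 R, ‖κ y * f (z + π y)‖ₑ := by
        rw [setLIntegral_eq_of_support_subset]
        intro y hy
        apply hR
        apply subset_tsupport
        intro h0
        simp [h0] at hy
    _ ≤ ∫⁻ y in Metric.closedBall 0 R, M.toNNReal * ‖f (z + π y)‖ₑ := by
        refine lintegral_mono fun y => ?_
        rw [enorm_mul]
        gcongr
        rw [← ofReal_norm]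
        exact ENNReal.ofReal_le_ofReal (hM y)
    _ = M.toNNReal * ∫⁻ y in Metric.closedBall 0 R, ‖f (z + π y)‖ₑ := by
        rw [lintegral_const_mul' _ _ ENNReal.coe_ne_top]
    _ ≤ M.toNNReal * (C * ∫⁻ z, ‖f z‖ₑ) := by
        gcongr
        exact hC (fun z => ‖f z‖ₑ) hf.1.enorm z
    _ = _ := by push_cast; ring

/-- Each fibre map is a translation. This is the source of joint measurability of (y, z) ↦ f(z + π
y). -/
lemma IsCovering.measurePreserving_shear :
    MeasurePreserving (fun p : E × Γ => (p.1, p.2 + π p.1))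
      ((volume : Measure E).prod (volume : Measure Γ)) (volume.prod volume) := by
  refine (MeasurePreserving.id (volume : Measure E)).skew_product
    (g := fun y z => z + π y) ?_ ?_
  · exact measurable_snd.add (hπ.measurable.comp measurable_fst)
  · exact Eventually.of_forall fun y => (measurePreserving_add_right volume (π y)).map_eq

lemma IsCovering.aesm_shear {V : Type*} [TopologicalSpace V] {f : Γ → V}
    (hf : AEStronglyMeasurable f) :
    AEStronglyMeasurable (fun p : E × Γ => f (p.2 + π p.1)) (volume.prod volume) := by
  have h : AEStronglyMeasurable (fun p : E × Γ => f p.2) (volume.prod volume) := hf.comp_snd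
  exact h.comp_measurePreserving hπ.measurePreserving_shear

lemma IsCovering.integrable_prod {κ : E → ℝ} (hκ : Continuous κ)
    (hc : HasCompactSupport κ) {f g : Γ → ℝ} (hf : Integrable f) (hg : Integrable g) :
    Integrable (fun p : Γ × E => f p.1 * (κ p.2 * g (p.1 + π p.2))) (volume.prod volume) := by
  have hm : AEStronglyMeasurable (fun p : Γ × E => f p.1 * (κ p.2 * g (p.1 + π p.2)))
      (volume.prod volume) := by
    refine hf.1.comp_fst.mul ((hκ.aestronglyMeasurable.comp_snd).mul ?_)
    exact (hπ.aesm_shear hg.1).prod_swap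
  refine ⟨hm, ?_⟩
  obtain ⟨C, hC⟩ := hπ.lintegral_kernel_le hκ hc
  rw [hasFiniteIntegral_iff_enorm, lintegral_prod _ hm.enorm]
  calc ∫⁻ z, ∫⁻ y, ‖f z * (κ y * g (z + π y))‖ₑ
      ≤ ∫⁻ z, ‖f z‖ₑ * (C * ∫⁻ z, ‖g z‖ₑ) := by
        refine lintegral_mono fun z => ?_
        simp_rw [enorm_mul (f z)]
        rw [lintegral_const_mul' _ _ enorm_ne_top]
        gcongr
        exact hC g hg z
    _ = (∫⁻ z, ‖f z‖ₑ) * (C * ∫⁻ z, ‖g z‖ₑ) := by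
        rw [lintegral_mul_const' _ _ (ENNReal.mul_ne_top ENNReal.coe_ne_top hg.2.ne)]
    _ < ⊤ := ENNReal.mul_lt_top hf.2 (ENNReal.mul_lt_top ENNReal.coe_lt_top hg.2)

/-- Fubini. All later arguments pass through this bridge: identities are proved for mollified
pairings and interpreted through correlations, which make sense at a single separation. -/
lemma IsCovering.integral_mul_conv {κ : E → ℝ} (hκ : Continuous κ)
    (hc : HasCompactSupport κ) {f g : Γ → ℝ} (hf : Integrable f) (hg : Integrable g) :
    ∫ z, f z * conv π κ g z = ∫ y, κ y * corr f g (π y) := by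
  simp_rw [conv, corr, ← integral_const_mul]
  rw [integral_integral_swap (hπ.integrable_prod hκ hc hf hg)]
  congr with y
  congr with z
  ring

lemma IsCovering.integrable_mul_conv {κ : E → ℝ} (hκ : Continuous κ)
    (hc : HasCompactSupport κ) {f g : Γ → ℝ} (hf : Integrable f) (hg : Integrable g) :
    Integrable (fun z => f z * conv π κ g z) := by
  simp_rw [conv, ← integral_const_mul]
  exact (hπ.integrable_prod hκ hc hf hg).integral_prod_left

omit hπ in
lemma corr_neg (f g : Γ → ℝ) (w : Γ) : corr f g (-w) = corr g f w := by
  unfold corr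
  rw [← integral_add_right_eq_self (fun z => f z * g (z + -w)) w]
  congr with z
  rw [add_neg_cancel_right, mul_comm]

/-- Exchanging the two functions reflects the separation, which is compensated by reflecting the
kernel. -/
lemma IsCovering.integral_conv_adjoint {κ : E → ℝ} (hκ : Continuous κ)
    (hc : HasCompactSupport κ) {f g : Γ → ℝ} (hf : Integrable f) (hg : Integrable g) :
    ∫ z, f z * conv π κ g z = ∫ z, g z * conv π (fun y => κ (-y)) f z := by
  have h := hπ.integral_mul_conv (κ := fun y => κ (-y)) (hκ.comp continuous_neg)
    (hc.comp_homeomorph (Homeomorph.neg E)) hg hf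
  rw [hπ.integral_mul_conv hκ hc hf hg, h, ← integral_neg_eq_self]
  congr with y
  rw [map_neg, corr_neg]

omit hπ in
-- Along each orbit of the covering, `conv` is an ordinary convolution with the reflected kernel, so
-- smoothness can be read off on the vector space.
lemma conv_eq_convolution (κ : E → ℝ) (f : Γ → ℝ) (z : Γ) (y : E) :
    conv π κ f (z + π y) = convolution (fun s => κ (-s)) (fun s => f (z + π s))
      (ContinuousLinearMap.mul ℝ ℝ) volume y := by
  unfold conv convolution
  rw [← integral_neg_eq_self]
  congr with s
  simp [sub_eq_add_neg, add_assoc]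

lemma IsCovering.contDiff_conv {κ : E → ℝ} (hκ : ContDiff ℝ ∞ κ) (hc : HasCompactSupport κ)
    {f : Γ → ℝ} (hf : Integrable f) (z : Γ) :
    ContDiff ℝ ∞ (fun y => conv π κ f (z + π y)) := by
  simp_rw [conv_eq_convolution]
  exact (hc.comp_homeomorph (Homeomorph.neg E)).contDiff_convolution_left _
    (hκ.comp contDiff_neg) (hπ.locallyIntegrable hf z)

/-- The minus sign comes from the convention f(z + π y) in `conv`, which reflects the kernel. -/
lemma IsCovering.fderiv_conv {κ : E → ℝ} (hκ : ContDiff ℝ ∞ κ) (hc : HasCompactSupport κ)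
    {f : Γ → ℝ} (hf : Integrable f) (z : Γ) (y a : E) :
    fderiv ℝ (fun y => conv π κ f (z + π y)) y a =
      - conv π (fun s => fderiv ℝ κ s a) f (z + π y) := by
  have hc' : HasCompactSupport (fun s => κ (-s)) := hc.comp_homeomorph (Homeomorph.neg E)
  have hκ' : ContDiff ℝ ∞ (fun s => κ (-s)) := hκ.comp contDiff_neg
  have h2 : (fun y => conv π κ f (z + π y)) = convolution (fun s => f (z + π s))
      (fun s => κ (-s)) (ContinuousLinearMap.mul ℝ ℝ).flip volume := by
    ext y; rw [conv_eq_convolution, convolution_flip]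
  have h1 := hc'.hasFDerivAt_convolution_right (ContinuousLinearMap.mul ℝ ℝ).flip
    (hπ.locallyIntegrable hf z) (hκ'.of_le (by exact_mod_cast le_top)) y
  rw [h2, h1.fderiv, conv_eq_convolution,
    convolution_precompR_apply _ (hπ.locallyIntegrable hf z) (hc'.fderiv ℝ)
      (hκ'.continuous_fderiv (by simp)), convolution_flip]
  unfold convolution
  rw [← integral_neg]
  congr with s
  have h3 : fderiv ℝ (fun s => κ (-s)) s = -(fderiv ℝ κ (-s)) := by
    have h4 := ((hκ.differentiable (by simp) (-s)).hasFDerivAt.comp s (hasFDerivAt_id s).neg).fderiv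
    rw [show (fun s => κ (-s)) = κ ∘ Neg.neg from rfl, h4]
    ext v
    simp
  simp [h3]

lemma IsCovering.conv_congr_ae (κ : E → ℝ) {f g : Γ → ℝ} (h : f =ᵐ[volume] g) (z : Γ) :
    conv π κ f z = conv π κ g z := by
  refine integral_congr_ae ?_
  filter_upwards [(hπ.quasiMeasurePreserving z).ae_eq h] with y hy
  simp only [Function.comp_apply] at hy
  rw [hy]

omit hπ in
/-- The integral of a derivative along a one-parameter group of translations vanishes. -/
lemma integral_deriv_shift_eq_zero {a : E} {Φ Ψ g : Γ → ℝ}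
    (hd : ∀ z, HasDerivAt (fun s : ℝ => Φ (z + π (s • a))) (Ψ z) 0) (hΦ : Integrable Φ)
    (hΨ : AEStronglyMeasurable Ψ) (hg : Integrable g)
    (hb : ∀ z, ∀ s ∈ Metric.ball (0 : ℝ) 1, |Ψ (z + π (s • a))| ≤ g z) : ∫ z, Ψ z = 0 := by
  have hd' : ∀ z, ∀ s : ℝ, HasDerivAt (fun s : ℝ => Φ (z + π (s • a))) (Ψ (z + π (s • a))) s := by
    intro z s
    have h := hd (z + π (s • a))
    have h2 : (fun r : ℝ => Φ (z + π (s • a) + π (r • a))) =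
        fun r => Φ (z + π ((s + r) • a)) := by
      ext r; rw [add_smul, map_add, add_assoc]
    rw [h2] at h
    have h3 := HasDerivAt.comp_sub_const (f := fun r => Φ (z + π ((s + r) • a))) s s
      (by simpa using h)
    simpa using h3
  -- Differentiate under the integral sign: by translation invariance the integral of the shifted
  -- function is constant in s, so its derivative, the integral of `Ψ`, is zero.
  have h := (hasDerivAt_integral_of_dominated_loc_of_deriv_le (μ := (volume : Measure Γ))
    (F := fun s z => Φ (z + π (s • a))) (F' := fun s z => Ψ (z + π (s • a))) (x₀ := (0 : ℝ))
    (bound := g) (Metric.ball_mem_nhds 0 one_pos)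
    (Eventually.of_forall fun s => aesm_shift hΦ.1 _)
    (integrable_shift hΦ _) (aesm_shift hΨ _)
    (Eventually.of_forall fun z s hs => hb z s hs) hg
    (Eventually.of_forall fun z s _ => hd' z s)).2
  have h1 : (fun s : ℝ => ∫ z, Φ (z + π (s • a))) = fun _ => ∫ z, Φ z := by
    ext s; exact integral_add_right_eq_self Φ _
  rw [h1] at h
  have h2 := h.unique (hasDerivAt_const 0 _)
  simpa using h2

end Mollification

/-! ### Continuity of translations in `L^p` -/

section Translation

variable {Γ : Type*} [AddCommGroup Γ] [TopologicalSpace Γ] [IsTopologicalAddGroup Γ] [T2Space Γ]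
  [SecondCountableTopology Γ] [LocallyCompactSpace Γ] [MeasureSpace Γ] [BorelSpace Γ]
  [(volume : Measure Γ).IsAddHaarMeasure] [SigmaFinite (volume : Measure Γ)]
  [(volume : Measure Γ).Regular]

/-- Translations form a continuous family of measure-preserving maps, and composition with such a
family acts continuously on L^p for finite p. -/
lemma tendsto_eLpNorm_shift_sub {p : ℝ≥0∞} (hp1 : 1 ≤ p) (hp : p ≠ ⊤) {f : Γ → ℝ}
    (hf : MemLp f p) (w₀ : Γ) :
    Tendsto (fun w => eLpNorm (fun z => f (z + w) - f (z + w₀)) p volume) (𝓝 w₀) (𝓝 0) := by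
  have : Fact (1 ≤ p) := ⟨hp1⟩
  let g : C(Γ, C(Γ, Γ)) := (ContinuousMap.mk (fun a : Γ × Γ => a.2 + a.1)
    (continuous_snd.add continuous_fst)).curry
  have hg : ∀ w, MeasurePreserving (g w) (volume : Measure Γ) volume := fun w =>
    measurePreserving_add_right volume w
  have h := Filter.Tendsto.compMeasurePreservingLp (l := 𝓝 w₀) (f := fun _ => hf.toLp f)
    tendsto_const_nhds (g.continuous.tendsto w₀) hg (hg w₀) hp
  rw [Lp.tendsto_Lp_iff_tendsto_eLpNorm'] at h
  refine h.congr fun w => eLpNorm_congr_ae ?_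
  have h1 := fun w => Lp.coeFn_compMeasurePreserving (hf.toLp f) (hg w)
  have h2 := fun w => (hg w).quasiMeasurePreserving.ae_eq hf.coeFn_toLp
  filter_upwards [h1 w, h1 w₀, h2 w, h2 w₀] with z a b c d
  simp only [Pi.sub_apply]
  rw [a, b, c, d]
  rfl

lemma tendsto_integral_shift_sub {f : Γ → ℝ} (hf : Integrable f) (w₀ : Γ) :
    Tendsto (fun w => ∫ z, |f (z + w) - f (z + w₀)|) (𝓝 w₀) (𝓝 0) := by
  have h := tendsto_eLpNorm_shift_sub le_rfl ENNReal.one_ne_top (memLp_one_iff_integrable.2 hf) w₀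
  have h2 := (ENNReal.tendsto_toReal ENNReal.zero_ne_top).comp h
  refine h2.congr fun w => ?_
  simp only [Function.comp_apply, eLpNorm_one_eq_lintegral_enorm]
  exact (integral_norm_eq_lintegral_enorm
    ((integrable_shift hf w).1.sub (integrable_shift hf w₀).1)).symm

end Translation

end

section

/-! ### The torus and space-time as quotients of vector spaces -/

/-- Space-time `ℝ × 𝕋³`. -/
abbrev ST : Type := ℝ × T3

/-- The universal cover of space-time. -/
abbrev STE : Type := ℝ × E3

instance : IsProbabilityMeasure (volume : Measure UnitAddCircle) :=
  ⟨by rw [AddCircle.measure_univ]; simp⟩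

instance : IsProbabilityMeasure (volume : Measure T3) :=
  inferInstanceAs (IsProbabilityMeasure (Measure.pi fun _ : Fin 3 => (volume : Measure UnitAddCircle)))

instance : (volume : Measure ST).IsAddHaarMeasure := by
  have : (volume : Measure T3).IsAddHaarMeasure := inferInstance
  exact Measure.prod.instIsAddHaarMeasure (volume : Measure ℝ) (volume : Measure T3)

instance : (volume : Measure STE).IsAddHaarMeasure :=
  Measure.prod.instIsAddHaarMeasure (volume : Measure ℝ) (volume : Measure E3)

instance : (volume : Measure ST).Regular :=
  Measure.Regular.of_sigmaCompactSpace_of_isLocallyFiniteMeasure volume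

/-- The quotient map `ℝ³ → 𝕋³` as a homomorphism. -/
def projHom : E3 →+ T3 where
  toFun := proj
  map_zero' := by ext i; simp [proj]
  map_add' x y := by ext i; simp [proj]

/-- The quotient map `ℝ × ℝ³ → ℝ × 𝕋³` as a homomorphism. -/
def stHom : STE →+ ST := (AddMonoidHom.id ℝ).prodMap projHom

@[simp] lemma projHom_apply (l : E3) : projHom l = proj l := rfl

@[simp] lemma stHom_apply (y : STE) : stHom y = (y.1, proj y.2) := rfl

lemma continuous_proj : Continuous proj := by
  refine continuous_pi fun i => ?_
  exact (AddCircle.continuous_mk' 1).comp (EuclideanSpace.proj i : E3 →L[ℝ] ℝ).continuous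

lemma proj_surjective : Function.Surjective proj := by
  intro x
  have h : ∀ i, ∃ r : ℝ, (r : UnitAddCircle) = x i := fun i => QuotientAddGroup.mk_surjective (x i)
  choose r hr using h
  exact ⟨WithLp.toLp 2 r, funext hr⟩

/-- Half-open unit cubes are fundamental domains of the lattice; the claim is the product of three
copies of the statement on the circle. -/
lemma measurePreserving_proj_cube (a : Fin 3 → ℝ) :
    MeasurePreserving proj ((volume : Measure E3).restrict
      ((fun l : E3 => l.ofLp) ⁻¹' (univ.pi fun i => Ioc (a i) (a i + 1)))) (volume : Measure T3) := by
  have h1 : MeasurePreserving (fun (l : Fin 3 → ℝ) (i : Fin 3) => ((l i : ℝ) : UnitAddCircle))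
      ((volume : Measure (Fin 3 → ℝ)).restrict (univ.pi fun i => Ioc (a i) (a i + 1)))
      (volume : Measure T3) := by
    have := measurePreserving_pi (fun i => (volume : Measure ℝ).restrict (Ioc (a i) (a i + 1)))
      (fun _ : Fin 3 => (volume : Measure UnitAddCircle))
      (f := fun _ => QuotientAddGroup.mk) (fun i => UnitAddCircle.measurePreserving_mk (a i))
    rw [← Measure.restrict_pi_pi] at this
    exact this
  have h2 := (PiLp.volume_preserving_ofLp (Fin 3)).restrict_preimage
    (s := univ.pi fun i => Ioc (a i) (a i + 1))
    (MeasurableSet.univ_pi fun i => measurableSet_Ioc)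
  exact h1.comp h2

lemma closedBall_subset_cubes (R : ℝ) : ∃ s : Finset (Fin 3 → ℤ),
    Metric.closedBall (0 : E3) R ⊆ ⋃ k ∈ s, ((fun l : E3 => l.ofLp) ⁻¹'
      (univ.pi fun i => Ioc ((k i : ℝ)) ((k i : ℝ) + 1))) := by
  -- The intervals are open on the left and closed on the right, so the integer k with k < l ≤ k + 1
  -- is ⌈l⌉ − 1; this shifts both ends of the index range.
  refine ⟨Fintype.piFinset fun _ => Finset.Icc (⌈-R⌉ - 1) (⌈R⌉ - 1), fun l hl => ?_⟩
  rw [mem_iUnion₂]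
  refine ⟨fun i => ⌈l i⌉ - 1, ?_, ?_⟩
  · rw [Fintype.mem_piFinset]
    intro i
    have h : |l i| ≤ R := by
      rw [mem_closedBall_zero_iff] at hl
      exact (PiLp.norm_apply_le l i).trans hl
    rw [abs_le] at h
    rw [Finset.mem_Icc]
    exact ⟨by have := Int.ceil_mono h.1; omega, by have := Int.ceil_mono h.2; omega⟩
  · rw [mem_preimage, mem_univ_pi]
    intro i
    rw [mem_Ioc]
    push_cast
    have h1 := Int.ceil_lt_add_one (l i)
    have h2 := Int.le_ceil (l i)
    constructor <;> linarith

/-- The constant is the number of unit cubes needed to cover the ball: each of them contributes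
exactly the Haar measure. -/
lemma map_proj_le (R : ℝ) : ∃ C : NNReal,
    ((volume : Measure E3).restrict (Metric.closedBall 0 R)).map proj ≤ C • (volume : Measure T3) := by
  obtain ⟨s, hs⟩ := closedBall_subset_cubes R
  refine ⟨s.card, ?_⟩
  refine Measure.le_iff.2 fun A hA => ?_
  rw [Measure.map_apply continuous_proj.measurable hA]
  have hA' : MeasurableSet (proj ⁻¹' A) := continuous_proj.measurable hA
  calc (volume.restrict (Metric.closedBall 0 R)) (proj ⁻¹' A)
      ≤ (volume.restrict (⋃ k ∈ s, ((fun l : E3 => l.ofLp) ⁻¹'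
      (univ.pi fun i => Ioc ((k i : ℝ)) ((k i : ℝ) + 1))))) (proj ⁻¹' A) :=
        Measure.restrict_mono hs le_rfl _
    _ ≤ ∑ k ∈ s, (volume.restrict ((fun l : E3 => l.ofLp) ⁻¹'
      (univ.pi fun i => Ioc ((k i : ℝ)) ((k i : ℝ) + 1)))) (proj ⁻¹' A) := by
        rw [Measure.restrict_apply hA', inter_iUnion₂]
        refine (measure_biUnion_finset_le _ _).trans (Finset.sum_le_sum fun k _ => ?_)
        rw [Measure.restrict_apply hA']
    _ = ∑ k ∈ s, volume A := by
        refine Finset.sum_congr rfl fun k _ => ?_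
        exact (measurePreserving_proj_cube fun i => (k i : ℝ)).measure_preimage hA.nullMeasurableSet
    _ = _ := by simp

lemma isCovering_projHom : IsCovering projHom := ⟨continuous_proj, map_proj_le⟩

lemma isCovering_stHom : IsCovering stHom := by
  refine ⟨?_, fun R => ?_⟩
  · exact continuous_fst.prodMk (continuous_proj.comp continuous_snd)
  · obtain ⟨C, hC⟩ := map_proj_le R
    refine ⟨C, ?_⟩
    have h1 : (volume : Measure STE).restrict (Metric.closedBall 0 R) ≤
        (volume : Measure ℝ).prod ((volume : Measure E3).restrict (Metric.closedBall 0 R)) := by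
      rw [← Measure.restrict_univ (μ := (volume : Measure ℝ)), Measure.prod_restrict]
      refine Measure.restrict_mono ?_ le_rfl
      intro y hy
      rw [show (0 : STE) = (0, 0) from rfl, ← closedBall_prod_same] at hy
      exact ⟨mem_univ _, hy.2⟩
    refine (Measure.map_mono h1 ?_).trans ?_
    · exact measurable_fst.prodMk (continuous_proj.measurable.comp measurable_snd)
    · have h2 : Measure.map stHom ((volume : Measure ℝ).prod
          ((volume : Measure E3).restrict (Metric.closedBall 0 R))) =
          (volume : Measure ℝ).prod
          (((volume : Measure E3).restrict (Metric.closedBall 0 R)).map proj) := by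
        have := Measure.map_prod_map (volume : Measure ℝ)
          ((volume : Measure E3).restrict (Metric.closedBall 0 R)) measurable_id
          continuous_proj.measurable
        rw [Measure.map_id] at this
        rw [this]
        rfl
      rw [h2]
      refine (Measure.prod_mono le_rfl hC).trans ?_
      rw [Measure.prod_smul_right]
      exact le_rfl

end

section

/-! ### Smooth functions and test functions on space-time -/

lemma isOpenMap_proj : IsOpenMap proj := by
  have h1 : IsOpenMap (fun l : E3 => l.ofLp) := by
    have := (PiLp.homeomorph 2 (fun _ : Fin 3 => ℝ)).isOpenMap
    exact this
  have h2 : IsOpenMap (Pi.map (fun (_ : Fin 3) (r : ℝ) => (r : UnitAddCircle))) :=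
    IsOpenMap.piMap (fun _ => QuotientAddGroup.isOpenMap_coe)
      (by simp)
  exact h2.comp h1

lemma stHom_surjective : Function.Surjective stHom := by
  rintro ⟨t, x⟩
  obtain ⟨l, rfl⟩ := proj_surjective x
  exact ⟨(t, l), rfl⟩

/-- The covering map is open and onto, hence a quotient map. Continuity of periodic objects is
always obtained upstairs and descended in this way. -/
lemma continuous_of_comp_stHom {V : Type*} [TopologicalSpace V] {f : ST → V}
    (h : Continuous fun y => f (stHom y)) : Continuous f := by
  have h1 : IsOpenMap stHom := IsOpenMap.id.prodMap isOpenMap_proj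
  exact (h1.isQuotientMap isCovering_stHom.continuous stHom_surjective).continuous_iff.2 h

lemma continuous_of_comp_proj {V : Type*} [TopologicalSpace V] {f : T3 → V}
    (h : Continuous fun y => f (proj y)) : Continuous f :=
  (isOpenMap_proj.isQuotientMap continuous_proj proj_surjective).continuous_iff.2 h

/-- Smooth functions on space-time. -/
def SmoothST (f : ST → ℝ) : Prop := ContDiff ℝ ∞ fun y : STE => f (stHom y)

/-- The time direction (`none`) and the three space directions. -/
def dir : Option (Fin 3) → STE
  | none => (1, 0)
  | some k => (0, EuclideanSpace.single k 1)

/-- The partial derivatives of a function on space-time. -/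
def sd (α : Option (Fin 3)) (f : ST → ℝ) (z : ST) : ℝ :=
  fderiv ℝ (fun y : STE => f (z + stHom y)) 0 (dir α)

/-- `f` belongs to `C_c^∞((0,T) × 𝕋³)`. -/
def IsTest (T : ℝ) (f : ST → ℝ) : Prop :=
  SmoothST f ∧ ∃ a c : ℝ, 0 < a ∧ c < T ∧ ∀ z : ST, z.1 ∉ Icc a c → f z = 0

lemma SmoothST.shift {f : ST → ℝ} (hf : SmoothST f) (z : ST) :
    ContDiff ℝ ∞ fun y : STE => f (z + stHom y) := by
  obtain ⟨w, rfl⟩ := stHom_surjective z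
  simp_rw [← map_add]
  exact ContDiff.comp (g := fun y : STE => f (stHom y)) hf (contDiff_const.add contDiff_id)

lemma sd_stHom {f : ST → ℝ} (α : Option (Fin 3)) (y : STE) :
    sd α f (stHom y) = fderiv ℝ (fun y : STE => f (stHom y)) y (dir α) := by
  unfold sd
  simp_rw [← map_add]
  have := fderiv_comp_add_left (𝕜 := ℝ) (f := fun y : STE => f (stHom y)) (x := 0) y
  rw [this, add_zero]

lemma SmoothST.sd {f : ST → ℝ} (hf : SmoothST f) (α : Option (Fin 3)) : SmoothST (sd α f) := by
  unfold SmoothST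
  simp_rw [sd_stHom]
  exact (ContDiff.fderiv_right (m := ∞) hf (by simp)).clm_apply contDiff_const

lemma SmoothST.continuous {f : ST → ℝ} (hf : SmoothST f) : Continuous f :=
  continuous_of_comp_stHom (ContDiff.continuous hf)

lemma SmoothST.mul {f g : ST → ℝ} (hf : SmoothST f) (hg : SmoothST g) :
    SmoothST (fun z => f z * g z) := ContDiff.mul hf hg

lemma sd_mul {f g : ST → ℝ} (hf : SmoothST f) (hg : SmoothST g) (α : Option (Fin 3)) (z : ST) :
    sd α (fun z => f z * g z) z = sd α f z * g z + f z * sd α g z := by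
  unfold sd
  rw [fderiv_fun_mul ((hf.shift z).differentiable (by simp) 0)
    ((hg.shift z).differentiable (by simp) 0)]
  simp only [map_zero, add_zero, add_apply, smul_apply, smul_eq_mul]
  ring

lemma sd_comm {f : ST → ℝ} (hf : SmoothST f) (α β : Option (Fin 3)) (z : ST) :
    sd α (sd β f) z = sd β (sd α f) z := by
  obtain ⟨w, rfl⟩ := stHom_surjective z
  rw [sd_stHom, sd_stHom]
  simp_rw [sd_stHom]
  have hd : DifferentiableAt ℝ (fderiv ℝ fun y : STE => f (stHom y)) w :=
    (ContDiff.fderiv_right (m := ∞) hf (by simp)).differentiable (by simp) w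
  rw [fderiv_clm_apply hd (differentiableAt_const _), fderiv_clm_apply hd (differentiableAt_const _)]
  simp only [fderiv_fun_const, Pi.zero_apply, ContinuousLinearMap.comp_zero, zero_add,
    ContinuousLinearMap.flip_apply]
  have hs : IsSymmSndFDerivAt ℝ (fun y : STE => f (stHom y)) w :=
    (ContDiff.contDiffAt hf).isSymmSndFDerivAt (by
      simp only [minSmoothness_of_isRCLikeNormedField]
      exact WithTop.coe_le_coe.2 (le_top : (2 : ℕ∞) ≤ ⊤))
  exact hs _ _

lemma SmoothST.conv {κ : STE → ℝ} (hκ : ContDiff ℝ ∞ κ) (hc : HasCompactSupport κ)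
    {f : ST → ℝ} (hf : Integrable f) : SmoothST (conv stHom κ f) := by
  unfold SmoothST
  have := isCovering_stHom.contDiff_conv hκ hc hf 0
  simpa only [zero_add] using this

lemma sd_conv {κ : STE → ℝ} (hκ : ContDiff ℝ ∞ κ) (hc : HasCompactSupport κ)
    {f : ST → ℝ} (hf : Integrable f) (α : Option (Fin 3)) (z : ST) :
    sd α (conv stHom κ f) z = - conv stHom (fun s => fderiv ℝ κ s (dir α)) f z := by
  unfold sd
  rw [isCovering_stHom.fderiv_conv hκ hc hf z 0 (dir α), map_zero, add_zero]

section IsTest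

variable {T : ℝ} {f g : ST → ℝ}

lemma IsTest.sd (hf : IsTest T f) (α : Option (Fin 3)) : IsTest T (sd α f) := by
  obtain ⟨h, a, c, ha, hc, h0⟩ := hf
  refine ⟨h.sd α, a, c, ha, hc, fun z hz => ?_⟩
  have : (fun y : STE => f (z + stHom y)) =ᶠ[𝓝 0] fun _ => 0 := by
    have hU : {y : STE | z.1 + y.1 ∈ (Icc a c)ᶜ} ∈ 𝓝 (0 : STE) := by
      refine IsOpen.mem_nhds ?_ (by simpa using hz)
      exact isClosed_Icc.isOpen_compl.preimage (continuous_const.add continuous_fst)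
    filter_upwards [hU] with y hy
    exact h0 _ hy
  unfold HallMHD.sd
  rw [this.fderiv_eq]
  simp

lemma IsTest.mul_smooth (hf : IsTest T f) (hg : SmoothST g) : IsTest T (fun z => f z * g z) := by
  obtain ⟨h, a, c, ha, hc, h0⟩ := hf
  exact ⟨h.mul hg, a, c, ha, hc, fun z hz => by simp [h0 z hz]⟩

lemma IsTest.eq_zero (hf : IsTest T f) {z : ST} (hz : z.1 ∉ Ioo 0 T) : f z = 0 := by
  obtain ⟨h, a, c, ha, hc, h0⟩ := hf
  exact h0 z fun h => hz ⟨ha.trans_le h.1, h.2.trans_lt hc⟩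

lemma IsTest.bound (hf : IsTest T f) : ∃ C : ℝ, 0 ≤ C ∧ ∀ z, |f z| ≤ C := by
  obtain ⟨h, a, c, ha, hc, h0⟩ := hf
  have hK : IsCompact (Icc a c ×ˢ (univ : Set T3)) := isCompact_Icc.prod isCompact_univ
  obtain ⟨C, hC⟩ := hK.exists_bound_of_continuousOn h.continuous.continuousOn
  refine ⟨max C 0, le_max_right _ _, fun z => ?_⟩
  by_cases hz : z.1 ∈ Icc a c
  · exact (hC z ⟨hz, mem_univ _⟩).trans (le_max_left _ _)
  · rw [h0 z hz]; simp

lemma IsTest.continuous (hf : IsTest T f) : Continuous f := hf.1.continuous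

lemma IsTest.integrable (hf : IsTest T f) : Integrable f := by
  obtain ⟨h, a, c, ha, hc, h0⟩ := hf
  refine h.continuous.integrable_of_hasCompactSupport ?_
  refine HasCompactSupport.of_support_subset_isCompact
    (isCompact_Icc.prod isCompact_univ : IsCompact (Icc a c ×ˢ (univ : Set T3))) fun z hz => ?_
  refine ⟨?_, mem_univ _⟩
  by_contra h1
  exact hz (h0 z h1)

lemma IsTest.integrable_mul (hf : IsTest T f) (hg : Integrable g) :
    Integrable (fun z => f z * g z) := by
  obtain ⟨C, -, hC⟩ := hf.bound
  exact hg.bdd_mul hf.continuous.aestronglyMeasurable (Eventually.of_forall hC)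

/-- The mollification of a function supported in `[a,c] ⊆ (0,T)` with a kernel supported in
`|t| ≤ τ` is a test function. -/
lemma IsTest.conv {κ : STE → ℝ} (hκ : ContDiff ℝ ∞ κ) (hc : HasCompactSupport κ)
    (hf : Integrable f) {a c τ : ℝ} (ha : τ < a) (hcT : c + τ < T)
    (hf0 : ∀ z : ST, z.1 ∉ Icc a c → f z = 0) (hκ0 : ∀ y : STE, τ < |y.1| → κ y = 0) :
    IsTest T (conv stHom κ f) := by
  refine ⟨SmoothST.conv hκ hc hf, a - τ, c + τ, by linarith, hcT, fun z hz => ?_⟩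
  unfold HallMHD.conv
  rw [← integral_zero STE ℝ]
  congr with y
  by_cases hy : τ < |y.1|
  · rw [hκ0 y hy, zero_mul]
  · rw [hf0, mul_zero]
    intro h
    apply hz
    rw [not_lt, abs_le] at hy
    simp only [stHom_apply, Prod.fst_add, mem_Icc] at h
    constructor <;> linarith [h.1, h.2, hy.1, hy.2]

lemma sd_time_eq (hf : SmoothST f) (t : ℝ) (x : T3) :
    sd none f (t, x) = deriv (fun s => f (s, x)) t := by
  obtain ⟨l, rfl⟩ := proj_surjective x
  have h0 : ((t, proj l) : ST) = stHom (t, l) := rfl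
  rw [h0, sd_stHom]
  have h1 : HasFDerivAt (fun y : STE => f (stHom y)) _ (t, l) :=
    (ContDiff.differentiable hf (by simp) (t, l)).hasFDerivAt
  have h2 : HasDerivAt (fun s : ℝ => ((s, l) : STE)) (1, 0) t :=
    (hasDerivAt_id t).prodMk (hasDerivAt_const t l)
  exact (h1.comp_hasDerivAt t h2).deriv.symm

lemma sd_space_eq (hf : SmoothST f) (k : Fin 3) (t : ℝ) (x : T3) :
    sd (some k) f (t, x) = pd k (fun x => f (t, x)) x := by
  have h1 : HasFDerivAt (fun y : STE => f ((t, x) + stHom y)) _ (0, 0) :=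
    ((hf.shift (t, x)).differentiable (by simp) (0, 0)).hasFDerivAt
  have h2 : HasFDerivAt (fun l : E3 => ((0, l) : STE)) (ContinuousLinearMap.inr ℝ ℝ E3) 0 :=
    (ContinuousLinearMap.inr ℝ ℝ E3).hasFDerivAt
  have h3 := (h1.comp 0 h2).fderiv
  unfold sd pd
  have h4 : ((fun y : STE => f ((t, x) + stHom y)) ∘ fun l : E3 => ((0, l) : STE)) =
      fun l : E3 => f (t, x + proj l) := by
    ext l; simp
  rw [h4] at h3
  rw [h3]
  rfl

lemma isTest_of_mem (ψ : TestFn T ℝ) : IsTest T (fun z => ψ.1 z.1 z.2) := by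
  obtain ⟨h, a, c, ha, hc, h0⟩ := ψ.2
  exact ⟨h, a, c, ha, hc, fun z hz => h0 z.1 hz z.2⟩

/-- A test function in the sense of `IsTest`, as an element of the space of test functions. -/
def IsTest.toTestFn (hf : IsTest T f) : TestFn T ℝ :=
  ⟨fun t x => f (t, x), hf.1, by
    obtain ⟨h, a, c, ha, hc, h0⟩ := hf
    exact ⟨a, c, ha, hc, fun t ht x => h0 (t, x) ht⟩⟩

/-- The vector field with components given by three test functions. -/
def vecTest {f : Fin 3 → ST → ℝ} (hf : ∀ i, IsTest T (f i)) : TestFn T E3 :=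
  ⟨fun t x => WithLp.toLp 2 fun i => f i (t, x), by
    refine ⟨?_, ?_⟩
    · rw [contDiff_piLp]
      exact fun i => (hf i).1
    · choose a c ha hc h0 using fun i => (hf i).2
      refine ⟨min (a 0) (min (a 1) (a 2)), max (c 0) (max (c 1) (c 2)),
        lt_min (ha 0) (lt_min (ha 1) (ha 2)), max_lt (hc 0) (max_lt (hc 1) (hc 2)),
        fun t ht x => ?_⟩
      ext i
      refine h0 i (t, x) fun h => ht ?_
      simp only [mem_Icc, min_le_iff, le_max_iff] at h ⊢
      fin_cases i <;> tauto⟩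

lemma pd_vecTest {f : Fin 3 → ST → ℝ} (hf : ∀ i, IsTest T (f i)) (k i : Fin 3) (t : ℝ) (x : T3) :
    pd k ((vecTest hf).1 t) x i = sd (some k) (f i) (t, x) := by
  rw [sd_space_eq (hf i).1]
  unfold pd
  have h : Differentiable ℝ (fun l : E3 => (vecTest hf).1 t (x + proj l)) := by
    rw [differentiable_piLp]
    intro i
    have h1 := ((hf i).1.shift (t, x)).differentiable (by simp)
    have h2 := h1.comp (ContinuousLinearMap.inr ℝ ℝ E3).differentiable
    convert h2 using 2 with l
    simp [vecTest]
  have h3 := ((EuclideanSpace.proj i : E3 →L[ℝ] ℝ).hasFDerivAt.comp 0 (h 0).hasFDerivAt).fderiv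
  have h4 : ((EuclideanSpace.proj i : E3 →L[ℝ] ℝ) ∘ fun l : E3 => (vecTest hf).1 t (x + proj l)) =
      fun l => f i (t, x + proj l) := rfl
  rw [h4] at h3
  rw [h3]
  rfl

lemma deriv_vecTest {f : Fin 3 → ST → ℝ} (hf : ∀ i, IsTest T (f i)) (i : Fin 3) (t : ℝ) (x : T3) :
    deriv (fun s => (vecTest hf).1 s x) t i = sd none (f i) (t, x) := by
  rw [sd_time_eq (hf i).1]
  have h : Differentiable ℝ (fun s : ℝ => (vecTest hf).1 s x) := by
    rw [differentiable_piLp]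
    intro i
    obtain ⟨l, rfl⟩ := proj_surjective x
    have h1 := (ContDiff.differentiable (hf i).1 (by simp) : Differentiable ℝ _)
    have h2 := h1.comp ((differentiable_id (𝕜 := ℝ) (E := ℝ)).prodMk (differentiable_const l))
    exact h2
  exact ((EuclideanSpace.proj i : E3 →L[ℝ] ℝ).hasFDerivAt.comp_hasDerivAt t
    (h t).hasDerivAt).deriv.symm

end IsTest

/-! ### Extension by zero -/

/-- A function on `(0,T) × 𝕋³`, extended by zero to space-time. -/
def ext (T : ℝ) (f : ℝ → T3 → ℝ) : ST → ℝ :=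
  (Ioo 0 T ×ˢ univ).indicator (fun z => f z.1 z.2)

lemma stMeasure_eq (T : ℝ) : stMeasure T = (volume : Measure ST).restrict (Ioo 0 T ×ˢ univ) := by
  unfold stMeasure
  rw [show (volume : Measure ST) = (volume : Measure ℝ).prod (volume : Measure T3) from rfl,
    ← Measure.prod_restrict, Measure.restrict_univ]

lemma measurableSet_slab (T : ℝ) : MeasurableSet (Ioo 0 T ×ˢ (univ : Set T3)) :=
  measurableSet_Ioo.prod MeasurableSet.univ

lemma stInt_eq (T : ℝ) (f : ℝ → T3 → ℝ) : stInt T f = ∫ z, ext T f z := by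
  unfold stInt ext
  rw [stMeasure_eq, integral_indicator (measurableSet_slab T)]

lemma integrable_ext_iff {T : ℝ} {f : ℝ → T3 → ℝ} :
    Integrable (ext T f) ↔ Integrable (fun z : ST => f z.1 z.2) (stMeasure T) := by
  rw [stMeasure_eq, ext, integrable_indicator_iff (measurableSet_slab T)]
  rfl

lemma aesm_ext_iff {T : ℝ} {f : ℝ → T3 → ℝ} :
    AEStronglyMeasurable (ext T f) ↔
      AEStronglyMeasurable (fun z : ST => f z.1 z.2) (stMeasure T) := by
  rw [stMeasure_eq, ext, aestronglyMeasurable_indicator_iff (measurableSet_slab T)]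

lemma ext_of_mem {T : ℝ} {f : ℝ → T3 → ℝ} {z : ST} (hz : z.1 ∈ Ioo 0 T) :
    ext T f z = f z.1 z.2 := by
  unfold ext
  rw [indicator_of_mem (by exact ⟨hz, mem_univ _⟩)]

lemma ext_of_notMem {T : ℝ} {f : ℝ → T3 → ℝ} {z : ST} (hz : z.1 ∉ Ioo 0 T) :
    ext T f z = 0 := by
  unfold ext
  rw [indicator_of_notMem (by simpa using hz)]

/-- Integrals over (0,T) × 𝕋³ become integrals over the whole group ℝ × 𝕋³, where translations act.
All weak formulations are translated through this lemma. -/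
lemma stInt_eq_of_isTest {T : ℝ} {f : ℝ → T3 → ℝ} {F : ST → ℝ}
    (h : ∀ z : ST, z.1 ∈ Ioo 0 T → f z.1 z.2 = F z) (h0 : ∀ z : ST, z.1 ∉ Ioo 0 T → F z = 0) :
    stInt T f = ∫ z, F z := by
  rw [stInt_eq]
  congr with z
  by_cases hz : z.1 ∈ Ioo 0 T
  · rw [ext_of_mem hz, h z hz]
  · rw [ext_of_notMem hz, h0 z hz]

end

section

/-! ### The mollified pairing -/

/-- Smooth compactly supported kernels on `ℝ × ℝ³`. -/
structure IsKernel (κ : STE → ℝ) : Prop where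
  smooth : ContDiff ℝ ∞ κ
  compact : HasCompactSupport κ

/-- The partial derivatives of a kernel. -/
def dk (α : Option (Fin 3)) (κ : STE → ℝ) (y : STE) : ℝ := fderiv ℝ κ y (dir α)

/-- The mollified pairing `∫ f (κ * g)`. -/
def bil (κ : STE → ℝ) (f g : ST → ℝ) : ℝ := ∫ z, f z * conv stHom κ g z

section Bil

variable {κ : STE → ℝ} {f f' g g' : ST → ℝ}

lemma IsKernel.dk (hκ : IsKernel κ) (α : Option (Fin 3)) : IsKernel (dk α κ) where
  smooth := (hκ.smooth.fderiv_right (m := ∞) (by simp)).clm_apply contDiff_const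
  compact := hκ.compact.fderiv_apply (𝕜 := ℝ) (dir α)

lemma IsKernel.neg (hκ : IsKernel κ) : IsKernel (fun y => κ (-y)) where
  smooth := hκ.smooth.comp contDiff_neg
  compact := hκ.compact.comp_homeomorph (Homeomorph.neg STE)

lemma IsKernel.continuous (hκ : IsKernel κ) : Continuous κ := hκ.smooth.continuous

lemma dk_neg (hκ : IsKernel κ) (α : Option (Fin 3)) (y : STE) :
    dk α (fun y => κ (-y)) y = - dk α κ (-y) := by
  unfold dk
  have h4 := ((hκ.smooth.differentiable (by simp) (-y)).hasFDerivAt.comp y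
    (hasFDerivAt_id y).neg).fderiv
  rw [show (fun s => κ (-s)) = κ ∘ Neg.neg from rfl, h4]
  simp

lemma IsKernel.integrable_conv_integrand (hκ : IsKernel κ) (hg : Integrable g) (z : ST) :
    Integrable (fun y => κ y * g (z + stHom y)) :=
  isCovering_stHom.integrable_conv_integrand hκ.continuous hκ.compact hg z

lemma IsKernel.integrable_mul_conv (hκ : IsKernel κ) (hf : Integrable f) (hg : Integrable g) :
    Integrable (fun z => f z * conv stHom κ g z) :=
  isCovering_stHom.integrable_mul_conv hκ.continuous hκ.compact hf hg

lemma bil_eq_corr (hκ : IsKernel κ) (hf : Integrable f) (hg : Integrable g) :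
    bil κ f g = ∫ y, κ y * corr f g (stHom y) :=
  isCovering_stHom.integral_mul_conv hκ.continuous hκ.compact hf hg

lemma bil_adjoint (hκ : IsKernel κ) (hf : Integrable f) (hg : Integrable g) :
    bil κ f g = ∫ z, g z * conv stHom (fun y => κ (-y)) f z :=
  isCovering_stHom.integral_conv_adjoint hκ.continuous hκ.compact hf hg

lemma bil_add_left (hκ : IsKernel κ) (hf : Integrable f) (hf' : Integrable f')
    (hg : Integrable g) : bil κ (fun z => f z + f' z) g = bil κ f g + bil κ f' g := by
  unfold bil
  simp_rw [add_mul]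
  exact integral_add (hκ.integrable_mul_conv hf hg) (hκ.integrable_mul_conv hf' hg)

lemma bil_smul_left (κ : STE → ℝ) (c : ℝ) (f g : ST → ℝ) :
    bil κ (fun z => c * f z) g = c * bil κ f g := by
  unfold bil
  simp_rw [mul_assoc]
  rw [integral_const_mul]

lemma conv_add (hκ : IsKernel κ) (hg : Integrable g) (hg' : Integrable g') (z : ST) :
    conv stHom κ (fun z => g z + g' z) z = conv stHom κ g z + conv stHom κ g' z := by
  unfold conv
  simp_rw [mul_add]
  exact integral_add (hκ.integrable_conv_integrand hg z) (hκ.integrable_conv_integrand hg' z)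

lemma conv_smul (κ : STE → ℝ) (c : ℝ) (g : ST → ℝ) (z : ST) :
    conv stHom κ (fun z => c * g z) z = c * conv stHom κ g z := by
  unfold conv
  rw [← integral_const_mul]
  congr with y
  ring

lemma bil_add_right (hκ : IsKernel κ) (hf : Integrable f) (hg : Integrable g)
    (hg' : Integrable g') : bil κ f (fun z => g z + g' z) = bil κ f g + bil κ f g' := by
  unfold bil
  simp_rw [conv_add hκ hg hg', mul_add]
  exact integral_add (hκ.integrable_mul_conv hf hg) (hκ.integrable_mul_conv hf hg')

lemma bil_smul_right (κ : STE → ℝ) (c : ℝ) (f g : ST → ℝ) :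
    bil κ f (fun z => c * g z) = c * bil κ f g := by
  unfold bil
  simp_rw [conv_smul]
  rw [← integral_const_mul]
  congr with z
  ring

lemma bil_sub_left (hκ : IsKernel κ) (hf : Integrable f) (hf' : Integrable f')
    (hg : Integrable g) : bil κ (fun z => f z - f' z) g = bil κ f g - bil κ f' g := by
  have := bil_add_left hκ hf (hf'.const_mul (-1)) hg
  rw [bil_smul_left] at this
  rw [sub_eq_add_neg, ← neg_one_mul (bil κ f' g), ← this]
  congr with z
  ring

lemma bil_sub_right (hκ : IsKernel κ) (hf : Integrable f) (hg : Integrable g)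
    (hg' : Integrable g') : bil κ f (fun z => g z - g' z) = bil κ f g - bil κ f g' := by
  have := bil_add_right hκ hf hg (hg'.const_mul (-1))
  rw [bil_smul_right] at this
  rw [sub_eq_add_neg, ← neg_one_mul (bil κ f g'), ← this]
  congr with z
  ring

lemma bil_zero_left (κ : STE → ℝ) (g : ST → ℝ) : bil κ (fun _ => 0) g = 0 := by
  simp [bil]

lemma bil_zero_right (κ : STE → ℝ) (f : ST → ℝ) : bil κ f (fun _ => 0) = 0 := by
  simp [bil, conv]

lemma bil_sum_left {ι : Type*} (s : Finset ι) {F : ι → ST → ℝ} (hκ : IsKernel κ)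
    (hF : ∀ i, Integrable (F i)) (hg : Integrable g) :
    bil κ (fun z => ∑ i ∈ s, F i z) g = ∑ i ∈ s, bil κ (F i) g := by
  unfold bil
  simp_rw [Finset.sum_mul]
  exact integral_finsetSum _ fun i _ => hκ.integrable_mul_conv (hF i) hg

lemma bil_sum_right {ι : Type*} (s : Finset ι) {F : ι → ST → ℝ} (hκ : IsKernel κ)
    (hf : Integrable f) (hF : ∀ i, Integrable (F i)) :
    bil κ f (fun z => ∑ i ∈ s, F i z) = ∑ i ∈ s, bil κ f (F i) := by
  have h : ∀ z, conv stHom κ (fun z => ∑ i ∈ s, F i z) z = ∑ i ∈ s, conv stHom κ (F i) z := by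
    intro z
    unfold conv
    simp_rw [Finset.mul_sum]
    exact integral_finsetSum _ fun i _ => hκ.integrable_conv_integrand (hF i) z
  unfold bil
  simp_rw [h, Finset.mul_sum]
  exact integral_finsetSum _ fun i _ => hκ.integrable_mul_conv hf (hF i)

lemma bil_congr_left (κ : STE → ℝ) (h : f =ᵐ[volume] f') (g : ST → ℝ) :
    bil κ f g = bil κ f' g := by
  refine integral_congr_ae ?_
  filter_upwards [h] with z hz
  rw [hz]

lemma bil_congr_right (κ : STE → ℝ) (f : ST → ℝ) (h : g =ᵐ[volume] g') :
    bil κ f g = bil κ f g' := by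
  unfold bil
  simp_rw [isCovering_stHom.conv_congr_ae κ h]

end Bil

/-! ### Weak divergence relations -/

/-- `∂ₜ X₀ + div X = -Y` in the sense of distributions on `(0,T) × 𝕋³`. -/
def WeakDiv (T : ℝ) (X : Option (Fin 3) → ST → ℝ) (Y : ST → ℝ) : Prop :=
  ∀ Φ : ST → ℝ, IsTest T Φ → ∫ z, ∑ α, X α z * sd α Φ z = ∫ z, Y z * Φ z

section WeakDiv

variable {T : ℝ} {κ ψ : ST → ℝ} {X : Option (Fin 3) → ST → ℝ} {Y f g : ST → ℝ}

/-- Testing with the mollification of `f`. -/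
lemma WeakDiv.left (h : WeakDiv T X Y) (hX : ∀ α, Integrable (X α)) (hY : Integrable Y)
    {κ : STE → ℝ} (hκ : IsKernel κ) (hf : Integrable f) {a c τ : ℝ} (ha : τ < a) (hcT : c + τ < T)
    (hf0 : ∀ z : ST, z.1 ∉ Icc a c → f z = 0) (hκ0 : ∀ y : STE, τ < |y.1| → κ y = 0) :
    ∑ α, bil (dk α κ) f (X α) = bil κ f Y := by
  have hκ' := hκ.neg
  have ht : IsTest T (conv stHom (fun y => κ (-y)) f) :=
    IsTest.conv hκ'.smooth hκ'.compact hf ha hcT hf0 fun y hy => hκ0 (-y) (by simpa using hy)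
  have h1 := h _ ht
  rw [bil_adjoint hκ hf hY, ← h1]
  have h2 : ∀ α, bil (dk α κ) f (X α) =
      ∫ z, X α z * sd α (conv stHom (fun y => κ (-y)) f) z := by
    intro α
    rw [bil_adjoint (hκ.dk α) hf (hX α)]
    congr with z
    rw [sd_conv hκ'.smooth hκ'.compact hf]
    have h3 : (fun s => fderiv ℝ (fun y => κ (-y)) s (dir α)) = fun s => - dk α κ (-s) :=
      funext fun s => dk_neg hκ α s
    rw [h3]
    unfold conv
    simp_rw [neg_mul]
    rw [integral_neg, neg_neg]
  simp_rw [h2]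
  rw [integral_finsetSum]
  intro α _
  have := (ht.sd α).integrable_mul (hX α)
  exact this.congr (Eventually.of_forall fun z => mul_comm _ _)

/-- Testing with the product of a test function and a mollification. -/
lemma WeakDiv.right (h : WeakDiv T X Y) (hX : ∀ α, Integrable (X α))
    {κ : STE → ℝ} (hκ : IsKernel κ) (hψ : IsTest T ψ) (hg : Integrable g) :
    ∑ α, bil (dk α κ) (fun z => ψ z * X α z) g =
      - bil κ (fun z => ψ z * Y z) g + ∑ α, bil κ (fun z => sd α ψ z * X α z) g := by
  have hs : SmoothST (conv stHom κ g) := SmoothST.conv hκ.smooth hκ.compact hg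
  have h1 := h _ (hψ.mul_smooth hs)
  have h2 : ∀ α z, X α z * sd α (fun z => ψ z * conv stHom κ g z) z =
      sd α ψ z * X α z * conv stHom κ g z - ψ z * X α z * conv stHom (dk α κ) g z := by
    intro α z
    rw [sd_mul hψ.1 hs, sd_conv hκ.smooth hκ.compact hg]
    unfold dk
    ring
  simp_rw [h2] at h1
  rw [integral_finsetSum] at h1
  · have h3 : ∀ α, ∫ z, (sd α ψ z * X α z * conv stHom κ g z -
        ψ z * X α z * conv stHom (dk α κ) g z) =
        bil κ (fun z => sd α ψ z * X α z) g - bil (dk α κ) (fun z => ψ z * X α z) g :=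
      fun α => integral_sub (hκ.integrable_mul_conv ((hψ.sd α).integrable_mul (hX α)) hg)
        ((hκ.dk α).integrable_mul_conv (hψ.integrable_mul (hX α)) hg)
    simp_rw [h3] at h1
    rw [Finset.sum_sub_distrib] at h1
    have h4 : ∫ z, Y z * (ψ z * conv stHom κ g z) = bil κ (fun z => ψ z * Y z) g := by
      unfold bil
      congr with z
      ring
    rw [h4] at h1
    linarith
  · intro α _
    exact (hκ.integrable_mul_conv ((hψ.sd α).integrable_mul (hX α)) hg).sub
        ((hκ.dk α).integrable_mul_conv (hψ.integrable_mul (hX α)) hg)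

/-- A purely spatial vector field. -/
def sp (v : Fin 3 → ST → ℝ) : Option (Fin 3) → ST → ℝ
  | none => fun _ => 0
  | some k => v k

lemma integrable_sp {v : Fin 3 → ST → ℝ} (hv : ∀ k, Integrable (v k)) (α : Option (Fin 3)) :
    Integrable (sp v α) := by
  cases α with
  | none => exact integrable_zero _ _ _
  | some k => exact hv k

lemma weakDiv_sp_iff {v : Fin 3 → ST → ℝ} : WeakDiv T (sp v) Y ↔
    ∀ Φ : ST → ℝ, IsTest T Φ → ∫ z, ∑ k, v k z * sd (some k) Φ z = ∫ z, Y z * Φ z := by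
  simp [WeakDiv, Fintype.sum_option, sp]

lemma WeakDiv.left_sp {v : Fin 3 → ST → ℝ} (h : WeakDiv T (sp v) Y) (hv : ∀ k, Integrable (v k))
    (hY : Integrable Y)
    {κ : STE → ℝ} (hκ : IsKernel κ) (hf : Integrable f) {a c τ : ℝ} (ha : τ < a) (hcT : c + τ < T)
    (hf0 : ∀ z : ST, z.1 ∉ Icc a c → f z = 0) (hκ0 : ∀ y : STE, τ < |y.1| → κ y = 0) :
    ∑ k, bil (dk (some k) κ) f (v k) = bil κ f Y := by
  have := h.left (integrable_sp hv) hY hκ hf ha hcT hf0 hκ0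
  simpa [Fintype.sum_option, sp, bil_zero_right] using this

lemma WeakDiv.right_sp {v : Fin 3 → ST → ℝ} (h : WeakDiv T (sp v) Y)
    (hv : ∀ k, Integrable (v k))
    {κ : STE → ℝ} (hκ : IsKernel κ) (hψ : IsTest T ψ) (hg : Integrable g) :
    ∑ k, bil (dk (some k) κ) (fun z => ψ z * v k z) g =
      - bil κ (fun z => ψ z * Y z) g + ∑ k, bil κ (fun z => sd (some k) ψ z * v k z) g := by
  have := h.right (integrable_sp hv) hκ hψ hg
  simpa [Fintype.sum_option, sp, bil_zero_left] using this

/-- The quantity `f X` is transported by `∂ₜ f + div X = 0`. -/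
lemma WeakDiv.energy (h : WeakDiv T X fun _ => 0) (hX : ∀ α, Integrable (X α))
    {κ : STE → ℝ} (hκ : IsKernel κ) (hψ : IsTest T ψ) {a c τ : ℝ} (ha : τ < a) (hcT : c + τ < T)
    (hψ0 : ∀ z : ST, z.1 ∉ Icc a c → ψ z = 0) (hκ0 : ∀ y : STE, τ < |y.1| → κ y = 0) :
    ∑ k, (bil (dk (some k) κ) (fun z => ψ z * X (some k) z) (X none) -
        bil (dk (some k) κ) (fun z => ψ z * X none z) (X (some k))) =
      bil κ (fun z => sd none ψ z * X none z) (X none) +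
        ∑ k, bil κ (fun z => sd (some k) ψ z * X (some k) z) (X none) := by
  -- Testing with the mollification of `ψ X₀`, and with ψ times the mollification of `X₀`, produces
  -- the same pairing for the time derivative; subtraction removes it and leaves only spatial
  -- derivatives of the kernel.
  have h1 := h.left hX (integrable_zero _ _ _) hκ (hψ.integrable_mul (hX none)) ha hcT
    (fun z hz => by rw [hψ0 z hz, zero_mul]) hκ0
  have h2 := h.right hX hκ hψ (hX none)
  simp only [Fintype.sum_option, bil_zero_right, mul_zero, bil_zero_left] at h1 h2
  rw [Finset.sum_sub_distrib]
  linarith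

end WeakDiv

end

section

lemma int_add {f g : ST → ℝ} (hf : Integrable f) (hg : Integrable g) :
    Integrable (fun z => f z + g z) := hf.add hg

lemma int_sub {f g : ST → ℝ} (hf : Integrable f) (hg : Integrable g) :
    Integrable (fun z => f z - g z) := hf.sub hg

/-! ### The Kármán–Howarth–Monin relation for mollified pairings -/

/-- The fields of a solution extended by zero to space-time, with the gradient
`G k i = ∂ₖ bᵢ`, and the distributional relations which they satisfy on `(0,T) × 𝕋³`. -/
structure HallData (T : ℝ) (u b j : Fin 3 → ST → ℝ) (P : ST → ℝ)
    (G : Fin 3 → Fin 3 → ST → ℝ) : Prop where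
  int_u : ∀ i, Integrable (u i)
  int_b : ∀ i, Integrable (b i)
  int_j : ∀ i, Integrable (j i)
  int_P : Integrable P
  int_G : ∀ k i, Integrable (G k i)
  int_uu : ∀ k i, Integrable (fun z => u k z * u i z)
  int_ub : ∀ k i, Integrable (fun z => u k z * b i z)
  int_bu : ∀ k i, Integrable (fun z => b k z * u i z)
  int_bb : ∀ k i, Integrable (fun z => b k z * b i z)
  int_jb : ∀ k i, Integrable (fun z => j k z * b i z)
  int_bj : ∀ k i, Integrable (fun z => b k z * j i z)
  int_bG : ∀ l k i, Integrable (fun z => b l z * G k i z)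
  div_u : WeakDiv T (sp u) fun _ => 0
  div_b : WeakDiv T (sp b) fun _ => 0
  div_j : WeakDiv T (sp j) fun _ => 0
  momentum : ∀ i, WeakDiv T (fun α => match α with
    | none => u i
    | some k => fun z => u k z * u i z - b k z * b i z + if k = i then P z else 0) fun _ => 0
  induction : ∀ i, WeakDiv T (fun α => match α with
    | none => b i
    | some k => fun z => u k z * b i z - b k z * u i z - (j k z * b i z - b k z * j i z))
      fun _ => 0
  grad_b : ∀ k i, ∀ Φ : ST → ℝ, IsTest T Φ →
    ∫ z, b i z * sd (some k) Φ z = ∫ z, -G k i z * Φ z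
  tensor : ∀ i, WeakDiv T (sp fun k z => b k z * b i z) fun z => -∑ k, b k z * G k i z
  sq : ∀ i, ∀ Φ : ST → ℝ, IsTest T Φ → ∫ z, (∑ k, b k z * b k z) * sd (some i) Φ z =
    ∫ z, (-2 * ∑ k, b k z * G i k z) * Φ z
  curl : ∀ᵐ z, j 0 z = G 1 2 z - G 2 1 z ∧ j 1 z = G 2 0 z - G 0 2 z ∧
    j 2 z = G 0 1 z - G 1 0 z

/-- A single weak partial derivative as a divergence relation. -/
lemma weakDiv_single {T : ℝ} {f Y : ST → ℝ} {k : Fin 3}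
    (h : ∀ Φ : ST → ℝ, IsTest T Φ → ∫ z, f z * sd (some k) Φ z = ∫ z, Y z * Φ z) :
    WeakDiv T (sp (Pi.single k f)) Y := by
  rw [weakDiv_sp_iff]
  intro Φ hΦ
  rw [← h Φ hΦ]
  congr with z
  rw [Finset.sum_eq_single k]
  · simp
  · intro l _ hl; simp [hl]
  · simp

lemma integrable_single {f : ST → ℝ} (hf : Integrable f) (k l : Fin 3) :
    Integrable ((Pi.single k f : Fin 3 → ST → ℝ) l) := by
  by_cases h : l = k
  · subst h; simpa using hf
  · rw [Pi.single_eq_of_ne h]; exact integrable_zero _ _ _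

section Single

variable {T : ℝ} {ψ f g Y : ST → ℝ} {k : Fin 3} {κ : STE → ℝ} {a c τ : ℝ}

lemma single_left (h : ∀ Φ : ST → ℝ, IsTest T Φ → ∫ z, f z * sd (some k) Φ z = ∫ z, Y z * Φ z)
    (hf : Integrable f) (hY : Integrable Y) (hκ : IsKernel κ) (hg : Integrable g)
    (ha : τ < a) (hcT : c + τ < T)
    (hg0 : ∀ z : ST, z.1 ∉ Icc a c → g z = 0) (hκ0 : ∀ y : STE, τ < |y.1| → κ y = 0) :
    bil (dk (some k) κ) g f = bil κ g Y := by
  have := (weakDiv_single h).left_sp (integrable_single hf k) hY hκ hg ha hcT hg0 hκ0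
  rw [← this, Finset.sum_eq_single k]
  · simp
  · intro l _ hl
    rw [Pi.single_eq_of_ne hl]
    exact bil_zero_right _ _
  · simp

lemma single_right (h : ∀ Φ : ST → ℝ, IsTest T Φ → ∫ z, f z * sd (some k) Φ z = ∫ z, Y z * Φ z)
    (hf : Integrable f) (hκ : IsKernel κ) (hψ : IsTest T ψ) (hg : Integrable g) :
    bil (dk (some k) κ) (fun z => ψ z * f z) g =
      - bil κ (fun z => ψ z * Y z) g + bil κ (fun z => sd (some k) ψ z * f z) g := by
  have := (weakDiv_single h).right_sp (integrable_single hf k) hκ hψ hg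
  rw [Finset.sum_eq_single k, Finset.sum_eq_single k] at this
  · simpa using this
  · intro l _ hl
    simp [Pi.single_eq_of_ne hl, bil_zero_left]
  · simp
  · intro l _ hl
    simp [Pi.single_eq_of_ne hl, bil_zero_left]
  · simp

end Single

/-- `∑ₖᵢ ∂ₖκ-pairings of vₖ wᵢ with zᵢ`, antisymmetrized. -/
def epair (κ : STE → ℝ) (ψ : ST → ℝ) (v w z : Fin 3 → ST → ℝ) : ℝ :=
  ∑ k, ∑ i, (bil (dk (some k) κ) (fun p => ψ p * (v k p * w i p)) (z i) -
    bil (dk (some k) κ) (fun p => ψ p * z i p) (fun p => v k p * w i p))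

/-- The terms produced by the momentum equation. -/
def rhsMomentum (β : (ST → ℝ) → (ST → ℝ) → ℝ) (ψ : ST → ℝ) (u b : Fin 3 → ST → ℝ)
    (P : ST → ℝ) : ℝ :=
  (∑ i, β (fun p => sd none ψ p * u i p) (u i)) +
    (∑ k, ∑ i, (β (fun p => sd (some k) ψ p * (u k p * u i p)) (u i) -
      β (fun p => sd (some k) ψ p * (b k p * b i p)) (u i))) +
    ((∑ i, β (fun p => sd (some i) ψ p * P p) (u i)) +
      ∑ i, β (fun p => sd (some i) ψ p * u i p) P)

/-- The terms produced by the induction equation. -/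
def rhsInduction (β : (ST → ℝ) → (ST → ℝ) → ℝ) (ψ : ST → ℝ) (u b j : Fin 3 → ST → ℝ) : ℝ :=
  (∑ i, β (fun p => sd none ψ p * b i p) (b i)) +
    ∑ k, ∑ i, (β (fun p => sd (some k) ψ p * (u k p * b i p)) (b i) -
      β (fun p => sd (some k) ψ p * (b k p * u i p)) (b i) -
      β (fun p => sd (some k) ψ p * (j k p * b i p)) (b i) +
      β (fun p => sd (some k) ψ p * (b k p * j i p)) (b i))

/-- The terms produced by the relation between the magnetic field and its current. -/
def rhsCurrent (β : (ST → ℝ) → (ST → ℝ) → ℝ) (ψ : ST → ℝ) (b j : Fin 3 → ST → ℝ) : ℝ :=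
  ∑ k, ∑ i, (β (fun p => sd (some k) ψ p * (b k p * b i p)) (j i) -
    (1 / 2) * β (fun p => sd (some k) ψ p * (b i p * b i p)) (j k) -
    (1 / 2) * β (fun p => sd (some k) ψ p * j k p) (fun p => b i p * b i p) -
    β (fun p => sd (some k) ψ p * b i p) (fun p => j k p * b i p) +
    β (fun p => sd (some k) ψ p * b i p) (fun p => b k p * j i p))

namespace HallData

variable {T : ℝ} {u b j : Fin 3 → ST → ℝ} {P : ST → ℝ} {G : Fin 3 → Fin 3 → ST → ℝ}
  (H : HallData T u b j P G) {κ : STE → ℝ} {ψ : ST → ℝ} {a c τ : ℝ}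
include H

/-- Sum the transport identity `WeakDiv.energy` over the components. The pressure pairs with ∂ᵢ of
the mollified uᵢ and with ψ uᵢ; by div u = 0 both contributions reduce to terms with a derivative on
ψ. -/
lemma epair_momentum (hκ : IsKernel κ) (hψ : IsTest T ψ) (ha : τ < a) (hcT : c + τ < T)
    (hψ0 : ∀ z : ST, z.1 ∉ Icc a c → ψ z = 0) (hκ0 : ∀ y : STE, τ < |y.1| → κ y = 0) :
    epair κ ψ u u u - epair κ ψ b b u = rhsMomentum (bil κ) ψ u b P := by
  have hP : ∀ k i : Fin 3, Integrable (fun z => if k = i then P z else 0) := by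
    intro k i
    split_ifs
    · exact H.int_P
    · exact integrable_zero _ _ _
  have h1 := fun i => (H.momentum i).energy (by
    rintro (_ | k)
    · exact H.int_u i
    · exact ((H.int_uu k i).sub (H.int_bb k i)).add (hP k i)) hκ hψ ha hcT hψ0 hκ0
  have e1 : ∀ (χ : ST → ℝ), IsTest T χ → ∀ (κ' : STE → ℝ), IsKernel κ' → ∀ k i,
      bil κ' (fun p => χ p * (u k p * u i p - b k p * b i p + if k = i then P p else 0)) (u i) =
      bil κ' (fun p => χ p * (u k p * u i p)) (u i) - bil κ' (fun p => χ p * (b k p * b i p)) (u i)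
      + if k = i then bil κ' (fun p => χ p * P p) (u i) else 0 := by
    intro χ hχ κ' hκ' k i
    rw [← bil_sub_left hκ' (hχ.integrable_mul (H.int_uu k i))
      (hχ.integrable_mul (H.int_bb k i)) (H.int_u i)]
    have : (if k = i then bil κ' (fun p => χ p * P p) (u i) else 0) =
        bil κ' (fun p => χ p * if k = i then P p else 0) (u i) := by
      split_ifs
      · rfl
      · simp [bil_zero_left]
    rw [this, ← bil_add_left hκ' (int_sub (hχ.integrable_mul (H.int_uu k i))
      (hχ.integrable_mul (H.int_bb k i))) (hχ.integrable_mul (hP k i)) (H.int_u i)]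
    congr with p
    ring
  have e2 : ∀ k i,
      bil (dk (some k) κ) (fun p => ψ p * u i p)
        (fun p => u k p * u i p - b k p * b i p + if k = i then P p else 0) =
      bil (dk (some k) κ) (fun p => ψ p * u i p) (fun p => u k p * u i p)
      - bil (dk (some k) κ) (fun p => ψ p * u i p) (fun p => b k p * b i p)
      + if k = i then bil (dk (some k) κ) (fun p => ψ p * u i p) P else 0 := by
    intro k i
    have hk := hκ.dk (some k)
    have hu := hψ.integrable_mul (H.int_u i)
    rw [bil_add_right hk hu (int_sub (H.int_uu k i) (H.int_bb k i)) (hP k i),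
      bil_sub_right hk hu (H.int_uu k i) (H.int_bb k i)]
    congr 1
    split_ifs
    · rfl
    · simp [bil_zero_right]
  simp only [e1 ψ hψ _ (hκ.dk _), e1 _ (hψ.sd _) κ hκ, e2, Finset.sum_add_distrib,
    Finset.sum_sub_distrib, Finset.sum_ite_eq', Finset.mem_univ, if_true] at h1
  have h3 := H.div_u.left_sp H.int_u (integrable_zero _ _ _) hκ (hψ.integrable_mul H.int_P) ha hcT
    (fun z hz => by rw [hψ0 z hz, zero_mul]) hκ0
  have h4 := H.div_u.right_sp H.int_u hκ hψ H.int_P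
  simp only [bil_zero_right, mul_zero, bil_zero_left, neg_zero, zero_add] at h3 h4
  unfold epair rhsMomentum
  simp only [Fin.sum_univ_three] at h1 h3 h4 ⊢
  linarith [h1 0, h1 1, h1 2]

/-- The same transport identity for b. The Hall term ∇ × (j × b) is the divergence of the
antisymmetric tensor bₖ jᵢ − jₖ bᵢ, which explains the last two pairings on the left. -/
lemma epair_induction (hκ : IsKernel κ) (hψ : IsTest T ψ) (ha : τ < a) (hcT : c + τ < T)
    (hψ0 : ∀ z : ST, z.1 ∉ Icc a c → ψ z = 0) (hκ0 : ∀ y : STE, τ < |y.1| → κ y = 0) :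
    epair κ ψ u b b - epair κ ψ b u b - epair κ ψ j b b + epair κ ψ b j b =
      rhsInduction (bil κ) ψ u b j := by
  have h1 := fun i => (H.induction i).energy (by
    rintro (_ | k)
    · exact H.int_b i
    · exact ((H.int_ub k i).sub (H.int_bu k i)).sub ((H.int_jb k i).sub (H.int_bj k i)))
      hκ hψ ha hcT hψ0 hκ0
  have e1 : ∀ (χ : ST → ℝ), IsTest T χ → ∀ (κ' : STE → ℝ), IsKernel κ' → ∀ k i,
      bil κ' (fun p => χ p * (u k p * b i p - b k p * u i p - (j k p * b i p - b k p * j i p)))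
        (b i) =
      bil κ' (fun p => χ p * (u k p * b i p)) (b i) - bil κ' (fun p => χ p * (b k p * u i p)) (b i)
      - (bil κ' (fun p => χ p * (j k p * b i p)) (b i)
      - bil κ' (fun p => χ p * (b k p * j i p)) (b i)) := by
    intro χ hχ κ' hκ' k i
    rw [← bil_sub_left hκ' (hχ.integrable_mul (H.int_ub k i))
      (hχ.integrable_mul (H.int_bu k i)) (H.int_b i),
      ← bil_sub_left hκ' (hχ.integrable_mul (H.int_jb k i))
      (hχ.integrable_mul (H.int_bj k i)) (H.int_b i),
      ← bil_sub_left hκ' (int_sub (hχ.integrable_mul (H.int_ub k i))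
      (hχ.integrable_mul (H.int_bu k i))) (int_sub (hχ.integrable_mul (H.int_jb k i))
      (hχ.integrable_mul (H.int_bj k i))) (H.int_b i)]
    congr with p
    ring
  have e2 : ∀ k i,
      bil (dk (some k) κ) (fun p => ψ p * b i p) (fun p => u k p * b i p - b k p * u i p -
        (j k p * b i p - b k p * j i p)) =
      bil (dk (some k) κ) (fun p => ψ p * b i p) (fun p => u k p * b i p)
      - bil (dk (some k) κ) (fun p => ψ p * b i p) (fun p => b k p * u i p)
      - (bil (dk (some k) κ) (fun p => ψ p * b i p) (fun p => j k p * b i p)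
      - bil (dk (some k) κ) (fun p => ψ p * b i p) (fun p => b k p * j i p)) := by
    intro k i
    have hk := hκ.dk (some k)
    have hu := hψ.integrable_mul (H.int_b i)
    rw [bil_sub_right hk hu (int_sub (H.int_ub k i) (H.int_bu k i))
      (int_sub (H.int_jb k i) (H.int_bj k i)),
      bil_sub_right hk hu (H.int_ub k i) (H.int_bu k i),
      bil_sub_right hk hu (H.int_jb k i) (H.int_bj k i)]
  simp only [e1 ψ hψ _ (hκ.dk _), e1 _ (hψ.sd _) κ hκ, e2] at h1
  unfold epair rhsInduction
  simp only [Fin.sum_univ_three] at h1 ⊢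
  linarith [h1 0, h1 1, h1 2]

end HallData

end

/-! ### The relation between the magnetic field and its current, and the expansion of increments -/

section

namespace HallData

variable {T : ℝ} {u b j : Fin 3 → ST → ℝ} {P : ST → ℝ} {G : Fin 3 → Fin 3 → ST → ℝ}
  (H : HallData T u b j P G) {κ : STE → ℝ} {ψ : ST → ℝ} {a c τ : ℝ}
include H

lemma curl_ae (m : Fin 3) : j m =ᵐ[volume] fun z => G (m + 1) (m + 2) z - G (m + 2) (m + 1) z := by
  filter_upwards [H.curl] with z hz
  fin_cases m
  exacts [hz.1, hz.2.1, hz.2.2]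

/-- Contraction of an antisymmetric tensor with the gradient of the magnetic field. -/
lemma sum_antisymm_left (hκ : IsKernel κ) (hψ : IsTest T ψ) :
    ∑ k, ∑ i, (bil κ (fun p => ψ p * (j k p * b i p)) (G k i) -
      -- Both sides express ψ (j × b)(z) · j(z + y): on the left j(z + y) is unfolded as the curl of
      -- b, on the right j(z) is.
      bil κ (fun p => ψ p * (b k p * j i p)) (G k i)) =
    ∑ i, ∑ k, (bil κ (fun p => ψ p * (b k p * G k i p)) (j i) -
      bil κ (fun p => ψ p * (b k p * G i k p)) (j i)) := by
  have hbG := fun l k i => hψ.integrable_mul (H.int_bG l k i)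
  have c : ∀ m f, Integrable f → bil κ f (j m) =
      bil κ f (G (m + 1) (m + 2)) - bil κ f (G (m + 2) (m + 1)) := fun m f hf => by
    rw [← bil_sub_right hκ hf (H.int_G _ _) (H.int_G _ _)]
    exact bil_congr_right _ _ (H.curl_ae m)
  have d : ∀ l m g, Integrable g → bil κ (fun p => ψ p * (b l p * j m p)) g =
      bil κ (fun p => ψ p * (b l p * G (m + 1) (m + 2) p)) g -
        bil κ (fun p => ψ p * (b l p * G (m + 2) (m + 1) p)) g := fun l m g hg => by
    rw [← bil_sub_left hκ (hbG _ _ _) (hbG _ _ _) hg]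
    exact bil_congr_left _ ((H.curl_ae m).mono fun z hz => by simp only [hz]; ring) _
  simp only [mul_comm (j _ _), Fin.sum_univ_three, c _ _ (hbG _ _ _), d _ _ _ (H.int_G _ _),
    Fin.reduceAdd]
  ring

/-- Contraction of the gradient of the magnetic field with an antisymmetric tensor. -/
lemma sum_antisymm_right (hκ : IsKernel κ) (hψ : IsTest T ψ) :
    ∑ k, ∑ i, (bil κ (fun p => ψ p * G k i p) (fun p => j k p * b i p) -
      bil κ (fun p => ψ p * G k i p) (fun p => b k p * j i p)) =
    ∑ i, ∑ k, (bil κ (fun p => ψ p * j i p) (fun p => b k p * G k i p) -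
      bil κ (fun p => ψ p * j i p) (fun p => b k p * G i k p)) := by
  have hG := fun k i => hψ.integrable_mul (H.int_G k i)
  have c : ∀ m g, Integrable g → bil κ (fun p => ψ p * j m p) g =
      bil κ (fun p => ψ p * G (m + 1) (m + 2) p) g -
        bil κ (fun p => ψ p * G (m + 2) (m + 1) p) g := fun m g hg => by
    rw [← bil_sub_left hκ (hG _ _) (hG _ _) hg]
    exact bil_congr_left _ ((H.curl_ae m).mono fun z hz => by simp only [hz]; ring) _
  have d : ∀ l m f, Integrable f → bil κ f (fun p => b l p * j m p) =
      bil κ f (fun p => b l p * G (m + 1) (m + 2) p) -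
        bil κ f (fun p => b l p * G (m + 2) (m + 1) p) := fun l m f hf => by
    rw [← bil_sub_right hκ hf (H.int_bG _ _ _) (H.int_bG _ _ _)]
    exact bil_congr_right _ _ ((H.curl_ae m).mono fun z hz => by simp only [hz]; ring)
  simp only [mul_comm (j _ _), Fin.sum_univ_three, c _ _ (H.int_bG _ _ _), d _ _ _ (hG _ _),
    Fin.reduceAdd]
  ring

lemma int_sq : Integrable fun z => ∑ k, b k z * b k z :=
  integrable_finsetSum _ fun k _ => H.int_bb k k

/-- In `epair` for j, b, b and for b, j, b, the kernel derivative is moved onto b and produces its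
gradient contracted with jₖ bᵢ − bₖ jᵢ. In `epair` for b, b, j it falls on b ⊗ b and produces (b·∇)b
paired with j. By j × b = (b·∇)b − ∇|b|²/2 the two agree up to ∇|b|²/2 paired with j, which reduces
to derivatives of ψ because div j = 0. The argument is carried out twice, with the quadratic
expression in the first and in the second slot. -/
lemma epair_current (hκ : IsKernel κ) (hψ : IsTest T ψ) (ha : τ < a) (hcT : c + τ < T)
    (hψ0 : ∀ z : ST, z.1 ∉ Icc a c → ψ z = 0) (hκ0 : ∀ y : STE, τ < |y.1| → κ y = 0) :
    epair κ ψ j b b - epair κ ψ b j b + epair κ ψ b b j = rhsCurrent (bil κ) ψ b j := by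
  have z0 : ∀ f : ST → ℝ, ∀ z : ST, z.1 ∉ Icc a c → ψ z * f z = 0 :=
    fun f z hz => by rw [hψ0 z hz, zero_mul]
  have hψb := fun i => hψ.integrable_mul (H.int_b i)
  have hψj := fun i => hψ.integrable_mul (H.int_j i)
  have hbG := fun l k i => hψ.integrable_mul (H.int_bG l k i)
  -- first slot carries the tensors
  have a1 : ∀ f, Integrable f → ∀ k i, bil (dk (some k) κ) (fun p => ψ p * f p) (b i) =
      - bil κ (fun p => ψ p * f p) (G k i) := by
    intro f hf k i
    rw [single_left (H.grad_b k i) (H.int_b i) (H.int_G k i).neg hκ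
      (hψ.integrable_mul hf) ha hcT (z0 _) hκ0, ← neg_one_mul, ← bil_smul_right]
    simp
  have a3 : ∀ i, ∑ k, bil (dk (some k) κ) (fun p => ψ p * (b k p * b i p)) (j i) =
      ∑ k, bil κ (fun p => ψ p * (b k p * G k i p)) (j i) +
      ∑ k, bil κ (fun p => sd (some k) ψ p * (b k p * b i p)) (j i) := by
    intro i
    rw [(H.tensor i).right_sp (fun k => H.int_bb k i) hκ hψ (H.int_j i)]
    congr 1
    rw [← bil_sum_left _ hκ (fun k => hbG k k i) (H.int_j i), ← neg_one_mul, ← bil_smul_left]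
    congr with p
    rw [← Finset.mul_sum]
    ring
  -- The pairing of ψ ∇|b|²/2 with j: integrating by parts on |b|² and using div j = 0 leaves only
  -- ∇ψ.
  have a4 : ∑ i, ∑ k, bil κ (fun p => ψ p * (b k p * G i k p)) (j i) =
      -(1 / 2) * ∑ k, ∑ i, bil κ (fun p => sd (some k) ψ p * (b i p * b i p)) (j k) := by
    have h1 := H.div_j.left_sp H.int_j (integrable_zero _ _ _) hκ (hψ.integrable_mul H.int_sq)
      ha hcT (z0 _) hκ0
    rw [bil_zero_right] at h1
    have h2 : ∀ k, bil (dk (some k) κ) (fun z => ψ z * ∑ k, b k z * b k z) (j k) =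
        2 * ∑ i, bil κ (fun p => ψ p * (b i p * G k i p)) (j k) +
        ∑ i, bil κ (fun p => sd (some k) ψ p * (b i p * b i p)) (j k) := by
      intro k
      rw [single_right (H.sq k) H.int_sq hκ hψ (H.int_j k),
        ← bil_sum_left _ hκ (fun i => hbG i k i) (H.int_j k),
        ← bil_sum_left _ hκ (fun i => (hψ.sd _).integrable_mul (H.int_bb i i)) (H.int_j k),
        ← neg_one_mul, ← bil_smul_left, ← bil_smul_left]
      simp_rw [← Finset.mul_sum]
      congr 2
      ext p
      ring
    simp_rw [h2] at h1
    rw [Finset.sum_add_distrib, ← Finset.mul_sum] at h1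
    linarith
  -- second slot carries the tensors
  have b1 : ∀ f, Integrable f → ∀ k i, bil (dk (some k) κ) (fun p => ψ p * b i p) f =
      bil κ (fun p => ψ p * G k i p) f + bil κ (fun p => sd (some k) ψ p * b i p) f := by
    intro f hf k i
    rw [single_right (H.grad_b k i) (H.int_b i) hκ hψ hf, ← neg_one_mul, ← bil_smul_left]
    simp
  have b3 : ∀ i, ∑ k, bil (dk (some k) κ) (fun p => ψ p * j i p) (fun p => b k p * b i p) =
      - ∑ k, bil κ (fun p => ψ p * j i p) (fun p => b k p * G k i p) := by
    intro i
    rw [(H.tensor i).left_sp (fun k => H.int_bb k i)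
      (integrable_finsetSum _ fun k _ => H.int_bG k k i).neg hκ (hψj i) ha hcT (z0 _) hκ0,
      ← bil_sum_right _ hκ (hψj i) (fun k => H.int_bG k k i), ← neg_one_mul, ← bil_smul_right]
    simp
  -- The same reduction with |b|² in the mollified slot.
  have b4 : ∑ i, ∑ k, bil κ (fun p => ψ p * j i p) (fun p => b k p * G i k p) =
      -(1 / 2) * ∑ k, ∑ i, bil κ (fun p => sd (some k) ψ p * j k p) (fun p => b i p * b i p) := by
    have h1 := H.div_j.right_sp H.int_j hκ hψ H.int_sq
    simp only [mul_zero, bil_zero_left, neg_zero, zero_add] at h1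
    have h2 : ∀ k, bil (dk (some k) κ) (fun z => ψ z * j k z) (fun z => ∑ k, b k z * b k z) =
        -2 * ∑ i, bil κ (fun p => ψ p * j k p) (fun p => b i p * G k i p) := by
      intro k
      rw [single_left (H.sq k) H.int_sq
        ((integrable_finsetSum _ fun i _ => H.int_bG i k i).const_mul _) hκ (hψj k) ha hcT
        (z0 _) hκ0, bil_smul_right, bil_sum_right _ hκ (hψj k) (fun i => H.int_bG i k i)]
    have h3 : ∀ k, bil κ (fun z => sd (some k) ψ z * j k z) (fun z => ∑ k, b k z * b k z) =
        ∑ i, bil κ (fun p => sd (some k) ψ p * j k p) (fun p => b i p * b i p) := fun k =>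
      bil_sum_right _ hκ ((hψ.sd _).integrable_mul (H.int_j k)) (fun i => H.int_bb i i)
    simp_rw [h2, h3] at h1
    rw [← Finset.mul_sum] at h1
    linarith
  have s1 := H.sum_antisymm_left hκ hψ
  have s2 := H.sum_antisymm_right hκ hψ
  have a3' : ∑ k, ∑ i, bil (dk (some k) κ) (fun p => ψ p * (b k p * b i p)) (j i) =
      ∑ i, ∑ k, bil κ (fun p => ψ p * (b k p * G k i p)) (j i) +
      ∑ k, ∑ i, bil κ (fun p => sd (some k) ψ p * (b k p * b i p)) (j i) := by
    rw [Finset.sum_comm, Finset.sum_congr rfl fun i _ => a3 i, Finset.sum_add_distrib]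
    congr 1
    rw [Finset.sum_comm]
  have b3' : ∑ k, ∑ i, bil (dk (some k) κ) (fun p => ψ p * j i p) (fun p => b k p * b i p) =
      - ∑ i, ∑ k, bil κ (fun p => ψ p * j i p) (fun p => b k p * G k i p) := by
    rw [Finset.sum_comm, Finset.sum_congr rfl fun i _ => b3 i, Finset.sum_neg_distrib]
  unfold epair rhsCurrent
  simp only [Finset.sum_add_distrib, Finset.sum_sub_distrib, a1 _ (H.int_jb _ _),
    a1 _ (H.int_bj _ _), b1 _ (H.int_jb _ _), b1 _ (H.int_bj _ _), a3', b3', Finset.sum_neg_distrib, ← Finset.mul_sum] at s1 s2 ⊢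
  linarith

end HallData

/-! ### Expansion of the trilinear increments -/

/-- The expansion of `ψ δvₖ (δwᵢ δzᵢ)` into pairings. -/
def trilin (β : (ST → ℝ) → (ST → ℝ) → ℝ) (ψ v w z : ST → ℝ) : ℝ :=
  β ψ (fun p => v p * (w p * z p)) - β (fun p => ψ p * z p) (fun p => v p * w p) -
    β (fun p => ψ p * w p) (fun p => v p * z p) + β (fun p => ψ p * (w p * z p)) v -
    β (fun p => ψ p * v p) (fun p => w p * z p) + β (fun p => ψ p * (v p * z p)) w +
    β (fun p => ψ p * (v p * w p)) z

/-- The flux part of the expansion of `ψ δv |δw · δz|`. -/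
def rhsFlux (β : (ST → ℝ) → (ST → ℝ) → ℝ) (ψ : ST → ℝ) (v w z : Fin 3 → ST → ℝ) : ℝ :=
  ∑ k, ∑ i, (β (sd (some k) ψ) (fun p => v k p * (w i p * z i p)) -
    β (fun p => sd (some k) ψ p * v k p) (fun p => w i p * z i p))

lemma integral_sd_eq_zero {T : ℝ} {Φ : ST → ℝ} (hΦ : IsTest T Φ) (α : Option (Fin 3)) :
    ∫ z, sd α Φ z = 0 := by
  obtain ⟨C, hC0, hC⟩ := (hΦ.sd α).bound
  obtain ⟨-, a, c, ha, hc, h0⟩ := hΦ.sd α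
  -- The time support is enlarged by one on each side since the dominating function has to cover all
  -- shifts of size less than one.
  have hK : IsCompact (Icc (a - 1) (c + 1) ×ˢ (univ : Set T3)) := isCompact_Icc.prod isCompact_univ
  refine integral_deriv_shift_eq_zero (π := stHom) (a := dir α) (Φ := Φ)
    (g := (Icc (a - 1) (c + 1) ×ˢ (univ : Set T3)).indicator fun _ => C) (fun z => ?_)
    hΦ.integrable (hΦ.sd α).continuous.aestronglyMeasurable ?_ ?_
  · have h1 : HasFDerivAt (fun y : STE => Φ (z + stHom y)) _ ((0 : ℝ) • dir α) :=
      ((hΦ.1.shift z).differentiable (by simp) _).hasFDerivAt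
    have h2 : HasDerivAt (fun s : ℝ => s • dir α) (dir α) 0 := by
      simpa using (hasDerivAt_id (0 : ℝ)).smul_const (dir α)
    have h3 := h1.comp_hasDerivAt (0 : ℝ) h2
    rw [zero_smul] at h3
    exact h3
  · exact (integrable_indicator_iff hK.measurableSet).2 (integrableOn_const hK.measure_lt_top.ne)
  · intro z s hs
    rw [Metric.mem_ball, dist_zero_right, Real.norm_eq_abs] at hs
    by_cases hz : z.1 ∈ Icc (a - 1) (c + 1)
    · rw [indicator_of_mem (by exact ⟨hz, mem_univ _⟩)]
      exact hC _
    · rw [h0, abs_zero, indicator_of_notMem (by simpa using hz)]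
      intro h
      apply hz
      have hd : |(dir α).1| ≤ 1 := by
        cases α <;> simp [dir]
      have h4 : |s * (dir α).1| ≤ 1 := by
        rw [abs_mul]
        exact mul_le_one₀ hs.le (abs_nonneg _) hd
      rw [abs_le] at h4
      simp only [stHom_apply, Prod.fst_add, Prod.smul_fst, smul_eq_mul, mem_Icc] at h
      constructor <;> linarith [h.1, h.2, h4.1, h4.2]

/-- Of the seven terms of `trilin`, the four in which one of w, z is separated from the other two
factors make up the two `epair`s. In the remaining three the kernel derivative either acts on v
alone or can be moved onto ψ; div v = 0 kills the first and turns the others into `rhsFlux`. -/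
lemma sum_trilin {T : ℝ} {v w z : Fin 3 → ST → ℝ} (hv : WeakDiv T (sp v) fun _ => 0)
    (hvi : ∀ k, Integrable (v k))
    (hwz : ∀ i, Integrable fun p => w i p * z i p)
    (hvwz : ∀ k i, Integrable fun p => v k p * (w i p * z i p))
    {κ : STE → ℝ} {ψ : ST → ℝ} {a c τ : ℝ}
    (hκ : IsKernel κ) (hψ : IsTest T ψ) (ha : τ < a) (hcT : c + τ < T)
    (hψ0 : ∀ z : ST, z.1 ∉ Icc a c → ψ z = 0) (hκ0 : ∀ y : STE, τ < |y.1| → κ y = 0) :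
    ∑ k, ∑ i, trilin (bil (dk (some k) κ)) ψ (v k) (w i) (z i) =
      epair κ ψ v w z + epair κ ψ v z w + rhsFlux (bil κ) ψ v w z := by
  have z0 : ∀ f : ST → ℝ, ∀ z : ST, z.1 ∉ Icc a c → ψ z * f z = 0 :=
    fun f z hz => by rw [hψ0 z hz, zero_mul]
  have h1 : ∀ k i, bil (dk (some k) κ) ψ (fun p => v k p * (w i p * z i p)) =
      bil κ (sd (some k) ψ) (fun p => v k p * (w i p * z i p)) := by
    intro k i
    have hs : SmoothST (conv stHom κ fun p => v k p * (w i p * z i p)) :=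
      SmoothST.conv hκ.smooth hκ.compact (hvwz k i)
    have h := integral_sd_eq_zero (hψ.mul_smooth hs) (some k)
    simp_rw [sd_mul hψ.1 hs, sd_conv hκ.smooth hκ.compact (hvwz k i)] at h
    have e := integral_add (hκ.integrable_mul_conv (hψ.sd (some k)).integrable (hvwz k i))
      ((hκ.dk (some k)).integrable_mul_conv hψ.integrable (hvwz k i)).neg
    simp only [mul_neg] at h
    have e2 : ∫ a, (sd (some k) ψ a * conv stHom κ (fun p => v k p * (w i p * z i p)) a +
      -(ψ a * conv stHom (fun s => fderiv ℝ κ s (dir (some k)))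
        (fun p => v k p * (w i p * z i p)) a)) = bil κ (sd (some k) ψ)
        (fun p => v k p * (w i p * z i p)) - bil (dk (some k) κ) ψ
        (fun p => v k p * (w i p * z i p)) := by
      rw [sub_eq_add_neg]
      unfold bil
      rw [← integral_neg]
      exact e
    linarith
  have h2 : ∀ i, ∑ k, bil (dk (some k) κ) (fun p => ψ p * (w i p * z i p)) (v k) = 0 := by
    intro i
    rw [hv.left_sp hvi (integrable_zero _ _ _) hκ (hψ.integrable_mul (hwz i)) ha hcT (z0 _) hκ0,
      bil_zero_right]
  have h3 : ∀ i, ∑ k, bil (dk (some k) κ) (fun p => ψ p * v k p) (fun p => w i p * z i p) =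
      ∑ k, bil κ (fun p => sd (some k) ψ p * v k p) (fun p => w i p * z i p) := by
    intro i
    rw [hv.right_sp hvi hκ hψ (hwz i)]
    simp [bil_zero_left]
  have h2' : ∑ k, ∑ i, bil (dk (some k) κ) (fun p => ψ p * (w i p * z i p)) (v k) = 0 := by
    rw [Finset.sum_comm, Finset.sum_congr rfl fun i _ => h2 i]; simp
  have h3' : ∑ k, ∑ i, bil (dk (some k) κ) (fun p => ψ p * v k p) (fun p => w i p * z i p) =
      ∑ k, ∑ i, bil κ (fun p => sd (some k) ψ p * v k p) (fun p => w i p * z i p) := by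
    rw [Finset.sum_comm, Finset.sum_congr rfl fun i _ => h3 i, Finset.sum_comm]
  unfold trilin epair rhsFlux
  simp only [Finset.sum_add_distrib, Finset.sum_sub_distrib, h1, h2', h3']
  ring

/-- The combination of trilinear increments which defines the dissipation. -/
def dissForm (β : (ST → ℝ) → (ST → ℝ) → ℝ) (ψ : ST → ℝ) (u b j : Fin 3 → ST → ℝ)
    (k i : Fin 3) : ℝ :=
  -(1 / 4) * trilin β ψ (u k) (u i) (u i) - (1 / 4) * trilin β ψ (u k) (b i) (b i) +
    (1 / 2) * trilin β ψ (b k) (u i) (b i) + (1 / 8) * trilin β ψ (j k) (b i) (b i) -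
    (1 / 4) * trilin β ψ (b k) (j i) (b i)

/-- The source in the Kármán–Howarth–Monin relation. -/
def khmRhs (β : (ST → ℝ) → (ST → ℝ) → ℝ) (ψ : ST → ℝ) (u b j : Fin 3 → ST → ℝ)
    (P : ST → ℝ) : ℝ :=
  -(1 / 2) * rhsMomentum β ψ u b P - (1 / 2) * rhsInduction β ψ u b j -
    (1 / 4) * rhsCurrent β ψ b j +
    (-(1 / 4) * rhsFlux β ψ u u u - (1 / 4) * rhsFlux β ψ u b b + (1 / 2) * rhsFlux β ψ b u b +
      (1 / 8) * rhsFlux β ψ j b b - (1 / 4) * rhsFlux β ψ b j b)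

end

/-! ### The assembled Kármán–Howarth–Monin relation, for pairings and for correlations -/

section

/-- The Kármán–Howarth–Monin relation for mollified pairings. -/
lemma HallData.sum_dissForm {T : ℝ} {u b j : Fin 3 → ST → ℝ} {P : ST → ℝ}
    {G : Fin 3 → Fin 3 → ST → ℝ} (H : HallData T u b j P G)
    (huuu : ∀ k i, Integrable fun p => u k p * (u i p * u i p))
    (hubb : ∀ k i, Integrable fun p => u k p * (b i p * b i p))
    (hbub : ∀ k i, Integrable fun p => b k p * (u i p * b i p))
    (hjbb : ∀ k i, Integrable fun p => j k p * (b i p * b i p))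
    (hbjb : ∀ k i, Integrable fun p => b k p * (j i p * b i p))
    {κ : STE → ℝ} {ψ : ST → ℝ} {a c τ : ℝ}
    (hκ : IsKernel κ) (hψ : IsTest T ψ) (ha : τ < a) (hcT : c + τ < T)
    (hψ0 : ∀ z : ST, z.1 ∉ Icc a c → ψ z = 0) (hκ0 : ∀ y : STE, τ < |y.1| → κ y = 0) :
    ∑ k, ∑ i, dissForm (bil (dk (some k) κ)) ψ u b j k i = khmRhs (bil κ) ψ u b j P := by
  have e1 := sum_trilin H.div_u H.int_u (fun i => H.int_uu i i) huuu hκ hψ ha hcT hψ0 hκ0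
  have e2 := sum_trilin H.div_u H.int_u (fun i => H.int_bb i i) hubb hκ hψ ha hcT hψ0 hκ0
  have e3 := sum_trilin H.div_b H.int_b (fun i => H.int_ub i i) hbub hκ hψ ha hcT hψ0 hκ0
  have e4 := sum_trilin H.div_j H.int_j (fun i => H.int_bb i i) hjbb hκ hψ ha hcT hψ0 hκ0
  have e5 := sum_trilin H.div_b H.int_b (fun i => H.int_jb i i) hbjb hκ hψ ha hcT hψ0 hκ0
  have r1 := H.epair_momentum hκ hψ ha hcT hψ0 hκ0
  have r2 := H.epair_induction hκ hψ ha hcT hψ0 hκ0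
  have r3 := H.epair_current hκ hψ ha hcT hψ0 hκ0
  -- After `sum_trilin` the pairings jbb, bjb, bbj carry the coefficients 1/4, −1/4, −1/4. This is
  -- 1/2 (jbb − bjb) from the induction equation minus 1/4 (jbb − bjb + bbj) from the current
  -- relation. The coefficients 1/8 and 1/4 in the dissipation are exactly those for which this
  -- works.
  unfold dissForm khmRhs
  simp only [Finset.sum_add_distrib, Finset.sum_sub_distrib, ← Finset.mul_sum]
  rw [e1, e2, e3, e4, e5, ← r1, ← r2, ← r3]
  ring

/-! ### From pairings to correlations -/

/-- `h` is integrable against `κ`, with integral `I`. -/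
def HasInt {X : Type*} [MeasurableSpace X] (κ h : X → ℝ) (I : ℝ)
    (μ : Measure X := by volume_tac) : Prop :=
  Integrable (fun y => κ y * h y) μ ∧ ∫ y, κ y * h y ∂μ = I

namespace HasInt

variable {X : Type*} [MeasurableSpace X] {μ : Measure X} {κ h h' : X → ℝ} {I I' : ℝ}

lemma add (H : HasInt κ h I μ) (H' : HasInt κ h' I' μ) :
    HasInt κ (fun y => h y + h' y) (I + I') μ := by
  unfold HasInt
  simp_rw [mul_add]
  exact ⟨H.1.add H'.1, by rw [integral_add H.1 H'.1, H.2, H'.2]⟩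

lemma sub (H : HasInt κ h I μ) (H' : HasInt κ h' I' μ) :
    HasInt κ (fun y => h y - h' y) (I - I') μ := by
  unfold HasInt
  simp_rw [mul_sub]
  exact ⟨H.1.sub H'.1, by rw [integral_sub H.1 H'.1, H.2, H'.2]⟩

lemma smul (H : HasInt κ h I μ) (c : ℝ) : HasInt κ (fun y => c * h y) (c * I) μ := by
  unfold HasInt
  simp_rw [mul_left_comm _ c]
  exact ⟨H.1.const_mul c, by rw [integral_const_mul, H.2]⟩

lemma sum {ι : Type*} {s : Finset ι} {h : ι → X → ℝ} {I : ι → ℝ}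
    (H : ∀ i, HasInt κ (h i) (I i) μ) : HasInt κ (fun y => ∑ i ∈ s, h i y) (∑ i ∈ s, I i) μ := by
  unfold HasInt
  simp_rw [Finset.mul_sum]
  exact ⟨integrable_finsetSum _ fun i _ => (H i).1, by
    rw [integral_finsetSum _ fun i _ => (H i).1]; exact Finset.sum_congr rfl fun i _ => (H i).2⟩

lemma corr {κ : STE → ℝ} (hκ : IsKernel κ) {f g : ST → ℝ} (hf : Integrable f) (hg : Integrable g)
    (hc : Continuous fun y => HallMHD.corr f g (stHom y)) :
    HasInt κ (fun y => HallMHD.corr f g (stHom y)) (bil κ f g) :=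
  ⟨(hκ.continuous.mul hc).integrable_of_hasCompactSupport hκ.compact.mul_right,
    (bil_eq_corr hκ hf hg).symm⟩

end HasInt

/-- A pair of functions whose correlation is well defined and continuous. -/
structure CorrPair (f g : ST → ℝ) : Prop where
  left : Integrable f
  right : Integrable g
  int : Integrable fun z => f z * g z
  cont : Continuous fun y : STE => corr f g (stHom y)

lemma CorrPair.hasInt {f g : ST → ℝ} (h : CorrPair f g) {κ : STE → ℝ} (hκ : IsKernel κ) :
    HasInt κ (fun y => corr f g (stHom y)) (bil κ f g) :=
  HasInt.corr hκ h.left h.right h.cont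

/-- All the products occurring in the expansion of a trilinear increment. -/
structure TriPairs (T : ℝ) (v w z : ST → ℝ) : Prop where
  p1 : ∀ ψ, IsTest T ψ → CorrPair ψ (fun p => v p * (w p * z p))
  p2 : ∀ ψ, IsTest T ψ → CorrPair (fun p => ψ p * z p) (fun p => v p * w p)
  p3 : ∀ ψ, IsTest T ψ → CorrPair (fun p => ψ p * w p) (fun p => v p * z p)
  p4 : ∀ ψ, IsTest T ψ → CorrPair (fun p => ψ p * (w p * z p)) v
  p5 : ∀ ψ, IsTest T ψ → CorrPair (fun p => ψ p * v p) (fun p => w p * z p)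
  p6 : ∀ ψ, IsTest T ψ → CorrPair (fun p => ψ p * (v p * z p)) w
  p7 : ∀ ψ, IsTest T ψ → CorrPair (fun p => ψ p * (v p * w p)) z

/-- A property of functions which is stable under linear combinations. -/
structure LinClosed {Y : Type*} (Q : (Y → ℝ) → Prop) : Prop where
  add : ∀ {f g}, Q f → Q g → Q fun y => f y + g y
  sub : ∀ {f g}, Q f → Q g → Q fun y => f y - g y
  smul : ∀ {f} (c : ℝ), Q f → Q fun y => c * f y
  sum : ∀ {f : Fin 3 → Y → ℝ}, (∀ i, Q (f i)) → Q fun y => ∑ i, f i y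

lemma linClosed_continuous {Y : Type*} [TopologicalSpace Y] :
    LinClosed (Continuous : (Y → ℝ) → Prop) :=
  ⟨.add, .sub, fun c h => h.const_mul c, fun h => continuous_finsetSum _ fun i _ => h i⟩

/-- Adjoining one point to the domain stores the value of the integral together with the integrand.
Linear expressions in the two can then be handled by the same closure argument as continuity. -/
lemma linClosed_hasInt {X : Type*} [MeasureSpace X] (ρ : X → ℝ) :
    LinClosed fun h : Option X → ℝ => HasInt ρ (fun y => h (some y)) (h none) :=
  ⟨.add, .sub, fun c h => h.smul c, .sum⟩

section

variable {Y : Type*} {Q : (Y → ℝ) → Prop} {β : Y → (ST → ℝ) → (ST → ℝ) → ℝ} (hQ : LinClosed Q)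
  (hβ : ∀ {f g}, CorrPair f g → Q fun y => β y f g) {T : ℝ} {ψ : ST → ℝ} (hψ : IsTest T ψ)
include hQ hβ hψ

lemma TriPairs.closed {v w z : ST → ℝ} (h : TriPairs T v w z) :
    Q fun y => trilin (β y) ψ v w z :=
  hQ.add (hQ.add (hQ.sub (hQ.add (hQ.sub (hQ.sub (hβ (h.p1 ψ hψ)) (hβ (h.p2 ψ hψ)))
    (hβ (h.p3 ψ hψ))) (hβ (h.p4 ψ hψ))) (hβ (h.p5 ψ hψ))) (hβ (h.p6 ψ hψ))) (hβ (h.p7 ψ hψ))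

lemma TriPairs.closed_rhsFlux {v w z : Fin 3 → ST → ℝ}
    (h : ∀ k i, TriPairs T (v k) (w i) (z i)) : Q fun y => rhsFlux (β y) ψ v w z :=
  hQ.sum fun k => hQ.sum fun i => hQ.sub (hβ ((h k i).p1 _ (hψ.sd _))) (hβ ((h k i).p5 _ (hψ.sd _)))

end

/-- All the products occurring in the Kármán–Howarth–Monin relation. -/
structure HallPairs (T : ℝ) (u b j : Fin 3 → ST → ℝ) (P : ST → ℝ) : Prop where
  uuu : ∀ k i, TriPairs T (u k) (u i) (u i)
  ubb : ∀ k i, TriPairs T (u k) (b i) (b i)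
  bub : ∀ k i, TriPairs T (b k) (u i) (b i)
  jbb : ∀ k i, TriPairs T (j k) (b i) (b i)
  bjb : ∀ k i, TriPairs T (b k) (j i) (b i)
  uu : ∀ i, ∀ ψ, IsTest T ψ → CorrPair (fun p => ψ p * u i p) (u i)
  bb : ∀ i, ∀ ψ, IsTest T ψ → CorrPair (fun p => ψ p * b i p) (b i)
  Pu : ∀ i, ∀ ψ, IsTest T ψ → CorrPair (fun p => ψ p * P p) (u i)
  uP : ∀ i, ∀ ψ, IsTest T ψ → CorrPair (fun p => ψ p * u i p) P

namespace HallPairs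

variable {T : ℝ} {u b j : Fin 3 → ST → ℝ} {P : ST → ℝ} (H : HallPairs T u b j P)
  {κ : STE → ℝ} {ψ : ST → ℝ}
include H

section

variable {Y : Type*} {Q : (Y → ℝ) → Prop} {β : Y → (ST → ℝ) → (ST → ℝ) → ℝ} (hQ : LinClosed Q)
  (hβ : ∀ {f g}, CorrPair f g → Q fun y => β y f g) (hψ : IsTest T ψ)
include hQ hβ hψ

lemma closed_dissForm (k i : Fin 3) : Q fun y => dissForm (β y) ψ u b j k i :=
  hQ.sub (hQ.add (hQ.add (hQ.sub (hQ.smul _ ((H.uuu k i).closed hQ hβ hψ))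
    (hQ.smul _ ((H.ubb k i).closed hQ hβ hψ))) (hQ.smul _ ((H.bub k i).closed hQ hβ hψ)))
    (hQ.smul _ ((H.jbb k i).closed hQ hβ hψ))) (hQ.smul _ ((H.bjb k i).closed hQ hβ hψ))

lemma closed_khmRhs : Q fun y => khmRhs (β y) ψ u b j P := by
  have hd := fun α => hψ.sd α
  refine hQ.add (hQ.sub (hQ.sub (hQ.smul _ ?_) (hQ.smul _ ?_)) (hQ.smul _ ?_))
    (hQ.sub (hQ.add (hQ.add (hQ.sub
      (hQ.smul _ (TriPairs.closed_rhsFlux hQ hβ hψ H.uuu))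
      (hQ.smul _ (TriPairs.closed_rhsFlux hQ hβ hψ H.ubb)))
      (hQ.smul _ (TriPairs.closed_rhsFlux hQ hβ hψ H.bub)))
      (hQ.smul _ (TriPairs.closed_rhsFlux hQ hβ hψ H.jbb)))
      (hQ.smul _ (TriPairs.closed_rhsFlux hQ hβ hψ H.bjb)))
  · exact hQ.add (hQ.add (hQ.sum fun i => hβ (H.uu i _ (hd _))) (hQ.sum fun k => hQ.sum fun i =>
      hQ.sub (hβ ((H.uuu k i).p6 _ (hd _))) (hβ ((H.bub k i).p6 _ (hd _)))))
      (hQ.add (hQ.sum fun i => hβ (H.Pu i _ (hd _))) (hQ.sum fun i => hβ (H.uP i _ (hd _))))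
  · exact hQ.add (hQ.sum fun i => hβ (H.bb i _ (hd _))) (hQ.sum fun k => hQ.sum fun i =>
      hQ.add (hQ.sub (hQ.sub (hβ ((H.ubb k i).p6 _ (hd _))) (hβ ((H.bub k i).p7 _ (hd _))))
        (hβ ((H.jbb k i).p6 _ (hd _)))) (hβ ((H.bjb k i).p7 _ (hd _))))
  · exact hQ.sum fun k => hQ.sum fun i => hQ.add (hQ.sub (hQ.sub (hQ.sub
      (hβ ((H.bjb k i).p6 _ (hd _))) (hQ.smul _ (hβ ((H.jbb k i).p4 _ (hd _)))))
      (hQ.smul _ (hβ ((H.jbb k i).p5 _ (hd _))))) (hβ ((H.jbb k i).p2 _ (hd _))))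
      (hβ ((H.bjb k i).p2 _ (hd _)))

end

lemma hasInt_khmRhs {X : Type*} [MeasureSpace X] {ρ : X → ℝ}
    {β : X → (ST → ℝ) → (ST → ℝ) → ℝ} {B : (ST → ℝ) → (ST → ℝ) → ℝ}
    (hβ : ∀ {f g}, CorrPair f g → HasInt ρ (fun y => β y f g) (B f g)) (hψ : IsTest T ψ) :
    HasInt ρ (fun y => khmRhs (β y) ψ u b j P) (khmRhs B ψ u b j P) := by
  have h := H.closed_khmRhs (linClosed_hasInt ρ) (β := fun o => o.elim B β) (fun h => hβ h) hψ
  simpa only [Option.elim] using h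

lemma hasInt_dissForm (hκ : IsKernel κ) (hψ : IsTest T ψ) (k i : Fin 3) :
    HasInt κ (fun y => dissForm (fun f g => corr f g (stHom y)) ψ u b j k i)
      (dissForm (bil κ) ψ u b j k i) := by
  have h := H.closed_dissForm (linClosed_hasInt κ)
    (β := fun o => o.elim (bil κ) fun y f g => corr f g (stHom y)) (fun h => h.hasInt hκ) hψ k i
  simpa only [Option.elim] using h

lemma continuous_dissForm (hψ : IsTest T ψ) (k i : Fin 3) :
    Continuous (fun y : STE => dissForm (fun f g => corr f g (stHom y)) ψ u b j k i) :=
  H.closed_dissForm linClosed_continuous CorrPair.cont hψ k i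

lemma continuous_khmRhs (hψ : IsTest T ψ) :
    Continuous (fun y : STE => khmRhs (fun f g => corr f g (stHom y)) ψ u b j P) :=
  H.closed_khmRhs linClosed_continuous CorrPair.cont hψ

/-- The Kármán–Howarth–Monin relation in terms of correlations. -/
lemma integral_dk_mul_dissForm {G : Fin 3 → Fin 3 → ST → ℝ} (HD : HallData T u b j P G)
    {a c τ : ℝ} (hκ : IsKernel κ) (hψ : IsTest T ψ) (ha : τ < a) (hcT : c + τ < T)
    (hψ0 : ∀ z : ST, z.1 ∉ Icc a c → ψ z = 0) (hκ0 : ∀ y : STE, τ < |y.1| → κ y = 0) :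
    ∑ k, ∫ y, dk (some k) κ y * ∑ i, dissForm (fun f g => corr f g (stHom y)) ψ u b j k i =
      ∫ y, κ y * khmRhs (fun f g => corr f g (stHom y)) ψ u b j P := by
  rw [(H.hasInt_khmRhs (fun h => h.hasInt hκ) hψ).2, ← HD.sum_dissForm (fun k i => ((H.uuu k i).p1 ψ hψ).right)
    (fun k i => ((H.ubb k i).p1 ψ hψ).right) (fun k i => ((H.bub k i).p1 ψ hψ).right)
    (fun k i => ((H.jbb k i).p1 ψ hψ).right) (fun k i => ((H.bjb k i).p1 ψ hψ).right)
    hκ hψ ha hcT hψ0 hκ0]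
  exact Finset.sum_congr rfl fun k _ =>
    (HasInt.sum (s := Finset.univ) fun i => H.hasInt_dissForm (hκ.dk (some k)) hψ k i).2

end HallPairs

end

section

/-! ### Localization at a point and restriction to the time diagonal -/

/-- The fundamental lemma of the calculus of variations gives vanishing almost everywhere;
continuity upgrades it to every point, which is needed to evaluate at the origin. -/
lemma eq_zero_of_integral_smooth_mul {E : Type*} [NormedAddCommGroup E] [NormedSpace ℝ E]
    [FiniteDimensional ℝ E] [MeasurableSpace E] [BorelSpace E] {μ : Measure E}
    [IsLocallyFiniteMeasure μ] [μ.IsOpenPosMeasure] {U : Set E} (hU : IsOpen U) {f : E → ℝ}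
    (hf : ContinuousOn f U)
    (h : ∀ g : E → ℝ, ContDiff ℝ ∞ g → HasCompactSupport g → tsupport g ⊆ U →
      ∫ x, g x * f x ∂μ = 0) : ∀ x ∈ U, f x = 0 := by
  have h1 := hU.ae_eq_zero_of_integral_contDiff_smul_eq_zero
    (hf.locallyIntegrableOn hU.measurableSet) (μ := μ) h
  have h2 : f =ᵐ[μ.restrict U] fun _ => 0 := (ae_restrict_iff' hU.measurableSet).2 h1
  exact fun x hx => Measure.eqOn_open_of_ae_eq h2 hU hf continuousOn_const hx

/-- A continuous function which is orthogonal to all kernels concentrated near time zero vanishes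
at the origin. -/
lemma eq_zero_of_kernel {h : STE → ℝ} (hc : Continuous h) {τ : ℝ} (hτ : 0 < τ)
    (hint : ∀ κ : STE → ℝ, IsKernel κ → (∀ y : STE, τ < |y.1| → κ y = 0) →
      ∫ y, κ y * h y = 0) : h 0 = 0 := by
  have hU : IsOpen {y : STE | |y.1| < τ} := isOpen_lt (by fun_prop) continuous_const
  refine eq_zero_of_integral_smooth_mul (μ := volume) hU hc.continuousOn (fun g hg hgc hgs => ?_) 0
    (by simpa using hτ)
  refine hint g ⟨hg, hgc⟩ fun y hy => ?_
  by_contra hne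
  exact absurd (hgs (subset_tsupport _ hne)) (by simpa using hy.le)

lemma continuous_integral_kernel {X : Type*} [TopologicalSpace X] [FirstCountableTopology X]
    [LocallyCompactSpace X]
    {φ : E3 → ℝ} (hφ : Continuous φ) (hc : HasCompactSupport φ) {V : X × E3 → ℝ}
    (hV : Continuous V) : Continuous fun x => ∫ l, φ l * V (x, l) := by
  have h1 : ∀ x, ∫ l, φ l * V (x, l) = ∫ l in tsupport φ, φ l * V (x, l) := fun x =>
    (setIntegral_eq_integral_of_forall_compl_eq_zero fun l hl => by
      rw [image_eq_zero_of_notMem_tsupport hl, zero_mul]).symm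
  simp_rw [h1]
  refine continuous_parametric_integral_of_continuous ?_ hc
  exact (hφ.comp continuous_snd).mul hV

/-- Test with product kernels ρ(t)φ(l). The difference of the two sides at time lag s is continuous
in s and orthogonal to every smooth ρ supported in |s| < τ, so it vanishes at s = 0. This is the
only place where the mollification in time is removed. -/
lemma time_diagonal {V : Fin 3 → STE → ℝ} {A : STE → ℝ} (hV : ∀ k, Continuous (V k))
    (hA : Continuous A) {τ : ℝ} (hτ : 0 < τ)
    (h : ∀ κ : STE → ℝ, IsKernel κ → (∀ y : STE, τ < |y.1| → κ y = 0) →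
      ∑ k, ∫ y, dk (some k) κ y * V k y = ∫ y, κ y * A y)
    {φ : E3 → ℝ} (hφ : ContDiff ℝ ∞ φ) (hc : HasCompactSupport φ) :
    ∑ k, ∫ l, fderiv ℝ φ l (EuclideanSpace.single k 1) * V k (0, l) = ∫ l, φ l * A (0, l) := by
  have hd : ∀ k : Fin 3, Continuous fun l => fderiv ℝ φ l (EuclideanSpace.single k 1) := fun k =>
    (hφ.continuous_fderiv (by simp)).clm_apply continuous_const
  have hdc : ∀ k : Fin 3, HasCompactSupport fun l => fderiv ℝ φ l (EuclideanSpace.single k 1) :=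
    fun k => hc.fderiv_apply (𝕜 := ℝ) _
  set g : ℝ → ℝ := fun s => (∑ k, ∫ l, fderiv ℝ φ l (EuclideanSpace.single k 1) * V k (s, l)) -
    ∫ l, φ l * A (s, l) with hg
  have hgc : Continuous g := (continuous_finsetSum _ fun k _ =>
    continuous_integral_kernel (hd k) (hdc k) (hV k)).sub
    (continuous_integral_kernel hφ.continuous hc hA)
  suffices h0 : g 0 = 0 by
    rw [hg] at h0
    exact sub_eq_zero.1 h0
  have hU : IsOpen {s : ℝ | |s| < τ} := isOpen_lt continuous_abs continuous_const
  refine eq_zero_of_integral_smooth_mul (μ := volume) hU hgc.continuousOn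
    (fun ρ hρ hρc hρs => ?_) 0 (by simpa using hτ)
  have hker : ∀ χ : E3 → ℝ, HasCompactSupport χ →
      HasCompactSupport fun y : STE => ρ y.1 * χ y.2 := by
    intro χ hχ
    refine HasCompactSupport.intro (hρc.prod hχ) fun y hy => ?_
    rcases not_and_or.1 (fun h => hy (mem_prod.2 h)) with h | h
    · rw [image_eq_zero_of_notMem_tsupport h, zero_mul]
    · rw [image_eq_zero_of_notMem_tsupport h, mul_zero]
  have hfub : ∀ (χ : E3 → ℝ) (W : STE → ℝ), Continuous χ → HasCompactSupport χ → Continuous W →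
      Integrable (fun s => ρ s * ∫ l, χ l * W (s, l)) ∧
      ∫ y : STE, (ρ y.1 * χ y.2) * W y = ∫ s, ρ s * ∫ l, χ l * W (s, l) := by
    intro χ W hχ hχc hW
    have hint : Integrable (fun y : STE => (ρ y.1 * χ y.2) * W y) :=
      (((hρ.continuous.comp continuous_fst).mul (hχ.comp continuous_snd)).mul
        hW).integrable_of_hasCompactSupport (hker χ hχc).mul_right
    constructor
    · exact (hρ.continuous.mul
        (continuous_integral_kernel hχ hχc hW)).integrable_of_hasCompactSupport hρc.mul_right
    · rw [Measure.volume_eq_prod, integral_prod _ hint]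
      congr with s
      rw [← integral_const_mul]
      congr with l
      ring
  have hκ : IsKernel fun y : STE => ρ y.1 * φ y.2 :=
    ⟨(hρ.comp contDiff_fst).mul (hφ.comp contDiff_snd), hker φ hc⟩
  have hdk : ∀ k (y : STE), dk (some k) (fun y : STE => ρ y.1 * φ y.2) y =
      ρ y.1 * fderiv ℝ φ y.2 (EuclideanSpace.single k 1) := by
    intro k y
    have h1 : HasFDerivAt (fun y : STE => ρ y.1 * φ y.2) _ y :=
      ((hρ.differentiable (by simp) y.1).hasFDerivAt.comp y hasFDerivAt_fst).mul
      ((hφ.differentiable (by simp) y.2).hasFDerivAt.comp y hasFDerivAt_snd)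
    unfold dk
    rw [h1.fderiv]
    simp [dir]
  have := h _ hκ fun y hy => by
    have : ρ y.1 = 0 := by
      by_contra hne
      exact absurd (hρs (subset_tsupport _ hne)) (by simpa using hy.le)
    simp [this]
  simp_rw [hdk, (hfub _ _ (hd _) (hdc _) (hV _)).2, (hfub _ _ hφ.continuous hc hA).2] at this
  rw [hg]
  simp_rw [mul_sub, Finset.mul_sum]
  rw [integral_sub (integrable_finsetSum _ fun k _ => (hfub _ _ (hd _) (hdc _) (hV _)).1)
    (hfub _ _ hφ.continuous hc hA).1, integral_finsetSum _ fun k _ =>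
    (hfub _ _ (hd _) (hdc _) (hV _)).1, this, sub_self]

/-! ### Spherical averages -/

/-- Integration in polar coordinates. -/
lemma integral_polar {f : E3 → ℝ} (hf : Integrable f) :
    ∫ x, f x = ∫ r in Ioi (0 : ℝ), r ^ 2 * ∫ ζ, f (r • (ζ : E3)) ∂sphereMeasure := by
  have hmp := (volume : Measure E3).measurePreserving_homeomorphUnitSphereProd
  have hdim : Module.finrank ℝ E3 - 1 = 2 := by simp
  rw [hdim] at hmp
  set e := homeomorphUnitSphereProd E3
  have h1 : ∫ x, f x = ∫ x : ({0}ᶜ : Set E3), f (x : E3) ∂(Measure.comap Subtype.val volume) := by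
    rw [integral_subtype_comap (measurableSet_singleton _).compl, restrict_compl_singleton]
  have hfe : ∀ x : ({0}ᶜ : Set E3), f (x : E3) = (fun p => f (e.symm p)) (e x) := by
    intro x; simp
  have hint : Integrable (fun p => f (e.symm p))
      ((volume : Measure E3).toSphere.prod (Measure.volumeIoiPow 2)) := by
    rw [← hmp.integrable_comp_emb e.measurableEmbedding]
    simp only [Function.comp_def, Homeomorph.symm_apply_apply]
    have := hf.integrableOn (s := {0}ᶜ)
    rwa [integrableOn_iff_comap_subtypeVal (measurableSet_singleton _).compl] at this
  have hw : (fun r : Ioi (0 : ℝ) => ENNReal.ofReal (r.1 ^ 2)) =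
    fun r => ((Real.toNNReal (r.1 ^ 2) : NNReal) : ℝ≥0∞) := rfl
  rw [h1, integral_congr_ae (Eventually.of_forall hfe),
    hmp.integral_comp e.measurableEmbedding (fun p => f (e.symm p)), integral_prod_symm _ hint,
    Measure.volumeIoiPow, hw, integral_withDensity_eq_integral_smul
      (by fun_prop : Measurable fun r : Ioi (0 : ℝ) => Real.toNNReal (r.1 ^ 2))]
  rw [← integral_subtype_comap measurableSet_Ioi
    (fun r => r ^ 2 * ∫ ζ, f (r • (ζ : E3)) ∂sphereMeasure)]
  congr with r
  rw [NNReal.smul_def, Real.coe_toNNReal _ (by positivity), smul_eq_mul]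
  rfl

instance : IsFiniteMeasure sphereMeasure := by unfold sphereMeasure; infer_instance

lemma sphereMeasure_univ : sphereMeasure.real univ = 4 * Real.pi := by
  unfold sphereMeasure
  rw [Measure.toSphere_real_apply_univ, measureReal_def, EuclideanSpace.volume_ball_fin_three]
  simp
  have := Real.pi_pos
  rw [ENNReal.toReal_ofReal (by positivity)]
  ring

lemma continuous_sphere_integral {g : E3 → E3 → ℝ} (hg : Continuous fun p : E3 × E3 => g p.1 p.2) :
    Continuous fun r : ℝ => ∫ ζ, g (ζ : E3) (r • (ζ : E3)) ∂sphereMeasure := by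
  have := continuous_parametric_integral_of_continuous (μ := sphereMeasure) (s := univ)
    (f := fun (r : ℝ) (ζ : Metric.sphere (0 : E3) 1) => g (ζ : E3) (r • (ζ : E3)))
    (by
      have h2 : Continuous fun p : ℝ × Metric.sphere (0 : E3) 1 =>
        ((p.2 : E3), p.1 • (p.2 : E3)) := by fun_prop
      exact hg.comp h2) isCompact_univ
  simpa using this

/-- The divergence theorem on a ball for a vector field that is merely continuous and whose
distributional divergence is −A. Radial test functions with arbitrary radial profile give an
identity between one-dimensional integrals, which is then localized at a single radius. -/
lemma sphere_flux {V : Fin 3 → E3 → ℝ} {A : E3 → ℝ} (hV : ∀ k, Continuous (V k))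
    (hA : Continuous A)
    (h : ∀ φ : E3 → ℝ, ContDiff ℝ ∞ φ → HasCompactSupport φ →
      ∑ k, ∫ l, fderiv ℝ φ l (EuclideanSpace.single k 1) * V k l = ∫ l, φ l * A l)
    {r : ℝ} (hr : 0 < r) :
    r ^ 2 * ∫ ζ, (∑ k, (ζ : E3) k * V k (r • (ζ : E3))) ∂sphereMeasure =
      - ∫ s in (0 : ℝ)..r, s ^ 2 * ∫ ζ, A (s • (ζ : E3)) ∂sphereMeasure := by
  set W : ℝ → ℝ := fun r => ∫ ζ, (∑ k, (ζ : E3) k * V k (r • (ζ : E3))) ∂sphereMeasure with hW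
  set M : ℝ → ℝ := fun s => ∫ ζ, A (s • (ζ : E3)) ∂sphereMeasure with hM
  have hWc : Continuous W := continuous_sphere_integral (g := fun x y => ∑ k, x k * V k y)
    (by
      refine continuous_finsetSum _ fun k _ => Continuous.mul (by fun_prop) ?_
      exact (hV k).comp continuous_snd)
  have hMc : Continuous M := continuous_sphere_integral (g := fun x y => A y)
    (hA.comp continuous_snd)
  have hsM : Continuous fun s : ℝ => s ^ 2 * M s := by fun_prop
  set B : ℝ → ℝ := fun r => ∫ s in (0 : ℝ)..r, s ^ 2 * M s with hB
  have hBd : ∀ r, HasDerivAt B (r ^ 2 * M r) r := fun r =>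
    intervalIntegral.integral_hasDerivAt_right (hsM.intervalIntegrable _ _)
      hsM.stronglyMeasurable.stronglyMeasurableAtFilter hsM.continuousAt
  have hBc : Continuous B := continuous_iff_continuousAt.2 fun r => (hBd r).continuousAt
  change r ^ 2 * W r = - B r
  -- In the variable s = r² the test function Ψ(|x|²) is smooth at the origin, and its gradient
  -- 2χ(|x|²)x involves an arbitrary χ.
  suffices hz : ∀ s ∈ Ioi (0 : ℝ), Real.sqrt s ^ 2 * W (Real.sqrt s) + B (Real.sqrt s) = 0 by
    have := hz (r ^ 2) (by simpa using by positivity)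
    rw [Real.sqrt_sq hr.le] at this
    linarith
  refine eq_zero_of_integral_smooth_mul (μ := volume) isOpen_Ioi (by fun_prop)
    fun χ hχ hχc hχs => ?_
  -- the radial test function
  obtain ⟨R, hR⟩ : ∃ R : ℝ, ∀ t, R ≤ t → χ t = 0 := by
    obtain ⟨R, hR⟩ := hχc.isCompact.isBounded.subset_closedBall 0
    refine ⟨R + 1, fun t ht => image_eq_zero_of_notMem_tsupport fun hm => ?_⟩
    have := hR hm
    rw [Metric.mem_closedBall, dist_zero_right, Real.norm_eq_abs] at this
    linarith [le_abs_self t]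
  -- The primitive starts at `R`, beyond the support of χ, so that Ψ vanishes for large arguments
  -- and the radial function has compact support.
  set Ψ : ℝ → ℝ := fun s => ∫ t in R..s, χ t with hΨ
  have hΨd : ∀ s, HasDerivAt Ψ (χ s) s := fun s =>
    intervalIntegral.integral_hasDerivAt_right (hχ.continuous.intervalIntegrable _ _)
      hχ.continuous.stronglyMeasurable.stronglyMeasurableAtFilter hχ.continuous.continuousAt
  have hΨs : ContDiff ℝ ∞ Ψ := by
    rw [contDiff_infty_iff_deriv]
    refine ⟨fun s => (hΨd s).differentiableAt, ?_⟩
    rwa [show deriv Ψ = χ from funext fun s => (hΨd s).deriv]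
  have hΨ0 : ∀ s, R ≤ s → Ψ s = 0 := by
    intro s hs
    rw [hΨ]
    simp only
    rw [intervalIntegral.integral_congr (g := fun _ => 0), intervalIntegral.integral_zero]
    intro t ht
    rw [uIcc_of_le hs] at ht
    exact hR t ht.1
  have hχ0 : ∀ s ≤ 0, χ s = 0 := fun s hs => image_eq_zero_of_notMem_tsupport fun hm =>
    absurd (hχs hm) (by simpa using hs)
  set φ : E3 → ℝ := fun x => Ψ (‖x‖ ^ 2) with hφ
  have hsq : ∀ x : ℝ, max R 1 < |x| → R ≤ x ^ 2 := by
    intro x hx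
    have h1 : 1 < |x| := (le_max_right _ _).trans_lt hx
    have h2 : R < |x| := (le_max_left _ _).trans_lt hx
    rw [← sq_abs]; nlinarith
  have hφs : ContDiff ℝ ∞ φ := hΨs.comp (contDiff_norm_sq ℝ)
  have hφc : HasCompactSupport φ := by
    refine HasCompactSupport.intro (isCompact_closedBall (0 : E3) (max R 1)) fun x hx => ?_
    rw [Metric.mem_closedBall, dist_zero_right, not_le] at hx
    exact hΨ0 _ (hsq _ (by rwa [abs_norm]))
  have hφd : ∀ (k : Fin 3) (x : E3), fderiv ℝ φ x (EuclideanSpace.single k 1) =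
      χ (‖x‖ ^ 2) * (2 * x k) := by
    intro k x
    have := (hΨd (‖x‖ ^ 2)).hasFDerivAt.comp x (HasStrictFDerivAt.hasFDerivAt
      (hasStrictFDerivAt_norm_sq x))
    rw [show φ = Ψ ∘ fun x => ‖x‖ ^ 2 from rfl, this.fderiv]
    simp [EuclideanSpace.inner_single_right]
    ring
  have hL : ∑ k, ∫ l, fderiv ℝ φ l (EuclideanSpace.single k 1) * V k l =
      ∫ r in Ioi (0 : ℝ), χ (r ^ 2) * (2 * r) * (r ^ 2 * W r) := by
    have hi : ∀ k, Integrable fun l => fderiv ℝ φ l (EuclideanSpace.single k 1) * V k l := by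
      intro k
      refine Continuous.integrable_of_hasCompactSupport ?_
        (hφc.fderiv_apply (𝕜 := ℝ) _).mul_right
      exact ((hφs.continuous_fderiv (by simp)).clm_apply continuous_const).mul (hV k)
    rw [← integral_finsetSum _ fun k _ => hi k, integral_polar (integrable_finsetSum _ fun k _ =>
      hi k)]
    refine setIntegral_congr_fun measurableSet_Ioi fun r hr => ?_
    have hr' : 0 < r := hr
    rw [hW]
    simp only
    rw [← integral_const_mul, ← integral_const_mul, ← integral_const_mul]
    congr with ζ
    have : ‖r • (ζ : E3)‖ ^ 2 = r ^ 2 := by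
      rw [norm_smul, norm_eq_of_mem_sphere]; simp
    simp_rw [hφd, this, Finset.mul_sum]
    refine Finset.sum_congr rfl fun k _ => ?_
    simp
    ring
  have hRt : ∫ l, φ l * A l = ∫ r in Ioi (0 : ℝ), Ψ (r ^ 2) * (r ^ 2 * M r) := by
    have hi : Integrable fun l => φ l * A l :=
      (hφs.continuous.mul hA).integrable_of_hasCompactSupport hφc.mul_right
    rw [integral_polar hi]
    refine setIntegral_congr_fun measurableSet_Ioi fun r hr => ?_
    have hr' : 0 < r := hr
    rw [hM]
    simp only
    rw [← integral_const_mul, ← integral_const_mul, ← integral_const_mul]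
    congr with ζ
    have : ‖r • (ζ : E3)‖ ^ 2 = r ^ 2 := by
      rw [norm_smul, norm_eq_of_mem_sphere]; simp
    rw [hφ]
    simp only [this]
    ring
  have hcs : ∀ (f g : ℝ → ℝ), Continuous f → Continuous g → (∀ s, R ≤ s → f s = 0) →
      Integrable fun r => f (r ^ 2) * g r := by
    intro f g hf hg hf0
    refine Continuous.integrable_of_hasCompactSupport (by fun_prop) ?_
    refine HasCompactSupport.intro (isCompact_closedBall (0 : ℝ) (max R 1)) fun x hx => ?_
    rw [Metric.mem_closedBall, dist_zero_right, not_le] at hx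
    rw [hf0 _ (hsq _ hx), zero_mul]
  have hΨcont := hΨs.continuous
  have hχcont := hχ.continuous
  have i1 : Integrable fun r : ℝ => χ (r ^ 2) * (2 * r * B r) :=
    hcs χ _ hχcont (by fun_prop) hR
  have i2 : Integrable fun r : ℝ => Ψ (r ^ 2) * (r ^ 2 * M r) := hcs Ψ _ hΨcont hsM hΨ0
  have i3 : Integrable fun r : ℝ => χ (r ^ 2) * (2 * r * (r ^ 2 * W r)) :=
    hcs χ _ hχcont (by fun_prop) hR
  -- Integration of the derivative of Ψ(r²)B(r): the boundary terms vanish because B(0) = 0 and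
  -- Ψ(r²) = 0 for large r.
  have hparts : ∫ r in Ioi (0 : ℝ), (χ (r ^ 2) * (2 * r * B r) + Ψ (r ^ 2) * (r ^ 2 * M r)) = 0 := by
    have hd : ∀ r ∈ Ici (0 : ℝ), HasDerivAt (fun r => Ψ (r ^ 2) * B r)
        (χ (r ^ 2) * (2 * r * B r) + Ψ (r ^ 2) * (r ^ 2 * M r)) r := by
      intro r _
      have h1 : HasDerivAt (fun r : ℝ => Ψ (r ^ 2)) (χ (r ^ 2) * (2 * r)) r := by
        have := (hΨd (r ^ 2)).comp r (hasDerivAt_pow 2 r)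
        simpa [Function.comp_def] using this
      refine (h1.mul (hBd r)).congr_deriv ?_
      ring
    rw [integral_Ioi_of_hasDerivAt_of_tendsto' hd (i1.add i2).integrableOn (m := 0)]
    · simp [hB]
    · refine tendsto_const_nhds.congr' ?_
      filter_upwards [eventually_gt_atTop (max R 1)] with x hx
      rw [hΨ0 _ (hsq x (hx.trans_le (le_abs_self x))), zero_mul]
  rw [integral_add i1.integrableOn i2.integrableOn] at hparts
  have key := h φ hφs hφc
  rw [hL, hRt] at key
  -- The substitution s = r² turns the weight 2r χ(r²) into χ(s).
  have hsub := integral_comp_rpow_Ioi_of_pos (p := 2) (by norm_num)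
    (g := fun s => χ s * (Real.sqrt s ^ 2 * W (Real.sqrt s) + B (Real.sqrt s)))
  have e1 : ∫ s, χ s * (Real.sqrt s ^ 2 * W (Real.sqrt s) + B (Real.sqrt s)) =
      ∫ s in Ioi (0 : ℝ), χ s * (Real.sqrt s ^ 2 * W (Real.sqrt s) + B (Real.sqrt s)) :=
    (setIntegral_eq_integral_of_forall_compl_eq_zero fun s hs => by
      rw [hχ0 s (by simpa using hs), zero_mul]).symm
  rw [e1, ← hsub]
  have e2 : ∫ x in Ioi (0 : ℝ), ((2 : ℝ) * x ^ ((2 : ℝ) - 1)) • (χ (x ^ (2 : ℝ)) *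
      (Real.sqrt (x ^ (2 : ℝ)) ^ 2 * W (Real.sqrt (x ^ (2 : ℝ))) + B (Real.sqrt (x ^ (2 : ℝ))))) =
      ∫ r in Ioi (0 : ℝ), (χ (r ^ 2) * (2 * r * (r ^ 2 * W r)) + χ (r ^ 2) * (2 * r * B r)) := by
    refine setIntegral_congr_fun measurableSet_Ioi fun r hr => ?_
    have hr' : 0 ≤ r := le_of_lt hr
    have h1 : r ^ (2 : ℝ) = r ^ 2 := by exact_mod_cast Real.rpow_natCast r 2
    have h2 : r ^ ((2 : ℝ) - 1) = r := by norm_num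
    simp only [h1, h2, Real.sqrt_sq hr', smul_eq_mul]
    ring
  rw [e2, integral_add i3.integrableOn i1.integrableOn]
  have e3 : ∫ r in Ioi (0 : ℝ), χ (r ^ 2) * (2 * r * (r ^ 2 * W r)) =
      ∫ r in Ioi (0 : ℝ), χ (r ^ 2) * (2 * r) * (r ^ 2 * W r) := by
    congr with r; ring
  rw [e3, key]
  linarith

/-- Rescaling the flux identity to the unit interval gives −r ∫₀¹ s² M(rs) ds for the flux, with M
the integral of A over spheres; at r = 0 that integral is 4π/3 · A(0). The factor 1/3 = ∫₀¹ s² ds is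
the origin of the 4/3 in the law. -/
lemma tendsto_sphere_flux {V : Fin 3 → E3 → ℝ} {A : E3 → ℝ} (hV : ∀ k, Continuous (V k))
    (hA : Continuous A)
    (h : ∀ φ : E3 → ℝ, ContDiff ℝ ∞ φ → HasCompactSupport φ →
      ∑ k, ∫ l, fderiv ℝ φ l (EuclideanSpace.single k 1) * V k l = ∫ l, φ l * A l) :
    Tendsto (fun r : ℝ => r⁻¹ * ((4 * Real.pi)⁻¹ *
      ∫ ζ, (∑ k, (ζ : E3) k * V k (r • (ζ : E3))) ∂sphereMeasure)) (𝓝[>] 0)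
      (𝓝 (-(1 / 3) * A 0)) := by
  set M : ℝ → ℝ := fun s => ∫ ζ, A (s • (ζ : E3)) ∂sphereMeasure with hM
  have hMc : Continuous M := continuous_sphere_integral (g := fun x y => A y)
    (hA.comp continuous_snd)
  have hc : Continuous fun r : ℝ => ∫ s in (0 : ℝ)..1, s ^ 2 * M (r * s) :=
    intervalIntegral.continuous_parametric_intervalIntegral_of_continuous'
      (f := fun r s => s ^ 2 * M (r * s)) (by fun_prop) _ _
  have h0 : ∫ s in (0 : ℝ)..1, s ^ 2 * M (0 * s) = 4 * Real.pi / 3 * A 0 := by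
    simp only [hM, zero_mul, zero_smul, integral_const, sphereMeasure_univ, smul_eq_mul]
    rw [intervalIntegral.integral_mul_const, integral_pow]
    norm_num
    ring
  have hlim : Tendsto (fun r : ℝ => -((4 * Real.pi)⁻¹ * ∫ s in (0 : ℝ)..1, s ^ 2 * M (r * s)))
      (𝓝[>] 0) (𝓝 (-(1 / 3) * A 0)) := by
    have := ((hc.tendsto 0).const_mul (4 * Real.pi)⁻¹).neg.mono_left
      (nhdsWithin_le_nhds (s := Ioi (0 : ℝ)))
    rw [h0] at this
    convert this using 2
    have := Real.pi_pos
    field_simp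
  refine hlim.congr' ?_
  filter_upwards [self_mem_nhdsWithin] with r hr
  have hr' : 0 < r := hr
  have h1 := sphere_flux hV hA h hr'
  have h2 := intervalIntegral.integral_comp_mul_left (fun s => s ^ 2 * M s) hr'.ne' (a := 0) (b := 1)
  have h3 : ∫ s in (0 : ℝ)..1, (r * s) ^ 2 * M (r * s) =
      r ^ 2 * ∫ s in (0 : ℝ)..1, s ^ 2 * M (r * s) := by
    rw [← intervalIntegral.integral_const_mul]
    congr with s; ring
  rw [h3, mul_zero, mul_one, smul_eq_mul] at h2
  have h4 : ∫ ζ, (∑ k, (ζ : E3) k * V k (r • (ζ : E3))) ∂sphereMeasure =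
      - (r * ∫ s in (0 : ℝ)..1, s ^ 2 * M (r * s)) := by
    have : r ^ 2 * ∫ ζ, (∑ k, (ζ : E3) k * V k (r • (ζ : E3))) ∂sphereMeasure =
        r ^ 2 * - (r * ∫ s in (0 : ℝ)..1, s ^ 2 * M (r * s)) := by
      rw [h1]
      have : ∫ s in (0 : ℝ)..r, s ^ 2 * M s = r * (r ^ 2 * ∫ s in (0 : ℝ)..1, s ^ 2 * M (r * s)) := by
        rw [h2]; field_simp
      rw [this]; ring
    exact mul_left_cancel₀ (by positivity) this
  rw [h4]
  generalize (∫ s in (0 : ℝ)..1, s ^ 2 * M (r * s)) = X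
  field_simp

end

section

/-! ### Mixed norms and trilinear forms -/

/-- The mixed modular `∫ (∫ |f|^s dx)^{r/s} dt`. -/
def mixI (r s : ℝ) (f : ST → ℝ≥0∞) : ℝ≥0∞ := ∫⁻ t, (∫⁻ x, f (t, x) ^ s) ^ (r / s)

lemma aemeasurable_slice {f : ST → ℝ≥0∞} (hf : AEMeasurable f) :
    ∀ᵐ t : ℝ, AEMeasurable fun x => f (t, x) := by
  rw [Measure.volume_eq_prod] at hf
  filter_upwards [Measure.ae_ae_of_ae_prod hf.ae_eq_mk] with t ht
  exact ⟨fun x => hf.mk f (t, x), hf.measurable_mk.comp measurable_prodMk_left, ht⟩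

lemma aemeasurable_lintegral_slice {f : ST → ℝ≥0∞} (hf : AEMeasurable f) :
    AEMeasurable fun t : ℝ => ∫⁻ x, f (t, x) := by
  rw [Measure.volume_eq_prod] at hf
  exact hf.lintegral_prod_right'

/-- Hölder's inequality in x on each time slice with exponents s, then in t with exponents r. The
quantity `mixI` is the r-th power of the mixed norm, hence the outer exponent 1/r. -/
lemma lintegral_prod_le_mixI {ι : Type*} [Fintype ι] {f : ι → ST → ℝ≥0∞}
    (hf : ∀ i, AEMeasurable (f i)) {r s : ι → ℝ} (hr : ∀ i, 0 < r i) (hs : ∀ i, 0 < s i)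
    (hr1 : ∑ i, (r i)⁻¹ = 1) (hs1 : ∑ i, (s i)⁻¹ = 1) :
    ∫⁻ z, ∏ i, f i z ≤ ∏ i, mixI (r i) (s i) (f i) ^ (r i)⁻¹ := by
  have hm : ∀ i, AEMeasurable (fun z => f i z ^ s i) := fun i => (hf i).pow_const _
  have h0 : AEMeasurable (fun z => ∏ i, f i z) (volume : Measure ST) :=
    Finset.aemeasurable_fun_prod _ fun i _ => hf i
  calc ∫⁻ z, ∏ i, f i z = ∫⁻ t : ℝ, ∫⁻ x : T3, ∏ i, f i (t, x) := by
        rw [Measure.volume_eq_prod] at h0 ⊢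
        exact lintegral_prod _ h0
    _ ≤ ∫⁻ t : ℝ, ∏ i, ((∫⁻ x, f i (t, x) ^ s i) ^ (r i / s i)) ^ (r i)⁻¹ := by
        refine lintegral_mono_ae ?_
        have hsl : ∀ᵐ t : ℝ, ∀ i, AEMeasurable fun x => f i (t, x) ^ s i := by
          rw [ae_all_iff]
          exact fun i => aemeasurable_slice (hm i)
        filter_upwards [hsl] with t ht
        have := ENNReal.lintegral_prod_norm_pow_le (μ := volume) Finset.univ
          (f := fun i x => f i (t, x) ^ s i) (fun i _ => ht i) hs1
          (fun i _ => inv_nonneg.2 (hs i).le)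
        refine (le_of_eq ?_).trans (this.trans (le_of_eq ?_))
        · congr with x
          refine Finset.prod_congr rfl fun i _ => ?_
          rw [← ENNReal.rpow_mul, mul_inv_cancel₀ (hs i).ne', ENNReal.rpow_one]
        · refine Finset.prod_congr rfl fun i _ => ?_
          rw [← ENNReal.rpow_mul]
          congr 1
          have := (hr i).ne'
          field_simp
    _ ≤ _ := ENNReal.lintegral_prod_norm_pow_le (μ := volume) Finset.univ
          (fun i _ => (aemeasurable_lintegral_slice (hm i)).pow_const _) hr1
          (fun i _ => inv_nonneg.2 (hr i).le)

lemma mixI_shift (r s : ℝ) (f : ST → ℝ≥0∞) (w : ST) :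
    mixI r s (fun z => f (z + w)) = mixI r s f := by
  unfold mixI
  have h1 : ∀ t : ℝ, ∫⁻ x : T3, f ((t, x) + w) ^ s = ∫⁻ x : T3, f (t + w.1, x) ^ s := fun t =>
    lintegral_add_right_eq_self (fun x => f (t + w.1, x) ^ s) w.2
  simp_rw [h1]
  exact lintegral_add_right_eq_self (fun t : ℝ => (∫⁻ x : T3, f (t, x) ^ s) ^ (r / s)) w.1

/-- Dominated convergence, in x on almost every slice and then in t. -/
lemma tendsto_mixI_zero {r s : ℝ} (hr : 0 < r) (hs : 0 < s) {f : ST → ℝ≥0∞}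
    {g : ℕ → ST → ℝ≥0∞} (hf : AEMeasurable f) (hg : ∀ n, AEMeasurable (g n))
    (hfin : mixI r s f ≠ ⊤) (hle : ∀ n z, g n z ≤ f z)
    (hlim : ∀ z, Tendsto (fun n => g n z) atTop (𝓝 0)) :
    Tendsto (fun n => mixI r s (g n)) atTop (𝓝 0) := by
  have hrs : 0 < r / s := div_pos hr hs
  have hmf : AEMeasurable (fun t : ℝ => (∫⁻ x : T3, f (t, x) ^ s) ^ (r / s)) :=
    (aemeasurable_lintegral_slice (hf.pow_const s)).pow_const _
  have h0 : ∫⁻ _ : ℝ, (0 : ℝ≥0∞) = 0 := lintegral_zero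
  rw [← h0]
  refine tendsto_lintegral_of_dominated_convergence' _
    (fun n => (aemeasurable_lintegral_slice ((hg n).pow_const s)).pow_const _) (fun n => ?_) hfin ?_
  · refine Eventually.of_forall fun t => ?_
    refine ENNReal.rpow_le_rpow (lintegral_mono fun x => ?_) hrs.le
    exact ENNReal.rpow_le_rpow (hle n _) hs.le
  · have hsl : ∀ᵐ t : ℝ, ∀ n, AEMeasurable fun x => g n (t, x) ^ s := by
      rw [ae_all_iff]
      exact fun n => aemeasurable_slice ((hg n).pow_const s)
    filter_upwards [hsl, ae_lt_top' hmf hfin] with t ht htop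
    have hfin' : ∫⁻ x : T3, f (t, x) ^ s ≠ ⊤ := by
      intro h
      rw [h, ENNReal.top_rpow_of_pos hrs] at htop
      exact lt_irrefl _ htop
    have h1 : Tendsto (fun n => ∫⁻ x : T3, g n (t, x) ^ s) atTop (𝓝 (∫⁻ _ : T3, 0)) := by
      refine tendsto_lintegral_of_dominated_convergence' _ ht
        (fun n => Eventually.of_forall fun x => ENNReal.rpow_le_rpow (hle n _) hs.le) hfin' ?_
      refine Eventually.of_forall fun x => ?_
      have := ((ENNReal.continuous_rpow_const (y := s)).tendsto 0).comp (hlim (t, x))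
      rwa [ENNReal.zero_rpow_of_pos hs] at this
    rw [lintegral_zero] at h1
    have := ((ENNReal.continuous_rpow_const (y := r / s)).tendsto 0).comp h1
    rwa [ENNReal.zero_rpow_of_pos hrs] at this

/-- Three functions lie in mixed Lebesgue spaces with Hölder conjugate exponents. -/
def Tri (F : Fin 3 → ST → ℝ) : Prop := ∃ r s : Fin 3 → ℝ, (∀ i, 0 < r i) ∧ (∀ i, 0 < s i) ∧
  ∑ i, (r i)⁻¹ = 1 ∧ ∑ i, (s i)⁻¹ = 1 ∧
  ∀ i, Integrable (F i) ∧ mixI (r i) (s i) (fun z => ‖F i z‖ₑ) ≠ ⊤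

lemma aesm_shift_prod {F : Fin 3 → ST → ℝ} (hF : ∀ i, AEStronglyMeasurable (F i))
    (w : Fin 3 → ST) : AEStronglyMeasurable fun z => ∏ i, F i (z + w i) :=
  Finset.aestronglyMeasurable_fun_prod _ fun i _ => aesm_shift (hF i) _

/-- Mixed norms are translation invariant, so Hölder's bound is uniform in three independent shifts.
-/
lemma Tri.exists_bound {F : Fin 3 → ST → ℝ} (h : Tri F) :
    ∃ K : ℝ≥0∞, K ≠ ⊤ ∧ ∀ w : Fin 3 → ST, ∫⁻ z, ∏ i, ‖F i (z + w i)‖ₑ ≤ K := by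
  obtain ⟨r, s, hr, hs, hr1, hs1, hF⟩ := h
  refine ⟨∏ i, mixI (r i) (s i) (fun z => ‖F i z‖ₑ) ^ (r i)⁻¹, ?_, fun w => ?_⟩
  · exact ENNReal.prod_ne_top fun i _ => ENNReal.rpow_ne_top_of_nonneg
      (inv_nonneg.2 (hr i).le) (hF i).2
  · refine (lintegral_prod_le_mixI (fun i => (aesm_shift (hF i).1.1 (w i)).enorm)
      hr hs hr1 hs1).trans (le_of_eq ?_)
    refine Finset.prod_congr rfl fun i _ => ?_
    rw [mixI_shift _ _ (fun z => ‖F i z‖ₑ)]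

lemma Tri.aesm {F : Fin 3 → ST → ℝ} (h : Tri F) (i : Fin 3) : AEStronglyMeasurable (F i) := by
  obtain ⟨r, s, hr, hs, hr1, hs1, hF⟩ := h
  exact (hF i).1.1

lemma Tri.integrable_shift_prod {F : Fin 3 → ST → ℝ} (h : Tri F) (w : Fin 3 → ST) :
    Integrable fun z => ∏ i, F i (z + w i) := by
  obtain ⟨K, hK, hb⟩ := h.exists_bound
  refine ⟨aesm_shift_prod h.aesm w, ?_⟩
  unfold HasFiniteIntegral
  have hp : ∀ z, ‖∏ i, F i (z + w i)‖ₑ = ∏ i, ‖F i (z + w i)‖ₑ := fun z => by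
    simp [Fin.prod_univ_three, enorm_mul]
  simp_rw [hp]
  exact (hb w).trans_lt hK.lt_top

lemma integrable_bdd_mul {ψ f : ST → ℝ} (hψ : Continuous ψ) {C : ℝ} (hC : ∀ z, |ψ z| ≤ C)
    (hf : Integrable f) : Integrable fun z => ψ z * f z :=
  hf.bdd_mul (c := C) hψ.aestronglyMeasurable (Eventually.of_forall hC)

/-- Continuity of the trilinear form in the shifts, for bounded functions. -/
lemma continuous_shift_prod_of_bdd {F : Fin 3 → ST → ℝ} (hF : ∀ i, Integrable (F i)) {N : ℝ}
    (hN0 : 0 ≤ N) (hN : ∀ i z, |F i z| ≤ N) {ψ : ST → ℝ} (hψ : Continuous ψ) {C : ℝ} (hC0 : 0 ≤ C)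
    (hC : ∀ z, |ψ z| ≤ C) :
    Continuous fun w : Fin 3 → ST => ∫ z, ψ z * ∏ i, F i (z + w i) := by
  have hint : ∀ w : Fin 3 → ST, Integrable fun z => ψ z * ∏ i, F i (z + w i) := by
    intro w
    refine integrable_bdd_mul hψ hC ?_
    simp_rw [Fin.prod_univ_three]
    have hb : ∀ i, ∀ᵐ z, ‖F i (z + w i)‖ ≤ N := fun i => Eventually.of_forall fun z => hN i _
    exact (((integrable_shift (hF 0) (w 0)).mul_bdd (c := N) (integrable_shift (hF 1) (w 1)).1
      (hb 1))).mul_bdd (c := N) (integrable_shift (hF 2) (w 2)).1 (hb 2)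
  rw [continuous_iff_continuousAt]
  intro w₀
  have hd : ∀ (w : Fin 3 → ST) i, Integrable fun z => |F i (z + w i) - F i (z + w₀ i)| :=
    fun w i => ((integrable_shift (hF i) (w i)).sub (integrable_shift (hF i) (w₀ i))).abs
  rw [ContinuousAt, tendsto_iff_norm_sub_tendsto_zero]
  have hlim : Tendsto (fun w : Fin 3 → ST => C * N ^ 2 *
      ∑ i, ∫ z, |F i (z + w i) - F i (z + w₀ i)|) (𝓝 w₀) (𝓝 0) := by
    have h1 : ∀ i : Fin 3, Tendsto (fun w : Fin 3 → ST => ∫ z, |F i (z + w i) - F i (z + w₀ i)|)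
        (𝓝 w₀) (𝓝 0) := fun i =>
      (tendsto_integral_shift_sub (hF i) (w₀ i)).comp ((continuous_apply i).tendsto w₀)
    have := (tendsto_finsetSum Finset.univ fun i _ => h1 i).const_mul (C * N ^ 2)
    simpa using this
  refine squeeze_zero (fun _ => norm_nonneg _) (fun w => ?_) hlim
  rw [← integral_sub (hint w) (hint w₀), ← integral_finsetSum _ fun i _ => hd w i,
    ← integral_const_mul]
  refine norm_integral_le_of_norm_le ((integrable_finsetSum _ fun i _ => hd w i).const_mul _)
    (Eventually.of_forall fun z => ?_)
  rw [← mul_sub, norm_mul, mul_assoc]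
  refine mul_le_mul (hC z) ?_ (norm_nonneg _) hC0
  simp only [Fin.prod_univ_three, Fin.sum_univ_three, Real.norm_eq_abs]
  set a0 := F 0 (z + w 0)
  set a1 := F 1 (z + w 1)
  set a2 := F 2 (z + w 2)
  set b0 := F 0 (z + w₀ 0)
  set b1 := F 1 (z + w₀ 1)
  set b2 := F 2 (z + w₀ 2)
  have e : a0 * a1 * a2 - b0 * b1 * b2 = (a0 - b0) * (a1 * a2) + (a1 - b1) * (b0 * a2) +
    (a2 - b2) * (b0 * b1) := by ring
  have hb : ∀ x y d : ℝ, |x| ≤ N → |y| ≤ N → |d * (x * y)| ≤ N ^ 2 * |d| := by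
    intro x y d hx hy
    rw [abs_mul, abs_mul, mul_comm, sq]
    exact mul_le_mul_of_nonneg_right (mul_le_mul hx hy (abs_nonneg _) hN0) (abs_nonneg _)
  rw [e]
  refine (abs_add_three _ _ _).trans ?_
  have h1 := hb a1 a2 (a0 - b0) (hN _ _) (hN _ _)
  have h2 := hb b0 a2 (a1 - b1) (hN _ _) (hN _ _)
  have h3 := hb b0 b1 (a2 - b2) (hN _ _) (hN _ _)
  linarith

/-- Truncation at height `N`. -/
def trunc (N : ℕ) (f : ST → ℝ) (z : ST) : ℝ := if |f z| ≤ N then f z else 0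

lemma aesm_trunc {f : ST → ℝ} (hf : AEStronglyMeasurable f) (N : ℕ) :
    AEStronglyMeasurable (trunc N f) := by
  have hm : Measurable fun x : ℝ => if |x| ≤ N then x else 0 :=
    Measurable.ite (measurableSet_le measurable_norm measurable_const) measurable_id
      measurable_const
  exact (hm.comp_aemeasurable hf.aemeasurable).aestronglyMeasurable

lemma abs_trunc_le (N : ℕ) (f : ST → ℝ) (z : ST) : |trunc N f z| ≤ |f z| := by
  unfold trunc; split_ifs <;> simp

lemma abs_trunc_le_nat (N : ℕ) (f : ST → ℝ) (z : ST) : |trunc N f z| ≤ N := by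
  unfold trunc; split_ifs with h
  · exact h
  · simp

lemma integrable_trunc {f : ST → ℝ} (hf : Integrable f) (N : ℕ) : Integrable (trunc N f) :=
  hf.mono (aesm_trunc hf.1 N) (Eventually.of_forall fun z => abs_trunc_le N f z)

/-- Continuity of the trilinear form in the shifts. -/
lemma Tri.continuous {F : Fin 3 → ST → ℝ} (h : Tri F) {ψ : ST → ℝ} (hψ : Continuous ψ) {C : ℝ}
    (hC0 : 0 ≤ C) (hC : ∀ z, |ψ z| ≤ C) :
    Continuous fun w : Fin 3 → ST => ∫ z, ψ z * ∏ i, F i (z + w i) := by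
  have h' := h
  obtain ⟨r, s, hr, hs, hr1, hs1, hF⟩ := h
  -- The i-th tail replaces the i-th factor by the part removed in the truncation and keeps the
  -- other two factors in full.
  set tail : ℕ → Fin 3 → Fin 3 → ST → ℝ≥0∞ := fun N i j z =>
    if j = i then ‖F j z - trunc N (F j) z‖ₑ else ‖F j z‖ₑ with htail
  have hdm : ∀ N i, AEMeasurable fun z => ‖F i z - trunc N (F i) z‖ₑ := fun N i =>
    ((hF i).1.1.sub (aesm_trunc (hF i).1.1 N)).enorm
  have htm : ∀ N i j, AEMeasurable (tail N i j) := by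
    intro N i j
    simp only [htail]
    split_ifs
    · exact hdm N j
    · exact (hF j).1.1.enorm
  set R : ℕ → ℝ≥0∞ := fun N => ∑ i, ∏ j, mixI (r j) (s j) (tail N i j) ^ (r j)⁻¹ with hR
  have hRlim : Tendsto R atTop (𝓝 0) := by
    have : Tendsto R atTop (𝓝 (∑ i : Fin 3, 0)) := by
      refine tendsto_finsetSum _ fun i _ => ?_
      have e : ∀ N, ∏ j, mixI (r j) (s j) (tail N i j) ^ (r j)⁻¹ =
          (∏ j ∈ Finset.univ.erase i, mixI (r j) (s j) (fun z => ‖F j z‖ₑ) ^ (r j)⁻¹) *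
          mixI (r i) (s i) (fun z => ‖F i z - trunc N (F i) z‖ₑ) ^ (r i)⁻¹ := by
        intro N
        rw [← Finset.mul_prod_erase _ _ (Finset.mem_univ i), mul_comm]
        congr 1
        · refine Finset.prod_congr rfl fun j hj => ?_
          simp only [htail, if_neg (Finset.ne_of_mem_erase hj)]
        · simp only [htail, if_true]
      simp_rw [e]
      have h1 : Tendsto (fun N => mixI (r i) (s i) (fun z => ‖F i z - trunc N (F i) z‖ₑ))
          atTop (𝓝 0) := by
        refine tendsto_mixI_zero (hr i) (hs i) (hF i).1.1.enorm (hdm · i) (hF i).2 ?_ ?_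
        · intro N z
          unfold trunc
          split_ifs <;> simp
        · intro z
          refine tendsto_const_nhds.congr' ?_
          obtain ⟨n, hn⟩ := exists_nat_ge |F i z|
          filter_upwards [eventually_ge_atTop n] with N hN
          have : |F i z| ≤ N := hn.trans (by exact_mod_cast hN)
          simp [trunc, this]
      have h2 := ((ENNReal.continuous_rpow_const (y := (r i)⁻¹)).tendsto 0).comp h1
      rw [ENNReal.zero_rpow_of_pos (inv_pos.2 (hr i))] at h2
      have h3 := ENNReal.Tendsto.const_mul (a := ∏ j ∈ Finset.univ.erase i,
        mixI (r j) (s j) (fun z => ‖F j z‖ₑ) ^ (r j)⁻¹) h2 (Or.inr (ENNReal.prod_ne_top fun j _ =>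
          ENNReal.rpow_ne_top_of_nonneg (inv_nonneg.2 (hr j).le) (hF j).2))
      rw [mul_zero] at h3
      exact h3
    simpa using this
  -- If no factor exceeds N the truncated product is unchanged. Otherwise some truncated factor is
  -- zero, so the difference is the full product, which is the tail of that index. No telescoping is
  -- needed.
  have hpt : ∀ N (w : Fin 3 → ST) z, ‖∏ i, F i (z + w i) - ∏ i, trunc N (F i) (z + w i)‖ₑ ≤
      ∑ i, ∏ j, tail N i j (z + w j) := by
    intro N w z
    by_cases hall : ∀ i, |F i (z + w i)| ≤ N
    · have : ∀ i, trunc N (F i) (z + w i) = F i (z + w i) := fun i => by simp [trunc, hall i]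
      simp [this]
    · push Not at hall
      obtain ⟨i, hi⟩ := hall
      have h0 : trunc N (F i) (z + w i) = 0 := by simp [trunc, hi]
      rw [Finset.prod_eq_zero (f := fun i => trunc N (F i) (z + w i))
        (Finset.mem_univ i) h0, sub_zero]
      refine le_trans (le_of_eq ?_) (Finset.single_le_sum (f := fun i => ∏ j, tail N i j (z + w j))
        (fun _ _ => zero_le) (Finset.mem_univ i))
      have : ∀ j, tail N i j (z + w j) = ‖F j (z + w j)‖ₑ := by
        intro j
        simp only [htail]
        split_ifs with hj
        · subst hj; rw [h0, sub_zero]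
        · rfl
      simp [this, Fin.prod_univ_three, enorm_mul]
  have hunif : ∀ N (w : Fin 3 → ST),
      ∫⁻ z, ‖∏ i, F i (z + w i) - ∏ i, trunc N (F i) (z + w i)‖ₑ ≤ R N := by
    intro N w
    refine (lintegral_mono (hpt N w)).trans ?_
    have hsm : ∀ i j, AEMeasurable fun z => tail N i j (z + w j) := fun i j =>
      (htm N i j).comp_quasiMeasurePreserving
        (measurePreserving_add_right volume (w j)).quasiMeasurePreserving
    rw [lintegral_finsetSum' _ fun i _ => Finset.aemeasurable_fun_prod _ fun j _ => hsm i j]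
    refine Finset.sum_le_sum fun i _ => ?_
    refine (lintegral_prod_le_mixI (hsm i) hr hs hr1 hs1).trans (le_of_eq ?_)
    refine Finset.prod_congr rfl fun j _ => ?_
    rw [mixI_shift _ _ (tail N i j)]
  have hcN : ∀ N : ℕ, Continuous fun w : Fin 3 → ST =>
      ∫ z, ψ z * ∏ i, trunc N (F i) (z + w i) := fun N =>
    continuous_shift_prod_of_bdd (fun i => integrable_trunc (hF i).1 N) (Nat.cast_nonneg N)
      (fun i z => abs_trunc_le_nat N (F i) z) hψ hC0 hC
  -- The tails tend to zero uniformly in the shifts, so the form is a uniform limit of the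
  -- continuous forms of bounded functions.
  refine TendstoUniformly.continuous (p := atTop)
    (F := fun N (w : Fin 3 → ST) => ∫ z, ψ z * ∏ i, trunc N (F i) (z + w i)) ?_
    (Eventually.of_forall hcN).frequently
  rw [Metric.tendstoUniformly_iff]
  intro ε hε
  have hlim2 : Tendsto (fun N => C * (R N).toReal) atTop (𝓝 0) := by
    have := ((ENNReal.tendsto_toReal ENNReal.zero_ne_top).comp hRlim).const_mul C
    simpa using this
  filter_upwards [hlim2.eventually_lt_const hε, hRlim.eventually_lt_const ENNReal.zero_lt_top]
    with N hN hRN w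
  refine lt_of_le_of_lt ?_ hN
  have hPi := h'.integrable_shift_prod w
  have hdiff : Integrable fun z => ∏ i, F i (z + w i) - ∏ i, trunc N (F i) (z + w i) := by
    refine ⟨hPi.1.sub (aesm_shift_prod (fun i => aesm_trunc (hF i).1.1 N) w), ?_⟩
    exact (hunif N w).trans_lt hRN
  have hPN : Integrable fun z => ∏ i, trunc N (F i) (z + w i) := by
    have := hPi.sub hdiff
    simpa [Pi.sub_def] using this
  rw [dist_eq_norm, ← integral_sub (integrable_bdd_mul hψ hC hPi) (integrable_bdd_mul hψ hC hPN)]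
  have hle : ‖∫ z, (ψ z * ∏ i, F i (z + w i) - ψ z * ∏ i, trunc N (F i) (z + w i))‖ ≤
      ∫ z, C * ‖∏ i, F i (z + w i) - ∏ i, trunc N (F i) (z + w i)‖ := by
    refine norm_integral_le_of_norm_le (hdiff.norm.const_mul C) (Eventually.of_forall fun z => ?_)
    rw [← mul_sub, norm_mul]
    exact mul_le_mul_of_nonneg_right (hC z) (norm_nonneg _)
  refine hle.trans ?_
  rw [integral_const_mul]
  refine mul_le_mul_of_nonneg_left ?_ hC0
  rw [integral_norm_eq_lintegral_enorm hdiff.1]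
  exact ENNReal.toReal_mono hRN.ne (hunif N w)

end

/-! ### Hölder triples and the continuity of correlations -/

section

/-- Integrable functions of a mixed Lebesgue space. -/
def Mix (r s : ℝ) (f : ST → ℝ) : Prop := Integrable f ∧ mixI r s (fun z => ‖f z‖ₑ) ≠ ⊤

lemma Tri.of {r₀ r₁ r₂ s₀ s₁ s₂ : ℝ} {f g h : ST → ℝ} (hf : Mix r₀ s₀ f) (hg : Mix r₁ s₁ g)
    (hh : Mix r₂ s₂ h) (hr₀ : 0 < r₀) (hr₁ : 0 < r₁) (hr₂ : 0 < r₂) (hs₀ : 0 < s₀) (hs₁ : 0 < s₁)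
    (hs₂ : 0 < s₂) (hr : r₀⁻¹ + r₁⁻¹ + r₂⁻¹ = 1) (hs : s₀⁻¹ + s₁⁻¹ + s₂⁻¹ = 1) :
    Tri ![f, g, h] := by
  refine ⟨![r₀, r₁, r₂], ![s₀, s₁, s₂], ?_, ?_, ?_, ?_, ?_⟩
  · intro i; fin_cases i <;> assumption
  · intro i; fin_cases i <;> assumption
  · simpa [Fin.sum_univ_three] using hr
  · simpa [Fin.sum_univ_three] using hs
  · intro i; fin_cases i <;> assumption

/-- The indicator function of `(0,T) × 𝕋³`. -/
def slab (T : ℝ) : ST → ℝ := ext T fun _ _ => 1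

/-- The indicator lies in every mixed space, so it can serve as a third factor with whatever
exponents complete a Hölder triple; bilinear pairings are thereby special cases of trilinear ones.
-/
lemma mix_slab (T : ℝ) {r s : ℝ} (hr : 0 < r) (hs : 0 < s) : Mix r s (slab T) := by
  constructor
  · rw [slab, integrable_ext_iff, stMeasure]
    exact integrable_const _
  · have h : ∀ t : ℝ, ∀ x : T3, ‖slab T (t, x)‖ₑ ^ s = (Ioo 0 T).indicator 1 t := by
      intro t x
      by_cases ht : t ∈ Ioo 0 T
      · rw [slab, ext_of_mem (by exact ht), indicator_of_mem ht]; simp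
      · rw [slab, ext_of_notMem (by exact ht), indicator_of_notMem ht]; simp [hs]
    have h2 : ∀ t : ℝ, ((Ioo 0 T).indicator (1 : ℝ → ℝ≥0∞) t) ^ (r / s) =
        (Ioo 0 T).indicator 1 t := by
      intro t
      by_cases ht : t ∈ Ioo 0 T
      · simp [indicator_of_mem ht]
      · simp [indicator_of_notMem ht, div_pos hr hs]
    unfold mixI
    simp_rw [h, lintegral_const, measure_univ, mul_one, h2]
    rw [lintegral_indicator_one measurableSet_Ioo]
    simp

lemma IsTest.mul_slab {T : ℝ} {ψ : ST → ℝ} (hψ : IsTest T ψ) (z : ST) : ψ z * slab T z = ψ z := by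
  by_cases hz : z.1 ∈ Ioo 0 T
  · rw [slab, ext_of_mem hz, mul_one]
  · rw [hψ.eq_zero hz, zero_mul]

section Pairs

variable {T : ℝ} {f g h ψ : ST → ℝ}

lemma continuous_stHom : Continuous stHom := isCovering_stHom.continuous

lemma Tri.continuous_comp {F : Fin 3 → ST → ℝ} (hF : Tri F) (hψ : IsTest T ψ)
    {w : STE → Fin 3 → ST} (hw : Continuous w) :
    Continuous fun y : STE => ∫ z, ψ z * ∏ i, F i (z + w y i) := by
  obtain ⟨C, hC0, hC⟩ := hψ.bound
  exact (hF.continuous hψ.continuous hC0 hC).comp hw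

lemma Tri.integrable_prod (hF : Tri ![f, g, h]) : Integrable fun z => f z * (g z * h z) := by
  have := hF.integrable_shift_prod 0
  simp only [Fin.prod_univ_three, Pi.zero_apply, add_zero, Matrix.cons_val_zero,
    Matrix.cons_val_one, Matrix.cons_val] at this
  simpa only [mul_assoc] using this

/-- A shift pattern gives a continuous function of the shift. -/
lemma Tri.continuous_pattern (hF : Tri ![f, g, h]) (hψ : IsTest T ψ) (c₀ c₁ c₂ : Bool) :
    Continuous fun y : STE => ∫ z, ψ z * (f (z + if c₀ then stHom y else 0) *
      (g (z + if c₁ then stHom y else 0) * h (z + if c₂ then stHom y else 0))) := by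
  have hc : ∀ c : Bool, Continuous fun y : STE => if c then stHom y else 0 := by
    intro c
    cases c
    · exact continuous_const
    · exact continuous_stHom
  have := hF.continuous_comp hψ (w := fun y => ![if c₀ then stHom y else 0,
    if c₁ then stHom y else 0, if c₂ then stHom y else 0]) (by
      refine continuous_pi fun i => ?_
      fin_cases i
      · exact hc c₀
      · exact hc c₁
      · exact hc c₂)
  simpa only [Fin.prod_univ_three, Matrix.cons_val_zero, Matrix.cons_val_one, Matrix.cons_val,
    mul_assoc] using this

/-- Each of the seven correlations is the same trilinear form with a different subset of factors
shifted; the Booleans in `key` record that subset. Continuity in the separation is continuity of the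
trilinear form in its shifts. -/
lemma TriPairs.of_tri (hF : Tri ![f, g, h]) (hf : Integrable f) (hg : Integrable g)
    (hh : Integrable h) (hfg : Integrable fun z => f z * g z) (hfh : Integrable fun z => f z * h z)
    (hgh : Integrable fun z => g z * h z) : TriPairs T f g h := by
  have hl : ∀ {k : ST → ℝ}, Integrable k → ∀ ψ, IsTest T ψ → Integrable fun p => ψ p * k p :=
    fun hk ψ hψ => hψ.integrable_mul hk
  have key : ∀ ψ, IsTest T ψ → ∀ c₀ c₁ c₂ : Bool, ∀ {a b : ST → ℝ},
      (∀ y z, ψ z * (f (z + if c₀ then stHom y else 0) *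
      (g (z + if c₁ then stHom y else 0) * h (z + if c₂ then stHom y else 0))) =
      a z * b (z + stHom y)) → Continuous fun y : STE => corr a b (stHom y) := by
    intro ψ hψ c₀ c₁ c₂ a b hab
    have := hF.continuous_pattern hψ c₀ c₁ c₂
    unfold corr
    refine this.congr fun y => ?_
    simp_rw [hab]
  have hi : ∀ ψ, IsTest T ψ → ∀ {a b : ST → ℝ},
      (∀ z, ψ z * (f z * (g z * h z)) = a z * b z) → Integrable fun z => a z * b z := by
    intro ψ hψ a b hab
    simpa only [hab] using hψ.integrable_mul hF.integrable_prod
  constructor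
  · exact fun ψ hψ => ⟨hψ.integrable, hF.integrable_prod, hi ψ hψ fun z => by ring,
      key ψ hψ true true true fun y z => by
      simp⟩
  · exact fun ψ hψ => ⟨hl hh ψ hψ, hfg, hi ψ hψ fun z => by ring,
      key ψ hψ true true false fun y z => by simp; ring⟩
  · exact fun ψ hψ => ⟨hl hg ψ hψ, hfh, hi ψ hψ fun z => by ring,
      key ψ hψ true false true fun y z => by simp; ring⟩
  · exact fun ψ hψ => ⟨hl hgh ψ hψ, hf, hi ψ hψ fun z => by ring,
      key ψ hψ true false false fun y z => by simp; ring⟩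
  · exact fun ψ hψ => ⟨hl hf ψ hψ, hgh, hi ψ hψ fun z => by ring,
      key ψ hψ false true true fun y z => by simp; ring⟩
  · exact fun ψ hψ => ⟨hl hfh ψ hψ, hg, hi ψ hψ fun z => by ring,
      key ψ hψ false true false fun y z => by simp; ring⟩
  · exact fun ψ hψ => ⟨hl hfg ψ hψ, hh, hi ψ hψ fun z => by ring,
      key ψ hψ false false true fun y z => by simp; ring⟩

lemma CorrPair.of_tri (hF : Tri ![f, g, slab T]) (hf : Integrable f) (hg : Integrable g)
    (hψ : IsTest T ψ) : CorrPair (fun p => ψ p * f p) g := by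
  refine ⟨hψ.integrable_mul hf, hg, ?_, ?_⟩
  · refine (hψ.integrable_mul hF.integrable_prod).congr (Eventually.of_forall fun z => ?_)
    linear_combination (f z * g z) * hψ.mul_slab z
  have := hF.continuous_pattern hψ false true false
  unfold corr
  refine this.congr fun y => integral_congr_ae (Eventually.of_forall fun z => ?_)
  simp only [Bool.false_eq_true, if_false, if_true, add_zero]
  linear_combination (f z * g (z + stHom y)) * hψ.mul_slab z

/-- A correlation with a product of two functions. -/
lemma CorrPair.of_tri_left (hF : Tri ![f, g, h]) (hfg : Integrable fun z => f z * g z)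
    (hh : Integrable h) (hψ : IsTest T ψ) : CorrPair (fun p => ψ p * (f p * g p)) h := by
  refine ⟨hψ.integrable_mul hfg, hh, (hψ.integrable_mul hF.integrable_prod).congr
    (Eventually.of_forall fun z => by ring), ?_⟩
  have := hF.continuous_pattern hψ false false true
  unfold corr
  refine this.congr fun y => integral_congr_ae (Eventually.of_forall fun z => ?_)
  simp
  ring

lemma CorrPair.of_tri_right (hF : Tri ![f, g, h]) (hgh : Integrable fun z => g z * h z)
    (hf : Integrable f) (hψ : IsTest T ψ) : CorrPair (fun p => ψ p * f p) fun p => g p * h p := by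
  refine ⟨hψ.integrable_mul hf, hgh, (hψ.integrable_mul hF.integrable_prod).congr
    (Eventually.of_forall fun z => by ring), ?_⟩
  have := hF.continuous_pattern hψ false true true
  unfold corr
  refine this.congr fun y => integral_congr_ae (Eventually.of_forall fun z => ?_)
  simp
  ring

lemma Tri.integrable_pair (hF : Tri ![f, g, slab T]) (hf0 : ∀ z : ST, z.1 ∉ Ioo 0 T → f z = 0) :
    Integrable fun z => f z * g z := by
  refine hF.integrable_prod.congr (Eventually.of_forall fun z => ?_)
  by_cases hz : z.1 ∈ Ioo 0 T
  · simp only [slab, ext_of_mem hz, mul_one]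
  · simp only [hf0 z hz, zero_mul]

/-- The trilinear increment and its expansion into correlations. -/
lemma trilin_corr (hF : Tri ![f, g, h]) (hψ : IsTest T ψ) (w : ST) :
    trilin (fun a b => corr a b w) ψ f g h = (∫ z, ψ z * ((f (z + w) - f z) *
      ((g (z + w) - g z) * (h (z + w) - h z)))) + ∫ z, ψ z * (f z * (g z * h z)) := by
  obtain ⟨C, hC0, hC⟩ := hψ.bound
  have hi : ∀ w₀ w₁ w₂ : ST, Integrable fun z => ψ z * (f (z + w₀) * (g (z + w₁) * h (z + w₂))) := by
    intro w₀ w₁ w₂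
    have := integrable_bdd_mul hψ.continuous hC (hF.integrable_shift_prod ![w₀, w₁, w₂])
    simpa only [Fin.prod_univ_three, Matrix.cons_val_zero, Matrix.cons_val_one, Matrix.cons_val,
      mul_assoc] using this
  have i1 := hi w w w
  have i2 := hi w w 0
  have i3 := hi w 0 w
  have i4 := hi w 0 0
  have i5 := hi 0 w w
  have i6 := hi 0 w 0
  have i7 := hi 0 0 w
  have i8 := hi 0 0 0
  simp only [add_zero] at i1 i2 i3 i4 i5 i6 i7 i8
  -- The term of the expansion with no shifted factor has no counterpart in `trilin`; it is the
  -- integral added on the right-hand side, constant in the shift.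
  have e : ∀ z, ψ z * ((f (z + w) - f z) * ((g (z + w) - g z) * (h (z + w) - h z))) =
      ((((((ψ z * (f (z + w) * (g (z + w) * h (z + w))) - ψ z * (f (z + w) * (g (z + w) * h z))) -
      ψ z * (f (z + w) * (g z * h (z + w)))) + ψ z * (f (z + w) * (g z * h z))) -
      ψ z * (f z * (g (z + w) * h (z + w)))) + ψ z * (f z * (g (z + w) * h z))) +
      ψ z * (f z * (g z * h (z + w)))) - ψ z * (f z * (g z * h z)) := by
    intro z; ring
  simp_rw [e]
  have s2 := i1.sub i2
  have s3 := s2.sub i3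
  have s4 := s3.add i4
  have s5 := s4.sub i5
  have s6 := s5.add i6
  have s7 := s6.add i7
  have e8 := integral_sub s7 i8
  have e7 := integral_add s6 i7
  have e6 := integral_add s5 i6
  have e5 := integral_sub s4 i5
  have e4 := integral_add s3 i4
  have e3 := integral_sub s2 i3
  have e2 := integral_sub i1 i2
  simp only [Pi.add_apply, Pi.sub_apply] at e2 e3 e4 e5 e6 e7 e8
  rw [e8, e7, e6, e5, e4, e3, e2]
  simp only [trilin, corr]
  have r : ∀ {a b : ST → ℝ}, (∀ z, a z = b z) → ∫ z, a z = ∫ z, b z := fun h =>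
    integral_congr_ae (Eventually.of_forall h)
  rw [r (a := fun z => ψ z * h z * (f (z + w) * g (z + w)))
      (b := fun z => ψ z * (f (z + w) * (g (z + w) * h z))) fun z => by ring,
    r (a := fun z => ψ z * g z * (f (z + w) * h (z + w)))
      (b := fun z => ψ z * (f (z + w) * (g z * h (z + w)))) fun z => by ring,
    r (a := fun z => ψ z * (g z * h z) * f (z + w))
      (b := fun z => ψ z * (f (z + w) * (g z * h z))) fun z => by ring,
    r (a := fun z => ψ z * f z * (g (z + w) * h (z + w)))
      (b := fun z => ψ z * (f z * (g (z + w) * h (z + w)))) fun z => by ring,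
    r (a := fun z => ψ z * (f z * h z) * g (z + w))
      (b := fun z => ψ z * (f z * (g (z + w) * h z))) fun z => by ring,
    r (a := fun z => ψ z * (f z * g z) * h (z + w))
      (b := fun z => ψ z * (f z * (g z * h (z + w)))) fun z => by ring]
  ring

/-- Products of increments are bounded in `L¹`, uniformly in the shift. -/
lemma Tri.exists_bound_incr {F : Fin 3 → ST → ℝ} (hF : Tri F) :
    ∃ K : ℝ≥0∞, K ≠ ⊤ ∧ ∀ w : ST, ∫⁻ z, ∏ i, ‖F i (z + w) - F i z‖ₑ ≤ K := by
  obtain ⟨K, hK, hb⟩ := hF.exists_bound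
  -- One copy of the bound for each subset of shifted factors in the expansion of the product.
  refine ⟨∑ _s ∈ (Finset.univ : Finset (Fin 3)).powerset, K, ?_, fun w => ?_⟩
  · simp [ENNReal.mul_eq_top, hK]
  have h1 : ∀ z, ∏ i, ‖F i (z + w) - F i z‖ₑ ≤ ∑ s ∈ (Finset.univ : Finset (Fin 3)).powerset,
      ∏ i, ‖F i (z + if i ∈ s then w else 0)‖ₑ := by
    intro z
    refine (Finset.prod_le_prod' fun i _ => enorm_sub_le).trans (le_of_eq ?_)
    rw [Finset.prod_add]
    refine Finset.sum_congr rfl fun s _ => ?_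
    rw [← Finset.prod_sdiff (Finset.subset_univ s), mul_comm]
    congr 1
    · refine Finset.prod_congr rfl fun i hi => ?_
      rw [if_neg (Finset.mem_sdiff.1 hi).2, add_zero]
    · refine Finset.prod_congr rfl fun i hi => ?_
      rw [if_pos hi]
  refine (lintegral_mono h1).trans ?_
  rw [lintegral_finsetSum' _ fun s _ => Finset.aemeasurable_fun_prod _ fun i _ =>
    (aesm_shift (hF.aesm i) _).enorm]
  exact Finset.sum_le_sum fun s _ => hb fun i => if i ∈ s then w else 0

end Pairs

end

section

/-! ### Trigonometric polynomials and their heat flow -/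

lemma sd_add {f g : ST → ℝ} (hf : SmoothST f) (hg : SmoothST g) (α : Option (Fin 3)) (z : ST) :
    sd α (fun z => f z + g z) z = sd α f z + sd α g z := by
  unfold sd
  rw [fderiv_fun_add ((hf.shift z).differentiable (by simp) 0)
    ((hg.shift z).differentiable (by simp) 0)]
  rfl

lemma sd_const_mul (c : ℝ) {f : ST → ℝ} (hf : SmoothST f) (α : Option (Fin 3)) (z : ST) :
    sd α (fun z => c * f z) z = c * sd α f z := by
  unfold sd
  rw [fderiv_const_mul ((hf.shift z).differentiable (by simp) 0)]
  rfl

lemma smoothST_const (c : ℝ) : SmoothST fun _ => c := contDiff_const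

lemma SmoothST.add {f g : ST → ℝ} (hf : SmoothST f) (hg : SmoothST g) :
    SmoothST (fun z => f z + g z) := ContDiff.add hf hg

lemma SmoothST.const_mul {f : ST → ℝ} (hf : SmoothST f) (c : ℝ) :
    SmoothST (fun z => c * f z) := (smoothST_const c).mul hf

/-- The decay rate of a Fourier mode under the heat flow. -/
def lam (k : Fin 3 → ℤ) : ℝ := ∑ i, (2 * Real.pi * k i) ^ 2

/-- The heat flow of the plane wave `cos (2π k·x + φ)`. -/
def mode (k : Fin 3 → ℤ) (φ : ℝ) (z : ST) : ℝ :=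
  Real.exp (-lam k * z.1) *
    (Real.cos φ * (UnitAddTorus.mFourier k z.2).re - Real.sin φ * (UnitAddTorus.mFourier k z.2).im)

lemma mFourier_proj (k : Fin 3 → ℤ) (l : E3) :
    UnitAddTorus.mFourier k (proj l) = Complex.exp ((∑ i, 2 * Real.pi * k i * l i : ℝ) * Complex.I) := by
  simp only [UnitAddTorus.mFourier, proj, ContinuousMap.coe_mk, fourier_coe_apply]
  rw [← Complex.exp_sum]
  congr 1
  push_cast
  rw [Finset.sum_mul]
  refine Finset.sum_congr rfl fun i _ => ?_
  ring

lemma mode_stHom (k : Fin 3 → ℤ) (φ : ℝ) (y : STE) :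
    mode k φ (stHom y) =
      Real.exp (-lam k * y.1) * Real.cos ((∑ i, 2 * Real.pi * k i * y.2 i) + φ) := by
  simp only [mode, stHom_apply, mFourier_proj, Complex.exp_ofReal_mul_I_re,
    Complex.exp_ofReal_mul_I_im, Real.cos_add]
  ring

lemma smooth_mode (k : Fin 3 → ℤ) (φ : ℝ) : SmoothST (mode k φ) := by
  unfold SmoothST
  simp_rw [mode_stHom]
  fun_prop

/-- A spatial derivative of a plane wave advances its phase by a quarter period. Keeping the phase
as a parameter makes the family of modes stable under differentiation and under translation. -/
lemma sd_mode (k : Fin 3 → ℤ) (φ : ℝ) (i : Fin 3) :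
    sd (some i) (mode k φ) = fun z => 2 * Real.pi * k i * mode k (φ + Real.pi / 2) z := by
  ext z
  obtain ⟨y, rfl⟩ := stHom_surjective z
  rw [sd_stHom]
  simp_rw [mode_stHom]
  have h1 : HasFDerivAt (fun y : STE => -lam k * y.1) (-lam k • ContinuousLinearMap.fst ℝ ℝ E3) y :=
    hasFDerivAt_fst.const_mul _
  have h2 : HasFDerivAt (fun y : STE => (∑ i, 2 * Real.pi * k i * y.2 i) + φ)
      (∑ i, (2 * Real.pi * k i) • (EuclideanSpace.proj (𝕜 := ℝ) i).comp
        (ContinuousLinearMap.snd ℝ ℝ E3)) y := by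
    refine HasFDerivAt.add_const _ (HasFDerivAt.fun_sum fun i _ => ?_)
    exact ((EuclideanSpace.proj (𝕜 := ℝ) i).comp
      (ContinuousLinearMap.snd ℝ ℝ E3)).hasFDerivAt.const_mul _
  have h3 : HasFDerivAt (fun y : STE => Real.exp (-lam k * y.1) *
    Real.cos ((∑ i, 2 * Real.pi * k i * y.2 i) + φ)) _ y := h1.exp.mul h2.cos
  rw [h3.fderiv, ← add_assoc, Real.cos_add_pi_div_two]
  simp [dir]
  ring

lemma sd_none_mode (k : Fin 3 → ℤ) (φ : ℝ) :
    sd none (mode k φ) = fun z => -lam k * mode k φ z := by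
  ext z
  obtain ⟨y, rfl⟩ := stHom_surjective z
  rw [sd_stHom]
  simp_rw [mode_stHom]
  have h1 : HasFDerivAt (fun y : STE => -lam k * y.1) (-lam k • ContinuousLinearMap.fst ℝ ℝ E3) y :=
    hasFDerivAt_fst.const_mul _
  have h2 : HasFDerivAt (fun y : STE => (∑ i, 2 * Real.pi * k i * y.2 i) + φ)
      (∑ i, (2 * Real.pi * k i) • (EuclideanSpace.proj (𝕜 := ℝ) i).comp
        (ContinuousLinearMap.snd ℝ ℝ E3)) y := by
    refine HasFDerivAt.add_const _ (HasFDerivAt.fun_sum fun i _ => ?_)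
    exact ((EuclideanSpace.proj (𝕜 := ℝ) i).comp
      (ContinuousLinearMap.snd ℝ ℝ E3)).hasFDerivAt.const_mul _
  have h3 : HasFDerivAt (fun y : STE => Real.exp (-lam k * y.1) *
    Real.cos ((∑ i, 2 * Real.pi * k i * y.2 i) + φ)) _ y := h1.exp.mul h2.cos
  rw [h3.fderiv]
  simp [dir]
  ring

lemma mode_add_pi (k : Fin 3 → ℤ) (φ : ℝ) (z : ST) : mode k (φ + Real.pi) z = - mode k φ z := by
  simp only [mode, Real.cos_add_pi, Real.sin_add_pi]
  ring

lemma mode_eq (k : Fin 3 → ℤ) (φ : ℝ) (z : ST) :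
    mode k φ z = Real.cos φ * mode k 0 z + Real.sin φ * mode k (Real.pi / 2) z := by
  simp only [mode, Real.cos_zero, Real.sin_zero, Real.cos_pi_div_two, Real.sin_pi_div_two]
  ring

lemma sd_sd_mode (k : Fin 3 → ℤ) (φ : ℝ) (i : Fin 3) :
    sd (some i) (sd (some i) (mode k φ)) = fun z => -(2 * Real.pi * k i) ^ 2 * mode k φ z := by
  ext z
  rw [sd_mode, sd_const_mul _ (smooth_mode _ _), sd_mode, add_assoc, add_halves]
  simp only [mode_add_pi]
  ring

/-- Heat flows of trigonometric polynomials. -/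
def Heat : Submodule ℝ (ST → ℝ) :=
  Submodule.span ℝ (range fun q : (Fin 3 → ℤ) × Bool => mode q.1 (if q.2 then Real.pi / 2 else 0))

lemma mode_mem (k : Fin 3 → ℤ) (φ : ℝ) : mode k φ ∈ Heat := by
  have h0 : mode k 0 ∈ Heat := Submodule.subset_span ⟨(k, false), rfl⟩
  have h1 : mode k (Real.pi / 2) ∈ Heat := Submodule.subset_span ⟨(k, true), rfl⟩
  have : mode k φ = Real.cos φ • mode k 0 + Real.sin φ • mode k (Real.pi / 2) := by
    ext z; exact mode_eq k φ z
  rw [this]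
  exact Heat.add_mem (Heat.smul_mem _ h0) (Heat.smul_mem _ h1)

lemma heat_induction {p : (ST → ℝ) → Prop} (hm : ∀ k φ, p (mode k φ)) (h0 : p fun _ => 0)
    (ha : ∀ f g, f ∈ Heat → g ∈ Heat → p f → p g → p fun z => f z + g z)
    (hs : ∀ (c : ℝ) f, f ∈ Heat → p f → p fun z => c * f z) {f : ST → ℝ} (hf : f ∈ Heat) : p f := by
  refine Submodule.span_induction (p := fun f _ => p f) ?_ h0 (fun f g hf hg => ha f g hf hg)
    (fun c f hf => hs c f hf) hf
  rintro _ ⟨q, rfl⟩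
  exact hm _ _

lemma heat_smooth {f : ST → ℝ} (hf : f ∈ Heat) : SmoothST f :=
  heat_induction (p := SmoothST) smooth_mode (smoothST_const 0) (fun _ _ _ _ h h' => h.add h')
    (fun c _ _ h => h.const_mul c) hf

lemma heat_sd {f : ST → ℝ} (hf : f ∈ Heat) (i : Fin 3) : sd (some i) f ∈ Heat := by
  refine heat_induction (p := fun f => sd (some i) f ∈ Heat) ?_ ?_ ?_ ?_ hf
  · intro k φ
    rw [sd_mode]
    exact Heat.smul_mem _ (mode_mem _ _)
  · convert Heat.zero_mem
    ext z; simp [sd]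
  · intro f g hf hg h1 h2
    convert Heat.add_mem h1 h2 using 1
    ext z
    exact sd_add (heat_smooth hf) (heat_smooth hg) _ z
  · intro c f hf h
    convert Heat.smul_mem c h using 1
    ext z
    exact sd_const_mul c (heat_smooth hf) _ z

/-- The Laplacian in space. -/
def lap (f : ST → ℝ) (z : ST) : ℝ := ∑ i, sd (some i) (sd (some i) f) z

lemma lap_add {f g : ST → ℝ} (hf : SmoothST f) (hg : SmoothST g) (z : ST) :
    lap (fun z => f z + g z) z = lap f z + lap g z := by
  unfold lap
  rw [← Finset.sum_add_distrib]
  refine Finset.sum_congr rfl fun i _ => ?_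
  rw [show sd (some i) (fun z => f z + g z) = fun z => sd (some i) f z + sd (some i) g z from
    funext fun z => sd_add hf hg _ z, sd_add (hf.sd _) (hg.sd _)]

lemma lap_const_mul (c : ℝ) {f : ST → ℝ} (hf : SmoothST f) (z : ST) :
    lap (fun z => c * f z) z = c * lap f z := by
  unfold lap
  rw [Finset.mul_sum]
  refine Finset.sum_congr rfl fun i _ => ?_
  rw [show sd (some i) (fun z => c * f z) = fun z => c * sd (some i) f z from
    funext fun z => sd_const_mul c hf _ z, sd_const_mul c (hf.sd _)]

lemma lap_zero (z : ST) : lap (fun _ => 0) z = 0 := by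
  have h : ∀ i : Fin 3, sd (some i) (fun _ : ST => (0 : ℝ)) = fun _ => 0 := by
    intro i; ext z; simp [sd]
  simp [lap, h]

lemma lap_mode (k : Fin 3 → ℤ) (φ : ℝ) (z : ST) : lap (mode k φ) z = -lam k * mode k φ z := by
  simp only [lap, sd_sd_mode, lam, ← Finset.sum_mul, Finset.sum_neg_distrib]

lemma heat_lap {f : ST → ℝ} (hf : f ∈ Heat) : lap f ∈ Heat := by
  have : lap f = ∑ i, sd (some i) (sd (some i) f) := by
    ext z; simp [lap]
  rw [this]
  exact Heat.sum_mem fun i _ => heat_sd (heat_sd hf i) i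

lemma heat_equation {f : ST → ℝ} (hf : f ∈ Heat) : ∀ z, sd none f z = lap f z := by
  refine heat_induction (p := fun f => ∀ z, sd none f z = lap f z) ?_ ?_ ?_ ?_ hf
  · intro k φ z
    rw [lap_mode, sd_none_mode]
  · intro z
    rw [lap_zero]
    simp [sd]
  · intro f g hf hg h1 h2 z
    rw [sd_add (heat_smooth hf) (heat_smooth hg), lap_add (heat_smooth hf) (heat_smooth hg), h1, h2]
  · intro c f hf h z
    rw [sd_const_mul c (heat_smooth hf), lap_const_mul c (heat_smooth hf), h]

lemma abs_mode_le (k : Fin 3 → ℤ) (φ : ℝ) (z : ST) : |mode k φ z| ≤ Real.exp (-lam k * z.1) := by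
  obtain ⟨y, rfl⟩ := stHom_surjective z
  rw [mode_stHom, abs_mul, Real.abs_exp]
  exact mul_le_of_le_one_right (Real.exp_pos _).le (Real.abs_cos_le_one _)

/-- The spectral gap on mean-zero functions. It provides the decay rate e^{-t} of derivatives along
the heat flow and the invertibility of the Laplacian on nonconstant modes. -/
lemma one_le_lam {k : Fin 3 → ℤ} {i : Fin 3} (hk : k i ≠ 0) : 1 ≤ lam k := by
  have h1 : (1 : ℝ) ≤ |(k i : ℝ)| := by exact_mod_cast Int.one_le_abs hk
  have h2 : (1 : ℝ) ≤ (2 * Real.pi * k i) ^ 2 := by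
    rw [← sq_abs, abs_mul, abs_of_pos Real.two_pi_pos]
    have : 1 ≤ 2 * Real.pi * |(k i : ℝ)| := by nlinarith [Real.pi_gt_three]
    nlinarith
  exact h2.trans (Finset.single_le_sum (f := fun i => (2 * Real.pi * (k i : ℝ)) ^ 2)
    (fun _ _ => sq_nonneg _) (Finset.mem_univ i))

/-- Derivatives of heat flows decay exponentially. -/
lemma heat_decay {f : ST → ℝ} (hf : f ∈ Heat) (i : Fin 3) :
    ∃ C : ℝ, ∀ z : ST, 0 ≤ z.1 → |sd (some i) f z| ≤ C * Real.exp (-z.1) := by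
  refine heat_induction (p := fun f => ∃ C : ℝ, ∀ z : ST, 0 ≤ z.1 →
    |sd (some i) f z| ≤ C * Real.exp (-z.1)) ?_ ?_ ?_ ?_ hf
  · intro k φ
    refine ⟨|2 * Real.pi * k i|, fun z hz => ?_⟩
    rw [sd_mode, abs_mul]
    -- If kᵢ = 0 the derivative vanishes identically; otherwise the spectral gap applies.
    by_cases hk : k i = 0
    · simp [hk]
    · refine mul_le_mul_of_nonneg_left ((abs_mode_le _ _ _).trans (Real.exp_le_exp.2 ?_))
        (abs_nonneg _)
      nlinarith [one_le_lam hk]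
  · exact ⟨0, fun z _ => by simp [sd]⟩
  · rintro f g hf hg ⟨C, hC⟩ ⟨C', hC'⟩
    refine ⟨C + C', fun z hz => ?_⟩
    rw [sd_add (heat_smooth hf) (heat_smooth hg), add_mul]
    exact (abs_add_le _ _).trans (add_le_add (hC z hz) (hC' z hz))
  · rintro c f hf ⟨C, hC⟩
    refine ⟨|c| * C, fun z hz => ?_⟩
    rw [sd_const_mul c (heat_smooth hf), abs_mul, mul_assoc]
    exact mul_le_mul_of_nonneg_left (hC z hz) (abs_nonneg _)

/-- Heat flows are bounded for positive times. -/
lemma heat_bound {f : ST → ℝ} (hf : f ∈ Heat) : ∃ C : ℝ, ∀ z : ST, 0 ≤ z.1 → |f z| ≤ C := by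
  refine heat_induction (p := fun f => ∃ C : ℝ, ∀ z : ST, 0 ≤ z.1 → |f z| ≤ C) ?_ ?_ ?_ ?_ hf
  · intro k φ
    refine ⟨1, fun z hz => (abs_mode_le _ _ _).trans ?_⟩
    rw [Real.exp_le_one_iff, neg_mul, neg_nonpos]
    exact mul_nonneg (Finset.sum_nonneg fun _ _ => sq_nonneg _) hz
  · exact ⟨0, fun z _ => by simp⟩
  · rintro f g - - ⟨C, hC⟩ ⟨C', hC'⟩
    exact ⟨C + C', fun z hz => (abs_add_le _ _).trans (add_le_add (hC z hz) (hC' z hz))⟩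
  · rintro c f - ⟨C, hC⟩
    refine ⟨|c| * C, fun z hz => ?_⟩
    rw [abs_mul]
    exact mul_le_mul_of_nonneg_left (hC z hz) (abs_nonneg _)

/-- Solvability of the Poisson equation for trigonometric polynomials. -/
lemma heat_poisson {f : ST → ℝ} (hf : f ∈ Heat) : ∃ w ∈ Heat, ∃ c : ℝ, ∀ z, lap w z = f z - c := by
  refine heat_induction (p := fun f => ∃ w ∈ Heat, ∃ c : ℝ, ∀ z, lap w z = f z - c) ?_ ?_ ?_ ?_ hf
  · intro k φ
    by_cases hk : k = 0
    · refine ⟨0, Heat.zero_mem, mode k φ 0, fun z => ?_⟩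
      have : lap 0 z = 0 := lap_zero z
      rw [this]
      obtain ⟨y, rfl⟩ := stHom_surjective z
      rw [← map_zero stHom, mode_stHom, mode_stHom]
      simp [hk, lam]
    · obtain ⟨i, hi⟩ := Function.ne_iff.1 hk
      have hl : lam k ≠ 0 := by
        have := one_le_lam hi
        linarith
      refine ⟨fun z => (-lam k)⁻¹ * mode k φ z, Heat.smul_mem _ (mode_mem k φ), 0, fun z => ?_⟩
      rw [lap_const_mul _ (smooth_mode k φ), lap_mode]
      field_simp
      simp
  · exact ⟨0, Heat.zero_mem, 0, fun z => by rw [sub_zero]; exact lap_zero z⟩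
  · rintro f g - - ⟨w, hw, c, hc⟩ ⟨w', hw', c', hc'⟩
    refine ⟨fun z => w z + w' z, Heat.add_mem hw hw', c + c', fun z => ?_⟩
    rw [lap_add (heat_smooth hw) (heat_smooth hw'), hc, hc']
    ring
  · rintro a f - ⟨w, hw, c, hc⟩
    refine ⟨fun z => a * w z, Heat.smul_mem a hw, a * c, fun z => ?_⟩
    rw [lap_const_mul a (heat_smooth hw), hc]
    ring

/-- Trigonometric polynomials are dense in the continuous functions. -/
lemma heat_dense {f : T3 → ℝ} (hf : Continuous f) {ε : ℝ} (hε : 0 < ε) :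
    ∃ F ∈ Heat, ∀ x, |F (0, x) - f x| < ε := by
  set g : C(T3, ℂ) := ⟨fun x => (f x : ℂ), Complex.continuous_ofReal.comp hf⟩
  have hg : g ∈ (Submodule.span ℂ (range (UnitAddTorus.mFourier (d := Fin 3)))).topologicalClosure := by
    rw [UnitAddTorus.span_mFourier_closure_eq_top]; trivial
  obtain ⟨h, hh, hd⟩ := Metric.mem_closure_iff.1 hg ε hε
  have key : ∃ F ∈ Heat, ∃ F' ∈ Heat, ∀ x, F (0, x) = (h x).re ∧ F' (0, x) = (h x).im := by
    refine Submodule.span_induction (p := fun h _ => ∃ F ∈ Heat, ∃ F' ∈ Heat, ∀ x,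
      F (0, x) = ((h : C(T3, ℂ)) x).re ∧ F' (0, x) = (h x).im) ?_ ?_ ?_ ?_ hh
    · rintro _ ⟨k, rfl⟩
      refine ⟨_, mode_mem k 0, _, mode_mem k (-(Real.pi / 2)), fun x => ?_⟩
      simp [mode]
    · exact ⟨0, Heat.zero_mem, 0, Heat.zero_mem, fun x => by simp⟩
    · rintro h h' - - ⟨F, hF, F', hF', e⟩ ⟨G, hG, G', hG', e'⟩
      refine ⟨F + G, Heat.add_mem hF hG, F' + G', Heat.add_mem hF' hG', fun x => ?_⟩
      simp [e x, e' x]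
    · rintro c h - ⟨F, hF, F', hF', e⟩
      refine ⟨c.re • F - c.im • F', Heat.sub_mem (Heat.smul_mem _ hF) (Heat.smul_mem _ hF'),
        c.re • F' + c.im • F, Heat.add_mem (Heat.smul_mem _ hF') (Heat.smul_mem _ hF),
        fun x => ?_⟩
      simp [e x]
  obtain ⟨F, hF, F', -, e⟩ := key
  refine ⟨F, hF, fun x => ?_⟩
  have h1 : ‖g x - h x‖ < ε := by
    rw [← dist_eq_norm]
    exact (ContinuousMap.dist_apply_le_dist x).trans_lt hd
  have h2 : |F (0, x) - f x| = |(g x - h x).re| := by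
    rw [(e x).1, abs_sub_comm]; simp [g]
  rw [h2]
  exact (Complex.abs_re_le_norm _).trans_lt h1

end

section

/-! ### A Bellman function -/

namespace Bellman

/-- The regularized absolute value of the first variable. -/
def bn (ε F : ℝ) : ℝ := Real.sqrt (F ^ 2 + ε)

/-- The regularized power of the second variable. -/
def bM (c ε G : ℝ) : ℝ := (G ^ 2 + ε) ^ (c / 2)

/-- The sum of the two regularized variables. -/
def bS (c ε F G : ℝ) : ℝ := bn ε F + bM c ε G

/-- The constant in front of the power of the first variable. -/
def bA (p c : ℝ) : ℝ := ((2 + c) ^ 2 + 2) / (p * (p - 1))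

/-- The Bellman function. -/
def bell (p c ε F G : ℝ) : ℝ := bA p c * bn ε F ^ p + G ^ 2 * bS c ε F G ^ (2 - p)

/-- Its first partial derivative. -/
def bellF (p c ε F G : ℝ) : ℝ :=
  bA p c * p * (bn ε F ^ p / bn ε F ^ 2) * F +
    (2 - p) * G ^ 2 * (bS c ε F G ^ (2 - p) / bS c ε F G) * (F / bn ε F)

/-- Its second partial derivative. -/
def bellG (p c ε F G : ℝ) : ℝ :=
  2 * G * bS c ε F G ^ (2 - p) +
    (2 - p) * G ^ 2 * (bS c ε F G ^ (2 - p) / bS c ε F G) * (c * G * bM c ε G / (G ^ 2 + ε))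

variable {p c ε : ℝ}

lemma bn_pos (hε : 0 < ε) (F : ℝ) : 0 < bn ε F := Real.sqrt_pos.2 (by positivity)

lemma bn_sq (hε : 0 < ε) (F : ℝ) : bn ε F ^ 2 = F ^ 2 + ε := Real.sq_sqrt (by positivity)

lemma bM_pos (hε : 0 < ε) (G : ℝ) : 0 < bM c ε G := Real.rpow_pos_of_pos (by positivity) _

lemma bS_pos (hε : 0 < ε) (F G : ℝ) : 0 < bS c ε F G := add_pos (bn_pos hε F) (bM_pos hε G)

section Derivatives

variable {F G : ℝ → ℝ} {F' G' s : ℝ}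

lemma hasDerivAt_bn (hε : 0 < ε) (hF : HasDerivAt F F' s) :
    HasDerivAt (fun s => bn ε (F s)) (F s * F' / bn ε (F s)) s := by
  have h1 : HasDerivAt (fun s => F s ^ 2 + ε) (2 * F s * F') s := by
    simpa using (hF.pow 2).add_const ε
  refine (h1.sqrt (by positivity)).congr_deriv ?_
  have := (bn_pos hε (F s)).ne'
  unfold bn at this ⊢
  field_simp

lemma hasDerivAt_bM (hε : 0 < ε) (hG : HasDerivAt G G' s) :
    HasDerivAt (fun s => bM c ε (G s)) (c * G s * bM c ε (G s) / (G s ^ 2 + ε) * G') s := by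
  have h1 : HasDerivAt (fun s => G s ^ 2 + ε) (2 * G s * G') s := by
    simpa using (hG.pow 2).add_const ε
  have hp : 0 < G s ^ 2 + ε := by positivity
  refine (h1.rpow_const (p := c / 2) (Or.inl hp.ne')).congr_deriv ?_
  rw [Real.rpow_sub_one hp.ne', bM]
  field_simp

lemma hasDerivAt_bS (hε : 0 < ε) (hF : HasDerivAt F F' s) (hG : HasDerivAt G G' s) :
    HasDerivAt (fun s => bS c ε (F s) (G s)) (F s * F' / bn ε (F s) +
      c * G s * bM c ε (G s) / (G s ^ 2 + ε) * G') s :=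
  (hasDerivAt_bn hε hF).add (hasDerivAt_bM hε hG)

/-- The exponent p − 2 is written as a p-th power divided by a square. Real powers then occur only
as atoms, and the second derivatives below reduce to identities of rational functions. -/
lemma hasDerivAt_bn_rpow (hε : 0 < ε) (hF : HasDerivAt F F' s) :
    HasDerivAt (fun s => bn ε (F s) ^ p) (p * (bn ε (F s) ^ p / bn ε (F s) ^ 2) * (F s * F')) s := by
  have h0 := (bn_pos hε (F s)).ne'
  refine ((hasDerivAt_bn hε hF).rpow_const (p := p) (Or.inl h0)).congr_deriv ?_
  rw [Real.rpow_sub_one h0]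
  field_simp

lemma hasDerivAt_bS_rpow (hε : 0 < ε) (hF : HasDerivAt F F' s) (hG : HasDerivAt G G' s) (σ : ℝ) :
    HasDerivAt (fun s => bS c ε (F s) (G s) ^ σ) (σ * (bS c ε (F s) (G s) ^ σ / bS c ε (F s) (G s)) *
      (F s * F' / bn ε (F s) + c * G s * bM c ε (G s) / (G s ^ 2 + ε) * G')) s := by
  have h0 := (bS_pos (c := c) hε (F s) (G s)).ne'
  refine ((hasDerivAt_bS hε hF hG).rpow_const (p := σ) (Or.inl h0)).congr_deriv ?_
  rw [Real.rpow_sub_one h0]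
  ring

lemma hasDerivAt_bell (hε : 0 < ε) (hF : HasDerivAt F F' s) (hG : HasDerivAt G G' s) :
    HasDerivAt (fun s => bell p c ε (F s) (G s))
      (bellF p c ε (F s) (G s) * F' + bellG p c ε (F s) (G s) * G') s := by
  have h := ((hasDerivAt_bn_rpow (p := p) hε hF).const_mul (bA p c)).add
    ((hG.pow 2).mul (hasDerivAt_bS_rpow (c := c) hε hF hG (2 - p)))
  refine h.congr_deriv ?_
  simp only [bellF, bellG, Nat.cast_ofNat, Nat.add_one_sub_one, pow_one, Pi.pow_apply]
  ring

/-- The Hessian entries of the Bellman function. -/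
def bellFF (p c ε F G : ℝ) : ℝ :=
  bA p c * p * (bn ε F ^ p / bn ε F ^ 2) * (1 + (p - 2) * (F ^ 2 / bn ε F ^ 2)) +
    (2 - p) * G ^ 2 * ((1 - p) * (bS c ε F G ^ (2 - p) / bS c ε F G ^ 2) * (F ^ 2 / bn ε F ^ 2) +
      bS c ε F G ^ (2 - p) / bS c ε F G * (1 / bn ε F - F ^ 2 / bn ε F ^ 3))

/-- The mixed Hessian entry of the Bellman function. -/
def bellFG (p c ε F G : ℝ) : ℝ :=
  (2 - p) * (F / bn ε F) * (2 * G * (bS c ε F G ^ (2 - p) / bS c ε F G) +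
    (1 - p) * G ^ 2 * (bS c ε F G ^ (2 - p) / bS c ε F G ^ 2) *
      (c * G * bM c ε G / (G ^ 2 + ε)))

/-- The last Hessian entry of the Bellman function. -/
def bellGG (p c ε F G : ℝ) : ℝ :=
  2 * bS c ε F G ^ (2 - p) +
    4 * (2 - p) * G * (bS c ε F G ^ (2 - p) / bS c ε F G) * (c * G * bM c ε G / (G ^ 2 + ε)) +
    (2 - p) * G ^ 2 * ((1 - p) * (bS c ε F G ^ (2 - p) / bS c ε F G ^ 2) *
      (c * G * bM c ε G / (G ^ 2 + ε)) ^ 2 + bS c ε F G ^ (2 - p) / bS c ε F G *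
      (c * bM c ε G / (G ^ 2 + ε) ^ 2 * (ε + (c - 1) * G ^ 2)))

lemma hasDerivAt_bellF (hε : 0 < ε) (hF : HasDerivAt F F' s) (hG : HasDerivAt G G' s) :
    HasDerivAt (fun s => bellF p c ε (F s) (G s))
      (bellFF p c ε (F s) (G s) * F' + bellFG p c ε (F s) (G s) * G') s := by
  have hn := (bn_pos hε (F s)).ne'
  have hS := (bS_pos (c := c) hε (F s) (G s)).ne'
  have hY : G s ^ 2 + ε ≠ 0 := by positivity
  have h1 := (((hasDerivAt_bn_rpow (p := p) hε hF).fun_div ((hasDerivAt_bn hε hF).fun_pow 2)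
    (pow_ne_zero 2 hn)).const_mul (bA p c * p)).fun_mul hF
  have h2 := ((((hG.fun_pow 2).const_mul (2 - p)).fun_mul
    ((hasDerivAt_bS_rpow (c := c) hε hF hG (2 - p)).fun_div
    (hasDerivAt_bS (c := c) hε hF hG) hS)).fun_mul (hF.fun_div (hasDerivAt_bn hε hF) hn))
  refine (h1.fun_add h2).congr_deriv ?_
  simp only [bellFF, bellFG, Nat.cast_ofNat, Nat.add_one_sub_one, pow_one]
  generalize bn ε (F s) ^ p = a at *
  generalize bS c ε (F s) (G s) ^ (2 - p) = b at *
  generalize bS c ε (F s) (G s) = S at *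
  generalize bM c ε (G s) = M at *
  generalize bn ε (F s) = n at *
  generalize G s ^ 2 + ε = Y at *
  field_simp
  ring

lemma hasDerivAt_bellG (hε : 0 < ε) (hF : HasDerivAt F F' s) (hG : HasDerivAt G G' s) :
    HasDerivAt (fun s => bellG p c ε (F s) (G s))
      (bellFG p c ε (F s) (G s) * F' + bellGG p c ε (F s) (G s) * G') s := by
  have hn := (bn_pos hε (F s)).ne'
  have hS := (bS_pos (c := c) hε (F s) (G s)).ne'
  have hY : G s ^ 2 + ε ≠ 0 := by positivity
  have h0 : HasDerivAt (fun s => G s ^ 2 + ε) (2 * G s * G') s := by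
    simpa using (hG.pow 2).add_const ε
  have h1 := (hG.const_mul 2).fun_mul (hasDerivAt_bS_rpow (c := c) hε hF hG (2 - p))
  have h2 := ((((hG.fun_pow 2).const_mul (2 - p)).fun_mul
    ((hasDerivAt_bS_rpow (c := c) hε hF hG (2 - p)).fun_div
    (hasDerivAt_bS (c := c) hε hF hG) hS)).fun_mul
    (((hG.const_mul c).fun_mul (hasDerivAt_bM (c := c) hε hG)).fun_div h0 hY))
  refine (h1.fun_add h2).congr_deriv ?_
  simp only [bellGG, bellFG, Nat.cast_ofNat, Nat.add_one_sub_one, pow_one]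
  have hYe : ε = (G s ^ 2 + ε) - G s ^ 2 := by ring
  -- Eliminates ε in favour of G² + ε, which can then be treated as an independent variable.
  have hYe' : ε + (c - 1) * G s ^ 2 = (G s ^ 2 + ε) + (c - 2) * G s ^ 2 := by ring
  rw [hYe']
  generalize bS c ε (F s) (G s) ^ (2 - p) = b at *
  generalize bS c ε (F s) (G s) = S at *
  generalize bM c ε (G s) = M at *
  generalize bn ε (F s) = n at *
  clear hYe hYe' h0 h1 h2
  generalize G s ^ 2 + ε = Y at *
  field_simp
  ring

end Derivatives

set_option maxHeartbeats 1000000 in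
/-- The algebraic inequality behind the convexity of the Bellman function. -/
lemma hessian_lower_bound {n M S Y κ b A F G : ℝ} (hp : 1 < p) (hp2 : p ≤ 2) (hc : c * (p - 1) = 1)
    (hε : 0 < ε) (hn : 0 < n) (hM : 0 < M) (hn2 : n ^ 2 = F ^ 2 + ε) (hS : S = n + M)
    (hY : Y = G ^ 2 + ε) (hκ : 0 < κ) (hb : 0 < b) (hbκ : 1 ≤ b * κ) (hG : |G| * b ≤ S)
    (hA : A * (p * (p - 1)) = (2 + c) ^ 2 + 2) (x y : ℝ) :
    κ * x ^ 2 + κ⁻¹ * y ^ 2 ≤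
      (A * p * κ * (1 + (p - 2) * (F ^ 2 / n ^ 2)) +
        (2 - p) * G ^ 2 * ((1 - p) * (b / S ^ 2) * (F ^ 2 / n ^ 2) +
          b / S * (1 / n - F ^ 2 / n ^ 3))) * x ^ 2 +
      2 * ((2 - p) * (F / n) * (2 * G * (b / S) +
        (1 - p) * G ^ 2 * (b / S ^ 2) * (c * G * M / Y))) * (x * y) +
      (2 * b + 4 * (2 - p) * G * (b / S) * (c * G * M / Y) +
        (2 - p) * G ^ 2 * ((1 - p) * (b / S ^ 2) * (c * G * M / Y) ^ 2 + b / S *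
          (c * M / Y ^ 2 * (ε + (c - 1) * G ^ 2)))) * y ^ 2 := by
  have hS0 : 0 < S := by rw [hS]; positivity
  have hY0 : 0 < Y := by rw [hY]; positivity
  have hc0 : 0 < c := (pos_iff_pos_of_mul_pos (hc ▸ one_pos)).2 (by linarith)
  have hc1 : 1 ≤ c := by nlinarith
  have hA0 : 0 < A := (pos_iff_pos_of_mul_pos (hA.symm ▸ by positivity :
    0 < A * (p * (p - 1)))).2 (mul_pos (by linarith) (by linarith))
  have hp0 : 0 ≤ 2 - p := by linarith
  -- normalized quantities
  set g := |G| * (b / S) with hg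
  have hg0 : 0 ≤ g := by positivity
  have hg1 : g ≤ 1 := by
    rw [hg, ← mul_div_assoc, div_le_one hS0]; exact hG
  set θ := F ^ 2 / n ^ 2 with hθ
  have hθ0 : 0 ≤ θ := by positivity
  have hθ1 : θ ≤ 1 := by rw [hθ, div_le_one (by positivity), hn2]; linarith
  set μ := M / S with hμ
  have hμ0 : 0 ≤ μ := by positivity
  have hμ1 : μ ≤ 1 := by rw [hμ, div_le_one hS0, hS]; linarith
  set τ := G ^ 2 / Y with hτ
  have hτ0 : 0 ≤ τ := by positivity
  have hτ1 : τ ≤ 1 := by rw [hτ, div_le_one hY0, hY]; linarith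
  have hbκ' : κ⁻¹ ≤ b := (inv_le_iff_one_le_mul₀ hκ).2 hbκ
  have hbinv : b⁻¹ ≤ κ := (inv_le_iff_one_le_mul₀ hb).2 (mul_comm b κ ▸ hbκ)
  -- diagonal entry in the first variable
  have hG2 : G ^ 2 * (b / S ^ 2) ≤ κ := by
    have : G ^ 2 * (b / S ^ 2) = g ^ 2 * b⁻¹ := by
      rw [hg, ← sq_abs G]; field_simp
    rw [this]
    calc g ^ 2 * b⁻¹ ≤ 1 * κ := by
          refine mul_le_mul ?_ hbinv (by positivity) (by norm_num)
          nlinarith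
      _ = κ := one_mul _
  -- The power term contributes (2 + c)² + 2 by the choice of `A`; one unit is spent on the negative
  -- part of the second derivative of the coupling term, leaving (2 + c)² for the cross term and one
  -- for the conclusion.
  have hFF : ((2 + c) ^ 2 + 1) * κ ≤ A * p * κ * (1 + (p - 2) * θ) +
        (2 - p) * G ^ 2 * ((1 - p) * (b / S ^ 2) * θ + b / S * (1 / n - F ^ 2 / n ^ 3)) := by
    have h1 : ((2 + c) ^ 2 + 2) * κ ≤ A * p * κ * (1 + (p - 2) * θ) := by
      rw [← hA]
      have : 0 ≤ A * p * κ * ((2 - p) * (1 - θ)) := by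
        have h1 : 0 ≤ 1 - θ := by linarith
        positivity
      linarith
    have h2 : 0 ≤ (2 - p) * G ^ 2 * (b / S * (1 / n - F ^ 2 / n ^ 3)) := by
      have : 1 / n - F ^ 2 / n ^ 3 = (1 - θ) / n := by rw [hθ]; field_simp
      rw [this]
      have h1 : 0 ≤ 1 - θ := by linarith
      positivity
    have h3 : (2 - p) * (p - 1) * θ * (G ^ 2 * (b / S ^ 2)) ≤ 1 * κ := by
      refine mul_le_mul ?_ hG2 (by positivity) (by norm_num)
      have h4 : (2 - p) * (p - 1) ≤ 1 := by nlinarith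
      have h5 : 0 ≤ (2 - p) * (p - 1) := mul_nonneg hp0 (by linarith)
      nlinarith
    have e : (2 - p) * G ^ 2 * ((1 - p) * (b / S ^ 2) * θ + b / S * (1 / n - F ^ 2 / n ^ 3)) =
        -((2 - p) * (p - 1) * θ * (G ^ 2 * (b / S ^ 2))) +
        (2 - p) * G ^ 2 * (b / S * (1 / n - F ^ 2 / n ^ 3)) := by ring
    rw [e]
    linarith
  -- mixed entry
  have hFn : |F / n| ≤ 1 := by
    rw [abs_div, abs_of_pos hn, div_le_one hn]
    exact abs_le_of_sq_le_sq (by rw [hn2]; linarith) hn.le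
  have hFG : |(2 - p) * (F / n) * (2 * G * (b / S) +
        (1 - p) * G ^ 2 * (b / S ^ 2) * (c * G * M / Y))| ≤ 2 + c := by
    have e : (1 - p) * G ^ 2 * (b / S ^ 2) * (c * G * M / Y) =
        -- The conjugacy c(p − 1) = 1 removes the p-dependence of this coefficient, so only a factor
        -- 2 − μτ between 0 and 2 remains.
        -(c * (p - 1)) * (G * (b / S)) * (μ * τ) := by
      rw [hμ, hτ]; field_simp; ring
    have hgabs : |G * (b / S)| = g := by
      rw [hg, abs_mul, abs_of_pos (div_pos hb hS0)]
    have h1 : |2 * G * (b / S) + -(c * (p - 1)) * (G * (b / S)) * (μ * τ)| ≤ 2 + c := by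
      have e2 : 2 * G * (b / S) + -(c * (p - 1)) * (G * (b / S)) * (μ * τ) =
        (G * (b / S)) * (2 - μ * τ) := by rw [hc]; ring
      rw [e2, abs_mul, hgabs]
      have h3 : 0 ≤ μ * τ := by positivity
      have h4 : μ * τ ≤ 1 := mul_le_one₀ hμ1 hτ0 hτ1
      have h5 : |2 - μ * τ| ≤ 2 := by rw [abs_le]; constructor <;> linarith
      calc g * |2 - μ * τ| ≤ 1 * 2 := mul_le_mul hg1 h5 (abs_nonneg _) (by norm_num)
        _ ≤ 2 + c := by linarith
    rw [e, abs_mul, abs_mul]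
    have h2 : |2 - p| ≤ 1 := by rw [abs_le]; constructor <;> linarith
    calc |2 - p| * |F / n| * _ ≤ 1 * 1 * (2 + c) := by
          refine mul_le_mul (mul_le_mul h2 hFn (abs_nonneg _) (by norm_num)) h1 (abs_nonneg _)
            (by norm_num)
      _ = 2 + c := by ring
  -- diagonal entry in the second variable
  have hGG : 2 * b ≤ 2 * b + 4 * (2 - p) * G * (b / S) * (c * G * M / Y) +
        (2 - p) * G ^ 2 * ((1 - p) * (b / S ^ 2) * (c * G * M / Y) ^ 2 + b / S *
          (c * M / Y ^ 2 * (ε + (c - 1) * G ^ 2))) := by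
    have e1 : 4 * (2 - p) * G * (b / S) * (c * G * M / Y) = 4 * ((2 - p) * b * c * (μ * τ)) := by
      rw [hμ, hτ]; field_simp
    have e2 : (2 - p) * G ^ 2 * ((1 - p) * (b / S ^ 2) * (c * G * M / Y) ^ 2) =
        -((c * (p - 1)) * ((2 - p) * b * c * (μ * τ) * (μ * τ))) := by
      rw [hμ, hτ]; field_simp; ring
    have h3 : 0 ≤ (2 - p) * G ^ 2 * (b / S * (c * M / Y ^ 2 * (ε + (c - 1) * G ^ 2))) := by
      have h4 : 0 ≤ c - 1 := by linarith
      positivity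
    have h4 : μ * τ ≤ 1 := mul_le_one₀ hμ1 hτ0 hτ1
    have h5 : 0 ≤ (2 - p) * b * c * (μ * τ) := by
      positivity
    have h6 : (2 - p) * b * c * (μ * τ) * (μ * τ) ≤ (2 - p) * b * c * (μ * τ) :=
      mul_le_of_le_one_right h5 h4
    rw [mul_add, e1, e2, hc, one_mul]
    linarith
  -- conclusion
  set E := (2 - p) * (F / n) * (2 * G * (b / S) +
        (1 - p) * G ^ 2 * (b / S ^ 2) * (c * G * M / Y)) with hE
  -- The arithmetic-geometric mean inequality with weight κ. One of the two units of y²/κ available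
  -- in the second variable pays for it.
  have hcross : -((2 + c) ^ 2 * κ * x ^ 2 + κ⁻¹ * y ^ 2) ≤ 2 * E * (x * y) := by
    have h1 : |E * (x * y)| ≤ (2 + c) * (|x| * |y|) := by
      rw [abs_mul E, abs_mul x]
      exact mul_le_mul_of_nonneg_right hFG (mul_nonneg (abs_nonneg x) (abs_nonneg y))
    have h2 : 2 * ((2 + c) * (|x| * |y|)) ≤ (2 + c) ^ 2 * κ * x ^ 2 + κ⁻¹ * y ^ 2 := by
      have h3 : 0 ≤ κ * ((2 + c) * |x| - κ⁻¹ * |y|) ^ 2 := by positivity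
      have h4 : κ * ((2 + c) * |x| - κ⁻¹ * |y|) ^ 2 = (2 + c) ^ 2 * κ * x ^ 2 + κ⁻¹ * y ^ 2 -
          2 * ((2 + c) * (|x| * |y|)) := by
        rw [← sq_abs x, ← sq_abs y]
        field_simp
        ring
      linarith
    have := neg_abs_le (E * (x * y))
    linarith
  have hx := mul_le_mul_of_nonneg_right hFF (sq_nonneg x)
  have hy := mul_le_mul_of_nonneg_right hGG (sq_nonneg y)
  have hz := mul_le_mul_of_nonneg_right hbκ' (sq_nonneg y)
  linarith

/-- With c = 1/(p − 1) one has |G| ≤ M^{p−1} ≤ S^{p−1}, hence |G| S^{2−p} ≤ S; and S ≥ n with 2 − p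
≥ 0 gives S^{2−p} n^{p−2} ≥ 1. These are the two structural inputs of the algebraic inequality. The
reciprocal weights on x² and y² make the arithmetic-geometric mean produce |x||y| with no weight at
all. -/
lemma bell_hessian (hp : 1 < p) (hp2 : p ≤ 2) (hc : c * (p - 1) = 1) (hε : 0 < ε) (F G x y : ℝ) :
    bn ε F ^ (p - 2) * x ^ 2 + (bn ε F ^ (p - 2))⁻¹ * y ^ 2 ≤
      bellFF p c ε F G * x ^ 2 + 2 * bellFG p c ε F G * (x * y) + bellGG p c ε F G * y ^ 2 := by
  have hn := bn_pos hε F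
  have hM := bM_pos (c := c) hε G
  have hS := bS_pos (c := c) hε F G
  have hκe : bn ε F ^ (p - 2) = bn ε F ^ p / bn ε F ^ 2 := by
    rw [Real.rpow_sub hn]; norm_cast
  have hGp : 0 < G ^ 2 + ε := by positivity
  have hGS : |G| * bS c ε F G ^ (2 - p) ≤ bS c ε F G := by
    have h1 : |G| ≤ bM c ε G ^ (p - 1) := by
      rw [bM, ← Real.rpow_mul hGp.le, show c / 2 * (p - 1) = 1 / 2 by linarith, ← Real.sqrt_eq_rpow]
      exact Real.abs_le_sqrt (by linarith)
    have h2 : bM c ε G ^ (p - 1) ≤ bS c ε F G ^ (p - 1) :=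
      Real.rpow_le_rpow hM.le (by unfold bS; linarith) (by linarith)
    calc |G| * bS c ε F G ^ (2 - p) ≤ bS c ε F G ^ (p - 1) * bS c ε F G ^ (2 - p) :=
          mul_le_mul_of_nonneg_right (h1.trans h2) (Real.rpow_nonneg hS.le _)
      _ = bS c ε F G := by
          rw [← Real.rpow_add hS]; norm_num
  have hbκ : 1 ≤ bS c ε F G ^ (2 - p) * bn ε F ^ (p - 2) := by
    have h1 : bn ε F ^ (2 - p) ≤ bS c ε F G ^ (2 - p) :=
      Real.rpow_le_rpow hn.le (by unfold bS; linarith) (by linarith)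
    calc 1 = bn ε F ^ (2 - p) * bn ε F ^ (p - 2) := by
          rw [← Real.rpow_add hn]; norm_num
      _ ≤ _ := mul_le_mul_of_nonneg_right h1 (Real.rpow_nonneg hn.le _)
  have hA : bA p c * (p * (p - 1)) = (2 + c) ^ 2 + 2 := by
    unfold bA
    have h1 : p ≠ 0 := by linarith
    have h2 : p - 1 ≠ 0 := by linarith
    field_simp
  have := hessian_lower_bound hp hp2 hc hε hn hM (bn_sq hε F) (S := bS c ε F G) rfl
    (Y := G ^ 2 + ε) rfl (Real.rpow_pos_of_pos hn (p - 2)) (Real.rpow_pos_of_pos hS (2 - p)) hbκ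
    hGS hA x y
  simp only [bellFF, bellFG, bellGG]
  rw [← hκe]
  exact this

lemma bell_nonneg (hp : 1 < p) (hε : 0 < ε) (F G : ℝ) : 0 ≤ bell p c ε F G := by
  have hn := bn_pos hε F
  have hS := bS_pos (c := c) hε F G
  have : 0 ≤ bA p c := div_nonneg (by positivity) (mul_nonneg (by linarith) (by linarith))
  unfold bell
  positivity

lemma add_rpow_le_two {x y r : ℝ} (hx : 0 ≤ x) (hy : 0 ≤ y) (hr : 0 ≤ r) :
    (x + y) ^ r ≤ 2 ^ r * (x ^ r + y ^ r) := by
  have h1 : x + y ≤ 2 * max x y := by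
    have := le_max_left x y
    have := le_max_right x y
    linarith
  refine (Real.rpow_le_rpow (by positivity) h1 hr).trans ?_
  rw [Real.mul_rpow (by norm_num) (le_max_of_le_left hx)]
  refine mul_le_mul_of_nonneg_left ?_ (by positivity)
  rcases max_cases x y with ⟨h, -⟩ | ⟨h, -⟩ <;> rw [h]
  · linarith [Real.rpow_nonneg hy r]
  · linarith [Real.rpow_nonneg hx r]

lemma sqrt_rpow_le {F r : ℝ} (hε : 0 < ε) (hr : 0 ≤ r) :
    Real.sqrt (F ^ 2 + ε) ^ r ≤ 2 ^ r * (|F| ^ r + Real.sqrt ε ^ r) := by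
  refine le_trans (Real.rpow_le_rpow (Real.sqrt_nonneg _) ?_ hr)
    (add_rpow_le_two (abs_nonneg F) (Real.sqrt_nonneg ε) hr)
  rw [Real.sqrt_le_left (by positivity), add_sq, sq_abs, Real.sq_sqrt hε.le]
  have : 0 ≤ |F| * Real.sqrt ε := by positivity
  linarith

/-- Growth of the Bellman function, uniformly in the regularization. -/
lemma exists_bell_le (hp : 1 < p) (hc : c * (p - 1) = 1) :
    ∃ K : ℝ, 0 ≤ K ∧ ∀ ε, 0 < ε → ∀ F G, bell p c ε F G ≤
      K * (|F| ^ p + |G| ^ (c * p) + Real.sqrt ε ^ p + Real.sqrt ε ^ (c * p)) := by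
  have hA : 0 ≤ bA p c := div_nonneg (by positivity) (mul_nonneg (by linarith) (by linarith))
  have hc0 : 0 < c := (pos_iff_pos_of_mul_pos (hc ▸ one_pos)).2 (by linarith)
  refine ⟨(bA p c + 2 ^ p) * (2 ^ p + 2 ^ (c * p)), by positivity, fun ε hε F G => ?_⟩
  have hn := bn_pos hε F
  have hM := bM_pos (c := c) hε G
  have hS := bS_pos (c := c) hε F G
  have hGp : 0 < G ^ 2 + ε := by positivity
  have h1 : bn ε F ^ p ≤ 2 ^ p * (|F| ^ p + Real.sqrt ε ^ p) := sqrt_rpow_le hε (by linarith)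
  have h2 : bM c ε G ^ p ≤ 2 ^ (c * p) * (|G| ^ (c * p) + Real.sqrt ε ^ (c * p)) := by
    have : bM c ε G ^ p = Real.sqrt (G ^ 2 + ε) ^ (c * p) := by
      rw [bM, Real.sqrt_eq_rpow, ← Real.rpow_mul hGp.le, ← Real.rpow_mul hGp.le]
      congr 1; ring
    rw [this]
    exact sqrt_rpow_le hε (by positivity)
  -- G² ≤ S^{2(p−1)}, so the coupling term is at most S^p, and S^p is comparable to |F|^p + |G|^{cp}
  -- up to the regularization.
  have h3 : G ^ 2 * bS c ε F G ^ (2 - p) ≤ 2 ^ p * (bn ε F ^ p + bM c ε G ^ p) := by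
    have hG2 : G ^ 2 ≤ bS c ε F G ^ (2 * (p - 1)) := by
      have h4 : G ^ 2 ≤ bM c ε G ^ (2 * (p - 1)) := by
        rw [bM, ← Real.rpow_mul hGp.le, show c / 2 * (2 * (p - 1)) = 1 by linarith, Real.rpow_one]
        linarith
      exact h4.trans (Real.rpow_le_rpow hM.le (by unfold bS; linarith) (by linarith))
    calc G ^ 2 * bS c ε F G ^ (2 - p) ≤ bS c ε F G ^ (2 * (p - 1)) * bS c ε F G ^ (2 - p) :=
          mul_le_mul_of_nonneg_right hG2 (Real.rpow_nonneg hS.le _)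
      _ = (bn ε F + bM c ε G) ^ p := by
          rw [← Real.rpow_add hS]; congr 1; ring
      _ ≤ _ := add_rpow_le_two hn.le hM.le (by linarith)
  have e0 : 0 ≤ bn ε F ^ p := Real.rpow_nonneg hn.le _
  have e1 : 0 ≤ bM c ε G ^ p := Real.rpow_nonneg hM.le _
  have e2 : bell p c ε F G ≤ (bA p c + 2 ^ p) * (bn ε F ^ p + bM c ε G ^ p) := by
    unfold bell
    nlinarith [mul_nonneg hA e1]
  refine e2.trans ?_
  rw [mul_assoc]
  refine mul_le_mul_of_nonneg_left ?_ (by positivity)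
  have f1 : 0 ≤ |F| ^ p + Real.sqrt ε ^ p := by positivity
  have f2 : 0 ≤ |G| ^ (c * p) + Real.sqrt ε ^ (c * p) := by positivity
  have g1 : (0 : ℝ) ≤ 2 ^ p := by positivity
  have g2 : (0 : ℝ) ≤ 2 ^ (c * p) := by positivity
  nlinarith [mul_nonneg g1 f2, mul_nonneg g2 f1]

end Bellman

end

section

/-! ### Calculus on time slices -/

lemma SmoothST.hasDerivAt {f : ST → ℝ} (hf : SmoothST f) (α : Option (Fin 3)) (z : ST) :
    HasDerivAt (fun s : ℝ => f (z + stHom (s • dir α))) (HallMHD.sd α f z) 0 := by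
  have h1 : HasFDerivAt (fun y : STE => f (z + stHom y)) _ ((0 : ℝ) • dir α) :=
    ((hf.shift z).differentiable (by simp) _).hasFDerivAt
  have h2 : HasDerivAt (fun s : ℝ => s • dir α) (dir α) 0 := by
    simpa using (hasDerivAt_id (0 : ℝ)).smul_const (dir α)
  have h3 := h1.comp_hasDerivAt (0 : ℝ) h2
  rw [zero_smul] at h3
  exact h3

lemma SmoothST.hasDerivAt_time {f : ST → ℝ} (hf : SmoothST f) (t : ℝ) (x : T3) :
    HasDerivAt (fun s : ℝ => f (s, x)) (HallMHD.sd none f (t, x)) t := by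
  have h := hf.hasDerivAt none (t, x)
  have h2 := HasDerivAt.comp_sub_const t t (f := fun s : ℝ => f ((t, x) + stHom (s • dir none)))
    (f' := HallMHD.sd none f (t, x)) (by rwa [sub_self])
  have h3 : ∀ s : ℝ, (t, x) + stHom ((s - t) • dir none) = (s, x) := by
    intro s
    have h0 : proj 0 = 0 := map_zero projHom
    simp [dir, h0]
  simpa only [h3] using h2

lemma SmoothST.hasDerivAt_space {f : ST → ℝ} (hf : SmoothST f) (i : Fin 3) (t : ℝ) (x : T3) :
    HasDerivAt (fun s : ℝ => f (t, x + projHom (s • EuclideanSpace.single i 1)))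
      (HallMHD.sd (some i) f (t, x)) 0 := by
  have h := hf.hasDerivAt (some i) (t, x)
  convert h using 2 with s
  simp [dir]

lemma integral_space_deriv_eq_zero {Φ Φ' : T3 → ℝ} (i : Fin 3)
    (h : ∀ x, HasDerivAt (fun s : ℝ => Φ (x + projHom (s • EuclideanSpace.single i 1))) (Φ' x) 0)
    (hΦ : Continuous Φ) (hΦ' : Continuous Φ') : ∫ x, Φ' x = 0 := by
  obtain ⟨C, hC⟩ := (isCompact_univ.image hΦ'.norm).bddAbove
  exact integral_deriv_shift_eq_zero (π := projHom) (a := EuclideanSpace.single i 1) (Φ := Φ)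
    (g := fun _ => C) h
    (hΦ.integrable_of_hasCompactSupport (HasCompactSupport.of_compactSpace _))
    hΦ'.aestronglyMeasurable (integrable_const _)
    fun z s _ => hC ⟨_, mem_univ _, rfl⟩

lemma integrable_T3 {f : T3 → ℝ} (hf : Continuous f) : Integrable f :=
  hf.integrable_of_hasCompactSupport (HasCompactSupport.of_compactSpace _)

lemma SmoothST.continuous_slice {f : ST → ℝ} (hf : SmoothST f) (t : ℝ) :
    Continuous fun x => f (t, x) := hf.continuous.comp (by fun_prop)

/-- Integration by parts on a time slice. -/
lemma integral_space_parts {f g : ST → ℝ} (hf : SmoothST f) (hg : SmoothST g) (i : Fin 3) (t : ℝ) :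
    ∫ x, sd (some i) f (t, x) * g (t, x) = - ∫ x, f (t, x) * sd (some i) g (t, x) := by
  have h := integral_space_deriv_eq_zero (Φ := fun x => f (t, x) * g (t, x))
    (Φ' := fun x => sd (some i) f (t, x) * g (t, x) + f (t, x) * sd (some i) g (t, x)) i
    (fun x => by
      have := (hf.mul hg).hasDerivAt_space i t x
      rwa [sd_mul hf hg] at this)
    ((hf.mul hg).continuous_slice t)
    ((((hf.sd _).mul hg).continuous_slice t).add ((hf.mul (hg.sd _)).continuous_slice t))
  rw [integral_add (integrable_T3 (((hf.sd _).mul hg).continuous_slice t))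
    (integrable_T3 ((hf.mul (hg.sd _)).continuous_slice t))] at h
  linarith

/-- The fundamental theorem of calculus for space averages. -/
lemma integral_slice_sub {f D : ST → ℝ} (hD : Continuous D) (hf : ∀ t, Continuous fun x => f (t, x))
    (h : ∀ t x, HasDerivAt (fun s => f (s, x)) (D (t, x)) t) (T₁ : ℝ) (hT : 0 ≤ T₁) :
    (∫ x, f (T₁, x)) - ∫ x, f (0, x) = ∫ t in (0 : ℝ)..T₁, ∫ x, D (t, x) := by
  rw [← integral_sub (integrable_T3 (hf _)) (integrable_T3 (hf _)),
    intervalIntegral.integral_of_le hT]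
  have h1 : ∀ x, f (T₁, x) - f (0, x) = ∫ t in Ioc 0 T₁, D (t, x) := by
    intro x
    rw [← intervalIntegral.integral_of_le hT]
    refine (intervalIntegral.integral_eq_sub_of_hasDerivAt (fun t _ => h t x) ?_).symm
    exact (hD.comp (by fun_prop : Continuous fun t : ℝ => (t, x))).intervalIntegrable _ _
  simp_rw [h1]
  refine integral_integral_swap (f := fun (x : T3) (t : ℝ) => D (t, x)) ?_
  have hK : IsCompact (Icc (0 : ℝ) T₁ ×ˢ (univ : Set T3)) := isCompact_Icc.prod isCompact_univ
  have hi : IntegrableOn D (Ioc (0 : ℝ) T₁ ×ˢ (univ : Set T3)) (volume : Measure ST) :=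
    (hD.continuousOn.integrableOn_compact hK).mono_set (prod_mono Ioc_subset_Icc_self subset_rfl)
  rw [Measure.volume_eq_prod, IntegrableOn, ← Measure.prod_restrict, Measure.restrict_univ] at hi
  exact hi.swap

lemma continuous_slice_integral {D : ST → ℝ} (hD : Continuous D) :
    Continuous fun t : ℝ => ∫ x, D (t, x) := by
  have := continuous_parametric_integral_of_continuous (μ := (volume : Measure T3)) (s := univ)
    (f := fun (t : ℝ) (x : T3) => D (t, x)) hD isCompact_univ
  simpa using this

/-- Second derivatives of a trigonometric polynomial are controlled through the heat flow. -/
lemma abs_integral_mul_hessian_le {F W : ST → ℝ} (hF : F ∈ Heat) (hW : W ∈ Heat) (m k : Fin 3)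
    {R : ℝ} (hR : ∀ T₁, 0 ≤ T₁ → 2 * ∫ t in (0 : ℝ)..T₁, ∫ x,
      |sd (some m) F (t, x)| * |sd (some k) (lap W) (t, x)| ≤ R) :
    |∫ x, F (0, x) * sd (some m) (sd (some k) W) (0, x)| ≤ R := by
  set V := sd (some m) (sd (some k) W) with hV
  have hVm : V ∈ Heat := heat_sd (heat_sd hW k) m
  have sF := heat_smooth hF
  have sV := heat_smooth hVm
  have sW := heat_smooth hW
  have sG := heat_smooth (heat_lap hW)
  have hlapV : ∀ z, lap V z = sd (some m) (sd (some k) (lap W)) z := by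
    intro z
    rw [← heat_equation hVm, hV, sd_comm (sW.sd _)]
    have e1 : sd none (sd (some k) W) = sd (some k) (sd none W) := funext fun z => sd_comm sW _ _ z
    have e2 : sd none W = lap W := funext (heat_equation hW)
    rw [e1, e2]
  have hD : Continuous fun z => lap F z * V z + F z * lap V z :=
    ((heat_smooth (heat_lap hF)).mul sV).continuous.add
      (sF.mul (heat_smooth (heat_lap hVm))).continuous
  -- The Laplacian is symmetric on the slice, so both terms agree; in F ∂ₘ∂ₖΔW one derivative is
  -- then moved onto F.
  have hslice : ∀ t : ℝ, ∫ x, (lap F (t, x) * V (t, x) + F (t, x) * lap V (t, x)) =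
      -(2 * ∫ x, sd (some m) F (t, x) * sd (some k) (lap W) (t, x)) := by
    intro t
    have i1 := integrable_T3 (((heat_smooth (heat_lap hF)).mul sV).continuous_slice t)
    have i2 := integrable_T3 ((sF.mul (heat_smooth (heat_lap hVm))).continuous_slice t)
    have e1 : ∫ x, lap F (t, x) * V (t, x) = ∫ x, F (t, x) * lap V (t, x) := by
      unfold lap
      simp_rw [Finset.sum_mul, Finset.mul_sum]
      rw [integral_finsetSum _ fun i _ =>
          integrable_T3 ((((sF.sd _).sd _).mul sV).continuous_slice t),
        integral_finsetSum _ fun i _ => integrable_T3 ((sF.mul ((sV.sd _).sd _)).continuous_slice t)]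
      refine Finset.sum_congr rfl fun i _ => ?_
      rw [integral_space_parts (sF.sd _) sV, integral_space_parts sF (sV.sd _), neg_neg]
    have e2 : ∫ x, F (t, x) * lap V (t, x) =
        - ∫ x, sd (some m) F (t, x) * sd (some k) (lap W) (t, x) := by
      simp_rw [hlapV]
      rw [integral_space_parts sF (sG.sd _), neg_neg]
    rw [integral_add i1 i2, e1, e2]
    ring
  have hmain : ∀ T₁, 0 ≤ T₁ → |∫ x, F (0, x) * V (0, x)| ≤ |∫ x, F (T₁, x) * V (T₁, x)| + R := by
    intro T₁ hT
    have h1 := integral_slice_sub (f := fun z => F z * V z) hD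
      (fun t => (sF.mul sV).continuous_slice t) (fun t x => by
        have := (sF.hasDerivAt_time t x).mul (sV.hasDerivAt_time t x)
        rwa [heat_equation hF, heat_equation hVm] at this) T₁ hT
    simp_rw [hslice] at h1
    have h2 : |∫ t in (0 : ℝ)..T₁, -(2 * ∫ x, sd (some m) F (t, x) * sd (some k) (lap W) (t, x))| ≤
        R := by
      rw [intervalIntegral.integral_neg, abs_neg, intervalIntegral.integral_const_mul, abs_mul,
        abs_two]
      refine le_trans (mul_le_mul_of_nonneg_left ?_ (by norm_num)) (hR T₁ hT)
      refine (intervalIntegral.abs_integral_le_integral_abs hT).trans ?_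
      have c1 : Continuous fun z => sd (some m) F z * sd (some k) (lap W) z :=
        ((sF.sd _).mul (sG.sd _)).continuous
      have c2 : Continuous fun z => |sd (some m) F z| * |sd (some k) (lap W) z| :=
        (sF.sd _).continuous.abs.mul (sG.sd _).continuous.abs
      refine intervalIntegral.integral_mono_on hT
        ((continuous_slice_integral c1).abs.intervalIntegrable _ _)
        ((continuous_slice_integral c2).intervalIntegrable _ _) fun t _ => ?_
      refine (abs_integral_le_integral_abs).trans (le_of_eq ?_)
      simp_rw [abs_mul]
    have h3 : ∫ x, F (0, x) * V (0, x) = (∫ x, F (T₁, x) * V (T₁, x)) - ∫ t in (0 : ℝ)..T₁,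
        -(2 * ∫ x, sd (some m) F (t, x) * sd (some k) (lap W) (t, x)) := by linarith
    rw [h3]
    refine (abs_sub _ _).trans ?_
    linarith
  -- The contribution at time T₁ decays exponentially, since V is a derivative of a heat flow while
  -- F stays bounded; letting T₁ grow leaves only the time integral.
  obtain ⟨C, hC⟩ := heat_bound hF
  obtain ⟨C', hC'⟩ := heat_decay (heat_sd hW k) m
  have hlim : Tendsto (fun T₁ : ℝ => C * (C' * Real.exp (-T₁)) + R) atTop (𝓝 R) := by
    have := ((Real.tendsto_exp_neg_atTop_nhds_zero.const_mul C').const_mul C).add_const R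
    simpa using this
  refine ge_of_tendsto hlim ?_
  filter_upwards [eventually_ge_atTop (0 : ℝ)] with T₁ hT
  refine (hmain T₁ hT).trans (add_le_add ?_ le_rfl)
  have := norm_integral_le_of_norm_le_const (μ := (volume : Measure T3))
    (f := fun x => F (T₁, x) * V (T₁, x)) (C := C * (C' * Real.exp (-T₁)))
    (Eventually.of_forall fun x => by
      rw [norm_mul]
      exact mul_le_mul (hC _ hT) (hC' _ hT) (norm_nonneg _) ((abs_nonneg _).trans (hC (T₁, x) hT)))
  rwa [probReal_univ, mul_one] at this

/-! ### The Bellman function along the heat flow -/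

open Bellman in
lemma continuous_bell_parts {p c ε : ℝ} (hε : 0 < ε) :
    (Continuous fun q : ℝ × ℝ => bell p c ε q.1 q.2) ∧
    (Continuous fun q : ℝ × ℝ => bellF p c ε q.1 q.2) ∧
    (Continuous fun q : ℝ × ℝ => bellG p c ε q.1 q.2) ∧
    (Continuous fun q : ℝ × ℝ => bellFF p c ε q.1 q.2) ∧
    (Continuous fun q : ℝ × ℝ => bellFG p c ε q.1 q.2) ∧
    (Continuous fun q : ℝ × ℝ => bellGG p c ε q.1 q.2) := by
  have cn : Continuous fun q : ℝ × ℝ => bn ε q.1 := by unfold bn; fun_prop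
  have cM : Continuous fun q : ℝ × ℝ => bM c ε q.2 := by
    unfold bM
    exact Continuous.rpow_const (by fun_prop) fun q => Or.inl (by positivity)
  have cS : Continuous fun q : ℝ × ℝ => bS c ε q.1 q.2 := cn.add cM
  have hn : ∀ q : ℝ × ℝ, bn ε q.1 ≠ 0 := fun q => (bn_pos hε _).ne'
  have hS : ∀ q : ℝ × ℝ, bS c ε q.1 q.2 ≠ 0 := fun q => (bS_pos hε _ _).ne'
  have hY : ∀ q : ℝ × ℝ, q.2 ^ 2 + ε ≠ 0 := fun q => by positivity
  have cnp : Continuous fun q : ℝ × ℝ => bn ε q.1 ^ p := cn.rpow_const fun q => Or.inl (hn q)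
  have cSp : Continuous fun q : ℝ × ℝ => bS c ε q.1 q.2 ^ (2 - p) :=
    cS.rpow_const fun q => Or.inl (hS q)
  have q1 : Continuous fun q : ℝ × ℝ => bS c ε q.1 q.2 ^ (2 - p) / bS c ε q.1 q.2 := cSp.div cS hS
  have q2 : Continuous fun q : ℝ × ℝ => bS c ε q.1 q.2 ^ (2 - p) / bS c ε q.1 q.2 ^ 2 :=
    cSp.div (cS.pow 2) fun q => pow_ne_zero 2 (hS q)
  have q3 : Continuous fun q : ℝ × ℝ => bn ε q.1 ^ p / bn ε q.1 ^ 2 :=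
    cnp.div (cn.pow 2) fun q => pow_ne_zero 2 (hn q)
  have q4 : Continuous fun q : ℝ × ℝ => q.1 / bn ε q.1 := continuous_fst.div cn hn
  have q5 : Continuous fun q : ℝ × ℝ => c * q.2 * bM c ε q.2 / (q.2 ^ 2 + ε) :=
    Continuous.div (by fun_prop) (by fun_prop) hY
  have q6 : Continuous fun q : ℝ × ℝ => q.1 ^ 2 / bn ε q.1 ^ 2 :=
    Continuous.div (by fun_prop) (cn.pow 2) fun q => pow_ne_zero 2 (hn q)
  have q7 : Continuous fun q : ℝ × ℝ => q.1 ^ 2 / bn ε q.1 ^ 3 :=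
    Continuous.div (by fun_prop) (cn.pow 3) fun q => pow_ne_zero 3 (hn q)
  have q8 : Continuous fun q : ℝ × ℝ => 1 / bn ε q.1 := continuous_const.div cn hn
  have q9 : Continuous fun q : ℝ × ℝ => c * bM c ε q.2 / (q.2 ^ 2 + ε) ^ 2 :=
    Continuous.div (by fun_prop) (by fun_prop) fun q => pow_ne_zero 2 (hY q)
  refine ⟨?_, ?_, ?_, ?_, ?_, ?_⟩
  · unfold bell; fun_prop
  · unfold bellF; fun_prop
  · unfold bellG; fun_prop
  · unfold bellFF; fun_prop
  · unfold bellFG; fun_prop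
  · unfold bellGG; fun_prop

open Bellman in
/-- The square function estimate. -/
lemma heat_bellman {p c ε : ℝ} (hp : 1 < p) (hp2 : p ≤ 2) (hc : c * (p - 1) = 1) (hε : 0 < ε)
    {F G : ST → ℝ} (hF : F ∈ Heat) (hG : G ∈ Heat) (m k : Fin 3) (T₁ : ℝ) (hT : 0 ≤ T₁) :
    2 * ∫ t in (0 : ℝ)..T₁, ∫ x, |sd (some m) F (t, x)| * |sd (some k) G (t, x)| ≤
      ∫ x, bell p c ε (F (0, x)) (G (0, x)) := by
  obtain ⟨c0, c1, c2, c3, c4, c5⟩ := continuous_bell_parts (p := p) (c := c) hε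
  have sF := heat_smooth hF
  have sG := heat_smooth hG
  have hFG : Continuous fun z : ST => (F z, G z) := sF.continuous.prodMk sG.continuous
  have d0 := c0.comp hFG
  have d1 := c1.comp hFG
  have d2 := c2.comp hFG
  have d3 := c3.comp hFG
  have d4 := c4.comp hFG
  have d5 := c5.comp hFG
  simp only [Function.comp_def] at d0 d1 d2 d3 d4 d5
  have slice : ∀ {f : ST → ℝ}, Continuous f → ∀ t : ℝ, Continuous fun x => f (t, x) :=
    fun hf t => hf.comp (by fun_prop)
  -- the dissipation in a coordinate direction
  set Q : Fin 3 → ST → ℝ := fun i z => bellFF p c ε (F z) (G z) * sd (some i) F z ^ 2 +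
    2 * bellFG p c ε (F z) (G z) * (sd (some i) F z * sd (some i) G z) +
    bellGG p c ε (F z) (G z) * sd (some i) G z ^ 2 with hQ
  have cf : ∀ i, Continuous (sd (some i) F) := fun i => (sF.sd _).continuous
  have cg : ∀ i, Continuous (sd (some i) G) := fun i => (sG.sd _).continuous
  have cff : ∀ i, Continuous (sd (some i) (sd (some i) F)) := fun i => ((sF.sd _).sd _).continuous
  have cgg : ∀ i, Continuous (sd (some i) (sd (some i) G)) := fun i => ((sG.sd _).sd _).continuous
  have hQc : ∀ i, Continuous (Q i) := by
    intro i
    have := cf i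
    have := cg i
    simp only [hQ]
    fun_prop
  have hLc : ∀ i, Continuous fun z => bellF p c ε (F z) (G z) * sd (some i) (sd (some i) F) z +
      bellG p c ε (F z) (G z) * sd (some i) (sd (some i) G) z := by
    intro i
    have := cff i
    have := cgg i
    fun_prop
  -- The integral over the torus of ∂ᵢ(B_F ∂ᵢF + B_G ∂ᵢG) is zero, and the chain rule makes the
  -- Hessian form `Q` appear.
  have hparts : ∀ i (t : ℝ), ∫ x, (bellF p c ε (F (t, x)) (G (t, x)) *
      sd (some i) (sd (some i) F) (t, x) + bellG p c ε (F (t, x)) (G (t, x)) *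
      sd (some i) (sd (some i) G) (t, x)) = - ∫ x, Q i (t, x) := by
    intro i t
    have h := integral_space_deriv_eq_zero
      (Φ := fun x => bellF p c ε (F (t, x)) (G (t, x)) * sd (some i) F (t, x) +
        bellG p c ε (F (t, x)) (G (t, x)) * sd (some i) G (t, x))
      (Φ' := fun x => (bellF p c ε (F (t, x)) (G (t, x)) * sd (some i) (sd (some i) F) (t, x) +
        bellG p c ε (F (t, x)) (G (t, x)) * sd (some i) (sd (some i) G) (t, x)) + Q i (t, x)) i
      (fun x => by
        have hf := sF.hasDerivAt_space i t x
        have hg := sG.hasDerivAt_space i t x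
        have hff := (sF.sd (some i)).hasDerivAt_space i t x
        have hgg := (sG.sd (some i)).hasDerivAt_space i t x
        have h1 := (hasDerivAt_bellF (p := p) (c := c) hε hf hg).fun_mul hff
        have h2 := (hasDerivAt_bellG (p := p) (c := c) hε hf hg).fun_mul hgg
        refine (h1.fun_add h2).congr_deriv ?_
        simp only [zero_smul, map_zero, add_zero, hQ]
        ring)
      (by
        have := cf i
        have := cg i
        exact slice (f := fun z => bellF p c ε (F z) (G z) * sd (some i) F z +
          bellG p c ε (F z) (G z) * sd (some i) G z) (by fun_prop) t)
      ((slice (hLc i) t).add (slice (hQc i) t))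
    rw [integral_add (integrable_T3 (slice (hLc i) t)) (integrable_T3 (slice (hQc i) t))] at h
    linarith
  have hD : Continuous fun z => bellF p c ε (F z) (G z) * lap F z +
      bellG p c ε (F z) (G z) * lap G z := by
    have := (heat_smooth (heat_lap hF)).continuous
    have := (heat_smooth (heat_lap hG)).continuous
    fun_prop
  have hslice : ∀ t : ℝ, ∫ x, (bellF p c ε (F (t, x)) (G (t, x)) * lap F (t, x) +
      bellG p c ε (F (t, x)) (G (t, x)) * lap G (t, x)) = - ∑ i, ∫ x, Q i (t, x) := by
    intro t
    rw [← Finset.sum_neg_distrib, ← Finset.sum_congr rfl fun i _ => hparts i t,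
      ← integral_finsetSum _ fun i _ => integrable_T3 (slice (hLc i) t)]
    congr with x
    simp only [lap, Finset.mul_sum, Finset.sum_add_distrib]
  have hmain := integral_slice_sub (f := fun z => bell p c ε (F z) (G z)) hD (fun t => slice d0 t)
    (fun t x => by
      have := hasDerivAt_bell (p := p) (c := c) hε (sF.hasDerivAt_time t x)
        (sG.hasDerivAt_time t x)
      rwa [heat_equation hF, heat_equation hG] at this) T₁ hT
  simp_rw [hslice] at hmain
  rw [intervalIntegral.integral_neg] at hmain
  -- The total dissipation of ∫ B is the initial value minus the final one; nonnegativity of B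
  -- discards the final value.
  have hpos : 0 ≤ ∫ x, bell p c ε (F (T₁, x)) (G (T₁, x)) :=
    integral_nonneg fun x => bell_nonneg hp hε _ _
  have hQ0 : ∀ i z, bn ε (F z) ^ (p - 2) * sd (some i) F z ^ 2 +
      (bn ε (F z) ^ (p - 2))⁻¹ * sd (some i) G z ^ 2 ≤ Q i z :=
    fun i z => bell_hessian hp hp2 hc hε _ _ _ _
  -- The weights κ and 1/κ on the two gradients cancel in the arithmetic-geometric mean, even for
  -- different directions m and k, because the Hessian bound can be summed over all directions.
  have hpt : ∀ z, 2 * (|sd (some m) F z| * |sd (some k) G z|) ≤ ∑ i, Q i z := by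
    intro z
    have hκ : 0 < bn ε (F z) ^ (p - 2) := Real.rpow_pos_of_pos (bn_pos hε _) _
    set κ := bn ε (F z) ^ (p - 2)
    have h1 : ∑ i, (κ * sd (some i) F z ^ 2 + κ⁻¹ * sd (some i) G z ^ 2) ≤ ∑ i, Q i z :=
      Finset.sum_le_sum fun i _ => hQ0 i z
    have h2 : κ * sd (some m) F z ^ 2 ≤ ∑ i, κ * sd (some i) F z ^ 2 :=
      Finset.single_le_sum (f := fun i => κ * sd (some i) F z ^ 2)
        (fun i _ => by positivity) (Finset.mem_univ m)
    have h3 : κ⁻¹ * sd (some k) G z ^ 2 ≤ ∑ i, κ⁻¹ * sd (some i) G z ^ 2 :=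
      Finset.single_le_sum (f := fun i => κ⁻¹ * sd (some i) G z ^ 2)
        (fun i _ => by positivity) (Finset.mem_univ k)
    rw [Finset.sum_add_distrib] at h1
    have h4 : 2 * (|sd (some m) F z| * |sd (some k) G z|) ≤
        κ * sd (some m) F z ^ 2 + κ⁻¹ * sd (some k) G z ^ 2 := by
      have h5 : 0 ≤ κ * (|sd (some m) F z| - κ⁻¹ * |sd (some k) G z|) ^ 2 := by positivity
      have h6 : κ * (|sd (some m) F z| - κ⁻¹ * |sd (some k) G z|) ^ 2 =
          κ * sd (some m) F z ^ 2 + κ⁻¹ * sd (some k) G z ^ 2 -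
          2 * (|sd (some m) F z| * |sd (some k) G z|) := by
        rw [← sq_abs (sd (some m) F z), ← sq_abs (sd (some k) G z)]
        field_simp
        ring
      linarith
    linarith
  have hle : 2 * ∫ t in (0 : ℝ)..T₁, ∫ x, |sd (some m) F (t, x)| * |sd (some k) G (t, x)| ≤
      ∫ t in (0 : ℝ)..T₁, ∑ i, ∫ x, Q i (t, x) := by
    rw [← intervalIntegral.integral_const_mul]
    have c6 : Continuous fun z => |sd (some m) F z| * |sd (some k) G z| := (cf m).abs.mul (cg k).abs
    refine intervalIntegral.integral_mono_on hT
      (((continuous_slice_integral c6).const_mul 2).intervalIntegrable _ _)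
      ((continuous_finsetSum _ fun i _ =>
        continuous_slice_integral (hQc i)).intervalIntegrable _ _) fun t _ => ?_
    rw [← integral_const_mul, ← integral_finsetSum _ fun i _ => integrable_T3 (slice (hQc i) t)]
    exact integral_mono ((integrable_T3 (slice c6 t)).const_mul 2)
      (integrable_finsetSum _ fun i _ => integrable_T3 (slice (hQc i) t)) fun x => hpt _
  linarith

end

section

/-! ### The Calderón–Zygmund inequality on the torus -/

open Bellman in
-- The growth constant of the Bellman function does not depend on the regularization, so ε tends to
-- zero at a fixed time T₁.
lemma exists_abs_integral_mul_hessian_le_of_le_two {p : ℝ} (hp : 1 < p) (hp2 : p ≤ 2) :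
    ∃ K : ℝ, 0 ≤ K ∧ ∀ F ∈ Heat, ∀ G ∈ Heat, ∀ m k : Fin 3, ∀ T₁, 0 ≤ T₁ →
      2 * ∫ t in (0 : ℝ)..T₁, ∫ x, |sd (some m) F (t, x)| * |sd (some k) G (t, x)| ≤
        K * ((∫ x, |F (0, x)| ^ p) + ∫ x, |G (0, x)| ^ (p / (p - 1))) := by
  have hp0 : p - 1 ≠ 0 := by linarith
  have hc : (p - 1)⁻¹ * (p - 1) = 1 := inv_mul_cancel₀ hp0
  obtain ⟨K, hK0, hK⟩ := exists_bell_le hp hc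
  refine ⟨K, hK0, fun F hF G hG m k T₁ hT => ?_⟩
  have hcp : (p - 1)⁻¹ * p = p / (p - 1) := by field_simp
  have hq0 : 0 < p / (p - 1) := div_pos (by linarith) (by linarith)
  rw [hcp] at hK
  have cF := (heat_smooth hF).continuous_slice 0
  have cG := (heat_smooth hG).continuous_slice 0
  have i1 : Integrable fun x => |F (0, x)| ^ p :=
    integrable_T3 (cF.abs.rpow_const fun _ => Or.inr (by linarith))
  have i2 : Integrable fun x => |G (0, x)| ^ (p / (p - 1)) :=
    integrable_T3 (cG.abs.rpow_const fun _ => Or.inr hq0.le)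
  have hlim : Tendsto (fun ε : ℝ => K * ((∫ x, |F (0, x)| ^ p) + (∫ x, |G (0, x)| ^ (p / (p - 1))) +
      Real.sqrt ε ^ p + Real.sqrt ε ^ (p / (p - 1)))) (𝓝[>] 0)
      (𝓝 (K * ((∫ x, |F (0, x)| ^ p) + ∫ x, |G (0, x)| ^ (p / (p - 1))))) := by
    have h1 : ∀ r : ℝ, 0 < r → Tendsto (fun ε : ℝ => Real.sqrt ε ^ r) (𝓝[>] 0) (𝓝 0) := by
      intro r hr
      have : Continuous fun ε : ℝ => Real.sqrt ε ^ r :=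
        Real.continuous_sqrt.rpow_const fun _ => Or.inr hr.le
      have h2 := this.tendsto 0
      rw [Real.sqrt_zero, Real.zero_rpow hr.ne'] at h2
      exact h2.mono_left nhdsWithin_le_nhds
    have := (((h1 p (by linarith)).const_add ((∫ x, |F (0, x)| ^ p) +
      ∫ x, |G (0, x)| ^ (p / (p - 1)))).add (h1 _ hq0)).const_mul K
    simpa using this
  refine ge_of_tendsto hlim ?_
  filter_upwards [self_mem_nhdsWithin] with ε hε
  refine (heat_bellman hp hp2 hc hε hF hG m k T₁ hT).trans ?_
  have hb := (continuous_bell_parts (p := p) (c := (p - 1)⁻¹) hε).1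
  refine (integral_mono (integrable_T3 (hb.comp (cF.prodMk cG)))
    ((((i1.add i2).add (integrable_const (Real.sqrt ε ^ p))).add
      (integrable_const (Real.sqrt ε ^ (p / (p - 1))))).const_mul K)
    fun x => hK ε hε (F (0, x)) (G (0, x))).trans (le_of_eq ?_)
  rw [integral_const_mul]
  congr 1
  have e1 := integral_add ((i1.add i2).add (integrable_const (Real.sqrt ε ^ p)))
    (integrable_const (μ := (volume : Measure T3)) (Real.sqrt ε ^ (p / (p - 1))))
  have e2 := integral_add (i1.add i2) (integrable_const (μ := (volume : Measure T3))
    (Real.sqrt ε ^ p))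
  have e3 := integral_add i1 i2
  simp only [Pi.add_apply, integral_const, probReal_univ, one_smul] at e1 e2 e3 ⊢
  rw [e1, e2, e3]

/-- The square function estimate is symmetric in the two functions. For p ≥ 2 their roles are
exchanged and the estimate is used with the conjugate exponent. -/
lemma exists_abs_integral_mul_hessian_le {p : ℝ} (hp : 1 < p) :
    ∃ K : ℝ, 0 ≤ K ∧ ∀ F ∈ Heat, ∀ W ∈ Heat, ∀ m k : Fin 3,
      |∫ x, F (0, x) * sd (some m) (sd (some k) W) (0, x)| ≤
        K * ((∫ x, |F (0, x)| ^ p) + ∫ x, |lap W (0, x)| ^ (p / (p - 1))) := by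
  rcases le_total p 2 with hp2 | hp2
  · obtain ⟨K, hK0, hK⟩ := exists_abs_integral_mul_hessian_le_of_le_two hp hp2
    exact ⟨K, hK0, fun F hF W hW m k =>
      abs_integral_mul_hessian_le hF hW m k (hK F hF _ (heat_lap hW) m k)⟩
  · have hq : 1 < p / (p - 1) := by rw [lt_div_iff₀ (by linarith)]; linarith
    have hq2 : p / (p - 1) ≤ 2 := by rw [div_le_iff₀ (by linarith)]; linarith
    have hqq : p / (p - 1) / (p / (p - 1) - 1) = p := by
      have : p - 1 ≠ 0 := by linarith
      have h2 : p / (p - 1) - 1 ≠ 0 := by linarith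
      rw [div_eq_iff h2]
      field_simp
      ring
    obtain ⟨K, hK0, hK⟩ := exists_abs_integral_mul_hessian_le_of_le_two hq hq2
    rw [hqq] at hK
    refine ⟨K, hK0, fun F hF W hW m k => abs_integral_mul_hessian_le hF hW m k fun T₁ hT => ?_⟩
    have := hK _ (heat_lap hW) F hF k m T₁ hT
    simp_rw [mul_comm |sd (some k) (lap W) _|] at this
    linarith

/-- Passage to the limit under the integral for uniformly convergent sequences. -/
lemma tendsto_integral_comp {Φ : ℝ → ℝ} (hΦ : Continuous Φ) {f h : T3 → ℝ} (hf : Continuous f)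
    (hh : Continuous h) {g : ℕ → T3 → ℝ} (hg : ∀ n, Continuous (g n)) {δ : ℕ → ℝ}
    (hδ : Tendsto δ atTop (𝓝 0)) (hgf : ∀ n x, |g n x - f x| ≤ δ n) :
    Tendsto (fun n => ∫ x, Φ (g n x) * h x) atTop (𝓝 (∫ x, Φ (f x) * h x)) := by
  obtain ⟨M, hM⟩ := (isCompact_univ.image hf.norm).bddAbove
  obtain ⟨D, hD⟩ := hδ.bddAbove_range
  obtain ⟨B, hB⟩ := ((isCompact_closedBall (0 : ℝ) (M + D)).image hΦ.norm).bddAbove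
  obtain ⟨M', hM'⟩ := (isCompact_univ.image hh.norm).bddAbove
  refine tendsto_integral_of_dominated_convergence (fun _ => B * M')
    (fun n => ((hΦ.comp (hg n)).mul hh).aestronglyMeasurable) (integrable_const _) ?_ ?_
  · intro n
    refine Eventually.of_forall fun x => ?_
    rw [norm_mul]
    have h1 : ‖Φ (g n x)‖ ≤ B := by
      refine hB ⟨g n x, ?_, rfl⟩
      rw [Metric.mem_closedBall, dist_zero_right, Real.norm_eq_abs]
      have e1 : |f x| ≤ M := hM ⟨x, mem_univ _, rfl⟩
      have e2 : δ n ≤ D := hD ⟨n, rfl⟩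
      have e3 := abs_sub_abs_le_abs_sub (g n x) (f x)
      linarith [hgf n x]
    exact mul_le_mul h1 (hM' ⟨x, mem_univ _, rfl⟩) (norm_nonneg _) ((norm_nonneg _).trans h1)
  · refine Eventually.of_forall fun x => ?_
    refine Tendsto.mul_const _ ((hΦ.tendsto _).comp ?_)
    rw [tendsto_iff_norm_sub_tendsto_zero]
    exact squeeze_zero (fun _ => norm_nonneg _) (fun n => hgf n x) hδ

lemma exists_heat_approx {f : T3 → ℝ} (hf : Continuous f) :
    ∃ F : ℕ → ST → ℝ, (∀ n, F n ∈ Heat) ∧ ∀ n x, |F n (0, x) - f x| ≤ 1 / ((n : ℝ) + 1) := by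
  have h : ∀ n : ℕ, ∃ F ∈ Heat, ∀ x, |F (0, x) - f x| < 1 / ((n : ℝ) + 1) :=
    fun n => heat_dense hf Nat.one_div_pos_of_nat
  choose F hF hlt using h
  exact ⟨F, hF, fun n x => (hlt n x).le⟩

/-- The left side is invariant under S ↦ lS, W ↦ W/l while the right side is not. The free parameter
l later makes the second term small enough to be absorbed. -/
lemma exists_abs_integral_continuous_mul_hessian_le {p : ℝ} (hp : 1 < p) :
    ∃ K : ℝ, 0 ≤ K ∧ ∀ S : T3 → ℝ, Continuous S → ∀ W ∈ Heat, ∀ m k : Fin 3, ∀ l : ℝ, 0 < l →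
      |∫ x, S x * sd (some m) (sd (some k) W) (0, x)| ≤
        K * (l ^ p * (∫ x, |S x| ^ p) +
          (l ^ (p / (p - 1)))⁻¹ * ∫ x, |lap W (0, x)| ^ (p / (p - 1))) := by
  obtain ⟨K, hK0, hK⟩ := exists_abs_integral_mul_hessian_le hp
  have h1 : ∀ S : T3 → ℝ, Continuous S → ∀ W ∈ Heat, ∀ m k : Fin 3,
      |∫ x, S x * sd (some m) (sd (some k) W) (0, x)| ≤
        K * ((∫ x, |S x| ^ p) + ∫ x, |lap W (0, x)| ^ (p / (p - 1))) := by
    intro S hS W hW m k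
    obtain ⟨F, hF, hFS⟩ := exists_heat_approx hS
    have cF : ∀ n, Continuous fun x => F n (0, x) := fun n => (heat_smooth (hF n)).continuous_slice 0
    have cV := (((heat_smooth hW).sd (some k)).sd (some m)).continuous_slice 0
    have hδ := tendsto_one_div_add_atTop_nhds_zero_nat (𝕜 := ℝ)
    have l1 := tendsto_integral_comp (Φ := id) continuous_id hS cV cF hδ hFS
    have l2 := tendsto_integral_comp (Φ := fun s => |s| ^ p)
      (continuous_abs.rpow_const fun _ => Or.inr (by linarith)) hS
      (continuous_const (y := (1 : ℝ))) cF hδ hFS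
    simp only [id, mul_one] at l1 l2
    exact le_of_tendsto_of_tendsto' l1.abs ((l2.add_const _).const_mul K)
      fun n => hK _ (hF n) W hW m k
  refine ⟨K, hK0, fun S hS W hW m k l hl => ?_⟩
  have h2 := h1 (fun x => l * S x) (continuous_const.mul hS) (fun z => l⁻¹ * W z)
    (Heat.smul_mem _ hW) m k
  have e1 : ∀ z, sd (some m) (sd (some k) fun z => l⁻¹ * W z) z =
      l⁻¹ * sd (some m) (sd (some k) W) z := by
    intro z
    rw [show sd (some k) (fun z => l⁻¹ * W z) = fun z => l⁻¹ * sd (some k) W z from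
      funext fun z => sd_const_mul _ (heat_smooth hW) _ z,
      sd_const_mul _ ((heat_smooth hW).sd _)]
  have e2 : ∀ z, lap (fun z => l⁻¹ * W z) z = l⁻¹ * lap W z :=
    fun z => lap_const_mul _ (heat_smooth hW) z
  have e3 : ∀ a b : ℝ, l * a * (l⁻¹ * b) = a * b := fun a b => by field_simp
  have e4 : ∀ r a : ℝ, |l * a| ^ r = l ^ r * |a| ^ r := fun r a => by
    rw [abs_mul, abs_of_pos hl, Real.mul_rpow hl.le (abs_nonneg _)]
  have e5 : ∀ r a : ℝ, |l⁻¹ * a| ^ r = (l ^ r)⁻¹ * |a| ^ r := fun r a => by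
    rw [abs_mul, abs_of_pos (inv_pos.2 hl), Real.mul_rpow (inv_pos.2 hl).le (abs_nonneg _),
      Real.inv_rpow hl.le]
  simp only [e1, e2, e3, e4, e5, integral_const_mul] at h2
  exact h2

/-- The duality map `x ↦ |x|^{p-2} x`. -/
def dualMap (r x : ℝ) : ℝ := max x 0 ^ r - max (-x) 0 ^ r

lemma continuous_dualMap {r : ℝ} (hr : 0 ≤ r) : Continuous (dualMap r) := by
  unfold dualMap
  exact ((continuous_id.max continuous_const).rpow_const fun _ => Or.inr hr).sub
    ((continuous_neg.max continuous_const).rpow_const fun _ => Or.inr hr)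

lemma abs_dualMap {r : ℝ} (hr : 0 < r) (x : ℝ) : |dualMap r x| = |x| ^ r := by
  unfold dualMap
  rcases le_total 0 x with hx | hx
  · rw [max_eq_left hx, max_eq_right (by linarith), Real.zero_rpow hr.ne', sub_zero, abs_of_nonneg hx,
      abs_of_nonneg (Real.rpow_nonneg hx r)]
  · rw [max_eq_right hx, max_eq_left (by linarith), Real.zero_rpow hr.ne', zero_sub, abs_neg,
      abs_of_nonpos hx, abs_of_nonneg (Real.rpow_nonneg (by linarith) r)]

lemma mul_dualMap {r : ℝ} (hr : 0 < r) (x : ℝ) : dualMap r x * x = |x| ^ (r + 1) := by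
  unfold dualMap
  rcases le_total 0 x with hx | hx
  · rw [max_eq_left hx, max_eq_right (by linarith), Real.zero_rpow hr.ne', sub_zero, abs_of_nonneg hx,
      Real.rpow_add_one' hx (by linarith)]
  · rw [max_eq_right hx, max_eq_left (by linarith), Real.zero_rpow hr.ne', zero_sub,
      abs_of_nonpos hx, Real.rpow_add_one' (by linarith) (by linarith)]
    ring

lemma abs_integral_rpow_le {f : T3 → ℝ} (hf : Integrable f) {r : ℝ} (hr : 1 ≤ r)
    (hfr : Integrable fun x => |f x| ^ r) : |∫ x, f x| ^ r ≤ ∫ x, |f x| ^ r := by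
  have h1 := (convexOn_rpow hr).map_integral_le (μ := (volume : Measure T3))
    (f := fun x => |f x|) (Real.continuous_rpow_const (by linarith)).continuousOn isClosed_Ici
    (Eventually.of_forall fun x => abs_nonneg (f x)) hf.abs hfr
  exact (Real.rpow_le_rpow (abs_nonneg _) abs_integral_le_integral_abs (by linarith)).trans h1

lemma integral_lap_eq_zero {W : ST → ℝ} (hW : SmoothST W) (t : ℝ) : ∫ x, lap W (t, x) = 0 := by
  unfold lap
  rw [integral_finsetSum _ fun i _ => integrable_T3 (((hW.sd _).sd _).continuous_slice t)]
  refine Finset.sum_eq_zero fun i _ => ?_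
  have := integral_space_parts (hW.sd (some i)) (smoothST_const 1) i t
  simpa [sd] using this

/-- The Calderón–Zygmund inequality for continuous data. -/
theorem calderon_zygmund {p : ℝ} (hp : 1 < p) :
    ∃ C : ℝ, 0 ≤ C ∧ ∀ (H : T3 → ℝ) (S : Fin 3 → Fin 3 → T3 → ℝ), Continuous H →
      (∀ m k, Continuous (S m k)) →
      (∀ W ∈ Heat, ∫ x, H x * lap W (0, x) =
        ∑ m, ∑ k, ∫ x, S m k x * sd (some m) (sd (some k) W) (0, x)) →
      ∫ x, |H x - ∫ y, H y| ^ p ≤ C * ∑ m, ∑ k, ∫ x, |S m k x| ^ p := by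
  obtain ⟨K, hK0, hK⟩ := exists_abs_integral_continuous_mul_hessian_le hp
  set q := p / (p - 1) with hq
  have hp1 : 0 < p - 1 := by linarith
  have hq1 : 1 < q := by rw [hq, lt_div_iff₀ hp1]; linarith
  have hqp : (p - 1) * q = p := by rw [hq]; field_simp
  -- The factor 18 is twice the number of entries of the tensor: the nine error terms then add up to
  -- at most half of the left side. The added 1 keeps L positive when K = 0.
  set L : ℝ := 18 * K * 2 ^ (q + 1) + 1 with hL
  have hL1 : 0 < L := by positivity
  set l : ℝ := L ^ q⁻¹ with hl
  have hl0 : 0 < l := Real.rpow_pos_of_pos hL1 _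
  have hlq : l ^ q = L := by
    rw [hl, ← Real.rpow_mul hL1.le, inv_mul_cancel₀ (by linarith), Real.rpow_one]
  refine ⟨2 * (K * l ^ p), by positivity, fun H S hH hS hrel => ?_⟩
  set H₀ : T3 → ℝ := fun x => H x - ∫ y, H y with hH₀
  have cH₀ : Continuous H₀ := hH.sub continuous_const
  have hH₀mean : ∫ x, H₀ x = 0 := by
    rw [hH₀]
    simp only
    rw [integral_sub (integrable_T3 hH) (integrable_const _)]
    simp
  -- The extremal function of the duality between L^p and L^q: its pairing with H₀ is the p-th power
  -- of the norm, and |η|^q = |H₀|^p.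
  set η : T3 → ℝ := fun x => dualMap (p - 1) (H₀ x) with hη
  have cη : Continuous η := (continuous_dualMap hp1.le).comp cH₀
  set X := ∫ x, |H₀ x| ^ p with hX
  have hX0 : 0 ≤ X := integral_nonneg fun x => by positivity
  obtain ⟨g, hg, hgη⟩ := exists_heat_approx cη
  -- The relation can only be tested with Laplacians, so the approximations of η are written as ΔW
  -- up to a constant, and H₀ has mean zero.
  choose W hW c hWc using fun n => heat_poisson (hg n)
  have cg : ∀ n, Continuous fun x => g n (0, x) := fun n => (heat_smooth (hg n)).continuous_slice 0
  have cW : ∀ n, Continuous fun x => lap (W n) (0, x) :=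
    fun n => (heat_smooth (heat_lap (hW n))).continuous_slice 0
  have hc : ∀ n, c n = ∫ x, g n (0, x) := by
    intro n
    have h := integral_lap_eq_zero (heat_smooth (hW n)) 0
    simp_rw [hWc] at h
    rw [integral_sub (integrable_T3 (cg n)) (integrable_const _)] at h
    simp only [integral_const, probReal_univ, one_smul] at h
    linarith
  have hδ := tendsto_one_div_add_atTop_nhds_zero_nat (𝕜 := ℝ)
  -- the left-hand side
  have hlhs : ∀ n, ∫ x, H x * lap (W n) (0, x) = ∫ x, g n (0, x) * H₀ x := by
    intro n
    have e1 : ∫ x, H x * lap (W n) (0, x) = ∫ x, H₀ x * lap (W n) (0, x) := by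
      have i1 : Integrable fun x => H x * lap (W n) (0, x) := integrable_T3 (hH.mul (cW n))
      simp only [hH₀, sub_mul]
      rw [integral_sub i1 ((integrable_T3 (cW n)).const_mul _),
        integral_const_mul, integral_lap_eq_zero (heat_smooth (hW n)), mul_zero, sub_zero]
    have i2 : Integrable fun x => H₀ x * g n (0, x) := integrable_T3 (cH₀.mul (cg n))
    rw [e1]
    simp_rw [hWc, mul_sub]
    rw [integral_sub i2 ((integrable_T3 cH₀).mul_const _),
      integral_mul_const, hH₀mean, zero_mul, sub_zero]
    simp_rw [mul_comm]
  have hl1 : Tendsto (fun n => ∫ x, g n (0, x) * H₀ x) atTop (𝓝 X) := by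
    have := tendsto_integral_comp (Φ := id) continuous_id cη cH₀ cg hδ hgη
    simp only [id, hη, mul_dualMap hp1, sub_add_cancel] at this
    exact this
  -- the right-hand side
  have hmean : Tendsto c atTop (𝓝 (∫ x, η x)) := by
    have := tendsto_integral_comp (Φ := id) continuous_id cη (continuous_const (y := (1 : ℝ))) cg hδ
      hgη
    simp only [id, mul_one] at this
    exact this.congr fun n => (hc n).symm
  have hη1 : ∀ n x, |lap (W n) (0, x) - (η x - ∫ y, η y)| ≤
      1 / ((n : ℝ) + 1) + |c n - ∫ y, η y| := by
    intro n x
    rw [hWc]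
    have : g n (0, x) - c n - (η x - ∫ y, η y) = (g n (0, x) - η x) - (c n - ∫ y, η y) := by ring
    rw [this]
    exact (abs_sub _ _).trans (add_le_add (hgη n x) le_rfl)
  have hδ' : Tendsto (fun n : ℕ => 1 / ((n : ℝ) + 1) + |c n - ∫ y, η y|) atTop (𝓝 0) := by
    have h1 : Tendsto (fun n => |c n - ∫ y, η y|) atTop (𝓝 0) := by
      have := (hmean.sub_const (∫ y, η y)).abs
      simpa using this
    simpa using hδ.add h1
  have hl2 : Tendsto (fun n => ∫ x, |lap (W n) (0, x)| ^ q) atTop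
      (𝓝 (∫ x, |η x - ∫ y, η y| ^ q)) := by
    have := tendsto_integral_comp (Φ := fun s => |s| ^ q) (f := fun x => η x - ∫ y, η y)
      (continuous_abs.rpow_const fun _ => Or.inr (by linarith)) (cη.sub continuous_const)
      (continuous_const (y := (1 : ℝ))) cW hδ' hη1
    simpa only [mul_one] using this
  have hηq : ∀ x, |η x| ^ q = |H₀ x| ^ p := by
    intro x
    rw [hη]
    simp only
    rw [abs_dualMap hp1, ← Real.rpow_mul (abs_nonneg _), hqp]
  have hηi : Integrable fun x => |η x| ^ q :=
    integrable_T3 (cη.abs.rpow_const fun _ => Or.inr (by linarith))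
  -- A factor 2^q from splitting the difference and a further factor 2 from Jensen's inequality for
  -- the mean of η.
  have hηX : ∫ x, |η x - ∫ y, η y| ^ q ≤ 2 ^ (q + 1) * X := by
    have h1 : ∀ x, |η x - ∫ y, η y| ^ q ≤ 2 ^ q * (|η x| ^ q + |∫ y, η y| ^ q) := fun x =>
      (Real.rpow_le_rpow (abs_nonneg _) (abs_sub _ _) (by linarith)).trans
        (Bellman.add_rpow_le_two (abs_nonneg _) (abs_nonneg _) (by linarith))
    refine (integral_mono (integrable_T3 ((cη.sub continuous_const).abs.rpow_const
      fun _ => Or.inr (by linarith))) ((hηi.add (integrable_const _)).const_mul _) h1).trans ?_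
    rw [integral_const_mul]
    have e1 := integral_add hηi (integrable_const (μ := (volume : Measure T3)) (|∫ y, η y| ^ q))
    simp only [integral_const, probReal_univ, one_smul] at e1
    simp only [Pi.add_apply]
    rw [e1, Real.rpow_add_one (by norm_num), mul_assoc]
    refine mul_le_mul_of_nonneg_left ?_ (by positivity)
    have e2 := abs_integral_rpow_le (integrable_T3 cη) hq1.le hηi
    simp_rw [hηq] at e2 ⊢
    linarith
  have hmain : X ≤ ∑ m, ∑ k, K * (l ^ p * (∫ x, |S m k x| ^ p) + L⁻¹ * (2 ^ (q + 1) * X)) := by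
    have hlim : Tendsto (fun n => ∑ m, ∑ k, K * (l ^ p * (∫ x, |S m k x| ^ p) +
        L⁻¹ * ∫ x, |lap (W n) (0, x)| ^ q)) atTop
        (𝓝 (∑ m, ∑ k, K * (l ^ p * (∫ x, |S m k x| ^ p) +
          L⁻¹ * ∫ x, |η x - ∫ y, η y| ^ q))) :=
      tendsto_finsetSum _ fun m _ => tendsto_finsetSum _ fun k _ =>
        ((hl2.const_mul _).const_add _).const_mul _
    refine (le_of_tendsto_of_tendsto' hl1 hlim fun n => ?_).trans ?_
    · rw [← hlhs, hrel _ (hW n)]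
      refine Finset.sum_le_sum fun m _ => Finset.sum_le_sum fun k _ => ?_
      have := hK (S m k) (hS m k) (W n) (hW n) m k l hl0
      rw [hlq] at this
      exact (le_abs_self _).trans this
    · refine Finset.sum_le_sum fun m _ => Finset.sum_le_sum fun k _ => ?_
      refine mul_le_mul_of_nonneg_left (add_le_add le_rfl ?_) hK0
      exact mul_le_mul_of_nonneg_left hηX (by positivity)
  have hsum : ∑ m : Fin 3, ∑ k : Fin 3, K * (l ^ p * (∫ x, |S m k x| ^ p) +
      L⁻¹ * (2 ^ (q + 1) * X)) = K * l ^ p * (∑ m, ∑ k, ∫ x, |S m k x| ^ p) +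
      9 * (K * (L⁻¹ * (2 ^ (q + 1) * X))) := by
    simp only [mul_add, Finset.sum_add_distrib, ← Finset.mul_sum, Finset.sum_const,
      Finset.card_univ, Fintype.card_fin, nsmul_eq_mul]
    push_cast
    ring
  rw [hsum] at hmain
  -- Absorption: L was chosen so that the error terms are at most X/2.
  have habs : 9 * (K * (L⁻¹ * (2 ^ (q + 1) * X))) ≤ X / 2 := by
    have h1 : 9 * (K * (L⁻¹ * (2 ^ (q + 1) * X))) = (18 * K * 2 ^ (q + 1)) / L * (X / 2) := by
      field_simp
      ring
    rw [h1]
    refine mul_le_of_le_one_left (by positivity) ?_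
    rw [div_le_one hL1, hL]
    linarith
  have : X ≤ 2 * (K * l ^ p * (∑ m, ∑ k, ∫ x, |S m k x| ^ p)) := by linarith
  rw [mul_assoc 2]
  linarith

end

section

/-! ### Mollification on the torus -/

section TorusMollification

variable {κ : E3 → ℝ} {f : T3 → ℝ}

lemma continuous_conv_proj (hκ : ContDiff ℝ ∞ κ) (hc : HasCompactSupport κ) (hf : Integrable f) :
    Continuous (conv projHom κ f) := by
  refine continuous_of_comp_proj ?_
  have h := (isCovering_projHom.contDiff_conv hκ hc hf 0).continuous
  simp only [zero_add] at h
  exact h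

/-- Minkowski's integral inequality for an average. -/
lemma eLpNorm_integral_le {X Y : Type*} [MeasurableSpace X] [MeasurableSpace Y] {μ : Measure X}
    [IsProbabilityMeasure μ] {ν : Measure Y} [SFinite ν] {g : X × Y → ℝ}
    (hg : AEStronglyMeasurable g (μ.prod ν)) {r : ℝ} (hr : 1 ≤ r) {ε : ℝ≥0∞}
    (hε : ∀ᵐ l ∂μ, eLpNorm (fun x => g (l, x)) (.ofReal r) ν ≤ ε) :
    eLpNorm (fun x => ∫ l, g (l, x) ∂μ) (.ofReal r) ν ≤ ε := by
  have hr0 : 0 < r := by linarith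
  have conv_norm : ∀ g : Y → ℝ, eLpNorm g (.ofReal r) ν ^ r = ∫⁻ x, ‖g x‖ₑ ^ r ∂ν := by
    intro g
    rw [eLpNorm_eq_lintegral_rpow_enorm_toReal (by simpa using hr0) ENNReal.ofReal_ne_top,
      ENNReal.toReal_ofReal hr0.le, ← ENNReal.rpow_mul, one_div, inv_mul_cancel₀ hr0.ne',
      ENNReal.rpow_one]
  rw [← ENNReal.rpow_le_rpow_iff hr0, conv_norm]
  have hg' := hg.prod_swap
  -- Jensen's inequality for the probability measure at fixed x; Tonelli's theorem then exchanges
  -- the two integrations.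
  have key : ∀ᵐ x ∂ν, ‖∫ l, g (l, x) ∂μ‖ₑ ^ r ≤ ∫⁻ l, ‖g (l, x)‖ₑ ^ r ∂μ := by
    filter_upwards [hg'.prodMk_left] with x hx
    have hx : AEStronglyMeasurable (fun l => g (l, x)) μ := hx
    have e3 := eLpNorm'_le_eLpNorm'_of_exponent_le zero_lt_one hr μ hx
    simp only [eLpNorm', ENNReal.rpow_one, div_one, one_div] at e3
    calc _ ≤ ((∫⁻ l, ‖g (l, x)‖ₑ ^ r ∂μ) ^ r⁻¹) ^ r :=
          ENNReal.rpow_le_rpow ((enorm_integral_le_lintegral_enorm _).trans (by simpa using e3)) hr0.le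
      _ = _ := by rw [← ENNReal.rpow_mul, inv_mul_cancel₀ hr0.ne', ENNReal.rpow_one]
  refine (lintegral_mono_ae key).trans ?_
  rw [lintegral_lintegral_swap (hg'.enorm.pow_const r)]
  calc ∫⁻ l, ∫⁻ x, ‖g (l, x)‖ₑ ^ r ∂ν ∂μ ≤ ∫⁻ _, ε ^ r ∂μ := by
        refine lintegral_mono_ae ?_
        filter_upwards [hε] with l hl
        rw [← conv_norm]
        exact ENNReal.rpow_le_rpow hl hr0.le
    _ = ε ^ r := by simp

/-- The kernel is a probability density, so the difference is an average over shifts and Minkowski's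
inequality applies. The parameter c is 0 for the contraction property and 1 for the approximation
property. -/
lemma eLpNorm_conv_sub_le (hκ : Continuous κ) (hc : HasCompactSupport κ) (h0 : ∀ l, 0 ≤ κ l)
    (h1 : ∫ l, κ l = 1) {r : ℝ} (hr : 1 ≤ r) (hf : Integrable f) (c : ℝ) {ε : ℝ≥0∞}
    (hε : ∀ l, κ l ≠ 0 → eLpNorm (fun x => f (x + projHom l) - c * f x) (.ofReal r) volume ≤ ε) :
    eLpNorm (fun x => conv projHom κ f x - c * f x) (.ofReal r) volume ≤ ε := by
  have hκi : Integrable κ := hκ.integrable_of_hasCompactSupport hc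
  have hwm : Measurable fun l => ENNReal.ofReal (κ l) := hκ.measurable.ennreal_ofReal
  set μ : Measure E3 := volume.withDensity fun l => ENNReal.ofReal (κ l) with hμ
  have : IsProbabilityMeasure μ := ⟨by
    rw [hμ, withDensity_apply _ MeasurableSet.univ, Measure.restrict_univ,
      ← ofReal_integral_eq_lintegral_ofReal hκi (Eventually.of_forall h0), h1, ENNReal.ofReal_one]⟩
  have hae : AEStronglyMeasurable (fun p : E3 × T3 => f (p.2 + projHom p.1) - c * f p.2)
      (μ.prod volume) :=
    ((isCovering_projHom.aesm_shear hf.1).sub ((hf.1.comp_snd).const_mul c)).mono_ac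
      ((withDensity_absolutelyContinuous _ _).prod Measure.AbsolutelyContinuous.rfl)
  have e1 : ∀ x, conv projHom κ f x - c * f x = ∫ l, (f (x + projHom l) - c * f x) ∂μ := by
    intro x
    rw [hμ, integral_withDensity_eq_integral_toReal_smul hwm
      (Eventually.of_forall fun _ => ENNReal.ofReal_lt_top)]
    simp only [ENNReal.toReal_ofReal (h0 _), smul_eq_mul, mul_sub]
    rw [integral_sub (isCovering_projHom.integrable_conv_integrand hκ hc hf x)
      (hκi.mul_const _), integral_mul_const, h1, one_mul]
    rfl
  simp_rw [e1]
  refine eLpNorm_integral_le hae hr ?_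
  rw [hμ, ae_withDensity_iff hwm]
  refine Eventually.of_forall fun l hl => hε l fun h => ?_
  simp [h] at hl

/-- A sequence of mollifiers concentrating at the origin. -/
def moll (N : ℕ) : E3 → ℝ :=
  (⟨1 / (2 * (N + 1)), 1 / (N + 1), by positivity, by
    rw [div_lt_div_iff₀ (by positivity) (by positivity)]
    nlinarith [(Nat.cast_nonneg N : (0 : ℝ) ≤ N)]⟩ : ContDiffBump (0 : E3)).normed volume

lemma contDiff_moll (N : ℕ) : ContDiff ℝ ∞ (moll N) := ContDiffBump.contDiff_normed _

lemma hasCompactSupport_moll (N : ℕ) : HasCompactSupport (moll N) :=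
  ContDiffBump.hasCompactSupport_normed _

lemma moll_nonneg (N : ℕ) (l : E3) : 0 ≤ moll N l := ContDiffBump.nonneg_normed _ _

lemma integral_moll (N : ℕ) : ∫ l, moll N l = 1 := ContDiffBump.integral_normed _

lemma norm_lt_of_moll_ne_zero {N : ℕ} {l : E3} (h : moll N l ≠ 0) : ‖l‖ < 1 / ((N : ℝ) + 1) := by
  have : l ∈ Function.support (moll N) := h
  rw [moll, ContDiffBump.support_normed_eq] at this
  simpa using this

lemma eLpNorm_conv_moll_le {r : ℝ} (hr : 1 ≤ r) (hf : Integrable f) (N : ℕ) :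
    eLpNorm (conv projHom (moll N) f) (.ofReal r) volume ≤ eLpNorm f (.ofReal r) volume := by
  have := eLpNorm_conv_sub_le (contDiff_moll N).continuous (hasCompactSupport_moll N)
    (moll_nonneg N) (integral_moll N) hr hf 0 (ε := eLpNorm f (.ofReal r) volume) fun l _ => by
      simp only [zero_mul, sub_zero]
      exact (eLpNorm_comp_measurePreserving hf.1
        (measurePreserving_add_right volume (projHom l))).le
  simpa using this

lemma tendsto_eLpNorm_conv_moll {r : ℝ} (hr : 1 ≤ r) (hf : MemLp f (.ofReal r)) :
    Tendsto (fun N => eLpNorm (fun x => conv projHom (moll N) f x - f x) (.ofReal r) volume) atTop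
      (𝓝 0) := by
  have hr' : 1 ≤ ENNReal.ofReal r := by simpa using hr
  have h1 := (tendsto_eLpNorm_shift_sub hr' ENNReal.ofReal_ne_top hf 0).comp
    ((isCovering_projHom.continuous.tendsto 0).trans (by simp [map_zero]))
  rw [ENNReal.tendsto_nhds_zero] at h1 ⊢
  intro ε hε
  obtain ⟨δ, hδ, hb⟩ := Metric.eventually_nhds_iff_ball.1 (h1 ε hε)
  obtain ⟨N₀, hN₀⟩ := exists_nat_one_div_lt hδ
  filter_upwards [eventually_ge_atTop N₀] with N hN
  have := eLpNorm_conv_sub_le (contDiff_moll N).continuous (hasCompactSupport_moll N)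
    (moll_nonneg N) (integral_moll N) hr (hf.integrable hr') 1 (ε := ε) fun l hl => by
      have hl' := norm_lt_of_moll_ne_zero hl
      have hm : l ∈ Metric.ball (0 : E3) δ := by
        rw [mem_ball_zero_iff]
        refine hl'.trans (lt_of_le_of_lt ?_ hN₀)
        gcongr
      simpa using hb l hm
  simpa using this

end TorusMollification

/-! ### The Calderón–Zygmund inequality for integrable data -/

lemma mode_shift (k : Fin 3 → ℤ) (φ : ℝ) (l : E3) :
    (fun z => mode k φ (z + stHom (0, l))) = mode k (φ + ∑ i, 2 * Real.pi * k i * l i) := by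
  funext z
  obtain ⟨y, rfl⟩ := stHom_surjective z
  rw [← map_add, mode_stHom, mode_stHom]
  simp only [Prod.fst_add, add_zero, Prod.snd_add, PiLp.add_apply, mul_add, Finset.sum_add_distrib]
  congr 2
  ring

lemma heat_shift {W : ST → ℝ} (hW : W ∈ Heat) (w : T3) :
    (fun z => W (z + ((0 : ℝ), w))) ∈ Heat := by
  obtain ⟨l, rfl⟩ := proj_surjective w
  refine heat_induction (p := fun W => (fun z => W (z + ((0 : ℝ), proj l))) ∈ Heat) ?_ ?_ ?_ ?_ hW
  · intro k φ
    have := mode_shift k φ l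
    change (fun z => mode k φ (z + ((0 : ℝ), proj l))) = _ at this
    rw [this]
    exact mode_mem _ _
  · exact Heat.zero_mem
  · exact fun f g _ _ hf hg => Heat.add_mem hf hg
  · exact fun c f _ hf => Heat.smul_mem c hf

lemma sd_shift (α : Option (Fin 3)) (f : ST → ℝ) (w z : ST) :
    sd α (fun z => f (z + w)) z = sd α f (z + w) := by
  simp only [sd, add_right_comm]

lemma lap_shift (f : ST → ℝ) (w z : ST) : lap (fun z => f (z + w)) z = lap f (z + w) := by
  have h : ∀ α, HallMHD.sd α (fun z => f (z + w)) = fun z => HallMHD.sd α f (z + w) :=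
    fun α => funext fun z => sd_shift α f w z
  simp only [lap, h, sd_shift]

/-- Linear relations with constant coefficients, tested with trigonometric polynomials, are stable
under mollification. -/
lemma conv_relation {ι : Type*} [Fintype ι] {κ : E3 → ℝ} (hκ : Continuous κ)
    (hc : HasCompactSupport κ) {F : ι → T3 → ℝ} (hF : ∀ a, Integrable (F a))
    (L : ι → (ST → ℝ) → ST → ℝ) (hL : ∀ a, ∀ W ∈ Heat, SmoothST (L a W))
    (hLs : ∀ a W w z, L a (fun z => W (z + w)) z = L a W (z + w))
    (h : ∀ W ∈ Heat, ∑ a, ∫ x, F a x * L a W (0, x) = 0) {W : ST → ℝ} (hW : W ∈ Heat) :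
    ∑ a, ∫ x, conv projHom κ (F a) x * L a W (0, x) = 0 := by
  -- The mollification is moved onto the test function, which becomes an average of translates;
  -- translates of trigonometric polynomials are again trigonometric polynomials.
  have e : ∀ a, ∫ x, conv projHom κ (F a) x * L a W (0, x) =
      ∫ l, κ l * ∫ x, F a x * L a W (0, x - projHom l) := by
    intro a
    have h1 := isCovering_projHom.integral_mul_conv hκ hc
      (integrable_T3 ((hL a W hW).continuous_slice 0)) (hF a)
    simp_rw [mul_comm (conv _ _ _ _)]
    rw [h1]
    congr with l
    congr 1
    have := integral_sub_right_eq_self (μ := (volume : Measure T3))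
      (fun x => L a W (0, x) * F a (x + projHom l)) (projHom l)
    simp only [sub_add_cancel] at this
    rw [corr, ← this]
    simp_rw [mul_comm]
  have hi : ∀ a, Integrable fun l => κ l * ∫ x, F a x * L a W (0, x - projHom l) := by
    intro a
    have h1 := (isCovering_projHom.integrable_prod hκ hc
      (integrable_T3 ((hL a W hW).continuous_slice 0)) (hF a)).integral_prod_right
    refine h1.congr (Eventually.of_forall fun l => ?_)
    have := integral_sub_right_eq_self (μ := (volume : Measure T3))
      (fun x => L a W (0, x) * (κ l * F a (x + projHom l))) (projHom l)
    simp only [sub_add_cancel] at this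
    simp only
    rw [← this, ← integral_const_mul]
    congr with x
    ring
  simp_rw [e]
  rw [← integral_finsetSum _ fun a _ => hi a]
  refine integral_eq_zero_of_ae (Eventually.of_forall fun l => ?_)
  simp only [← Finset.mul_sum, Pi.zero_apply]
  have := h _ (heat_shift hW (-projHom l))
  simp only [hLs, Prod.mk_add_mk, add_zero, ← sub_eq_add_neg] at this
  rw [this, mul_zero]

end

/-! ### Lebesgue-norm form of the Calderón–Zygmund inequality and its extension to integrable data
-/

section

/-- Convergence in L¹ gives almost everywhere convergence of a subsequence, and Fatou's lemma does
the rest. No convergence in L^p is needed, and the limit is not assumed to lie in L^p. -/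
lemma eLpNorm_le_of_tendsto {X : Type*} [MeasurableSpace X] {μ : Measure X} {p : ℝ≥0∞}
    {g : ℕ → X → ℝ} {f : X → ℝ} (hg : ∀ n, AEStronglyMeasurable (g n) μ)
    (hf : AEStronglyMeasurable f μ)
    (h : Tendsto (fun n => eLpNorm (fun x => g n x - f x) 1 μ) atTop (𝓝 0)) {K : ℝ≥0∞}
    (hK : ∀ n, eLpNorm (g n) p μ ≤ K) : eLpNorm f p μ ≤ K := by
  obtain ⟨ns, -, hns⟩ := (tendstoInMeasure_of_tendsto_eLpNorm one_ne_zero hg hf h).exists_seq_tendsto_ae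
  refine (Lp.eLpNorm_lim_le_liminf_eLpNorm (fun n => hg (ns n)) f hns).trans ?_
  exact liminf_le_of_le (by isBoundedDefault) fun b hb => by
    obtain ⟨n, hn⟩ := hb.exists
    exact hn.trans (hK _)

lemma integral_conv_proj {κ : E3 → ℝ} (hκ : Continuous κ) (hc : HasCompactSupport κ) {f : T3 → ℝ}
    (hf : Integrable f) : ∫ x, conv projHom κ f x = (∫ l, κ l) * ∫ x, f x := by
  have := isCovering_projHom.integral_mul_conv hκ hc (integrable_T3 (continuous_const (y := 1))) hf
  simp only [one_mul] at this
  rw [this, ← integral_mul_const]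
  congr with l
  rw [corr]
  simp only [one_mul]
  rw [integral_add_right_eq_self f]

lemma eLpNorm_rpow_eq {X : Type*} [MeasurableSpace X] {μ : Measure X} {p : ℝ} (hp : 0 < p)
    (f : X → ℝ) : eLpNorm f (.ofReal p) μ ^ p = ∫⁻ x, ‖f x‖ₑ ^ p ∂μ := by
  rw [eLpNorm_eq_lintegral_rpow_enorm_toReal (by simpa using hp) ENNReal.ofReal_ne_top,
    ENNReal.toReal_ofReal hp.le, ← ENNReal.rpow_mul, one_div, inv_mul_cancel₀ hp.ne',
    ENNReal.rpow_one]

/-- The Calderón–Zygmund inequality for continuous data in terms of Lebesgue norms. -/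
lemma calderon_zygmund_eLpNorm {p : ℝ} (hp : 1 < p) :
    ∃ C : ℝ≥0∞, C ≠ ⊤ ∧ ∀ (H : T3 → ℝ) (S : Fin 3 → Fin 3 → T3 → ℝ), Continuous H →
      (∀ m k, Continuous (S m k)) →
      (∀ W ∈ Heat, ∫ x, H x * lap W (0, x) =
        ∑ m, ∑ k, ∫ x, S m k x * sd (some m) (sd (some k) W) (0, x)) →
      eLpNorm (fun x => H x - ∫ y, H y) (.ofReal p) volume ≤
        C * ∑ m, ∑ k, eLpNorm (S m k) (.ofReal p) volume := by
  have hp0 : 0 < p := by linarith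
  obtain ⟨C, hC0, hC⟩ := calderon_zygmund hp
  -- Nine is the number of tensor entries, each of whose norms is replaced by the sum of all of
  -- them.
  refine ⟨(ENNReal.ofReal C * 9) ^ p⁻¹, ENNReal.rpow_ne_top_of_nonneg (by positivity)
    (ENNReal.mul_ne_top ENNReal.ofReal_ne_top (by norm_num)), fun H S hH hS hrel => ?_⟩
  have hnorm : ∀ g : T3 → ℝ, Continuous g →
      eLpNorm g (.ofReal p) volume ^ p = ENNReal.ofReal (∫ x, |g x| ^ p) := by
    intro g hg
    rw [eLpNorm_rpow_eq hp0, ofReal_integral_eq_lintegral_ofReal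
      (integrable_T3 (hg.abs.rpow_const fun _ => Or.inr hp0.le))
      (Eventually.of_forall fun _ => by positivity)]
    congr with x
    rw [← Real.norm_eq_abs, ← ENNReal.ofReal_rpow_of_nonneg (norm_nonneg _) hp0.le,
      ofReal_norm]
  set M := ∑ m, ∑ k, eLpNorm (S m k) (.ofReal p) volume 
  have hle : ∀ m k, eLpNorm (S m k) (.ofReal p) volume ≤ M := fun m k =>
    (Finset.single_le_sum (f := fun k => eLpNorm (S m k) (.ofReal p) volume)
      (fun _ _ => zero_le) (Finset.mem_univ k)).trans
    (Finset.single_le_sum (f := fun m => ∑ k, eLpNorm (S m k) (.ofReal p) volume)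
      (fun _ _ => zero_le) (Finset.mem_univ m))
  rw [← ENNReal.rpow_le_rpow_iff hp0, ENNReal.mul_rpow_of_nonneg _ _ hp0.le, ← ENNReal.rpow_mul,
    inv_mul_cancel₀ hp0.ne', ENNReal.rpow_one, hnorm (fun x => H x - ∫ y, H y) (hH.sub continuous_const)]
  refine (ENNReal.ofReal_le_ofReal (hC H S hH hS hrel)).trans ?_
  rw [ENNReal.ofReal_mul hC0, mul_assoc]
  gcongr
  have h0 : ∀ m k, 0 ≤ ∫ x, |S m k x| ^ p := fun m k => integral_nonneg fun x => by positivity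
  rw [ENNReal.ofReal_sum_of_nonneg fun m _ => Finset.sum_nonneg fun k _ => h0 m k]
  calc _ ≤ ∑ m : Fin 3, ∑ k : Fin 3, M ^ p := by
        refine Finset.sum_le_sum fun m _ => ?_
        rw [ENNReal.ofReal_sum_of_nonneg fun k _ => h0 m k]
        refine Finset.sum_le_sum fun k _ => ?_
        rw [← hnorm _ (hS m k)]
        exact ENNReal.rpow_le_rpow (hle m k) hp0.le
    _ = 9 * M ^ p := by
        simp only [Finset.sum_const, Finset.card_univ, Fintype.card_fin, nsmul_eq_mul, ← mul_assoc]
        norm_num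

lemma tendsto_eLpNorm_conv_moll_one {f : T3 → ℝ} (hf : Integrable f) :
    Tendsto (fun N => eLpNorm (fun x => conv projHom (moll N) f x - f x) 1 volume) atTop (𝓝 0) := by
  have := tendsto_eLpNorm_conv_moll (f := f) le_rfl (by simpa [memLp_one_iff_integrable] using hf)
  simpa using this

/-- The Calderón–Zygmund inequality. -/
lemma calderon_zygmund_integrable {p : ℝ} (hp : 1 < p) :
    ∃ C : ℝ≥0∞, C ≠ ⊤ ∧ ∀ (f : T3 → ℝ) (S : Fin 3 → Fin 3 → T3 → ℝ), Integrable f →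
      (∀ m k, Integrable (S m k)) →
      (∀ W ∈ Heat, ∫ x, f x * lap W (0, x) =
        ∑ m, ∑ k, ∫ x, S m k x * sd (some m) (sd (some k) W) (0, x)) →
      eLpNorm (fun x => f x - ∫ y, f y) (.ofReal p) volume ≤
        C * ∑ m, ∑ k, eLpNorm (S m k) (.ofReal p) volume := by
  obtain ⟨C, hC0, hC⟩ := calderon_zygmund_eLpNorm hp
  refine ⟨C, hC0, fun f S hf hS hrel => ?_⟩
  have hcf : ∀ N, Continuous (conv projHom (moll N) f) := fun N =>
    continuous_conv_proj (contDiff_moll N) (hasCompactSupport_moll N) hf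
  have hmean : ∀ N, ∫ x, conv projHom (moll N) f x = ∫ x, f x := fun N => by
    rw [integral_conv_proj (contDiff_moll N).continuous (hasCompactSupport_moll N) hf, integral_moll,
      one_mul]
  refine eLpNorm_le_of_tendsto (g := fun N x => conv projHom (moll N) f x - ∫ y, f y)
    (fun N => ((hcf N).sub continuous_const).aestronglyMeasurable)
    (hf.1.sub aestronglyMeasurable_const) ?_ fun N => ?_
  · simpa using tendsto_eLpNorm_conv_moll_one hf
  have h := hC (conv projHom (moll N) f) (fun m k => conv projHom (moll N) (S m k)) (hcf N)
    (fun m k => continuous_conv_proj (contDiff_moll N) (hasCompactSupport_moll N) (hS m k)) ?_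
  · simp only [hmean] at h
    refine h.trans ?_
    gcongr with m _ k _
    exact eLpNorm_conv_moll_le hp.le (hS m k) N
  intro W hW
  -- The index `none` carries f with the Laplacian, the indices (m, k) carry the tensor with the
  -- negative second derivatives, so that the relation reads "sum equal to zero".
  have := conv_relation (ι := Option (Fin 3 × Fin 3)) (contDiff_moll N).continuous
    (hasCompactSupport_moll N) (F := fun a => a.elim f fun q x => S q.1 q.2 x)
    (by rintro (_ | ⟨m, k⟩) <;> simp [hf, hS])
    (fun a W => a.elim (lap W) fun q z => (-1 : ℝ) * sd (some q.1) (sd (some q.2) W) z)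
    (by
      rintro (_ | ⟨m, k⟩) W hW
      · exact heat_smooth (heat_lap hW)
      · exact (((heat_smooth hW).sd _).sd _).const_mul _)
    (by
      rintro (_ | ⟨m, k⟩) W w z
      · exact lap_shift W w z
      · have : HallMHD.sd (some k) (fun z => W (z + w)) = fun z => HallMHD.sd (some k) W (z + w) :=
          funext fun z => sd_shift _ W w z
        simp only [Option.elim, this, sd_shift])
    (by
      intro W hW
      have := hrel W hW
      simp only [Fintype.sum_option, Fintype.sum_prod_type, Option.elim, neg_one_mul, mul_neg,
        integral_neg, Finset.sum_neg_distrib]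
      linarith) hW
  simp only [Fintype.sum_option, Fintype.sum_prod_type, Option.elim, neg_one_mul, mul_neg,
    integral_neg, Finset.sum_neg_distrib] at this
  linarith

end

section

/-! ### Gradients of mollifications -/

@[simp] lemma proj_zero : proj 0 = 0 := map_zero projHom

section MollifiedGradient

variable {κ : E3 → ℝ} {f : T3 → ℝ}

/-- The partial derivative `∂ₖ` of a mollification. -/
def gconv (κ : E3 → ℝ) (k : Fin 3) (f : T3 → ℝ) (x : T3) : ℝ :=
  - conv projHom (fun l => fderiv ℝ κ l (EuclideanSpace.single k 1)) f x

lemma contDiff_fderiv_apply (hκ : ContDiff ℝ ∞ κ) (l : E3) :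
    ContDiff ℝ ∞ fun y => fderiv ℝ κ y l :=
  (hκ.fderiv_right (m := ∞) (by simp)).clm_apply contDiff_const

lemma continuous_gconv (hκ : ContDiff ℝ ∞ κ) (hc : HasCompactSupport κ) (k : Fin 3)
    (hf : Integrable f) : Continuous (gconv κ k f) :=
  (continuous_conv_proj (contDiff_fderiv_apply hκ _) (hc.fderiv_apply ℝ _) hf).neg

lemma hasDerivAt_conv_proj (hκ : ContDiff ℝ ∞ κ) (hc : HasCompactSupport κ) (hf : Integrable f)
    (x : T3) (l : E3) (s : ℝ) :
    HasDerivAt (fun s : ℝ => conv projHom κ f (x + projHom (s • l)))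
      (∑ k, l k * gconv κ k f (x + projHom (s • l))) s := by
  have h1 := ((isCovering_projHom.contDiff_conv hκ hc hf x).differentiable (by simp)).differentiableAt
    (x := s • l)
  have h2 := h1.hasFDerivAt.comp_hasDerivAt s ((hasDerivAt_id s).smul_const l)
  rw [isCovering_projHom.fderiv_conv hκ hc hf] at h2
  refine HasDerivAt.congr_deriv h2 (Eq.symm ?_)
  simp only [gconv, mul_neg, Finset.sum_neg_distrib, neg_inj, one_smul]
  have hl : l = ∑ k, l k • EuclideanSpace.single k (1 : ℝ) := by
    ext i
    simp [Pi.single_apply]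
  have hd : ∀ y, fderiv ℝ κ y l = ∑ k, l k * fderiv ℝ κ y (EuclideanSpace.single k 1) := fun y => by
    conv_lhs => rw [hl]
    simp
  simp only [conv, hd, Finset.sum_mul, mul_assoc]
  rw [integral_finsetSum _ fun k _ => ?_]
  · simp_rw [integral_const_mul]
  · exact (isCovering_projHom.integrable_conv_integrand (contDiff_fderiv_apply hκ _).continuous
      (hc.fderiv_apply ℝ _) hf _).const_mul _

lemma hasDerivAt_gconv (hκ : ContDiff ℝ ∞ κ) (hc : HasCompactSupport κ) (hf : Integrable f)
    (k : Fin 3) (x : T3) :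
    HasDerivAt (fun s : ℝ => conv projHom κ f (x + projHom (s • EuclideanSpace.single k 1)))
      (gconv κ k f x) 0 := by
  simpa [PiLp.single_apply] using
    hasDerivAt_conv_proj hκ hc hf x (EuclideanSpace.single k 1) 0

lemma integral_gconv_mul (hκ : ContDiff ℝ ∞ κ) (hc : HasCompactSupport κ) (hf : Integrable f)
    {Φ : ST → ℝ} (hΦ : SmoothST Φ) (t : ℝ) (k : Fin 3) :
    ∫ x, gconv κ k f x * Φ (t, x) = - ∫ x, conv projHom κ f x * sd (some k) Φ (t, x) := by
  have c1 := continuous_conv_proj hκ hc hf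
  have c2 := continuous_gconv hκ hc k hf
  have c3 := hΦ.continuous_slice t
  have c4 := (hΦ.sd (some k)).continuous_slice t
  have h := integral_space_deriv_eq_zero (Φ := fun x => conv projHom κ f x * Φ (t, x))
    (Φ' := fun x => gconv κ k f x * Φ (t, x) + conv projHom κ f x * sd (some k) Φ (t, x)) k
    (fun x => by
      have := (hasDerivAt_gconv hκ hc hf k x).mul (hΦ.hasDerivAt_space k t x)
      simp only [zero_smul, map_zero, add_zero] at this
      exact this) (c1.mul c3) ((c2.mul c3).add (c1.mul c4))
  have i1 : Integrable fun x => gconv κ k f x * Φ (t, x) := integrable_T3 (c2.mul c3)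
  have i2 : Integrable fun x => conv projHom κ f x * sd (some k) Φ (t, x) :=
    integrable_T3 (c1.mul c4)
  rw [integral_add i1 i2] at h
  linarith

lemma integral_gconv (hκ : ContDiff ℝ ∞ κ) (hc : HasCompactSupport κ) (hf : Integrable f)
    (k : Fin 3) : ∫ x, gconv κ k f x = 0 := by
  have := integral_gconv_mul hκ hc hf (smoothST_const 1) 0 k
  simpa [sd] using this

/-- The estimate of the mollified gradient of a solution of `Δf = div Q`. -/
lemma gradient_estimate {p : ℝ} (hp : 1 < p) :
    ∃ C : ℝ≥0∞, C ≠ ⊤ ∧ ∀ (f : T3 → ℝ) (Q : Fin 3 → T3 → ℝ), Integrable f →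
      (∀ m, Integrable (Q m)) →
      (∀ W ∈ Heat, ∫ x, f x * lap W (0, x) = ∑ m, ∫ x, Q m x * sd (some m) W (0, x)) →
      ∀ κ : E3 → ℝ, ContDiff ℝ ∞ κ → HasCompactSupport κ → ∀ k,
      eLpNorm (gconv κ k f) (.ofReal p) volume ≤
        C * ∑ m, eLpNorm (conv projHom κ (Q m)) (.ofReal p) volume := by
  obtain ⟨C, hC0, hC⟩ := calderon_zygmund_eLpNorm hp
  refine ⟨C, hC0, fun f Q hf hQ hrel κ hκ hc k => ?_⟩
  -- Apply the inequality to ∂ₖ of the mollified f, whose Laplacian is ∂ₖ div Q: the tensor has −Q,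
  -- mollified, in column k and zeros elsewhere. The derivative has mean zero, so no average has to
  -- be subtracted.
  have h := hC (gconv κ k f)
    (fun m k' x => if k' = k then -conv projHom κ (Q m) x else 0) (continuous_gconv hκ hc k hf)
    (fun m k' => by
      split_ifs
      · exact (continuous_conv_proj hκ hc (hQ m)).neg
      · exact continuous_const) ?_
  · simp only [integral_gconv hκ hc hf, sub_zero] at h
    refine h.trans ?_
    gcongr with m _
    rw [Finset.sum_eq_single k]
    · simp only [if_true]
      exact (eLpNorm_neg (conv projHom κ (Q m)) _ _).le
    · intro b _ hb
      simp [hb]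
    · simp
  intro W hW
  have hWk := heat_sd hW k
  have e1 : ∀ x, sd (some k) (lap W) (0, x) = lap (sd (some k) W) (0, x) := by
    intro x
    refine heat_induction (p := fun W => ∀ z, sd (some k) (lap W) z = lap (sd (some k) W) z)
      ?_ ?_ ?_ ?_ hW _
    · intro q φ z
      have : lap (mode q φ) = fun z => -lam q * mode q φ z := funext fun z => lap_mode q φ z
      rw [this, sd_const_mul _ (smooth_mode q φ), sd_mode, lap_const_mul _ (smooth_mode _ _), lap_mode]
      ring
    · intro z
      simp [lap, sd]
    · intro f g hf hg ef eg z
      have a1 : lap (fun z => f z + g z) = fun z => lap f z + lap g z :=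
        funext fun z => lap_add (heat_smooth hf) (heat_smooth hg) z
      have a2 : sd (some k) (fun z => f z + g z) = fun z => sd (some k) f z + sd (some k) g z :=
        funext fun z => sd_add (heat_smooth hf) (heat_smooth hg) _ z
      rw [a1, a2, sd_add (heat_smooth (heat_lap hf)) (heat_smooth (heat_lap hg)),
        lap_add ((heat_smooth hf).sd _) ((heat_smooth hg).sd _), ef, eg]
    · intro c f hf ef z
      have a1 : lap (fun z => c * f z) = fun z => c * lap f z :=
        funext fun z => lap_const_mul c (heat_smooth hf) z
      have a2 : sd (some k) (fun z => c * f z) = fun z => c * sd (some k) f z :=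
        funext fun z => sd_const_mul c (heat_smooth hf) _ z
      rw [a1, a2, sd_const_mul _ (heat_smooth (heat_lap hf)),
        lap_const_mul _ ((heat_smooth hf).sd _), ef]
  have e2 : ∀ V ∈ Heat, ∫ x, conv projHom κ f x * lap V (0, x) =
      ∑ m, ∫ x, conv projHom κ (Q m) x * sd (some m) V (0, x) := by
    intro V hV
    have := conv_relation (ι := Option (Fin 3)) hκ.continuous hc
      (F := fun a => a.elim f Q) (by rintro (_ | m) <;> simp [hf, hQ])
      (fun a W => a.elim (lap W) fun m z => (-1 : ℝ) * sd (some m) W z)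
      (by
        rintro (_ | m) W hW
        · exact heat_smooth (heat_lap hW)
        · exact ((heat_smooth hW).sd _).const_mul _)
      (by
        rintro (_ | m) W w z
        · exact lap_shift W w z
        · simp only [Option.elim, sd_shift])
      (by
        intro W hW
        have := hrel W hW
        simp only [Fintype.sum_option, Option.elim, neg_one_mul, mul_neg, integral_neg,
          Finset.sum_neg_distrib]
        linarith) hV
    simp only [Fintype.sum_option, Option.elim, neg_one_mul, mul_neg, integral_neg,
      Finset.sum_neg_distrib] at this
    linarith
  rw [integral_gconv_mul hκ hc hf (heat_smooth (heat_lap hW)) 0 k]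
  simp_rw [e1]
  rw [e2 _ hWk, ← Finset.sum_neg_distrib]
  refine Finset.sum_congr rfl fun m _ => ?_
  rw [Finset.sum_eq_single k]
  · simp only [if_true, neg_mul, integral_neg]
  · intro b _ hb
    simp [hb]
  · simp

/-! ### The Poincaré inequality -/

/-- Integrate the derivative along the segment from 0 to l and use Minkowski's inequality together
with translation invariance. -/
lemma eLpNorm_conv_shift_sub_le (hκ : ContDiff ℝ ∞ κ) (hc : HasCompactSupport κ)
    (hf : Integrable f) {r : ℝ} (hr : 1 ≤ r) {l : E3} (hl : ∀ k, |l k| ≤ 1) :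
    eLpNorm (fun x => conv projHom κ f (x + projHom l) - conv projHom κ f x) (.ofReal r) volume ≤
      ∑ k, eLpNorm (gconv κ k f) (.ofReal r) volume := by
  have hcg := fun k => continuous_gconv hκ hc k hf
  have hπ : Continuous projHom := isCovering_projHom.continuous
  have hcont : Continuous fun q : ℝ × T3 => ∑ k, l k * gconv κ k f (q.2 + projHom (q.1 • l)) := by
    refine continuous_finsetSum _ fun k _ => continuous_const.mul ((hcg k).comp ?_)
    exact continuous_snd.add (hπ.comp (continuous_fst.smul continuous_const))
  have : IsProbabilityMeasure ((volume : Measure ℝ).restrict (Ioc 0 1)) := ⟨by simp⟩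
  have e1 : ∀ x, conv projHom κ f (x + projHom l) - conv projHom κ f x =
      ∫ s in Ioc (0 : ℝ) 1, ∑ k, l k * gconv κ k f (x + projHom (s • l)) := by
    intro x
    rw [← intervalIntegral.integral_of_le zero_le_one,
      intervalIntegral.integral_eq_sub_of_hasDerivAt
        (fun s _ => hasDerivAt_conv_proj hκ hc hf x l s)]
    · simp
    · exact Continuous.intervalIntegrable
        (hcont.comp (continuous_id.prodMk continuous_const)) _ _
  simp_rw [e1]
  refine eLpNorm_integral_le (g := fun q : ℝ × T3 => ∑ k, l k * gconv κ k f (q.2 + projHom (q.1 • l)))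
    hcont.aestronglyMeasurable hr (Eventually.of_forall fun s => ?_)
  have hcs : ∀ k, Continuous fun x : T3 => l k * gconv κ k f (x + projHom (s • l)) := fun k =>
    continuous_const.mul ((hcg k).comp (continuous_id.add continuous_const))
  have := eLpNorm_sum_le (μ := (volume : Measure T3)) (p := .ofReal r) (s := Finset.univ)
    (f := fun k x => l k * gconv κ k f (x + projHom (s • l)))
    (fun k _ => (hcs k).aestronglyMeasurable) (by simpa using hr)
  refine (le_of_eq ?_).trans (this.trans (Finset.sum_le_sum fun k _ => ?_))
  · congr 1
  · refine (eLpNorm_mono (g := fun x => gconv κ k f (x + projHom (s • l))) fun x => ?_).trans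
      (eLpNorm_comp_measurePreserving (hcg k).aestronglyMeasurable
        (measurePreserving_add_right volume (projHom (s • l)))).le
    rw [norm_mul]
    exact mul_le_of_le_one_left (norm_nonneg _) (hl k)

lemma exists_proj_eq (w : T3) : ∃ l : E3, projHom l = w ∧ ∀ k, |l k| ≤ 1 := by
  have h : ∀ k, ∃ s : ℝ, (s : UnitAddCircle) = w k ∧ |s| ≤ 1 := fun k => by
    have hs := ((AddCircle.equivIco (1 : ℝ) 0) (w k)).2
    refine ⟨_, (AddCircle.equivIco (1 : ℝ) 0).symm_apply_apply (w k), ?_⟩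
    rw [abs_le]
    constructor <;> linarith [hs.1, hs.2]
  choose s hs hs1 using h
  exact ⟨WithLp.toLp 2 s, funext hs, hs1⟩

/-- The deviation from the mean is, up to sign, the average over w of the increments by w. Every
point of the torus is represented by a vector with coordinates bounded by 1, so each increment is
controlled by the gradient. -/
lemma poincare_conv (hκ : ContDiff ℝ ∞ κ) (hc : HasCompactSupport κ) (hf : Integrable f) {r : ℝ}
    (hr : 1 ≤ r) :
    eLpNorm (fun x => conv projHom κ f x - ∫ y, conv projHom κ f y) (.ofReal r) volume ≤
      ∑ k, eLpNorm (gconv κ k f) (.ofReal r) volume := by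
  have hcf := continuous_conv_proj hκ hc hf
  have e1 : ∀ x, -(conv projHom κ f x - ∫ y, conv projHom κ f y) =
      ∫ w, (conv projHom κ f (x + w) - conv projHom κ f x) := by
    intro x
    have := integral_add_left_eq_self (μ := (volume : Measure T3)) (conv projHom κ f) x
    have i1 : Integrable fun w => conv projHom κ f (x + w) := integrable_T3 (by fun_prop)
    rw [integral_sub i1 (integrable_const _)]
    simp [this]
  rw [← eLpNorm_neg]
  change eLpNorm (fun x => -(conv projHom κ f x - ∫ y, conv projHom κ f y)) _ _ ≤ _
  simp_rw [e1]
  refine eLpNorm_integral_le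
    (g := fun q : T3 × T3 => conv projHom κ f (q.2 + q.1) - conv projHom κ f q.2)
    (Continuous.aestronglyMeasurable (by fun_prop)) hr (Eventually.of_forall fun w => ?_)
  obtain ⟨l, rfl, hl⟩ := exists_proj_eq w
  exact eLpNorm_conv_shift_sub_le hκ hc hf hr hl

end MollifiedGradient

end

section

/-! ### Mixed norms through slices -/

/-- The `L^p` norm of the time slices. -/
def sliceNorm (p : ℝ) (f : ST → ℝ) (t : ℝ) : ℝ≥0∞ :=
  eLpNorm (fun x => f (t, x)) (.ofReal p) volume

lemma aemeasurable_sliceNorm {p : ℝ} (hp : 0 < p) {f : ST → ℝ} (hf : AEStronglyMeasurable f) :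
    AEMeasurable (sliceNorm p f) := by
  have h := (aemeasurable_lintegral_slice (hf.enorm.pow_const p)).pow_const p⁻¹
  refine h.congr (Eventually.of_forall fun t => ?_)
  simp only [sliceNorm, ← eLpNorm_rpow_eq hp (fun x => f (t, x))]
  rw [← ENNReal.rpow_mul, mul_inv_cancel₀ hp.ne', ENNReal.rpow_one]

lemma mixI_eq_lintegral_sliceNorm {p : ℝ} (hp : 0 < p) (r : ℝ) (f : ST → ℝ) :
    mixI r p (fun z => ‖f z‖ₑ) = ∫⁻ t, sliceNorm p f t ^ r := by
  refine lintegral_congr fun t => ?_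
  rw [sliceNorm, ← eLpNorm_rpow_eq hp (fun x => f (t, x)), ← ENNReal.rpow_mul]
  congr 1
  field_simp

lemma ennreal_le_one_add_rpow {r : ℝ} (hr : 1 ≤ r) (a : ℝ≥0∞) : a ≤ 1 + a ^ r := by
  rcases le_total a 1 with h | h
  · exact h.trans le_self_add
  · calc a = a ^ (1 : ℝ) := (ENNReal.rpow_one a).symm
      _ ≤ a ^ r := ENNReal.rpow_le_rpow_of_exponent_le h hr
      _ ≤ _ := le_add_self

lemma sliceNorm_eq_zero {T : ℝ} {f : ST → ℝ} (h0 : ∀ z : ST, z.1 ∉ Ioo 0 T → f z = 0) (p : ℝ)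
    {t : ℝ} (ht : t ∉ Ioo 0 T) : sliceNorm p f t = 0 := by
  have : (fun x => f (t, x)) = fun _ => 0 := funext fun x => h0 (t, x) ht
  rw [sliceNorm, this]
  exact eLpNorm_zero

/-- On a finite time interval integrability to the power r ≥ 1 implies integrability, through a ≤ 1
+ a^r. -/
lemma lintegral_sliceNorm_ne_top {T r p : ℝ} (hr : 1 ≤ r) (hp : 0 < p) {f : ST → ℝ}
    (hf : Mix r p f) (h0 : ∀ z : ST, z.1 ∉ Ioo 0 T → f z = 0) : ∫⁻ t, sliceNorm p f t ≠ ⊤ := by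
  have hle : ∀ t, sliceNorm p f t ≤ (Ioo 0 T).indicator (fun _ => 1) t + sliceNorm p f t ^ r := by
    intro t
    by_cases ht : t ∈ Ioo 0 T
    · rw [indicator_of_mem ht]
      exact ennreal_le_one_add_rpow hr _
    · rw [sliceNorm_eq_zero h0 p ht]
      exact zero_le
  refine ne_top_of_le_ne_top ?_ (lintegral_mono hle)
  rw [lintegral_add_left' (aemeasurable_const.indicator measurableSet_Ioo),
    lintegral_indicator measurableSet_Ioo, ← mixI_eq_lintegral_sliceNorm hp]
  refine ENNReal.add_ne_top.2 ⟨?_, hf.2⟩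
  simp

lemma lintegral_enorm_le_sliceNorm {p : ℝ} (hp : 1 ≤ p) {f : ST → ℝ}
    (hf : AEStronglyMeasurable f) : ∫⁻ z, ‖f z‖ₑ ≤ ∫⁻ t, sliceNorm p f t := by
  have hf' := hf
  rw [Measure.volume_eq_prod] at hf' ⊢
  rw [lintegral_prod _ hf'.enorm]
  refine lintegral_mono_ae ?_
  filter_upwards [hf'.prodMk_left] with t ht
  have := eLpNorm_le_eLpNorm_of_exponent_le (μ := (volume : Measure T3)) (p := 1)
    (q := .ofReal p) (by simpa using hp) ht
  rwa [eLpNorm_one_eq_lintegral_enorm] at this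

lemma ennreal_sum_rpow_le {ι : Type*} [Fintype ι] {r : ℝ} (hr : 0 < r) (a : ι → ℝ≥0∞) :
    (∑ i, a i) ^ r ≤ (Fintype.card ι : ℝ≥0∞) ^ r * ∑ i, a i ^ r := by
  rcases isEmpty_or_nonempty ι with h | h
  · simp [ENNReal.zero_rpow_of_pos hr]
  obtain ⟨i, -, hi⟩ := Finset.exists_max_image Finset.univ a Finset.univ_nonempty
  calc (∑ i, a i) ^ r ≤ (Fintype.card ι * a i) ^ r := by
        refine ENNReal.rpow_le_rpow ?_ hr.le
        refine (Finset.sum_le_sum fun j hj => hi j hj).trans ?_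
        simp
    _ = (Fintype.card ι : ℝ≥0∞) ^ r * a i ^ r := ENNReal.mul_rpow_of_nonneg _ _ hr.le
    _ ≤ _ := by
        gcongr
        exact Finset.single_le_sum (f := fun i => a i ^ r) (fun _ _ => zero_le) (Finset.mem_univ i)

/-- Raise the slicewise estimate to the power r and integrate in time. This is how every elliptic
estimate on the torus becomes an estimate in a mixed space. -/
lemma Mix.of_slice {ι : Type*} [Fintype ι] {T r p : ℝ} (hr : 1 ≤ r) (hp : 1 ≤ p) {f : ST → ℝ}
    {g : ι → ST → ℝ} (hf : AEStronglyMeasurable f) (hg : ∀ i, Mix r p (g i))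
    (h0 : ∀ i, ∀ z : ST, z.1 ∉ Ioo 0 T → g i z = 0) {C : ℝ≥0∞} (hC : C ≠ ⊤)
    (h : ∀ᵐ t, sliceNorm p f t ≤ C * ∑ i, sliceNorm p (g i) t) : Mix r p f := by
  have hp0 : 0 < p := by linarith
  have hm := fun i => aemeasurable_sliceNorm hp0 (hg i).1.1
  refine ⟨⟨hf, ?_⟩, ?_⟩
  · refine (lintegral_enorm_le_sliceNorm hp hf).trans_lt ((lintegral_mono_ae h).trans_lt ?_)
    rw [lintegral_const_mul' _ _ hC, lintegral_finsetSum' _ fun i _ => hm i]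
    exact ENNReal.mul_lt_top hC.lt_top (ENNReal.sum_lt_top.2 fun i _ =>
      (lintegral_sliceNorm_ne_top hr hp0 (hg i) (h0 i)).lt_top)
  · rw [mixI_eq_lintegral_sliceNorm hp0]
    have hr0 : 0 ≤ r := by linarith
    have h' : ∀ᵐ t, sliceNorm p f t ^ r ≤
        (C ^ r * (Fintype.card ι : ℝ≥0∞) ^ r) * ∑ i, sliceNorm p (g i) t ^ r := by
      filter_upwards [h] with t ht
      refine (ENNReal.rpow_le_rpow ht hr0).trans ?_
      rw [ENNReal.mul_rpow_of_nonneg _ _ hr0, mul_assoc]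
      gcongr
      exact ennreal_sum_rpow_le (by linarith) _
    have hK : C ^ r * (Fintype.card ι : ℝ≥0∞) ^ r ≠ ⊤ := ENNReal.mul_ne_top
      (ENNReal.rpow_ne_top_of_nonneg hr0 hC) (ENNReal.rpow_ne_top_of_nonneg hr0 (by simp))
    refine ne_top_of_le_ne_top ?_ (lintegral_mono_ae h')
    rw [lintegral_const_mul' _ _ hK, lintegral_finsetSum' _ fun i _ => (hm i).pow_const r]
    refine ENNReal.mul_ne_top hK (ENNReal.sum_ne_top.2 fun i _ => ?_)
    rw [← mixI_eq_lintegral_sliceNorm hp0]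
    exact (hg i).2

/-! ### Relations on time slices -/

lemma exists_Icc_of_tsupport {T : ℝ} {χ : ℝ → ℝ} (hc : HasCompactSupport χ)
    (hs : tsupport χ ⊆ Ioo 0 T) :
    ∃ a c : ℝ, 0 < a ∧ c < T ∧ ∀ t, t ∉ Icc a c → χ t = 0 := by
  rcases (tsupport χ).eq_empty_or_nonempty with he | hne
  · exact ⟨1, T - 1, one_pos, by linarith, fun t _ => by simp [tsupport_eq_empty_iff.1 he]⟩
  have hcomp : IsCompact (tsupport χ) := hc
  obtain ⟨a, haS, ha⟩ := hcomp.exists_isLeast hne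
  obtain ⟨c, hcS, hcM⟩ := hcomp.exists_isGreatest hne
  refine ⟨a, c, (hs haS).1, (hs hcS).2, fun t ht => ?_⟩
  by_contra hn
  have hm := subset_tsupport χ (Function.mem_support.2 hn)
  exact ht ⟨ha hm, hcM hm⟩

lemma integrable_cutoff_mul {χ : ℝ → ℝ} (hχ : Continuous χ) (hc : HasCompactSupport χ) {a c : ℝ}
    (hχ0 : ∀ t, t ∉ Icc a c → χ t = 0) {g : ST → ℝ} (hg : IntegrableOn g (Icc a c ×ˢ univ)) :
    Integrable fun z : ST => χ z.1 * g z := by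
  obtain ⟨B, hB⟩ := hχ.bounded_above_of_compact_support hc
  have h2 : IntegrableOn (fun z : ST => χ z.1 * g z) (Icc a c ×ˢ univ) :=
    Integrable.bdd_mul hg (hχ.comp continuous_fst).aestronglyMeasurable
      (Eventually.of_forall fun z => hB z.1)
  refine h2.integrable_of_forall_notMem_eq_zero fun z hz => ?_
  rw [hχ0 z.1 fun hm => hz ⟨hm, mem_univ _⟩, zero_mul]

lemma SmoothST.freeze {f : ST → ℝ} (hf : SmoothST f) : SmoothST fun z : ST => f (0, z.2) :=
  ContDiff.comp (g := fun y : STE => f (stHom y)) hf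
    (contDiff_const.prodMk contDiff_snd : ContDiff ℝ ∞ fun y : STE => ((0 : ℝ), y.2))

/-- The space integral is a locally integrable function of time that is orthogonal to all smooth
cutoffs. -/
lemma ae_slice_integral_eq_zero {T : ℝ} {g : ST → ℝ}
    (hloc : ∀ a c : ℝ, 0 < a → c < T → IntegrableOn g (Icc a c ×ˢ univ))
    (h : ∀ χ : ℝ → ℝ, ContDiff ℝ ∞ χ → HasCompactSupport χ → tsupport χ ⊆ Ioo 0 T →
      ∫ z : ST, χ z.1 * g z = 0) : ∀ᵐ t : ℝ, t ∈ Ioo 0 T → ∫ x, g (t, x) = 0 := by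
  refine isOpen_Ioo.ae_eq_zero_of_integral_contDiff_smul_eq_zero ?_ fun χ hχ hc hs => ?_
  · intro t ht
    obtain ⟨a, ha, hat⟩ := exists_between ht.1
    obtain ⟨c, hct, hcT⟩ := exists_between ht.2
    refine ⟨Icc a c, mem_nhdsWithin_of_mem_nhds (Icc_mem_nhds hat hct), ?_⟩
    have := hloc a c ha hcT
    rw [IntegrableOn, Measure.volume_eq_prod, ← Measure.prod_restrict, Measure.restrict_univ] at this
    exact this.integral_prod_left
  · obtain ⟨a, c, ha, hcT, hχ0⟩ := exists_Icc_of_tsupport hc hs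
    have hi := integrable_cutoff_mul hχ.continuous hc hχ0 (hloc a c ha hcT)
    have := h χ hχ hc hs
    rw [Measure.volume_eq_prod, integral_prod _ hi] at this
    simp only [integral_const_mul] at this
    simpa using this

/-- A linear differential operator in the space variables with constant coefficients. -/
structure SpaceOp (L : (ST → ℝ) → ST → ℝ) : Prop where
  smooth : ∀ f, SmoothST f → SmoothST (L f)
  add : ∀ f g, SmoothST f → SmoothST g → ∀ z, L (fun z => f z + g z) z = L f z + L g z
  const_mul : ∀ (c : ℝ) f, SmoothST f → ∀ z, L (fun z => c * f z) z = c * L f z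
  freeze : ∀ χ : ℝ → ℝ, ContDiff ℝ ∞ χ → ∀ f, SmoothST f → ∀ z : ST,
    L (fun z => χ z.1 * f (0, z.2)) z = χ z.1 * L f (0, z.2)

namespace SpaceOp

lemma sd (m : Fin 3) : SpaceOp (HallMHD.sd (some m)) where
  smooth f hf := hf.sd _
  add f g hf hg z := sd_add hf hg _ z
  const_mul c f hf z := sd_const_mul c hf _ z
  freeze χ hχ f hf z := by
    have hχz : SmoothST fun z : ST => χ z.1 := ContDiff.comp (g := χ) hχ contDiff_fst
    have h1 := (hχz.mul hf.freeze).hasDerivAt_space m z.1 z.2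
    have h2 := (hf.hasDerivAt_space m 0 z.2).const_mul (χ z.1)
    exact h1.unique h2

lemma comp {L M : (ST → ℝ) → ST → ℝ} (hL : SpaceOp L) (hM : SpaceOp M) :
    SpaceOp fun f => L (M f) where
  smooth f hf := hL.smooth _ (hM.smooth f hf)
  add f g hf hg z := by
    rw [funext fun z => hM.add f g hf hg z]
    exact hL.add _ _ (hM.smooth f hf) (hM.smooth g hg) z
  const_mul c f hf z := by
    rw [funext fun z => hM.const_mul c f hf z]
    exact hL.const_mul c _ (hM.smooth f hf) z
  freeze χ hχ f hf z := by
    rw [funext fun z => hM.freeze χ hχ f hf z]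
    exact hL.freeze χ hχ _ (hM.smooth f hf) z

lemma lap : SpaceOp HallMHD.lap where
  smooth f hf := ContDiff.sum fun i _ => ((hf.sd (some i)).sd (some i))
  add f g hf hg z := lap_add hf hg z
  const_mul c f hf z := lap_const_mul c hf z
  freeze χ hχ f hf z := by
    simp only [HallMHD.lap, ((sd _).comp (sd _)).freeze χ hχ f hf z, Finset.mul_sum]

end SpaceOp

/-- Countably many intervals with rational endpoints exhaust (0,T), so one null set of times
suffices. -/
lemma ae_integrable_slice_of_loc {T : ℝ} {f : ST → ℝ}
    (hf : ∀ a c : ℝ, 0 < a → c < T → IntegrableOn f (Icc a c ×ˢ univ)) :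
    ∀ᵐ t : ℝ, t ∈ Ioo 0 T → Integrable fun x => f (t, x) := by
  have h1 : ∀ q : ℚ × ℚ, ∀ᵐ t : ℝ, (0 : ℝ) < q.1 ∧ (q.2 : ℝ) < T → t ∈ Icc (q.1 : ℝ) q.2 →
      Integrable fun x => f (t, x) := by
    intro q
    by_cases hq : (0 : ℝ) < q.1 ∧ (q.2 : ℝ) < T
    · simp only [hq, and_self, forall_const]
      rw [← ae_restrict_iff' measurableSet_Icc]
      have := hf _ _ hq.1 hq.2
      rw [IntegrableOn, Measure.volume_eq_prod, ← Measure.prod_restrict, Measure.restrict_univ]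
        at this
      exact this.prod_right_ae
    · exact Eventually.of_forall fun t ht => absurd ht hq
  filter_upwards [ae_all_iff.2 h1] with t ht htT
  obtain ⟨a, ha, hat⟩ := exists_rat_btwn htT.1
  obtain ⟨c, hct, hcT⟩ := exists_rat_btwn htT.2
  exact ht (a, c) ⟨ha, hcT⟩ ⟨hat.le, hct.le⟩

/-- A relation in the sense of distributions holds on almost all time slices. -/
lemma ae_slice_relation {ι : Type*} [Fintype ι] {T : ℝ} {F : ι → ST → ℝ}
    (hF : ∀ i, ∀ a c : ℝ, 0 < a → c < T → IntegrableOn (F i) (Icc a c ×ˢ univ))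
    {L : ι → (ST → ℝ) → ST → ℝ} (hL : ∀ i, SpaceOp (L i))
    (h : ∀ Φ, IsTest T Φ → ∑ i, ∫ z, F i z * L i Φ z = 0) :
    ∀ᵐ t : ℝ, t ∈ Ioo 0 T → ∀ W ∈ Heat, ∑ i, ∫ x, F i (t, x) * L i W (0, x) = 0 := by
  have hb : ∀ {V : ST → ℝ}, SmoothST V → ∃ B : ℝ, ∀ x : T3, ‖V (0, x)‖ ≤ B := fun hV => by
    obtain ⟨B, hB⟩ := isCompact_univ.exists_bound_of_continuousOn (hV.continuous_slice 0).continuousOn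
    exact ⟨B, fun x => hB x (mem_univ x)⟩
  have hmul : ∀ {V : ST → ℝ}, SmoothST V → ∀ i, ∀ a c : ℝ, 0 < a → c < T →
      IntegrableOn (fun z : ST => F i z * V (0, z.2)) (Icc a c ×ˢ univ) := fun hV i a c ha hc => by
    obtain ⟨B, hB⟩ := hb hV
    exact (hF i a c ha hc).mul_bdd (c := B)
      ((hV.continuous_slice 0).comp continuous_snd).aestronglyMeasurable
      (Eventually.of_forall fun z => hB z.2)
  have hint : ∀ᵐ t : ℝ, t ∈ Ioo 0 T → ∀ i, Integrable fun x => F i (t, x) := by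
    filter_upwards [ae_all_iff.2 fun i => ae_integrable_slice_of_loc (hF i)] with t ht htT i
    exact ht i htT
  have hslice : ∀ {V : ST → ℝ} (_ : SmoothST V) {g : T3 → ℝ} (_ : Integrable g),
      Integrable fun x => g x * V (0, x) := fun hV g hg => by
    obtain ⟨B, hB⟩ := hb hV
    exact hg.mul_bdd (c := B) (hV.continuous_slice 0).aestronglyMeasurable (Eventually.of_forall hB)
  -- For one fixed mode, test with χ(t) times that mode frozen at heat time zero. The exceptional
  -- set of times depends on the mode.
  have hmode : ∀ k φ, ∀ᵐ t : ℝ, t ∈ Ioo 0 T →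
      ∑ i, ∫ x, F i (t, x) * L i (mode k φ) (0, x) = 0 := by
    intro k φ
    have hW := smooth_mode k φ
    have hg := ae_slice_integral_eq_zero (T := T)
      (g := fun z => ∑ i, F i z * L i (mode k φ) (0, z.2))
      (fun a c ha hc => integrable_finsetSum _ fun i _ => hmul ((hL i).smooth _ hW) i a c ha hc)
      fun χ hχ hc hs => ?_
    · filter_upwards [hg, hint] with t ht hi htT
      have e := ht htT
      rwa [integral_finsetSum _ fun i _ => hslice ((hL i).smooth _ hW) (hi htT i)] at e
    · obtain ⟨a, c, ha, hc', hχ0⟩ : ∃ a c : ℝ, 0 < a ∧ c < T ∧ ∀ t, t ∉ Icc a c → χ t = 0 :=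
        exists_Icc_of_tsupport hc hs
      have hχz : SmoothST fun z : ST => χ z.1 := ContDiff.comp (g := χ) hχ contDiff_fst
      have hT : IsTest T fun z : ST => χ z.1 * mode k φ (0, z.2) :=
        ⟨hχz.mul hW.freeze, a, c, ha, hc', fun z hz => by simp only [hχ0 _ hz, zero_mul]⟩
      have hi : ∀ i, Integrable fun z : ST => χ z.1 * (F i z * L i (mode k φ) (0, z.2)) := fun i =>
        integrable_cutoff_mul hχ.continuous hc hχ0 (hmul ((hL i).smooth _ hW) i a c ha hc')
      simp only [Finset.mul_sum]
      rw [integral_finsetSum _ fun i _ => hi i]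
      refine Eq.trans (Finset.sum_congr rfl fun i _ =>
        integral_congr_ae (Eventually.of_forall fun z => ?_)) (h _ hT)
      simp only [(hL i).freeze χ hχ _ hW z]
      ring
  -- The spanning set is countable, since two phases for each frequency are enough; off the union of
  -- the exceptional sets linearity gives the relation for the whole span.
  filter_upwards [hint, ae_all_iff.2 fun k => ae_all_iff.2 fun s : Bool =>
    hmode k (if s then Real.pi / 2 else 0)] with t hi hm htT W hW
  have hi := hi htT
  refine Submodule.span_induction (p := fun W _ => SmoothST W ∧
    ∑ i, ∫ x, F i (t, x) * L i W (0, x) = 0) ?_ ?_ ?_ ?_ hW |>.2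
  · rintro _ ⟨⟨k, s⟩, rfl⟩
    exact ⟨smooth_mode _ _, hm k s htT⟩
  · refine ⟨smoothST_const 0, Finset.sum_eq_zero fun i _ => ?_⟩
    have := (hL i).const_mul 0 (fun _ => 0) (smoothST_const 0)
    simp only [mul_zero, zero_mul] at this
    change ∫ x, F i (t, x) * L i (fun _ => 0) (0, x) = 0
    simp [this]
  · rintro f g - - ⟨hf, ef⟩ ⟨hg, eg⟩
    refine ⟨hf.add hg, ?_⟩
    have : ∀ i, ∫ x, F i (t, x) * L i (f + g) (0, x) =
        (∫ x, F i (t, x) * L i f (0, x)) + ∫ x, F i (t, x) * L i g (0, x) := fun i => by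
      rw [← integral_add (hslice ((hL i).smooth _ hf) (hi i)) (hslice ((hL i).smooth _ hg) (hi i))]
      congr with x
      rw [← mul_add]
      exact congrArg _ ((hL i).add f g hf hg _)
    simp only [this, Finset.sum_add_distrib, ef, eg, add_zero]
  · rintro c f - ⟨hf, ef⟩
    refine ⟨hf.const_mul c, ?_⟩
    have : ∀ i, ∫ x, F i (t, x) * L i (c • f) (0, x) = c * ∫ x, F i (t, x) * L i f (0, x) :=
      fun i => by
      rw [← integral_const_mul]
      congr with x
      rw [mul_left_comm]
      exact congrArg _ ((hL i).const_mul c f hf _)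
    simp only [this, ← Finset.mul_sum, ef, mul_zero]

end

section

/-! ### Mollification in the space variables -/

lemma measurePreserving_shift {X : Type*} [MeasurableSpace X] (μ : Measure X) [SFinite μ]
    {w : X → ST} (hw : Measurable w) :
    MeasurePreserving (fun p : X × ST => (p.1, p.2 + w p.1)) (μ.prod volume) (μ.prod volume) := by
  refine (MeasurePreserving.id μ).skew_product (g := fun y z => z + w y) ?_ ?_
  · exact measurable_snd.add (hw.comp measurable_fst)
  · exact Eventually.of_forall fun y => (measurePreserving_add_right volume (w y)).map_eq

lemma aesm_shift_comp {X : Type*} [MeasurableSpace X] (μ : Measure X) [SFinite μ]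
    {w : X → ST} (hw : Measurable w) {f : ST → ℝ} (hf : AEStronglyMeasurable f) :
    AEStronglyMeasurable (fun p : X × ST => f (p.2 + w p.1)) (μ.prod volume) :=
  (hf.comp_snd (μ := μ)).comp_measurePreserving (measurePreserving_shift μ hw)

/-- The mollification in the space variables. -/
def sconv (κ : E3 → ℝ) (f : ST → ℝ) (z : ST) : ℝ := conv projHom κ (fun x => f (z.1, x)) z.2

lemma aesm_sconv {κ : E3 → ℝ} (hκ : Continuous κ) {f : ST → ℝ} (hf : AEStronglyMeasurable f) :
    AEStronglyMeasurable (sconv κ f) := by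
  have hw : Measurable fun l : E3 => (((0 : ℝ), projHom l) : ST) :=
    measurable_const.prodMk isCovering_projHom.continuous.measurable
  have h1 : AEStronglyMeasurable (fun p : E3 × ST => κ p.1 * f (p.2 + (0, projHom p.1)))
      (volume.prod volume) :=
    (hκ.comp continuous_fst).aestronglyMeasurable.mul (aesm_shift_comp volume hw hf)
  have h2 := h1.prod_swap.integral_prod_right'
  refine h2.congr (Eventually.of_forall fun z => ?_)
  simp only [sconv, conv, Prod.swap_prod_mk]
  congr with l
  congr 2
  ext <;> simp

/-- On almost every slice mollifications converge in L^p, and since mollification contracts L^p the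
slice norms are dominated by twice that of f. -/
lemma tendsto_lintegral_sliceNorm_sconv {p : ℝ} (hp : 1 ≤ p) {f : ST → ℝ} (hf : Integrable f)
    (hfin : ∫⁻ t, sliceNorm p f t ≠ ⊤) :
    Tendsto (fun N => ∫⁻ t, sliceNorm p (fun z => sconv (moll N) f z - f z) t) atTop (𝓝 0) := by
  have hp0 : 0 < p := by linarith
  have hsl : ∀ᵐ t : ℝ, Integrable fun x => f (t, x) := by
    have := hf
    rw [Measure.volume_eq_prod] at this
    exact this.prod_right_ae
  have h0 : (0 : ℝ≥0∞) = ∫⁻ _ : ℝ, 0 := by simp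
  rw [h0]
  refine tendsto_lintegral_of_dominated_convergence' (fun t => 2 * sliceNorm p f t)
    (fun N => aemeasurable_sliceNorm hp0 ((aesm_sconv (contDiff_moll N).continuous hf.1).sub hf.1))
    (fun N => ?_) ?_ ?_
  · filter_upwards [hsl] with t ht
    refine (eLpNorm_sub_le (continuous_conv_proj (contDiff_moll N) (hasCompactSupport_moll N)
      ht).aestronglyMeasurable ht.1 (by simpa using hp)).trans ?_
    rw [two_mul]
    exact add_le_add (eLpNorm_conv_moll_le hp ht N) le_rfl
  · rw [lintegral_const_mul' _ _ (by norm_num)]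
    exact ENNReal.mul_ne_top (by norm_num) hfin
  · filter_upwards [hsl, ae_lt_top' (aemeasurable_sliceNorm hp0 hf.1) hfin] with t ht htop
    have hm : MemLp (fun x => f (t, x)) (.ofReal p) := ⟨ht.1, htop⟩
    have := tendsto_eLpNorm_conv_moll hp hm
    simpa only [sliceNorm, sconv] using this

lemma ae_ae_slice {P : ST → Prop} (h : ∀ᵐ z, P z) : ∀ᵐ t : ℝ, ∀ᵐ x : T3, P (t, x) := by
  rw [Measure.volume_eq_prod] at h
  exact Measure.ae_ae_of_ae_prod h

lemma lintegral_sliceNorm_one {f : ST → ℝ} (hf : AEStronglyMeasurable f) :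
    ∫⁻ t, sliceNorm 1 f t = ∫⁻ z, ‖f z‖ₑ := by
  simp only [sliceNorm, ENNReal.ofReal_one, eLpNorm_one_eq_lintegral_enorm]
  rw [Measure.volume_eq_prod] at hf ⊢
  rw [lintegral_prod _ hf.enorm]

lemma integrable_sconv_moll {f : ST → ℝ} (hf : Integrable f) (N : ℕ) :
    Integrable (sconv (moll N) f) := by
  have hm := aesm_sconv (contDiff_moll N).continuous hf.1
  refine ⟨hm, ?_⟩
  have hsl : ∀ᵐ t : ℝ, Integrable fun x => f (t, x) := by
    have := hf
    rw [Measure.volume_eq_prod] at this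
    exact this.prod_right_ae
  refine lt_of_le_of_lt ?_ hf.2
  rw [← lintegral_sliceNorm_one hm, ← lintegral_sliceNorm_one hf.1]
  refine lintegral_mono_ae ?_
  filter_upwards [hsl] with t ht
  exact eLpNorm_conv_moll_le le_rfl ht N

lemma tendsto_eLpNorm_sconv {f : ST → ℝ} (hf : Integrable f) :
    Tendsto (fun N => eLpNorm (fun z => sconv (moll N) f z - f z) 1 volume) atTop (𝓝 0) := by
  have h := tendsto_lintegral_sliceNorm_sconv le_rfl hf
    (by rw [lintegral_sliceNorm_one hf.1]; exact hf.2.ne)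
  refine h.congr fun N => ?_
  have hm : AEStronglyMeasurable fun z => sconv (moll N) f z - f z :=
    (aesm_sconv (contDiff_moll N).continuous hf.1).sub hf.1
  rw [lintegral_sliceNorm_one hm,
    eLpNorm_one_eq_lintegral_enorm]

lemma tendsto_integral_mul_of_eLpNorm {g : ℕ → ST → ℝ} {f : ST → ℝ} (hg : ∀ n, Integrable (g n))
    (hf : Integrable f) (h : Tendsto (fun n => eLpNorm (fun z => g n z - f z) 1 volume) atTop (𝓝 0))
    {T : ℝ} {Φ : ST → ℝ} (hΦ : IsTest T Φ) :
    Tendsto (fun n => ∫ z, g n z * Φ z) atTop (𝓝 (∫ z, f z * Φ z)) := by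
  obtain ⟨C, hC0, hC⟩ := hΦ.bound
  have hi : ∀ {g : ST → ℝ}, Integrable g → Integrable fun z => g z * Φ z := fun hg =>
    hg.mul_bdd (c := C) hΦ.continuous.aestronglyMeasurable (Eventually.of_forall hC)
  refine tendsto_integral_of_L1' _ (hi hf).1 (Eventually.of_forall fun n => hi (hg n)) ?_
  have h2 := ENNReal.Tendsto.const_mul (a := ENNReal.ofReal C) h (Or.inr ENNReal.ofReal_ne_top)
  rw [mul_zero] at h2
  refine tendsto_of_tendsto_of_tendsto_of_le_of_le tendsto_const_nhds h2 (fun N => zero_le)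
    fun n => ?_
  refine eLpNorm_le_mul_eLpNorm_of_ae_le_mul (Eventually.of_forall fun z => ?_) 1
  simp only [Pi.sub_apply, ← sub_mul, norm_mul]
  rw [mul_comm]
  exact mul_le_mul_of_nonneg_right (hC z) (norm_nonneg _)

lemma conv_proj_sub {κ κ' : E3 → ℝ} (hκ : Continuous κ) (hc : HasCompactSupport κ)
    (hκ' : Continuous κ') (hc' : HasCompactSupport κ') {f : T3 → ℝ} (hf : Integrable f) (x : T3) :
    conv projHom (fun l => κ l - κ' l) f x = conv projHom κ f x - conv projHom κ' f x := by
  simp only [conv, sub_mul]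
  exact integral_sub (isCovering_projHom.integrable_conv_integrand hκ hc hf x)
    (isCovering_projHom.integrable_conv_integrand hκ' hc' hf x)

lemma gconv_sub {κ κ' : E3 → ℝ} (hκ : ContDiff ℝ ∞ κ) (hc : HasCompactSupport κ)
    (hκ' : ContDiff ℝ ∞ κ') (hc' : HasCompactSupport κ') {f : T3 → ℝ} (hf : Integrable f) (k : Fin 3)
    (x : T3) : gconv (fun l => κ l - κ' l) k f x = gconv κ k f x - gconv κ' k f x := by
  have h : ∀ l, fderiv ℝ (fun l => κ l - κ' l) l (EuclideanSpace.single k 1) =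
      fderiv ℝ κ l (EuclideanSpace.single k 1) - fderiv ℝ κ' l (EuclideanSpace.single k 1) := by
    intro l
    rw [fderiv_fun_sub (hκ.differentiable (by simp) l) (hκ'.differentiable (by simp) l)]
    rfl
  simp only [gconv, h]
  rw [conv_proj_sub (contDiff_fderiv_apply hκ _).continuous (hc.fderiv_apply ℝ _)
    (contDiff_fderiv_apply hκ' _).continuous (hc'.fderiv_apply ℝ _) hf]
  ring

/-- A field satisfying `Δf = div Q` on almost every time slice has a weak gradient with the
integrability of `Q`. -/
theorem exists_weak_derivative {T r p : ℝ} (hr : 1 ≤ r) (hp : 1 < p) {f : ST → ℝ}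
    {Q : Fin 3 → ST → ℝ} (hf : Integrable f) (hQ : ∀ m, Mix r p (Q m))
    (hQ0 : ∀ m, ∀ z : ST, z.1 ∉ Ioo 0 T → Q m z = 0)
    (hrel : ∀ᵐ t : ℝ, ∀ W ∈ Heat, ∫ x, f (t, x) * lap W (0, x) =
      ∑ m, ∫ x, Q m (t, x) * sd (some m) W (0, x)) (k : Fin 3) :
    ∃ G : ST → ℝ, Mix r p G ∧
      ∀ Φ, IsTest T Φ → ∫ z, f z * sd (some k) Φ z = - ∫ z, G z * Φ z := by
  have hp0 : 0 < p := by linarith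
  obtain ⟨C, hC, hest⟩ := gradient_estimate hp
  have hslice : ∀ {g : ST → ℝ}, Integrable g → ∀ᵐ t : ℝ, Integrable fun x => g (t, x) := by
    intro g hg
    rw [Measure.volume_eq_prod] at hg
    exact hg.prod_right_ae
  have hall : ∀ᵐ t : ℝ, (Integrable fun x => f (t, x)) ∧ ∀ m, Integrable fun x => Q m (t, x) :=
    (hslice hf).and (ae_all_iff.2 fun m => hslice (hQ m).1)
  set κd : ℕ → E3 → ℝ := fun N l => fderiv ℝ (moll N) l (EuclideanSpace.single k 1) with hκd
  have hκdc : ∀ N, Continuous (κd N) := fun N => (contDiff_fderiv_apply (contDiff_moll N) _).continuous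
  set g : ℕ → ST → ℝ := fun N z => - sconv (κd N) f z with hg
  have hgm : ∀ N, AEStronglyMeasurable (g N) := fun N => (aesm_sconv (hκdc N) hf.1).neg
  have hgs : ∀ N t x, g N (t, x) = gconv (moll N) k (fun x => f (t, x)) x := fun N t x => rfl
  have hQfin := fun m => lintegral_sliceNorm_ne_top hr hp0 (hQ m) (hQ0 m)
  have hQm := fun m => aemeasurable_sliceNorm hp0 (hQ m).1.1
  have hgle : ∀ᵐ t : ℝ, ∀ N, sliceNorm p (g N) t ≤ C * ∑ m, sliceNorm p (Q m) t := by
    filter_upwards [hall, hrel] with t ht hrt N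
    refine (hest _ _ ht.1 ht.2 hrt (moll N) (contDiff_moll N) (hasCompactSupport_moll N) k).trans ?_
    gcongr with m _
    exact eLpNorm_conv_moll_le hp.le (ht.2 m) N
  have hgi : ∀ N, Integrable (g N) := fun N =>
    ((Mix.of_slice hr hp.le (hgm N) hQ hQ0 hC (hgle.mono fun t ht => ht N)).1)
  set e : ℕ → ℝ≥0∞ := fun N =>
    C * ∑ m, ∫⁻ t, sliceNorm p (fun z => sconv (moll N) (Q m) z - Q m z) t with he
  have he0 : Tendsto e atTop (𝓝 0) := by
    have := ENNReal.Tendsto.const_mul (a := C) (tendsto_finsetSum (Finset.univ : Finset (Fin 3))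
      fun m _ => tendsto_lintegral_sliceNorm_sconv hp.le (hQ m).1 (hQfin m)) (Or.inr hC)
    simpa using this
  have hem : ∀ N m, AEMeasurable (sliceNorm p fun z => sconv (moll N) (Q m) z - Q m z) := fun N m =>
    aemeasurable_sliceNorm hp0 ((aesm_sconv (contDiff_moll N).continuous (hQ m).1.1).sub (hQ m).1.1)
  -- The gradient estimate is linear in the kernel: applied to the difference of two mollifiers it
  -- bounds the difference of mollified gradients by that of the mollified Q's. Neither positivity
  -- nor unit mass of the kernel is required there.
  have hcauchy : ∀ N M, eLpNorm (fun z => g N z - g M z) 1 volume ≤ e N + e M := by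
    intro N M
    rw [eLpNorm_one_eq_lintegral_enorm]
    refine (lintegral_enorm_le_sliceNorm hp.le ((hgm N).sub (hgm M))).trans ?_
    have hb : ∀ᵐ t : ℝ, sliceNorm p (fun z => g N z - g M z) t ≤
        C * ∑ m, (sliceNorm p (fun z => sconv (moll N) (Q m) z - Q m z) t +
          sliceNorm p (fun z => sconv (moll M) (Q m) z - Q m z) t) := by
      filter_upwards [hall, hrel] with t ht hrt
      have h1 := hest _ _ ht.1 ht.2 hrt (fun l => moll N l - moll M l)
        ((contDiff_moll N).sub (contDiff_moll M))
        ((hasCompactSupport_moll N).sub (hasCompactSupport_moll M)) k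
      simp only [sliceNorm, hgs]
      simp only [funext fun x => gconv_sub (contDiff_moll N) (hasCompactSupport_moll N)
        (contDiff_moll M) (hasCompactSupport_moll M) ht.1 k x] at h1
      refine h1.trans ?_
      gcongr with m _
      have hcm : ∀ N, AEStronglyMeasurable
          (fun x => conv projHom (moll N) (fun x => Q m (t, x)) x - Q m (t, x)) := fun N =>
        (continuous_conv_proj (contDiff_moll N) (hasCompactSupport_moll N)
          (ht.2 m)).aestronglyMeasurable.sub (ht.2 m).1
      refine (le_of_eq ?_).trans (eLpNorm_sub_le (hcm N) (hcm M) (by simpa using hp.le))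
      congr 1
      ext x
      rw [conv_proj_sub (contDiff_moll N).continuous (hasCompactSupport_moll N)
        (contDiff_moll M).continuous (hasCompactSupport_moll M) (ht.2 m)]
      simp [sconv]
    refine (lintegral_mono_ae hb).trans (le_of_eq ?_)
    have hem2 : ∀ m, AEMeasurable fun t =>
        sliceNorm p (fun z => sconv (moll N) (Q m) z - Q m z) t +
          sliceNorm p (fun z => sconv (moll M) (Q m) z - Q m z) t := fun m => (hem N m).add (hem M m)
    rw [lintegral_const_mul' _ _ hC, lintegral_finsetSum' _ fun m _ => hem2 m, he]
    simp only
    rw [← mul_add, ← Finset.sum_add_distrib]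
    congr 1
    exact Finset.sum_congr rfl fun m _ => lintegral_add_left' (hem N m) _
  have hmem : ∀ N, MemLp (g N) 1 volume := fun N => memLp_one_iff_integrable.2 (hgi N)
  have hseq : CauchySeq fun N => (hmem N).toLp := by
    rw [EMetric.cauchySeq_iff]
    intro ε hε
    obtain ⟨δ, hδ0, hδ⟩ := exists_between hε
    obtain ⟨N₀, hN₀⟩ := (ENNReal.tendsto_atTop_zero.1 he0) (δ / 2) (by simpa using hδ0.ne')
    refine ⟨N₀, fun N hN M hM => ?_⟩
    rw [Lp.edist_toLp_toLp]
    refine (hcauchy N M).trans_lt ((add_le_add (hN₀ N hN) (hN₀ M hM)).trans_lt ?_)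
    rwa [ENNReal.add_halves]
  obtain ⟨G, hG⟩ := cauchySeq_tendsto_of_complete hseq
  have hGm : AEStronglyMeasurable (G : ST → ℝ) := Lp.aestronglyMeasurable G
  have hGlim : Tendsto (fun N => eLpNorm (fun z => g N z - G z) 1 volume) atTop (𝓝 0) := by
    have := tendsto_iff_edist_tendsto_0.1 hG
    refine this.congr fun N => ?_
    rw [Lp.edist_def]
    exact eLpNorm_congr_ae ((hmem N).coeFn_toLp.sub (EventuallyEq.refl _ _))
  obtain ⟨ns, -, hns⟩ :=
    (tendstoInMeasure_of_tendsto_eLpNorm one_ne_zero hgm hGm hGlim).exists_seq_tendsto_ae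
  have hns' : ∀ᵐ t : ℝ, ∀ᵐ x : T3, Tendsto (fun i => g (ns i) (t, x)) atTop (𝓝 (G (t, x))) :=
    ae_ae_slice hns
  -- Membership in the mixed space is obtained slice by slice from Fatou's lemma along an almost
  -- everywhere convergent subsequence.
  have hMix : Mix r p G := by
    refine Mix.of_slice hr hp.le hGm hQ hQ0 hC ?_
    filter_upwards [hns', hgle, hall] with t ht hb hi
    refine (Lp.eLpNorm_lim_le_liminf_eLpNorm (f := fun i x => g (ns i) (t, x)) (fun i => ?_) _
      ht).trans ?_
    · exact (continuous_gconv (contDiff_moll _) (hasCompactSupport_moll _) k hi.1).aestronglyMeasurable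
    · exact liminf_le_of_le (by isBoundedDefault) fun b hb' => by
        obtain ⟨n, hn⟩ := hb'.exists
        exact hn.trans (hb _)
  refine ⟨G, hMix, fun Φ hΦ => ?_⟩
  have hfi := integrable_sconv_moll hf
  have l1 := tendsto_integral_mul_of_eLpNorm hfi hf (tendsto_eLpNorm_sconv hf) (hΦ.sd (some k))
  have l2 := (tendsto_integral_mul_of_eLpNorm hgi hMix.1 hGlim hΦ).neg
  -- For smooth mollifications the integration by parts holds on every good slice; both sides
  -- converge in L¹ against the test function.
  refine tendsto_nhds_unique l1 (l2.congr fun N => ?_)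
  have i1 := hΦ.integrable_mul (hgi N)
  have i2 := (hΦ.sd (some k)).integrable_mul (hfi N)
  simp only [mul_comm (Φ _), mul_comm (HallMHD.sd _ _ _)] at i1 i2
  rw [Measure.volume_eq_prod] at i1 i2 ⊢
  rw [integral_prod _ i1, integral_prod _ i2, ← integral_neg]
  refine integral_congr_ae ?_
  filter_upwards [hall] with t ht
  have := integral_gconv_mul (contDiff_moll N) (hasCompactSupport_moll N) ht.1 hΦ.1 t k
  simp only [hgs, this, neg_neg]
  rfl

end

/-! ### Elliptic regularity in mixed Lebesgue spaces -/

section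

lemma Mix.of_lintegral {T r p : ℝ} (hr : 1 ≤ r) (hp : 1 ≤ p) {f : ST → ℝ}
    (hf : AEStronglyMeasurable f) (h0 : ∀ z : ST, z.1 ∉ Ioo 0 T → f z = 0)
    (h : ∫⁻ t in Ioo 0 T, sliceNorm p f t ^ r ≠ ⊤) : Mix r p f := by
  have hp0 : 0 < p := by linarith
  have hI : ∫⁻ t, sliceNorm p f t ^ r ≠ ⊤ := by
    rw [← lintegral_indicator measurableSet_Ioo] at h
    convert h using 2
    ext t
    by_cases ht : t ∈ Ioo 0 T
    · rw [indicator_of_mem ht]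
    · rw [indicator_of_notMem ht, sliceNorm_eq_zero h0 p ht, ENNReal.zero_rpow_of_pos (by linarith)]
  refine ⟨⟨hf, (lintegral_enorm_le_sliceNorm hp hf).trans_lt (lt_top_iff_ne_top.2 ?_)⟩, by
    rwa [mixI_eq_lintegral_sliceNorm hp0]⟩
  have hle : ∀ t, sliceNorm p f t ≤ (Ioo 0 T).indicator (fun _ => 1) t + sliceNorm p f t ^ r := by
    intro t
    by_cases ht : t ∈ Ioo 0 T
    · rw [indicator_of_mem ht]
      exact ennreal_le_one_add_rpow hr _
    · rw [sliceNorm_eq_zero h0 p ht]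
      exact zero_le
  refine ne_top_of_le_ne_top ?_ (lintegral_mono hle)
  rw [lintegral_add_left' (aemeasurable_const.indicator measurableSet_Ioo),
    lintegral_indicator measurableSet_Ioo]
  exact ENNReal.add_ne_top.2 ⟨by simp, hI⟩

/-- The mean is bounded by the L¹ norm. The oscillation is controlled by Poincaré's inequality and
the gradient estimate for the mollifications, uniformly in the mollifier, and passes to the limit;
the factor 3 counts the partial derivatives. -/
lemma eLpNorm_le_of_laplacian {p : ℝ} (hp : 1 < p) :
    ∃ C : ℝ≥0∞, C ≠ ⊤ ∧ ∀ (f : T3 → ℝ) (Q : Fin 3 → T3 → ℝ), Integrable f →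
      (∀ m, Integrable (Q m)) →
      (∀ W ∈ Heat, ∫ x, f x * lap W (0, x) = ∑ m, ∫ x, Q m x * sd (some m) W (0, x)) →
      eLpNorm f (.ofReal p) volume ≤
        eLpNorm f 1 volume + C * ∑ m, eLpNorm (Q m) (.ofReal p) volume := by
  obtain ⟨C, hC, hest⟩ := gradient_estimate hp
  have hp1 : 1 ≤ ENNReal.ofReal p := by simpa using hp.le
  refine ⟨3 * C, ENNReal.mul_ne_top (by norm_num) hC, fun f Q hf hQ hrel => ?_⟩
  have hmean : ∀ N, ∫ x, conv projHom (moll N) f x = ∫ x, f x := fun N => by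
    rw [integral_conv_proj (contDiff_moll N).continuous (hasCompactSupport_moll N) hf, integral_moll,
      one_mul]
  have key : eLpNorm (fun x => f x - ∫ y, f y) (.ofReal p) volume ≤
      3 * C * ∑ m, eLpNorm (Q m) (.ofReal p) volume := by
    refine eLpNorm_le_of_tendsto (g := fun N x => conv projHom (moll N) f x - ∫ y, f y)
      (fun N => ((continuous_conv_proj (contDiff_moll N) (hasCompactSupport_moll N) hf).sub
        continuous_const).aestronglyMeasurable)
      (hf.1.sub aestronglyMeasurable_const) ?_ fun N => ?_
    · simpa using tendsto_eLpNorm_conv_moll_one hf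
    have h := poincare_conv (contDiff_moll N) (hasCompactSupport_moll N) hf hp.le
    rw [hmean] at h
    refine h.trans ((Finset.sum_le_sum fun k _ => hest f Q hf hQ hrel (moll N) (contDiff_moll N)
      (hasCompactSupport_moll N) k).trans ?_)
    rw [Finset.sum_const, Finset.card_univ, Fintype.card_fin, nsmul_eq_mul, mul_assoc]
    gcongr
    · norm_num
    · exact eLpNorm_conv_moll_le hp.le (hQ _) N
  have hsum := eLpNorm_add_le (μ := (volume : Measure T3)) (p := .ofReal p)
    (f := fun _ => ∫ y, f y) (g := fun x => f x - ∫ y, f y) aestronglyMeasurable_const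
    (hf.1.sub aestronglyMeasurable_const) hp1
  have e : ((fun _ => ∫ y, f y) + fun x => f x - ∫ y, f y) = f := by
    ext x
    simp
  rw [e] at hsum
  refine hsum.trans (add_le_add ?_ key)
  rw [eLpNorm_const _ (by positivity) (NeZero.ne _)]
  simp only [measure_univ, ENNReal.one_rpow, mul_one, eLpNorm_one_eq_lintegral_enorm]
  exact enorm_integral_le_lintegral_enorm f

lemma sliceNorm_slab {T p : ℝ} (hp : 1 ≤ p) {t : ℝ} (ht : t ∈ Ioo 0 T) :
    sliceNorm p (slab T) t = 1 := by
  have : (fun x => slab T (t, x)) = fun _ => (1 : ℝ) := funext fun x => by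
    rw [slab, ext_of_mem (by exact ht)]
  rw [sliceNorm, this, eLpNorm_const _ (by simpa using lt_of_lt_of_le one_pos hp) (NeZero.ne _)]
  simp

lemma ae_integrable_slice {g : ST → ℝ} (hg : Integrable g) :
    ∀ᵐ t : ℝ, Integrable fun x => g (t, x) := by
  rw [Measure.volume_eq_prod] at hg
  exact hg.prod_right_ae

/-- A field satisfying `Δf = div Q` on almost every time slice has the integrability of `Q`. -/
lemma mix_of_laplacian {T r p : ℝ} (hr : 1 ≤ r) (hp : 1 < p) {f : ST → ℝ}
    {Q : Fin 3 → ST → ℝ} (hf : Integrable f) (hQ : ∀ m, Mix r p (Q m))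
    (hf0 : ∀ z : ST, z.1 ∉ Ioo 0 T → f z = 0)
    (hQ0 : ∀ m, ∀ z : ST, z.1 ∉ Ioo 0 T → Q m z = 0)
    (hrel : ∀ᵐ t : ℝ, ∀ W ∈ Heat, ∫ x, f (t, x) * lap W (0, x) =
      ∑ m, ∫ x, Q m (t, x) * sd (some m) W (0, x))
    {M : ℝ≥0∞} (hM : M ≠ ⊤) (hfM : ∀ᵐ t : ℝ, sliceNorm 1 f t ≤ M) : Mix r p f := by
  obtain ⟨C, hC, hest⟩ := eLpNorm_le_of_laplacian hp
  -- The indicator of the time slab is an additional comparison function: it represents the uniform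
  -- bound on the slice means, which Q does not control.
  refine Mix.of_slice (ι := Option (Fin 3)) (T := T) (C := M + C) hr hp.le hf.1
    (g := fun a => a.elim (slab T) Q) ?_ ?_ (ENNReal.add_ne_top.2 ⟨hM, hC⟩) ?_
  · rintro (_ | m)
    · exact mix_slab T (by linarith) (by linarith)
    · exact hQ m
  · rintro (_ | m) z hz
    · exact ext_of_notMem (f := fun _ _ => 1) hz
    · exact hQ0 m z hz
  filter_upwards [ae_integrable_slice hf, ae_all_iff.2 fun m => ae_integrable_slice (hQ m).1, hrel,
    hfM] with t h1 h2 h3 h4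
  by_cases ht : t ∈ Ioo 0 T
  · refine (hest _ _ h1 h2 h3).trans ?_
    simp only [Fintype.sum_option, Option.elim, sliceNorm_slab hp.le ht]
    rw [mul_add, mul_one]
    refine add_le_add ((?_ : _ ≤ M).trans le_self_add) ?_
    · simpa [sliceNorm] using h4
    · gcongr
      · exact le_add_self
      · exact le_rfl
  · rw [sliceNorm_eq_zero hf0 p ht]
    exact zero_le

/-- The Calderón–Zygmund inequality on almost every slice. A relation tested with Laplacians says
nothing about the slice mean, so the mean is subtracted; f itself need not be integrable up to the
ends of the time interval. -/
lemma mix_of_hessian {T r p : ℝ} (hr : 1 ≤ r) (hp : 1 < p) {f : ST → ℝ}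
    {S : Fin 3 → Fin 3 → ST → ℝ} (hf : AEStronglyMeasurable f)
    (hfi : ∀ᵐ t : ℝ, t ∈ Ioo 0 T → Integrable fun x => f (t, x))
    (hS : ∀ m k, Mix r p (S m k))
    (hS0 : ∀ m k, ∀ z : ST, z.1 ∉ Ioo 0 T → S m k z = 0)
    (hrel : ∀ᵐ t : ℝ, t ∈ Ioo 0 T → ∀ W ∈ Heat, ∫ x, f (t, x) * lap W (0, x) =
      ∑ m, ∑ k, ∫ x, S m k (t, x) * sd (some m) (sd (some k) W) (0, x)) :
    Mix r p fun z => slab T z * (f z - ∫ y, f (z.1, y)) := by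
  obtain ⟨C, hC, hest⟩ := calderon_zygmund_integrable hp
  have hm : AEStronglyMeasurable fun z : ST => slab T z * (f z - ∫ y, f (z.1, y)) := by
    refine (mix_slab T one_pos one_pos).1.1.mul (hf.sub ?_)
    have hf' := hf
    rw [Measure.volume_eq_prod] at hf' ⊢
    exact hf'.integral_prod_right'.comp_fst
  refine Mix.of_slice (ι := Fin 3 × Fin 3) (T := T) (C := C) hr hp.le hm
    (g := fun a => S a.1 a.2) (fun a => hS a.1 a.2) (fun a => hS0 a.1 a.2) hC ?_
  filter_upwards [hfi, ae_all_iff.2 fun m => ae_all_iff.2 fun k => ae_integrable_slice (hS m k).1,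
    hrel] with t h1 h2 h3
  by_cases ht : t ∈ Ioo 0 T
  · have := hest _ _ (h1 ht) h2 (h3 ht)
    rw [Fintype.sum_prod_type]
    refine (le_of_eq ?_).trans this
    rw [sliceNorm]
    congr 1
    ext x
    rw [slab, ext_of_mem (by exact ht), one_mul]
  · rw [sliceNorm_eq_zero (T := T) (fun z hz => ?_) p ht]
    · exact zero_le
    · simp only [slab, ext_of_notMem hz, zero_mul]

/-! ### Components of vector fields -/

/-- The components of a vector field, extended by zero. -/
def comp (T : ℝ) (v : ℝ → T3 → E3) (k : Fin 3) : ST → ℝ := ext T fun t x => v t x k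

lemma comp_of_mem {T : ℝ} {v : ℝ → T3 → E3} {k : Fin 3} {z : ST} (hz : z.1 ∈ Ioo 0 T) :
    comp T v k z = v z.1 z.2 k := ext_of_mem hz

lemma comp_of_notMem {T : ℝ} {v : ℝ → T3 → E3} {k : Fin 3} {z : ST} (hz : z.1 ∉ Ioo 0 T) :
    comp T v k z = 0 := ext_of_notMem hz

lemma aesm_comp {T : ℝ} {v : ℝ → T3 → E3}
    (hv : AEStronglyMeasurable (Function.uncurry v) (stMeasure T)) (k : Fin 3) :
    AEStronglyMeasurable (comp T v k) := by
  rw [comp, aesm_ext_iff]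
  exact (EuclideanSpace.proj (𝕜 := ℝ) k).continuous.comp_aestronglyMeasurable hv

lemma sliceNorm_comp_le {T p : ℝ} {v : ℝ → T3 → E3} (k : Fin 3) {t : ℝ} (ht : t ∈ Ioo 0 T) :
    sliceNorm p (comp T v k) t ≤ eLpNorm (v t) (.ofReal p) volume := by
  refine eLpNorm_mono fun x => ?_
  rw [comp_of_mem (by exact ht)]
  exact PiLp.norm_apply_le (v t x) k

lemma MemMixed.mix {T r p : ℝ} (hr : 1 ≤ r) (hp : 1 ≤ p) {v : ℝ → T3 → E3}
    (hv : MemMixed T (.ofReal r) (.ofReal p) v) (k : Fin 3) : Mix r p (comp T v k) := by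
  have hr0 : 0 < r := by linarith
  refine Mix.of_lintegral (T := T) hr hp (aesm_comp hv.1 k) (fun z hz => comp_of_notMem hz) ?_
  have h2 := hv.2
  rw [eLpNorm_eq_lintegral_rpow_enorm_toReal (by simpa using hr0) ENNReal.ofReal_ne_top,
    ENNReal.toReal_ofReal hr0.le] at h2
  have h3 : ∫⁻ t in Ioo 0 T, eLpNorm (v t) (.ofReal p) volume ^ r ≠ ⊤ := by
    intro h
    simp only [enorm_eq_self] at h2
    rw [h, ENNReal.top_rpow_of_pos (by positivity)] at h2
    exact lt_irrefl _ h2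
  refine ne_top_of_le_ne_top h3 (lintegral_mono_ae ?_)
  filter_upwards [ae_restrict_mem measurableSet_Ioo] with t ht
  exact ENNReal.rpow_le_rpow (sliceNorm_comp_le k ht) hr0.le

lemma MemMixed.exists_bound {T : ℝ} {v : ℝ → T3 → E3} (hv : MemMixed T ⊤ 2 v) :
    ∃ M : ℝ≥0∞, M ≠ ⊤ ∧ ∀ k, ∀ᵐ t : ℝ, sliceNorm 2 (comp T v k) t ≤ M := by
  have h2 := hv.2
  rw [eLpNorm_exponent_top] at h2
  refine ⟨_, h2.ne, fun k => ?_⟩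
  have h3 := enorm_ae_le_eLpNormEssSup (fun t => eLpNorm (v t) 2 volume) (volume.restrict (Ioo 0 T))
  rw [ae_restrict_iff' measurableSet_Ioo] at h3
  filter_upwards [h3] with t ht
  by_cases htT : t ∈ Ioo 0 T
  · have := ht htT
    rw [enorm_eq_self] at this
    refine (sliceNorm_comp_le k htT).trans ?_
    simpa using this
  · rw [sliceNorm_eq_zero (T := T) (fun z hz => comp_of_notMem hz) 2 htT]
    exact zero_le

end

section

/-! ### The weak formulation in components -/

lemma isTest_zero (T : ℝ) : IsTest T fun _ => 0 :=
  ⟨smoothST_const 0, 1, T - 1, one_pos, by linarith, fun _ _ => rfl⟩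

/-- The vector field `φ eᵢ`. -/
def single (i : Fin 3) (φ : ST → ℝ) (l : Fin 3) : ST → ℝ := if l = i then φ else fun _ => 0

lemma isTest_single {T : ℝ} {φ : ST → ℝ} (hφ : IsTest T φ) (i l : Fin 3) :
    IsTest T (single i φ l) := by
  unfold single
  split_ifs
  exacts [hφ, isTest_zero T]

lemma single_apply (i l : Fin 3) (φ : ST → ℝ) (z : ST) :
    single i φ l z = if l = i then φ z else 0 := by
  unfold single
  split_ifs <;> rfl

lemma sd_single (α : Option (Fin 3)) (i l : Fin 3) (φ : ST → ℝ) (z : ST) :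
    sd α (single i φ l) z = if l = i then sd α φ z else 0 := by
  unfold single
  split_ifs
  · rfl
  · simp [sd]

/-- The matrix of the cross product with `j`. -/
def curlMat (j : Fin 3 → ST → ℝ) (i k : Fin 3) (z : ST) : ℝ :=
  !![0, j 2 z, -j 1 z; -j 2 z, 0, j 0 z; j 1 z, -j 0 z, 0] i k

section Components

variable {T : ℝ} {v u b j : ℝ → T3 → E3} {P : ℝ → T3 → ℝ} {φ : ST → ℝ}

lemma IsWeakDivFree.weakDiv (h : IsWeakDivFree T v) :
    WeakDiv T (sp (comp T v)) fun _ => 0 := by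
  rw [weakDiv_sp_iff]
  intro Φ hΦ
  have h1 := h hΦ.toTestFn
  rw [stInt_eq_of_isTest (F := fun z => ∑ k, comp T v k z * sd (some k) Φ z)] at h1
  · simpa using h1
  · intro z hz
    simp only [PiLp.inner_apply, comp_of_mem hz, sd_space_eq hΦ.1, grad]
    exact Finset.sum_congr rfl fun k _ => mul_comm _ _
  · intro z hz
    simp [comp_of_notMem hz]

/-- The entries of `curlMat` are ∂ᵢbₖ − ∂ₖbᵢ. The antisymmetric matrix form is the one that can be
differentiated and summed to give the Laplacian. -/
lemma IsWeakCurl.component (h : IsWeakCurl T b j) (hφ : IsTest T φ) (i k : Fin 3) :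
    ∫ z, (comp T b i z * sd (some k) φ z - comp T b k z * sd (some i) φ z) =
      ∫ z, curlMat (comp T j) i k z * φ z := by
  have key : ∀ i : Fin 3, ∫ z, comp T j i z * φ z =
      ∫ z, (comp T b (i + 1) z * sd (some (i + 2)) φ z -
        comp T b (i + 2) z * sd (some (i + 1)) φ z) := by
    intro i
    have h1 := h (vecTest (isTest_single hφ i))
    rw [stInt_eq_of_isTest (F := fun z => comp T j i z * φ z),
      stInt_eq_of_isTest (F := fun z => comp T b (i + 1) z * sd (some (i + 2)) φ z -
        comp T b (i + 2) z * sd (some (i + 1)) φ z)] at h1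
    · exact h1
    · intro z hz
      simp only [PiLp.inner_apply, comp_of_mem hz, Fin.sum_univ_three, curl, pd_vecTest, sd_single]
      fin_cases i <;> simp <;> ring
    · intro z hz
      simp [comp_of_notMem hz]
    · intro z hz
      simp only [PiLp.inner_apply, comp_of_mem hz, Fin.sum_univ_three, vecTest, single_apply]
      fin_cases i <;> simp <;> ring
    · intro z hz
      simp [comp_of_notMem hz]
  have h0 := key 0
  have h1 := key 1
  have h2 := key 2
  simp only [Fin.isValue, zero_add, Fin.reduceAdd] at h0 h1 h2
  fin_cases i <;> fin_cases k <;>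
    simp only [curlMat, Fin.zero_eta, Fin.mk_one, Fin.reduceFinMk, Matrix.of_apply,
      Matrix.cons_val, sub_self, zero_mul, neg_mul, integral_neg, h0, h1, h2] <;>
    first | rfl | (rw [← integral_neg]; simp only [neg_sub])

lemma IsWeakSolution.momentum_component (h : IsWeakSolution T u b j P) (hφ : IsTest T φ)
    (i : Fin 3) :
    (∫ z, comp T u i z * sd none φ z) +
      (∫ z, ∑ k, (comp T u k z * comp T u i z - comp T b k z * comp T b i z) * sd (some k) φ z) +
      ∫ z, ext T P z * sd (some i) φ z = 0 := by
  have h1 := h.momentum (vecTest (isTest_single hφ i))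
  rw [stInt_eq_of_isTest (F := fun z => comp T u i z * sd none φ z),
    stInt_eq_of_isTest (F := fun z => ∑ k, (comp T u k z * comp T u i z -
      comp T b k z * comp T b i z) * sd (some k) φ z),
    stInt_eq_of_isTest (F := fun z => ext T P z * sd (some i) φ z)] at h1
  · linarith
  · intro z hz
    simp only [ext_of_mem hz, dvg, pd_vecTest, sd_single]
    simp
  · intro z hz
    simp [ext_of_notMem hz]
  · intro z hz
    simp only [comp_of_mem hz, pd_vecTest, sd_single]
    rw [Finset.sum_comm]
    simp
  · intro z hz
    simp [comp_of_notMem hz]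
  · intro z hz
    simp only [PiLp.inner_apply, comp_of_mem hz, deriv_vecTest, sd_single]
    simp [mul_comm]
  · intro z hz
    simp [comp_of_notMem hz]

/-- The inner product of j × b with the curl of φeᵢ is a contraction of ∇φ with an antisymmetric
tensor, so the Hall term acquires the same divergence form as the advection terms. -/
lemma IsWeakSolution.induction_component (h : IsWeakSolution T u b j P) (hφ : IsTest T φ)
    (i : Fin 3) :
    (∫ z, comp T b i z * sd none φ z) +
      (∫ z, ∑ k, (comp T u k z * comp T b i z - comp T b k z * comp T u i z) * sd (some k) φ z) -
      ∫ z, ∑ k, (comp T j k z * comp T b i z - comp T b k z * comp T j i z) * sd (some k) φ z =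
      0 := by
  have h1 := h.induction (vecTest (isTest_single hφ i))
  rw [stInt_eq_of_isTest (F := fun z => comp T b i z * sd none φ z),
    stInt_eq_of_isTest (F := fun z => ∑ k, (comp T u k z * comp T b i z -
      comp T b k z * comp T u i z) * sd (some k) φ z),
    stInt_eq_of_isTest (F := fun z => ∑ k, (comp T j k z * comp T b i z -
      comp T b k z * comp T j i z) * sd (some k) φ z)] at h1
  · linarith
  · intro z hz
    simp only [PiLp.inner_apply, comp_of_mem hz, Fin.sum_univ_three, curl, pd_vecTest, sd_single,
      cross, crossProduct]
    fin_cases i <;> simp <;> ring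
  · intro z hz
    simp [comp_of_notMem hz]
  · intro z hz
    simp only [comp_of_mem hz, pd_vecTest, sd_single]
    rw [Finset.sum_comm]
    simp
  · intro z hz
    simp [comp_of_notMem hz]
  · intro z hz
    simp only [PiLp.inner_apply, comp_of_mem hz, deriv_vecTest, sd_single]
    simp [mul_comm]
  · intro z hz
    simp [comp_of_notMem hz]

end Components

lemma SpaceOp.id : SpaceOp fun f => f where
  smooth _ hf := hf
  add _ _ _ _ _ := rfl
  const_mul _ _ _ _ := rfl
  freeze _ _ _ _ _ := rfl

lemma lintegral_enorm_eq_zero_of_slices {f : ST → ℝ} (hf : AEStronglyMeasurable f)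
    (h : ∀ᵐ t : ℝ, sliceNorm 1 f t = 0) : f =ᵐ[volume] 0 := by
  have := lintegral_sliceNorm_one hf
  rw [lintegral_congr_ae h, lintegral_zero, eq_comm, lintegral_eq_zero_iff' hf.enorm] at this
  filter_upwards [this] with z hz
  simpa using hz

/-- The fundamental lemma of the calculus of variations. -/
lemma ae_eq_zero_of_isTest {T : ℝ} {f : ST → ℝ} (hf : Integrable f)
    (hf0 : ∀ z : ST, z.1 ∉ Ioo 0 T → f z = 0)
    (h : ∀ Φ, IsTest T Φ → ∫ z, f z * Φ z = 0) : f =ᵐ[volume] 0 := by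
  obtain ⟨C, -, hC⟩ := calderon_zygmund_integrable one_lt_two
  refine lintegral_enorm_eq_zero_of_slices hf.1 ?_
  have hsl := ae_slice_relation (ι := Unit) (F := fun _ => f) (L := fun _ f => f) (T := T)
    (fun _ a c _ _ => hf.integrableOn) (fun _ => SpaceOp.id) (by simpa using h)
  filter_upwards [hsl, ae_integrable_slice hf] with t ht hi
  by_cases htT : t ∈ Ioo 0 T
  · have hW := ht htT
    simp only [Finset.univ_unique, Finset.sum_const, Finset.card_singleton, one_smul] at hW
    -- On almost every slice f is orthogonal to all trigonometric polynomials. The Calderón–Zygmund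
    -- inequality with zero right-hand side makes f equal to its mean, and the constant mode shows
    -- that the mean is zero.
    have h1 := hC (fun x => f (t, x)) (fun _ _ _ => 0) hi (fun _ _ => integrable_zero _ _ _)
      fun W hW' => by simpa using hW _ (heat_lap hW')
    have hmean : ∫ x, f (t, x) = 0 := by
      have := hW _ (mode_mem 0 0)
      simpa [mode, lam, UnitAddTorus.mFourier_zero] using this
    simp only [hmean, sub_zero] at h1
    have h0 : eLpNorm (fun _ : T3 => (0 : ℝ)) (.ofReal 2) volume = 0 := eLpNorm_zero
    simp only [h0, Finset.sum_const_zero, mul_zero, nonpos_iff_eq_zero] at h1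
    rw [eLpNorm_eq_zero_iff hi.1 (by norm_num)] at h1
    rw [sliceNorm, eLpNorm_congr_ae h1]
    exact eLpNorm_zero
  · exact sliceNorm_eq_zero hf0 1 htT

end

section

/-! ### Regularity of the solution -/

/-- The assumptions on a weak solution of the Hall MHD equations. -/
structure Setting (T p q m n : ℝ) (u b j : ℝ → T3 → E3) (P : ℝ → T3 → ℝ) : Prop where
  hT : 0 < T
  hp : 1 < p
  hq : 1 < q
  hm : 1 < m
  hn : 1 < n
  hpm : 2 / p + 1 / m = 1
  hqn : 2 / q + 1 / n = 1
  sol : IsWeakSolution T u b j P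
  u2 : MemMixed T ⊤ 2 u
  u3 : MemMixed T 3 3 u
  b2 : MemMixed T ⊤ 2 b
  bpq : MemMixed T (ENNReal.ofReal p) (ENNReal.ofReal q) b
  jmn : MemMixed T (ENNReal.ofReal m) (ENNReal.ofReal n) j

lemma Mix.neg {r p : ℝ} {f : ST → ℝ} (hf : Mix r p f) : Mix r p fun z => -f z :=
  ⟨hf.1.neg, by simpa only [enorm_neg] using hf.2⟩

lemma mixI_self {r : ℝ} (hr : 0 < r) {f : ST → ℝ} (hf : AEStronglyMeasurable f) :
    mixI r r (fun z => ‖f z‖ₑ) = ∫⁻ z, ‖f z‖ₑ ^ r := by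
  simp only [mixI, div_self hr.ne', ENNReal.rpow_one]
  rw [Measure.volume_eq_prod] at hf ⊢
  rw [lintegral_prod _ (hf.enorm.pow_const r)]

/-- The product of two fields in `L³` belongs to `L^{3/2}`. -/
lemma Mix.mul {f g : ST → ℝ} (hf : Mix 3 3 f) (hg : Mix 3 3 g) (hfg : Integrable fun z => f z * g z) :
    Mix (3 / 2) (3 / 2) fun z => f z * g z := by
  refine ⟨hfg, ?_⟩
  have h1 := hf.2
  have h2 := hg.2
  rw [mixI_self (by norm_num) hf.1.1] at h1
  rw [mixI_self (by norm_num) hg.1.1] at h2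
  rw [mixI_self (by norm_num) hfg.1]
  refine ne_top_of_le_ne_top (ENNReal.add_ne_top.2 ⟨h1, h2⟩)
    ((lintegral_mono fun z => ?_).trans_eq (lintegral_add_left' (hf.1.1.enorm.pow_const _) _))
  have key : ∀ a b : ℝ≥0∞, a ≤ b → (a * b) ^ (3 / 2 : ℝ) ≤ b ^ (3 : ℝ) := fun a b hab => by
    calc (a * b) ^ (3 / 2 : ℝ) ≤ (b ^ (2 : ℝ)) ^ (3 / 2 : ℝ) := by
          refine ENNReal.rpow_le_rpow ?_ (by norm_num)
          rw [ENNReal.rpow_two, sq]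
          gcongr
      _ = b ^ (3 : ℝ) := by
          rw [← ENNReal.rpow_mul]
          norm_num
  rw [enorm_mul]
  rcases le_total ‖f z‖ₑ ‖g z‖ₑ with h | h
  · exact (key _ _ h).trans le_add_self
  · rw [mul_comm]
    exact (key _ _ h).trans le_self_add

lemma MemLocLp.aesm {V : Type*} [NormedAddCommGroup V] {T : ℝ} {r : ℝ≥0∞} {f : ℝ → T3 → V}
    (hf : MemLocLp T r f) : AEStronglyMeasurable (Function.uncurry f) (stMeasure T) := by
  have hs : Ioo 0 T ×ˢ (univ : Set T3) ⊆ ⋃ q : {q : ℚ × ℚ // (0 : ℝ) < q.1 ∧ (q.2 : ℝ) < T},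
      Icc (q.1.1 : ℝ) q.1.2 ×ˢ (univ : Set T3) := by
    rintro ⟨t, x⟩ ⟨ht, -⟩
    obtain ⟨a, ha, hat⟩ := exists_rat_btwn ht.1
    obtain ⟨c, hct, hcT⟩ := exists_rat_btwn ht.2
    exact mem_iUnion.2 ⟨⟨(a, c), ha, hcT⟩, ⟨hat.le, hct.le⟩, mem_univ _⟩
  rw [stMeasure_eq]
  refine AEStronglyMeasurable.mono_set hs ((aestronglyMeasurable_iUnion_iff).2 fun q => ?_)
  have := (hf _ _ q.2.1 q.2.2).1
  rwa [← Measure.restrict_univ (μ := (volume : Measure T3)), Measure.prod_restrict,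
    ← Measure.volume_eq_prod] at this

lemma MemLocLp.integrableOn_ext {T : ℝ} {f : ℝ → T3 → ℝ} (hf : MemLocLp T 1 f) {a c : ℝ}
    (ha : 0 < a) (hc : c < T) : IntegrableOn (ext T f) (Icc a c ×ˢ univ) := by
  have := memLp_one_iff_integrable.1 (hf a c ha hc)
  rw [← Measure.restrict_univ (μ := (volume : Measure T3)), Measure.prod_restrict,
    ← Measure.volume_eq_prod] at this
  refine IntegrableOn.congr_fun (f := Function.uncurry f) this (fun z hz => ?_)
    (measurableSet_Icc.prod MeasurableSet.univ)
  rw [ext_of_mem ⟨ha.trans_le hz.1.1, hz.1.2.trans_lt hc⟩]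
  rfl

lemma IsTest.integrable_mul_of_loc {T : ℝ} {f Φ : ST → ℝ} (hΦ : IsTest T Φ)
    (hf : ∀ a c : ℝ, 0 < a → c < T → IntegrableOn f (Icc a c ×ˢ univ)) :
    Integrable fun z => f z * Φ z := by
  obtain ⟨C, -, hC⟩ := hΦ.bound
  obtain ⟨-, a, c, ha, hc, h0⟩ := id hΦ
  have h2 : IntegrableOn (fun z : ST => f z * Φ z) (Icc a c ×ˢ univ) :=
    (hf a c ha hc).mul_bdd (c := C) hΦ.continuous.aestronglyMeasurable (Eventually.of_forall hC)
  refine h2.integrable_of_forall_notMem_eq_zero fun z hz => ?_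
  rw [h0 z fun hm => hz ⟨hm, mem_univ _⟩, mul_zero]

namespace Setting

variable {T p q m n : ℝ} {u b j : ℝ → T3 → E3} {P : ℝ → T3 → ℝ} (S : Setting T p q m n u b j P)
include S

lemma mixU (k : Fin 3) : Mix 3 3 (comp T u k) :=
  MemMixed.mix (by norm_num) (by norm_num) (by simpa using S.u3) k

lemma mixB (k : Fin 3) : Mix p q (comp T b k) := S.bpq.mix S.hp.le S.hq.le k

lemma mixJ (k : Fin 3) : Mix m n (comp T j k) := S.jmn.mix S.hm.le S.hn.le k

lemma exponents : p⁻¹ + p⁻¹ + m⁻¹ = 1 ∧ q⁻¹ + q⁻¹ + n⁻¹ = 1 := by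
  have h1 := S.hpm
  have h2 := S.hqn
  simp only [div_eq_mul_inv, one_mul, two_mul] at h1 h2
  exact ⟨h1, h2⟩

/-- Two factors from the space of b and one from the space of j. The variants `tri'` and `tri''`
only move the latter to another slot. -/
lemma tri {f g h : ST → ℝ} (hf : Mix p q f) (hg : Mix p q g) (hh : Mix m n h) : Tri ![f, g, h] := by
  have := S.hp; have := S.hq; have := S.hm; have := S.hn
  exact Tri.of hf hg hh (by linarith) (by linarith) (by linarith) (by linarith) (by linarith)
    (by linarith) S.exponents.1 S.exponents.2

lemma tri' {f g h : ST → ℝ} (hf : Mix p q f) (hg : Mix m n g) (hh : Mix p q h) :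
    Tri ![f, g, h] := by
  have := S.hp; have := S.hq; have := S.hm; have := S.hn; have h := S.exponents
  exact Tri.of hf hg hh (by linarith) (by linarith) (by linarith) (by linarith) (by linarith)
    (by linarith) (by linarith) (by linarith)

lemma tri'' {f g h : ST → ℝ} (hf : Mix m n f) (hg : Mix p q g) (hh : Mix p q h) :
    Tri ![f, g, h] := by
  have := S.hp; have := S.hq; have := S.hm; have := S.hn; have h := S.exponents
  exact Tri.of hf hg hh (by linarith) (by linarith) (by linarith) (by linarith) (by linarith)
    (by linarith) (by linarith) (by linarith)

lemma slab_pq : Mix p q (slab T) := mix_slab T (by linarith [S.hp]) (by linarith [S.hq])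

lemma mix_curlMat (i k : Fin 3) : Mix m n (curlMat (comp T j) i k) := by
  have h0 : Mix m n fun _ => 0 := by
    refine ⟨integrable_zero _ _ _, ?_⟩
    have h1 : 0 < m / n := div_pos (by linarith [S.hm]) (by linarith [S.hn])
    simp [mixI, ENNReal.zero_rpow_of_pos h1, show (0 : ℝ) < n by linarith [S.hn]]
  fin_cases i <;> fin_cases k <;>
    first | exact h0 | exact S.mixJ _ | exact (S.mixJ _).neg

omit S in
lemma curlMat_of_notMem {i k : Fin 3} {z : ST} (hz : z.1 ∉ Ioo 0 T) :
    curlMat (comp T j) i k z = 0 := by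
  fin_cases i <;> fin_cases k <;> simp [curlMat, comp_of_notMem hz]

lemma weakDiv_b : WeakDiv T (sp (comp T b)) fun _ => 0 := S.sol.div_b.weakDiv

/-- Since ∂ᵢ div b = 0, the Laplacian of bᵢ is the sum over k of ∂ₖ(∂ₖbᵢ − ∂ᵢbₖ), that is, of
derivatives of components of the current. -/
lemma ae_laplacian (i : Fin 3) : ∀ᵐ t : ℝ, ∀ W ∈ Heat, ∫ x, comp T b i (t, x) * lap W (0, x) =
    ∑ k, ∫ x, curlMat (comp T j) i k (t, x) * sd (some k) W (0, x) := by
  have hsl := ae_slice_relation (T := T) (ι := Option (Fin 3))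
    (F := fun a => a.elim (comp T b i) fun k z => -curlMat (comp T j) i k z)
    (L := fun a => a.elim lap fun k => sd (some k))
    (by
      rintro (_ | k) a c - -
      · exact (S.mixB i).1.integrableOn
      · exact (S.mix_curlMat i k).1.neg.integrableOn)
    (by
      rintro (_ | k)
      · exact SpaceOp.lap
      · exact SpaceOp.sd k) ?_
  · filter_upwards [hsl] with t ht W hW
    by_cases htT : t ∈ Ioo 0 T
    · have := ht htT W hW
      simp only [Fintype.sum_option, Option.elim, neg_mul, integral_neg,
        Finset.sum_neg_distrib] at this
      linarith
    · have h1 : ∀ x, comp T b i (t, x) = 0 := fun x => comp_of_notMem (by exact htT)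
      have h2 : ∀ k x, curlMat (comp T j) i k (t, x) = 0 := fun k x =>
        curlMat_of_notMem (by exact htT)
      simp [h1, h2]
  intro Φ hΦ
  have hi : ∀ l {Ψ : ST → ℝ}, IsTest T Ψ → Integrable fun z => comp T b l z * Ψ z := fun l Ψ hΨ => by
    simpa only [mul_comm] using hΨ.integrable_mul (S.mixB l).1
  have h1 := weakDiv_sp_iff.1 S.weakDiv_b _ (hΦ.sd (some i))
  rw [integral_finsetSum _ fun k _ => hi k ((hΦ.sd _).sd _)] at h1
  have h2 : ∀ k, (∫ z, comp T b i z * sd (some k) (sd (some k) Φ) z) -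
      ∫ z, comp T b k z * sd (some k) (sd (some i) Φ) z =
      ∫ z, curlMat (comp T j) i k z * sd (some k) Φ z := fun k => by
    rw [← S.sol.curl_b.component (hΦ.sd (some k)) i k,
      integral_sub (hi i ((hΦ.sd _).sd _)) (hi k ((hΦ.sd _).sd _))]
    simp_rw [sd_comm hΦ.1 (some i) (some k)]
  simp only [Fintype.sum_option, Option.elim, neg_mul, integral_neg, Finset.sum_neg_distrib,
    lap, Finset.mul_sum]
  rw [integral_finsetSum _ fun k _ => hi i ((hΦ.sd _).sd _)]
  simp_rw [← h2]
  rw [Finset.sum_sub_distrib]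
  simp only [zero_mul, integral_zero] at h1
  linarith

/-- Elliptic regularity controls b up to its slice mean, and the energy bound controls the mean: the
L¹ norm is at most the L² norm on a probability space. -/
lemma mixB_mn (i : Fin 3) : Mix m n (comp T b i) := by
  obtain ⟨M, hM, hb⟩ := S.b2.exists_bound
  refine mix_of_laplacian (T := T) S.hm.le S.hn (S.mixB i).1 (S.mix_curlMat i)
    (fun z hz => comp_of_notMem hz) (fun k z hz => curlMat_of_notMem hz) (S.ae_laplacian i) hM ?_
  filter_upwards [hb i, ae_integrable_slice (S.mixB i).1] with t ht hi
  refine le_trans ?_ ht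
  have := eLpNorm_le_eLpNorm_of_exponent_le (μ := (volume : Measure T3)) (p := .ofReal 1)
    (q := .ofReal 2) (by simp) hi.1
  exact this

/-- Hölder's inequality for |b|³ with two factors in L^p L^q and one in L^m L^n. This gain makes the
terms coupling u and b meaningful. -/
lemma mixB3 (i : Fin 3) : Mix 3 3 (comp T b i) := by
  refine ⟨(S.mixB i).1, ?_⟩
  rw [mixI_self (by norm_num) (S.mixB i).1.1]
  obtain ⟨K, hK, hb⟩ := (S.tri (S.mixB i) (S.mixB i) (S.mixB_mn i)).exists_bound
  refine ne_top_of_le_ne_top hK ((le_of_eq ?_).trans (hb 0))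
  refine lintegral_congr fun z => ?_
  simp only [Fin.prod_univ_three, Matrix.cons_val, Pi.zero_apply, add_zero]
  rw [show (3 : ℝ) = ((3 : ℕ) : ℝ) by norm_num, ENNReal.rpow_natCast]
  ring

omit S in
lemma tri3 {f g h : ST → ℝ} (hf : Mix 3 3 f) (hg : Mix 3 3 g) (hh : Mix 3 3 h) : Tri ![f, g, h] :=
  Tri.of hf hg hh (by norm_num) (by norm_num) (by norm_num) (by norm_num) (by norm_num)
    (by norm_num) (by norm_num) (by norm_num)

/-- The weak gradient of the magnetic field. -/
lemma exists_gradient : ∃ G : Fin 3 → Fin 3 → ST → ℝ, (∀ k i, Mix m n (G k i)) ∧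
    (∀ k i, ∀ z : ST, z.1 ∉ Ioo 0 T → G k i z = 0) ∧
    ∀ k i, ∀ Φ, IsTest T Φ → ∫ z, comp T b i z * sd (some k) Φ z = ∫ z, -G k i z * Φ z := by
  choose G hG hw using fun k i => exists_weak_derivative (T := T) S.hm.le S.hn (S.mixB i).1
    (S.mix_curlMat i) (fun k z hz => curlMat_of_notMem hz) (S.ae_laplacian i) k
  have hs : ∀ z, ‖slab T z‖ₑ ≤ 1 := fun z => by
    by_cases hz : z.1 ∈ Ioo 0 T
    · rw [slab, ext_of_mem hz]; simp
    · rw [slab, ext_of_notMem hz]; simp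
  have hm0 : 0 ≤ m / n := div_nonneg (by linarith [S.hm]) (by linarith [S.hn])
  -- The weak derivative is determined only inside (0,T); it is cut off there, which does not change
  -- its pairing with test functions.
  refine ⟨fun k i z => slab T z * G k i z, fun k i => ⟨?_, ?_⟩, fun k i z hz => ?_,
    fun k i Φ hΦ => ?_⟩
  · refine (hG k i).1.bdd_mul (c := 1) S.slab_pq.1.1 (Eventually.of_forall fun z => ?_)
    have := hs z
    rwa [← ofReal_norm, ENNReal.ofReal_le_one] at this
  · refine ne_top_of_le_ne_top (hG k i).2 (lintegral_mono fun t => ENNReal.rpow_le_rpow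
      (lintegral_mono fun x => ENNReal.rpow_le_rpow ?_ (by linarith [S.hn])) hm0)
    change ‖slab T (t, x) * G k i (t, x)‖ₑ ≤ ‖G k i (t, x)‖ₑ
    rw [enorm_mul]
    exact mul_le_of_le_one_left' (hs _)
  · simp only [slab, ext_of_notMem hz, zero_mul]
  · rw [hw k i Φ hΦ, ← integral_neg]
    congr with z
    have := hΦ.mul_slab z
    rw [← neg_mul, ← this]
    have hs2 : slab T z * slab T z = slab T z := by
      by_cases hz : z.1 ∈ Ioo 0 T
      · rw [slab, ext_of_mem hz]; norm_num
      · rw [slab, ext_of_notMem hz]; norm_num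
    linear_combination G k i z * Φ z * hs2

end Setting

end

section

/-! ### The pressure -/

lemma Mix.sub {T r p : ℝ} (hr : 1 ≤ r) (hp : 1 ≤ p) {f g : ST → ℝ} (hf : Mix r p f)
    (hg : Mix r p g) (hf0 : ∀ z : ST, z.1 ∉ Ioo 0 T → f z = 0)
    (hg0 : ∀ z : ST, z.1 ∉ Ioo 0 T → g z = 0) : Mix r p fun z => f z - g z := by
  refine Mix.of_slice (T := T) (ι := Fin 2) (g := ![f, g]) (C := 1) hr hp (hf.1.1.sub hg.1.1)
    (by intro i; fin_cases i; exacts [hf, hg]) (by intro i; fin_cases i; exacts [hf0, hg0])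
    (by simp) ?_
  filter_upwards [ae_integrable_slice hf.1, ae_integrable_slice hg.1] with t h1 h2
  simp only [one_mul, Fin.sum_univ_two, Matrix.cons_val_zero, Matrix.cons_val_one]
  exact eLpNorm_sub_le h1.1 h2.1 (by rw [← ENNReal.ofReal_one]; exact ENNReal.ofReal_le_ofReal hp)

lemma integral_slice_sd_eq_zero {f : ST → ℝ} (hf : SmoothST f) (k : Fin 3) (t : ℝ) :
    ∫ x, sd (some k) f (t, x) = 0 := by
  have := integral_space_parts hf (smoothST_const 1) k t
  simpa [sd] using this

lemma integral_time_mul_eq_zero {c : ℝ → ℝ} {h : ST → ℝ} (hi : Integrable fun z : ST => c z.1 * h z)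
    (h0 : ∀ᵐ t, c t = 0 ∨ ∫ x, h (t, x) = 0) : ∫ z : ST, c z.1 * h z = 0 := by
  rw [Measure.volume_eq_prod] at hi ⊢
  rw [integral_prod _ hi, integral_eq_zero_of_ae]
  filter_upwards [h0] with t ht
  rw [integral_const_mul]
  rcases ht with h | h <;> simp [h]

/-- The space average of the pressure. -/
def meanPressure (T : ℝ) (P : ℝ → T3 → ℝ) (t : ℝ) : ℝ := ∫ x, ext T P (t, x)

/-- The pressure, normalized to have zero average at each time. -/
def press (T : ℝ) (P : ℝ → T3 → ℝ) (z : ST) : ℝ := slab T z * (ext T P z - meanPressure T P z.1)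

lemma press_of_notMem {T : ℝ} {P : ℝ → T3 → ℝ} {z : ST} (hz : z.1 ∉ Ioo 0 T) : press T P z = 0 := by
  rw [press, slab, ext_of_notMem hz, zero_mul]

lemma ext_eq_press_add {T : ℝ} {P : ℝ → T3 → ℝ} (z : ST) :
    ext T P z = press T P z + meanPressure T P z.1 := by
  by_cases hz : z.1 ∈ Ioo 0 T
  · rw [press, slab, ext_of_mem (f := fun _ _ => 1) hz]; ring
  · have : meanPressure T P z.1 = 0 := by
      have h0 : ∀ x, ext T P (z.1, x) = 0 := fun x => ext_of_notMem (by exact hz)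
      simp [meanPressure, h0]
    rw [press_of_notMem hz, ext_of_notMem hz, this, add_zero]

/-- A field in `L^{3/2}` is the product of two fields in `L³`. -/
lemma Mix.exists_factor {f : ST → ℝ} {T : ℝ} (hf : Mix (3 / 2) (3 / 2) f)
    (hf0 : ∀ z : ST, z.1 ∉ Ioo 0 T → f z = 0) :
    ∃ g h : ST → ℝ, Mix 3 3 g ∧ Mix 3 3 h ∧ f = fun z => g z * h z := by
  have hI := hf.2
  rw [mixI_self (by norm_num) hf.1.1] at hI
  have key : ∀ g : ST → ℝ, AEStronglyMeasurable g → (∀ z, |g z| = √|f z|) → Mix 3 3 g := by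
    intro g hg h
    have e : ∀ z, ‖g z‖ₑ ^ (2 : ℝ) = ‖f z‖ₑ := fun z => by
      rw [← Real.enorm_abs, h z, ENNReal.rpow_two, sq, ← enorm_mul, Real.mul_self_sqrt (abs_nonneg _),
        Real.enorm_abs]
    have e3 : ∀ z, ‖g z‖ₑ ^ (3 : ℝ) = ‖f z‖ₑ ^ (3 / 2 : ℝ) := fun z => by
      rw [← e, ← ENNReal.rpow_mul]
      norm_num
    refine ⟨?_, ?_⟩
    · refine ((mix_slab T one_pos one_pos).1.norm.add hf.1.norm).mono hg
        (Eventually.of_forall fun z => ?_)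
      rw [Real.norm_eq_abs, h z, Pi.add_apply, Real.norm_of_nonneg (by positivity)]
      by_cases hz : z.1 ∈ Ioo 0 T
      · rw [slab, ext_of_mem hz, Real.norm_eq_abs, Real.norm_eq_abs, abs_one]
        rw [Real.sqrt_le_left (by positivity)]
        nlinarith [abs_nonneg (f z)]
      · rw [hf0 z hz]
        simp
    · rw [mixI_self (by norm_num) hg]
      simpa only [e3] using hI
  have hm1 : AEStronglyMeasurable fun z => √|f z| :=
    Real.continuous_sqrt.comp_aestronglyMeasurable (continuous_abs.comp_aestronglyMeasurable hf.1.1)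
  have hm2 : AEStronglyMeasurable fun z => f z / √|f z| :=
    (hf.1.1.aemeasurable.div hm1.aemeasurable).aestronglyMeasurable
  -- Where f vanishes the quotient is 0/0 = 0, which is consistent with the factorization.
  refine ⟨fun z => √|f z|, fun z => f z / √|f z|, key _ hm1 fun z => abs_of_nonneg (by positivity),
    key _ hm2 fun z => ?_, ?_⟩
  · rw [abs_div, abs_of_nonneg (Real.sqrt_nonneg _), Real.div_sqrt]
  · funext z
    by_cases hz : f z = 0
    · simp [hz]
    · have : √|f z| ≠ 0 := (Real.sqrt_pos.2 (abs_pos.2 hz)).ne'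
      field_simp

namespace Setting

variable {T p q m n : ℝ} {u b j : ℝ → T3 → E3} {P : ℝ → T3 → ℝ} (S : Setting T p q m n u b j P)
include S

lemma int33 {f g : ST → ℝ} (hf : Mix 3 3 f) (hg : Mix 3 3 g)
    (hf0 : ∀ z : ST, z.1 ∉ Ioo 0 T → f z = 0) : Integrable fun z => f z * g z :=
  (tri3 hf hg (mix_slab T (by norm_num) (by norm_num))).integrable_pair hf0

lemma int_uu (k i : Fin 3) : Integrable fun z => comp T u k z * comp T u i z :=
  S.int33 (S.mixU k) (S.mixU i) fun _ hz => comp_of_notMem hz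

lemma int_ub (k i : Fin 3) : Integrable fun z => comp T u k z * comp T b i z :=
  S.int33 (S.mixU k) (S.mixB3 i) fun _ hz => comp_of_notMem hz

lemma int_bb (k i : Fin 3) : Integrable fun z => comp T b k z * comp T b i z :=
  S.int33 (S.mixB3 k) (S.mixB3 i) fun _ hz => comp_of_notMem hz

lemma mix_stress (i k : Fin 3) : Mix (3 / 2) (3 / 2)
    fun z => comp T u i z * comp T u k z - comp T b i z * comp T b k z :=
  Mix.sub (T := T) (by norm_num) (by norm_num) ((S.mixU i).mul (S.mixU k) (S.int_uu i k))
    ((S.mixB3 i).mul (S.mixB3 k) (S.int_bb i k)) (fun z hz => by simp [comp_of_notMem hz])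
    fun z hz => by simp [comp_of_notMem hz]

lemma loc_pressure (a c : ℝ) (ha : 0 < a) (hc : c < T) : IntegrableOn (ext T P) (Icc a c ×ˢ univ) :=
  S.sol.memLp_P.integrableOn_ext ha hc

lemma aesm_pressure : AEStronglyMeasurable (ext T P) := aesm_ext_iff.2 S.sol.memLp_P.aesm

/-- Test the momentum equation with ∇Φ. The time derivative disappears because div u = 0, and the
stress is paired with the Hessian of Φ. -/
lemma integral_pressure_lap {Φ : ST → ℝ} (hΦ : IsTest T Φ) : ∫ z, ext T P z * lap Φ z =
    ∑ i, ∑ k, ∫ z, -(comp T u i z * comp T u k z - comp T b i z * comp T b k z) *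
      sd (some i) (sd (some k) Φ) z := by
  have hs : ∀ (k i : Fin 3) {Ψ}, IsTest T Ψ → Integrable fun z =>
      (comp T u k z * comp T u i z - comp T b k z * comp T b i z) * Ψ z := fun k i Ψ hΨ => by
    simpa only [mul_comm] using hΨ.integrable_mul (S.mix_stress k i).1
  have h1 := fun i => S.sol.momentum_component (hΦ.sd (some i)) i
  have h2 : ∑ i, ∫ z, comp T u i z * sd none (sd (some i) Φ) z = 0 := by
    have := weakDiv_sp_iff.1 S.sol.div_u.weakDiv _ (hΦ.sd none)
    simp only [zero_mul, integral_zero] at this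
    rw [integral_finsetSum _ fun k _ => by
      simpa only [mul_comm] using ((hΦ.sd _).sd _).integrable_mul (S.mixU k).1] at this
    simpa only [sd_comm hΦ.1 none] using this
  have h3 := Finset.sum_congr (rfl : (Finset.univ : Finset (Fin 3)) = _) fun i _ => h1 i
  simp_rw [Finset.sum_add_distrib, h2, zero_add] at h3
  simp only [Finset.sum_const_zero] at h3
  simp_rw [lap, Finset.mul_sum]
  rw [integral_finsetSum _ fun k _ => ((hΦ.sd _).sd _).integrable_mul_of_loc S.loc_pressure]
  simp_rw [neg_mul, integral_neg, Finset.sum_neg_distrib]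
  rw [Finset.sum_comm]
  simp_rw [integral_finsetSum Finset.univ fun k _ => hs k _ ((hΦ.sd _).sd (some k))] at h3
  linarith

/-- The stress u ⊗ u − b ⊗ b lies in L^{3/2}, as both fields lie in L³; the pressure equation and
the Calderón–Zygmund inequality transfer this to the pressure with its slice mean removed. -/
lemma mix_press : Mix (3 / 2) (3 / 2) (press T P) := by
  refine mix_of_hessian (by norm_num) (by norm_num) S.aesm_pressure
    (ae_integrable_slice_of_loc S.loc_pressure) (fun i k => (S.mix_stress i k).neg)
    (fun i k z hz => by simp [comp_of_notMem hz]) ?_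
  have hsl := ae_slice_relation (T := T) (ι := Option (Fin 3 × Fin 3))
    (F := fun a => a.elim (ext T P) fun ik z =>
      comp T u ik.1 z * comp T u ik.2 z - comp T b ik.1 z * comp T b ik.2 z)
    (L := fun a => a.elim lap fun ik f => sd (some ik.1) (sd (some ik.2) f))
    (by
      rintro (_ | ⟨i, k⟩) a c ha hc
      · exact S.loc_pressure a c ha hc
      · exact (S.mix_stress i k).1.integrableOn)
    (by
      rintro (_ | ⟨i, k⟩)
      · exact SpaceOp.lap
      · exact (SpaceOp.sd i).comp (SpaceOp.sd k))
    (fun Φ hΦ => by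
      have := S.integral_pressure_lap hΦ
      simp only [neg_mul, integral_neg, Finset.sum_neg_distrib] at this
      simp only [Fintype.sum_option, Option.elim, Fintype.sum_prod_type, this]
      ring)
  filter_upwards [hsl] with t ht htT W hW
  have := ht htT W hW
  simp only [Fintype.sum_option, Option.elim, Fintype.sum_prod_type] at this
  simp only [neg_mul, integral_neg, Finset.sum_neg_distrib]
  linarith

lemma integrable_mean_mul {Φ : ST → ℝ} (hΦ : IsTest T Φ) :
    Integrable fun z : ST => meanPressure T P z.1 * Φ z := by
  have h1 : Integrable fun z => press T P z * Φ z := by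
    simpa only [mul_comm] using hΦ.integrable_mul S.mix_press.1
  refine ((hΦ.integrable_mul_of_loc S.loc_pressure).sub h1).congr (Eventually.of_forall fun z => ?_)
  simp only [Pi.sub_apply, ext_eq_press_add]
  ring

/-- The mean depends on time only and a spatial derivative integrates to zero over the torus. The
normalized pressure can therefore replace the original one in the momentum equation. -/
lemma integral_pressure_sd {Φ : ST → ℝ} (hΦ : IsTest T Φ) (i : Fin 3) :
    ∫ z, ext T P z * sd (some i) Φ z = ∫ z, press T P z * sd (some i) Φ z := by
  have h1 : Integrable fun z => press T P z * sd (some i) Φ z := by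
    simpa only [mul_comm] using (hΦ.sd _).integrable_mul S.mix_press.1
  have h2 := integral_time_mul_eq_zero (S.integrable_mean_mul (hΦ.sd (some i)))
    (Eventually.of_forall fun t => Or.inr (integral_slice_sd_eq_zero hΦ.1 i t))
  simp_rw [ext_eq_press_add, add_mul]
  rw [integral_add h1 (S.integrable_mean_mul (hΦ.sd _)), h2, add_zero]

end Setting

end

section

/-! ### The weak product rule and the structure of the equations -/

lemma corr_zero_right (f g : ST → ℝ) : corr f g (stHom 0) = ∫ z, f z * g z := by
  simp only [corr, map_zero, add_zero]

lemma int_neg {f : ST → ℝ} (hf : Integrable f) : Integrable fun z => -f z := hf.neg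

lemma exists_time_margin {a c T : ℝ} (ha : 0 < a) (hc : c < T) :
    ∃ τ : ℝ, 0 < τ ∧ τ < a ∧ c + τ < T := by
  obtain ⟨τ, hτ, h⟩ := exists_between (lt_min ha (sub_pos.2 hc))
  exact ⟨τ, hτ, (lt_min_iff.1 h).1, by linarith [(lt_min_iff.1 h).2]⟩

/-- The product rule for weak derivatives. -/
lemma weak_product {T : ℝ} {f g X Y : ST → ℝ} {k : Fin 3}
    (hX : ∀ Φ, IsTest T Φ → ∫ z, f z * sd (some k) Φ z = ∫ z, X z * Φ z)
    (hY : ∀ Φ, IsTest T Φ → ∫ z, g z * sd (some k) Φ z = ∫ z, Y z * Φ z)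
    (hfi : Integrable f)
    (hfg : ∀ ψ, IsTest T ψ → CorrPair (fun p => ψ p * f p) g)
    (hXg : ∀ ψ, IsTest T ψ → CorrPair (fun p => ψ p * X p) g)
    (hfY : ∀ ψ, IsTest T ψ → CorrPair (fun p => ψ p * f p) Y) {Φ : ST → ℝ} (hΦ : IsTest T Φ) :
    (∫ z, sd (some k) Φ z * f z * g z) - (∫ z, Φ z * X z * g z) - ∫ z, Φ z * f z * Y z = 0 := by
  obtain ⟨-, a, c, ha, hc, h0⟩ := id hΦ
  obtain ⟨τ, hτ, hτa, hτc⟩ := exists_time_margin ha hc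
  have C1 := hfg _ (hΦ.sd (some k))
  have C2 := hXg _ hΦ
  have C3 := hfY _ hΦ
  -- The pairing of Φf with g through ∂ₖκ is computed twice, with the derivative moved onto the
  -- first or onto the second factor. So the combination of correlations is orthogonal to every
  -- kernel; being continuous, it vanishes at zero separation, where it is the product rule.
  have := eq_zero_of_kernel ((C1.cont.sub C2.cont).sub C3.cont) hτ fun κ hκ hκ0 => by
    refine (((C1.hasInt hκ).sub (C2.hasInt hκ)).sub (C3.hasInt hκ)).2.trans ?_
    have h1 := single_right hX hfi hκ hΦ C1.right
    have h2 := single_left hY C1.right C3.right hκ C3.left hτa hτc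
      (fun z hz => by rw [h0 z hz, zero_mul]) hκ0
    linarith
  simpa only [Pi.sub_apply, corr_zero_right] using this

lemma integral_pair_test {T : ℝ} {f Φ : ST → ℝ} (hf : Integrable f) (hΦ : IsTest T Φ) :
    Integrable fun z => f z * Φ z := by
  simpa only [mul_comm] using hΦ.integrable_mul hf

namespace Setting

variable {T p q m n : ℝ} {u b j : ℝ → T3 → E3} {P : ℝ → T3 → ℝ} (S : Setting T p q m n u b j P)
include S

/-- The divergence of a curl: the curl relation tested with the three derivatives of Φ, whose sum
cancels by symmetry of second derivatives. -/
lemma div_j : WeakDiv T (sp (comp T j)) fun _ => 0 := by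
  rw [weakDiv_sp_iff]
  intro Φ hΦ
  have hb := fun (i k l : Fin 3) => integral_pair_test (S.mixB i).1 ((hΦ.sd (some k)).sd (some l))
  have hj := fun k : Fin 3 => integral_pair_test (S.mixJ k).1 (hΦ.sd (some k))
  have key := fun l i k : Fin 3 => S.sol.curl_b.component (hΦ.sd (some l)) i k
  have h2 := key 2 0 1
  have h0 := key 0 1 2
  have h1 := key 1 2 0
  simp only [curlMat, Matrix.of_apply, Matrix.cons_val] at h0 h1 h2
  rw [integral_sub (hb _ _ _) (hb _ _ _)] at h0 h1 h2
  rw [integral_finsetSum _ fun k _ => hj k, Fin.sum_univ_three, ← h0, ← h1, ← h2]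
  simp_rw [sd_comm hΦ.1 (some (2 : Fin 3)), sd_comm hΦ.1 (some (1 : Fin 3)) (some (0 : Fin 3))]
  simp

lemma momentum (i : Fin 3) : WeakDiv T (fun α => match α with
    | none => comp T u i
    | some k => fun z => comp T u k z * comp T u i z - comp T b k z * comp T b i z +
        if k = i then press T P z else 0) fun _ => 0 := by
  intro Φ hΦ
  have h := S.sol.momentum_component hΦ i
  rw [S.integral_pressure_sd hΦ] at h
  have i1 := integral_pair_test (S.mixU i).1 (hΦ.sd none)
  have i2 := integrable_finsetSum Finset.univ fun k _ =>
    integral_pair_test (S.mix_stress k i).1 (hΦ.sd (some k))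
  have i3 := integral_pair_test S.mix_press.1 (hΦ.sd (some i))
  rw [← integral_add i1 i2, ← integral_add (int_add i1 i2) i3] at h
  simp only [Fintype.sum_option, add_mul, Finset.sum_add_distrib, ite_mul, zero_mul,
    Finset.sum_ite_eq', Finset.mem_univ, if_true, integral_zero]
  rw [← h]
  congr with z
  ring

lemma int_jb (k i : Fin 3) : Integrable fun z => comp T j k z * comp T b i z :=
  (S.tri'' (S.mixJ k) (S.mixB i) S.slab_pq).integrable_pair fun _ hz => comp_of_notMem hz

lemma int_bj (k i : Fin 3) : Integrable fun z => comp T b k z * comp T j i z := by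
  simpa only [mul_comm] using S.int_jb i k

lemma induction (i : Fin 3) : WeakDiv T (fun α => match α with
    | none => comp T b i
    | some k => fun z => comp T u k z * comp T b i z - comp T b k z * comp T u i z -
        (comp T j k z * comp T b i z - comp T b k z * comp T j i z)) fun _ => 0 := by
  intro Φ hΦ
  have h := S.sol.induction_component hΦ i
  have hbu : ∀ k, Integrable fun z => comp T b k z * comp T u i z := fun k => by
    simpa only [mul_comm] using S.int_ub i k
  have i1 := integral_pair_test (S.mixB i).1 (hΦ.sd none)
  have i2 := integrable_finsetSum Finset.univ fun k _ =>
    integral_pair_test (int_sub (S.int_ub k i) (hbu k)) (hΦ.sd (some k))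
  have i3 := integrable_finsetSum Finset.univ fun k _ =>
    integral_pair_test (int_sub (S.int_jb k i) (S.int_bj k i)) (hΦ.sd (some k))
  rw [← integral_add i1 i2, ← integral_sub (int_add i1 i2) i3] at h
  simp only [Fintype.sum_option, zero_mul, integral_zero]
  rw [← h]
  congr with z
  simp only [sub_mul, Finset.sum_sub_distrib]
  ring

/-- The integrability and support of a weak gradient of the magnetic field. -/
structure IsGradient (T m n : ℝ) (b : ℝ → T3 → E3) (G : Fin 3 → Fin 3 → ST → ℝ) : Prop where
  mix : ∀ k i, Mix m n (G k i)
  zero : ∀ k i, ∀ z : ST, z.1 ∉ Ioo 0 T → G k i z = 0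
  weak : ∀ k i, ∀ Φ, IsTest T Φ → ∫ z, comp T b i z * sd (some k) Φ z = ∫ z, -G k i z * Φ z

variable {G : Fin 3 → Fin 3 → ST → ℝ} (hG : IsGradient T m n b G)
include hG

lemma int_bG (l k i : Fin 3) : Integrable fun z => comp T b l z * G k i z :=
  (S.tri' (S.mixB l) (hG.mix k i) S.slab_pq).integrable_pair fun _ hz => comp_of_notMem hz

lemma weak_product_b (l i k : Fin 3) {Φ : ST → ℝ} (hΦ : IsTest T Φ) :
    ∫ z, (comp T b l z * comp T b i z) * sd (some k) Φ z =
      ∫ z, -(comp T b i z * G k l z + comp T b l z * G k i z) * Φ z := by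
  have h1 := integral_pair_test (S.int_bG hG i k l) hΦ
  have h2 := integral_pair_test (S.int_bG hG l k i) hΦ
  have h := weak_product (hG.weak k l) (hG.weak k i) (S.mixB l).1
    (fun ψ hψ => CorrPair.of_tri (S.tri (S.mixB l) (S.mixB i) (mix_slab T
      (by linarith [S.hm]) (by linarith [S.hn]))) (S.mixB l).1 (S.mixB i).1 hψ)
    (fun ψ hψ => CorrPair.of_tri (S.tri'' (hG.mix k l).neg (S.mixB i) S.slab_pq)
      (hG.mix k l).neg.1 (S.mixB i).1 hψ)
    (fun ψ hψ => CorrPair.of_tri (S.tri' (S.mixB l) (hG.mix k i).neg S.slab_pq)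
      (S.mixB l).1 (hG.mix k i).neg.1 hψ) hΦ
  have e1 : ∫ z, Φ z * -G k l z * comp T b i z = - ∫ z, comp T b i z * G k l z * Φ z := by
    rw [← integral_neg]; congr with z; ring
  have e2 : ∫ z, Φ z * comp T b l z * -G k i z = - ∫ z, comp T b l z * G k i z * Φ z := by
    rw [← integral_neg]; congr with z; ring
  simp only [neg_mul, add_mul, integral_neg]
  rw [integral_add h1 h2]
  rw [e1, e2] at h
  have e3 : ∫ z, (comp T b l z * comp T b i z) * sd (some k) Φ z =
      ∫ z, sd (some k) Φ z * comp T b l z * comp T b i z := by congr with z; ring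
  linarith

lemma trace_gradient : ∀ᵐ z, ∑ k, G k k z = 0 := by
  refine ae_eq_zero_of_isTest (T := T) (integrable_finsetSum _ fun k _ => (hG.mix k k).1)
    (fun z hz => Finset.sum_eq_zero fun k _ => hG.zero k k z hz) fun Φ hΦ => ?_
  have h := weakDiv_sp_iff.1 S.weakDiv_b Φ hΦ
  rw [integral_finsetSum _ fun k _ => integral_pair_test (S.mixB k).1 (hΦ.sd _)] at h
  simp_rw [hG.weak _ _ Φ hΦ, neg_mul, integral_neg, Finset.sum_neg_distrib, zero_mul,
    integral_zero] at h
  simp_rw [Finset.sum_mul]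
  rw [integral_finsetSum _ fun k _ => integral_pair_test (hG.mix k k).1 hΦ]
  linarith

/-- Both sides represent the same distribution on (0,T) × 𝕋³ and vanish outside, so they agree
almost everywhere. The distributional curl is thereby identified with the antisymmetric part of the
weak gradient. -/
lemma curl_gradient (i k : Fin 3) : ∀ᵐ z, curlMat (comp T j) i k z = G i k z - G k i z := by
  have := ae_eq_zero_of_isTest (T := T)
    (((S.mix_curlMat i k).1.sub (hG.mix i k).1).add (hG.mix k i).1)
    (fun z hz => by
      simp [curlMat_of_notMem hz, hG.zero _ _ z hz])
    fun Φ hΦ => by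
      have h1 := S.sol.curl_b.component hΦ i k
      rw [integral_sub (integral_pair_test (S.mixB i).1 (hΦ.sd _))
        (integral_pair_test (S.mixB k).1 (hΦ.sd _)), hG.weak _ _ Φ hΦ, hG.weak _ _ Φ hΦ] at h1
      have i1 := integral_pair_test (S.mix_curlMat i k).1 hΦ
      have i2 := integral_pair_test (hG.mix i k).1 hΦ
      have i3 := integral_pair_test (hG.mix k i).1 hΦ
      simp only [neg_mul, integral_neg] at h1
      simp only [Pi.add_apply, Pi.sub_apply, add_mul, sub_mul]
      rw [integral_add (int_sub i1 i2) i3, integral_sub i1 i2]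
      linarith
  filter_upwards [this] with z hz
  simp only [Pi.add_apply, Pi.sub_apply, Pi.zero_apply] at hz
  linarith

lemma hallData : HallData T (comp T u) (comp T b) (comp T j) (press T P) G where
  int_u i := (S.mixU i).1
  int_b i := (S.mixB i).1
  int_j i := (S.mixJ i).1
  int_P := S.mix_press.1
  int_G k i := (hG.mix k i).1
  int_uu := S.int_uu
  int_ub := S.int_ub
  int_bu k i := by simpa only [mul_comm] using S.int_ub i k
  int_bb := S.int_bb
  int_jb := S.int_jb
  int_bj := S.int_bj
  int_bG := S.int_bG hG
  div_u := S.sol.div_u.weakDiv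
  div_b := S.weakDiv_b
  div_j := S.div_j
  momentum := S.momentum
  induction := S.induction
  grad_b := hG.weak
  tensor i := by
    rw [weakDiv_sp_iff]
    intro Φ hΦ
    rw [integral_finsetSum _ fun k _ => integral_pair_test (S.int_bb k i) (hΦ.sd _)]
    simp_rw [S.weak_product_b hG _ _ _ hΦ]
    rw [← integral_finsetSum _ fun k _ => integral_pair_test
      (int_neg (int_add (S.int_bG hG i k k) (S.int_bG hG k k i))) hΦ]
    refine integral_congr_ae ?_
    -- The product rule produces an extra bᵢ tr G, which vanishes by div b = 0.
    filter_upwards [S.trace_gradient hG] with z hz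
    rw [Fin.sum_univ_three] at hz
    simp only [Fin.sum_univ_three]
    linear_combination (-comp T b i z * Φ z) * hz
  sq i Φ hΦ := by
    simp_rw [Finset.sum_mul]
    rw [integral_finsetSum _ fun k _ => integral_pair_test (S.int_bb k k) (hΦ.sd _)]
    simp_rw [S.weak_product_b hG _ _ _ hΦ]
    rw [← integral_finsetSum _ fun k _ => integral_pair_test
      (int_neg (int_add (S.int_bG hG k i k) (S.int_bG hG k i k))) hΦ]
    congr with z
    simp only [Fin.sum_univ_three]
    ring
  curl := by
    filter_upwards [S.curl_gradient hG 1 2, S.curl_gradient hG 2 0, S.curl_gradient hG 0 1]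
      with z h0 h1 h2
    exact ⟨h0, h1, h2⟩

omit hG in
-- Cubic terms in u and b use three factors in L³; terms with j use the exponents of the hypotheses;
-- quadratic terms are completed by the slab. The pressure is factored into two functions in L³, so
-- that its product with u is again trilinear.
lemma hallPairs : HallPairs T (comp T u) (comp T b) (comp T j) (press T P) := by
  have hs : Mix 3 3 (slab T) := mix_slab T (by norm_num) (by norm_num)
  have hbu : ∀ k i, Integrable fun z => comp T b k z * comp T u i z := fun k i => by
    simpa only [mul_comm] using S.int_ub i k
  obtain ⟨g, h, hg, hh, hgh⟩ := S.mix_press.exists_factor fun z hz => press_of_notMem hz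
  have hP := S.mix_press.1
  rw [hgh] at hP
  exact
  { uuu := fun k i => TriPairs.of_tri (tri3 (S.mixU k) (S.mixU i) (S.mixU i)) (S.mixU k).1
      (S.mixU i).1 (S.mixU i).1 (S.int_uu _ _) (S.int_uu _ _) (S.int_uu _ _)
    ubb := fun k i => TriPairs.of_tri (tri3 (S.mixU k) (S.mixB3 i) (S.mixB3 i)) (S.mixU k).1
      (S.mixB i).1 (S.mixB i).1 (S.int_ub _ _) (S.int_ub _ _) (S.int_bb _ _)
    bub := fun k i => TriPairs.of_tri (tri3 (S.mixB3 k) (S.mixU i) (S.mixB3 i)) (S.mixB k).1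
      (S.mixU i).1 (S.mixB i).1 (hbu _ _) (S.int_bb _ _) (S.int_ub _ _)
    jbb := fun k i => TriPairs.of_tri (S.tri'' (S.mixJ k) (S.mixB i) (S.mixB i)) (S.mixJ k).1
      (S.mixB i).1 (S.mixB i).1 (S.int_jb _ _) (S.int_jb _ _) (S.int_bb _ _)
    bjb := fun k i => TriPairs.of_tri (S.tri' (S.mixB k) (S.mixJ i) (S.mixB i)) (S.mixB k).1
      (S.mixJ i).1 (S.mixB i).1 (S.int_bj _ _) (S.int_bb _ _) (S.int_jb _ _)
    uu := fun i ψ hψ => CorrPair.of_tri (tri3 (S.mixU i) (S.mixU i) hs) (S.mixU i).1 (S.mixU i).1 hψ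
    bb := fun i ψ hψ => CorrPair.of_tri (tri3 (S.mixB3 i) (S.mixB3 i) hs) (S.mixB i).1
      (S.mixB i).1 hψ
    Pu := fun i ψ hψ => by
      rw [hgh]
      exact CorrPair.of_tri_left (tri3 hg hh (S.mixU i)) hP (S.mixU i).1 hψ
    uP := fun i ψ hψ => by
      rw [hgh]
      exact CorrPair.of_tri_right (tri3 (S.mixU i) hg hh) hP (S.mixU i).1 hψ }

end Setting

end

section

/-! ### The energy flux -/

lemma CorrPair.hasInt_zero {f g : ST → ℝ} (h : CorrPair f g) :
    HasInt (fun _ : ST => 1) (fun z => f z * g z) (corr f g (stHom 0)) := by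
  simp only [HasInt, one_mul, corr_zero_right, and_true]
  exact h.int

/-- The divergence of `b ⊗ b`, in terms of a weak gradient of `b`. -/
def tensorDiv (b : ℝ → T3 → E3) (G : Fin 3 → Fin 3 → ST → ℝ) (t : ℝ) (x : T3) : E3 :=
  WithLp.toLp 2 fun i => ∑ k, b t x k * G k i (t, x)

lemma comp_tensorDiv {T : ℝ} (b : ℝ → T3 → E3) (G : Fin 3 → Fin 3 → ST → ℝ) (i : Fin 3) (z : ST) :
    comp T (tensorDiv b G) i z = ∑ k, comp T b k z * G k i z := by
  by_cases hz : z.1 ∈ Ioo 0 T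
  · simp only [comp_of_mem hz, tensorDiv]
  · simp [comp_of_notMem hz]

/-- The energy flux, for fields given by their components. -/
def flux (u b j F : Fin 3 → ST → ℝ) (P : ST → ℝ) (i : Fin 3) (z : ST) : ℝ :=
  (∑ l, (1 / 2 * (u i z * (u l z * u l z)) + 1 / 2 * (u i z * (b l z * b l z)) -
    b i z * (u l z * b l z) - 1 / 4 * (j i z * (b l z * b l z)) +
    1 / 2 * (b i z * (j l z * b l z)))) + u i z * P z +
    1 / 2 * (F (i + 1) z * b (i + 2) z - F (i + 2) z * b (i + 1) z)

/-- The slice mean of the pressure is split off: the rest of the flux is integrable up to the ends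
of the time interval, whereas the mean is only locally integrable in time. -/
lemma comp_energyFlux {T : ℝ} (u b j F : ℝ → T3 → E3) (P : ℝ → T3 → ℝ) (i : Fin 3) (z : ST) :
    comp T (energyFlux u b j F P) i z =
      flux (comp T u) (comp T b) (comp T j) (comp T F) (press T P) i z +
        meanPressure T P z.1 * comp T u i z := by
  have e : ∀ w, flux (comp T u) (comp T b) (comp T j) (comp T F) (press T P) i z +
      w * comp T u i z =
      flux (comp T u) (comp T b) (comp T j) (comp T F) (fun z => press T P z + w) i z := fun w => by
    unfold flux
    ring
  rw [e]
  by_cases hz : z.1 ∈ Ioo 0 T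
  · simp only [comp_of_mem hz, flux, ← ext_eq_press_add, ext_of_mem hz, energyFlux, energyDensity,
      EuclideanSpace.norm_sq_eq, PiLp.inner_apply, cross, crossProduct, Real.norm_eq_abs, sq_abs]
    fin_cases i <;> simp [Fin.sum_univ_three] <;> ring
  · simp [comp_of_notMem hz, flux]

namespace Setting

variable {T p q m n : ℝ} {u b j : ℝ → T3 → E3} {P : ℝ → T3 → ℝ} (S : Setting T p q m n u b j P)
include S

lemma int_press_u (i : Fin 3) : Integrable fun z => comp T u i z * press T P z := by
  obtain ⟨g, h, hg, hh, hgh⟩ := S.mix_press.exists_factor fun z hz => press_of_notMem hz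
  rw [hgh]
  exact (tri3 (S.mixU i) hg hh).integrable_prod

variable {G : Fin 3 → Fin 3 → ST → ℝ} (hG : IsGradient T m n b G)
include hG

lemma int_tensorDiv (i : Fin 3) : Integrable (comp T (tensorDiv b G) i) := by
  refine (integrable_finsetSum Finset.univ fun k _ => S.int_bG hG k k i).congr
    (Eventually.of_forall fun z => ?_)
  rw [comp_tensorDiv]

lemma int_tensorDiv_mul (i k : Fin 3) :
    Integrable fun z => comp T (tensorDiv b G) i z * comp T b k z := by
  refine (integrable_finsetSum Finset.univ fun l _ =>
    (S.tri' (S.mixB l) (hG.mix l i) (S.mixB k)).integrable_prod).congr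
    (Eventually.of_forall fun z => ?_)
  simp only [comp_tensorDiv, Finset.sum_mul, mul_assoc]

lemma integrable_flux (i : Fin 3) : Integrable
    (flux (comp T u) (comp T b) (comp T j) (comp T (tensorDiv b G)) (press T P) i) := by
  have H := S.hallPairs
  -- The field `p1` asks for some test function, but the integrability taken from it concerns the
  -- triple product only, so the zero function serves.
  have z0 := isTest_zero T
  exact ((integrable_finsetSum _ fun l _ => (((((H.uuu i l).p1 _ z0).right.const_mul _).add
    (((H.ubb i l).p1 _ z0).right.const_mul _)).sub ((H.bub i l).p1 _ z0).right |>.sub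
    (((H.jbb i l).p1 _ z0).right.const_mul _)).add
    (((H.bjb i l).p1 _ z0).right.const_mul _)).add (S.int_press_u i)).add
    (((S.int_tensorDiv_mul hG _ _).sub (S.int_tensorDiv_mul hG _ _)).const_mul _)

/-- The weak product rule for `bₖ bₖ b_c`. -/
lemma hasInt_triple (k c i : Fin 3) {Φ : ST → ℝ} (hΦ : IsTest T Φ) :
    HasInt (fun _ : ST => 1) (fun z => Φ z * (comp T b k z * (-G i k z - G i k z)) * comp T b c z +
        Φ z * (comp T b k z * comp T b k z) * -G i c z)
      (∫ z, sd (some i) Φ z * (comp T b k z * comp T b k z) * comp T b c z) := by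
  have h2 : Mix m n fun z => -G i k z - G i k z :=
    Mix.sub (T := T) S.hm.le S.hn.le (hG.mix i k).neg (hG.mix i k)
      (fun z hz => by simp [hG.zero i k z hz]) (hG.zero i k)
  have i2 : Integrable fun z => comp T b k z * (-G i k z - G i k z) :=
    (S.tri' (S.mixB k) h2 S.slab_pq).integrable_pair fun _ hz => comp_of_notMem hz
  have c2 : ∀ ψ, IsTest T ψ → CorrPair (fun p => ψ p * (comp T b k p * (-G i k p - G i k p)))
      (comp T b c) := fun ψ hψ =>
    CorrPair.of_tri_left (S.tri' (S.mixB k) h2 (S.mixB c)) i2 (S.mixB c).1 hψ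
  have c3 : ∀ ψ, IsTest T ψ → CorrPair (fun p => ψ p * (comp T b k p * comp T b k p))
      (fun z => -G i c z) := fun ψ hψ =>
    CorrPair.of_tri_left (S.tri (S.mixB k) (S.mixB k) (hG.mix i c).neg) (S.int_bb k k)
      (hG.mix i c).neg.1 hψ
  have h := weak_product (f := fun z => comp T b k z * comp T b k z) (g := comp T b c)
    (X := fun z => comp T b k z * (-G i k z - G i k z)) (Y := fun z => -G i c z) (k := i)
    (fun Ψ hΨ => (S.weak_product_b hG k k i hΨ).trans (by congr with z; ring))
    (hG.weak i c) (S.int_bb k k)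
    (fun ψ hψ => CorrPair.of_tri_left (tri3 (S.mixB3 k) (S.mixB3 k) (S.mixB3 c)) (S.int_bb k k)
      (S.mixB c).1 hψ) c2 c3 hΦ
  simp only [HasInt, one_mul]
  refine ⟨(c2 Φ hΦ).int.add (c3 Φ hΦ).int, ?_⟩
  rw [integral_add (c2 Φ hΦ).int (c3 Φ hΦ).int]
  linarith

/-- The weak form of `∇(|b|²/2) × b = - |b|² j / 2` up to a curl. -/
lemma integral_hall_flux {ψ : ST → ℝ} (hψ : IsTest T ψ) : HasInt (fun _ : ST => 1)
    (fun z => ∑ k, ∑ a, (sd (some a) ψ z * comp T b k z * (G (a + 1) k z * comp T b (a + 2) z -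
        G (a + 2) k z * comp T b (a + 1) z) + 1 / 2 * (sd (some a) ψ z *
      (comp T b k z * comp T b k z) * (G (a + 1) (a + 2) z - G (a + 2) (a + 1) z)))) 0 := by
  have h := HasInt.sum (s := Finset.univ) fun k : Fin 3 => HasInt.sum (s := Finset.univ)
    fun a : Fin 3 => ((S.hasInt_triple hG k (a + 2) (a + 1) (hψ.sd (some a))).sub
      (S.hasInt_triple hG k (a + 1) (a + 2) (hψ.sd (some a)))).smul (-(1 / 2))
  convert h using 1
  · funext z
    refine Finset.sum_congr rfl fun k _ => Finset.sum_congr rfl fun a _ => ?_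
    ring
  -- What is left is the integral of |b|² b against the curl of a gradient; symmetry of the second
  -- derivatives of ψ makes it zero.
  · rw [eq_comm]
    refine Finset.sum_eq_zero fun k _ => ?_
    simp only [Fin.sum_univ_three, Fin.isValue, zero_add, Fin.reduceAdd]
    simp_rw [sd_comm hψ.1 (some (2 : Fin 3)), sd_comm hψ.1 (some (1 : Fin 3)) (some (0 : Fin 3))]
    ring

/-- The source in the Kármán–Howarth–Monin relation, at zero separation. -/
lemma khmRhs_zero {ψ : ST → ℝ} (hψ : IsTest T ψ) :
    khmRhs (fun f g => corr f g (stHom 0)) ψ (comp T u) (comp T b) (comp T j) (press T P) =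
      -(∫ z, (∑ l, (comp T u l z * comp T u l z + comp T b l z * comp T b l z)) / 2 *
        sd none ψ z) -
      ∑ i, ∫ z, flux (comp T u) (comp T b) (comp T j) (comp T (tensorDiv b G)) (press T P) i z *
        sd (some i) ψ z := by
  have h1 := S.hallPairs.hasInt_khmRhs (β := fun z f g => f z * g z) (fun h => h.hasInt_zero) hψ
  have h2 := S.integral_hall_flux hG hψ
  simp only [HasInt, one_mul] at h1 h2
  have i1 : Integrable fun z => (∑ l, (comp T u l z * comp T u l z + comp T b l z * comp T b l z)) /
      2 * sd none ψ z := integral_pair_test ((integrable_finsetSum Finset.univ fun l _ =>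
        int_add (S.int_uu l l) (S.int_bb l l)).div_const 2) (hψ.sd _)
  have i2 := fun i => integral_pair_test (S.integrable_flux hG i) (hψ.sd (some i))
  have i3 := integrable_finsetSum Finset.univ fun i _ => i2 i
  -- By (b·∇)b = j × b + ∇|b|²/2 the Hall flux of the theorem equals (j × b) × b, the flux produced
  -- by the relation, plus a multiple of the curl of |b|² b. The vanishing integral of that curl
  -- against ∇ψ is added with factor −1/2, after which the integrands agree pointwise.
  rw [← h1.2, ← integral_finsetSum _ fun i _ => i2 i, ← integral_neg, ← integral_sub (int_neg i1) i3,
    ← add_zero (∫ z, _), ← mul_zero (-(1 / 2) : ℝ), ← h2.2,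
    ← integral_const_mul, ← integral_add h1.1 (h2.1.const_mul _)]
  refine integral_congr_ae ?_
  filter_upwards [S.curl_gradient hG 1 2, S.curl_gradient hG 2 0, S.curl_gradient hG 0 1]
    with z c0 c1 c2
  have e0 : G 1 2 z = comp T j 0 z + G 2 1 z := eq_add_of_sub_eq c0.symm
  have e1 : G 2 0 z = comp T j 1 z + G 0 2 z := eq_add_of_sub_eq c1.symm
  have e2 : G 0 1 z = comp T j 2 z + G 1 0 z := eq_add_of_sub_eq c2.symm
  simp only [khmRhs, rhsMomentum, rhsInduction, rhsCurrent, rhsFlux, flux, comp_tensorDiv,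
    Fin.sum_univ_three, Fin.isValue, zero_add, Fin.reduceAdd]
  rw [e0, e1, e2]
  ring

end Setting

end

section

/-! ### The local energy equation -/

lemma abs_sd_le {f : ST → ℝ} {M : ℝ}
    (h : ∀ y : STE, ‖iteratedFDeriv ℝ 1 (fun y => f (stHom y)) y‖ ≤ M) (α : Option (Fin 3)) (z : ST) :
    |sd α f z| ≤ M := by
  obtain ⟨y, rfl⟩ := stHom_surjective z
  have h1 := h y
  rw [norm_iteratedFDeriv_one] at h1
  have h2 : ‖dir α‖ ≤ 1 := by
    cases α <;> simp [dir]
  rw [sd_stHom]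
  calc _ ≤ ‖fderiv ℝ (fun y => f (stHom y)) y‖ * ‖dir α‖ := ContinuousLinearMap.le_opNorm _ _
    _ ≤ ‖fderiv ℝ (fun y => f (stHom y)) y‖ * 1 := by gcongr
    _ ≤ M := by rwa [mul_one]

/-- The space-time divergence of a locally integrable field is a distribution. -/
lemma exists_distribution {T : ℝ} {Q : Option (Fin 3) → ST → ℝ}
    (hQ : ∀ α, ∀ a c : ℝ, 0 < a → c < T → IntegrableOn (Q α) (Icc a c ×ˢ univ)) :
    ∃ D : TestFn T ℝ →ₗ[ℝ] ℝ, IsDistribution T D ∧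
      ∀ ψ : TestFn T ℝ, D ψ = -∑ α, ∫ z, Q α z * sd α (fun z => ψ.1 z.1 z.2) z := by
  have hi : ∀ (ψ : TestFn T ℝ) α, Integrable fun z => Q α z * sd α (fun z => ψ.1 z.1 z.2) z :=
    fun ψ α => ((isTest_of_mem ψ).sd α).integrable_mul_of_loc (hQ α)
  refine ⟨{ toFun := fun ψ => -∑ α, ∫ z, Q α z * sd α (fun z => ψ.1 z.1 z.2) z
            map_add' := fun ψ φ => ?_
            map_smul' := fun c ψ => ?_ }, fun a c ha hc => ?_, fun ψ => rfl⟩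
  · rw [← neg_add, ← Finset.sum_add_distrib]
    refine congrArg _ (Finset.sum_congr rfl fun α _ => ?_)
    rw [← integral_add (hi ψ α) (hi φ α)]
    congr with z
    rw [← mul_add, ← sd_add (isTest_of_mem ψ).1 (isTest_of_mem φ).1]
    rfl
  · simp only [RingHom.id_apply, smul_eq_mul, mul_neg, Finset.mul_sum]
    refine congrArg _ (Finset.sum_congr rfl fun α _ => ?_)
    rw [← integral_const_mul]
    congr with z
    rw [mul_left_comm, ← sd_const_mul c (isTest_of_mem ψ).1]
    rfl
  -- Only first derivatives occur, so order one suffices, with the L¹ norms on the time interval as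
  -- constant.
  · refine ⟨1, ∑ α, ∫ z in Icc a c ×ˢ univ, |Q α z|, fun ψ hψ M hM => ?_⟩
    have hM1 := abs_sd_le (f := fun z : ST => ψ.1 z.1 z.2) (hM 1 le_rfl)
    change |-∑ α, ∫ z, Q α z * sd α (fun z => ψ.1 z.1 z.2) z| ≤ _
    rw [abs_neg, Finset.sum_mul]
    refine (Finset.abs_sum_le_sum_abs _ _).trans (Finset.sum_le_sum fun α _ => ?_)
    have h0 : ∀ z ∉ Icc a c ×ˢ (univ : Set T3), Q α z * sd α (fun z => ψ.1 z.1 z.2) z = 0 := by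
      rintro ⟨t, x⟩ hz
      have ht : t ∉ Icc a c := fun h => hz ⟨h, mem_univ _⟩
      have hev : ∀ᶠ y : STE in 𝓝 0, ψ.1 (t + y.1) (x + proj y.2) = 0 := by
        have : ∀ᶠ y : STE in 𝓝 0, t + y.1 ∈ (Icc a c)ᶜ := by
          refine ContinuousAt.eventually_mem (by fun_prop) ?_
          simpa using isClosed_Icc.isOpen_compl.mem_nhds ht
        filter_upwards [this] with y hy
        exact hψ _ hy _
      have : sd α (fun z => ψ.1 z.1 z.2) (t, x) = 0 := by
        have h1 : (fun y : STE => ψ.1 (((t, x) : ST) + stHom y).1 (((t, x) : ST) + stHom y).2)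
            =ᶠ[𝓝 0] fun _ => 0 := hev
        rw [sd, h1.fderiv_eq]
        simp
      rw [this, mul_zero]
    rw [← setIntegral_eq_integral_of_forall_compl_eq_zero h0]
    refine (abs_integral_le_integral_abs).trans ?_
    rw [← integral_mul_const]
    refine integral_mono_of_nonneg (Eventually.of_forall fun z => abs_nonneg _)
      ((hQ α a c ha hc).abs.mul_const M) (Eventually.of_forall fun z => ?_)
    simp only [abs_mul]
    exact mul_le_mul_of_nonneg_left (hM1 α z) (abs_nonneg _)

lemma memLocLp_of_ext {T : ℝ} {f : ℝ → T3 → ℝ}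
    (h : ∀ a c : ℝ, 0 < a → c < T → IntegrableOn (ext T f) (Icc a c ×ˢ univ)) : MemLocLp T 1 f := by
  intro a c ha hc
  rw [memLp_one_iff_integrable, ← Measure.restrict_univ (μ := (volume : Measure T3)),
    Measure.prod_restrict, ← Measure.volume_eq_prod]
  refine IntegrableOn.congr_fun (h a c ha hc) (fun z hz => ?_)
    (measurableSet_Icc.prod MeasurableSet.univ)
  rw [ext_of_mem ⟨ha.trans_le hz.1.1, hz.1.2.trans_lt hc⟩]
  rfl

lemma memLocLp_of_comp {T : ℝ} {v : ℝ → T3 → E3}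
    (h : ∀ i, ∀ a c : ℝ, 0 < a → c < T → IntegrableOn (comp T v i) (Icc a c ×ˢ univ)) :
    MemLocLp T 1 v := fun a c ha hc =>
  MemLp.of_eval_piLp fun i => memLocLp_of_ext (f := fun t x => v t x i) (h i) a c ha hc

lemma exists_vecTest_eq {T : ℝ} (η : TestFn T E3) :
    ∃ (f : Fin 3 → ST → ℝ) (hf : ∀ i, IsTest T (f i)), η = vecTest hf := by
  obtain ⟨h, a, c, ha, hc, h0⟩ := η.2
  rw [contDiff_piLp] at h
  exact ⟨fun i z => η.1 z.1 z.2 i, fun i => ⟨h i, a, c, ha, hc, fun z hz => by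
    change η.1 z.1 z.2 i = 0
    rw [h0 _ hz]
    rfl⟩, rfl⟩

namespace Setting

variable {T p q m n : ℝ} {u b j : ℝ → T3 → E3} {P : ℝ → T3 → ℝ} (S : Setting T p q m n u b j P)
include S

/-- The mean pressure is locally integrable in time and u is bounded in time with values in L²,
hence in L¹. This is where the energy bound on u is used. -/
lemma loc_mean_mul (i : Fin 3) (a c : ℝ) (ha : 0 < a) (hc : c < T) :
    IntegrableOn (fun z : ST => meanPressure T P z.1 * comp T u i z) (Icc a c ×ˢ univ) := by
  have h1 := S.loc_pressure a c ha hc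
  have hu := (S.mixU i).1.integrableOn (s := Icc a c ×ˢ univ)
  obtain ⟨M, hM, hb⟩ := S.u2.exists_bound
  rw [IntegrableOn, Measure.volume_eq_prod, ← Measure.prod_restrict, Measure.restrict_univ]
    at h1 hu ⊢
  have h2 : Integrable (meanPressure T P) (volume.restrict (Icc a c)) := h1.integral_prod_left
  have hm : AEStronglyMeasurable (fun z : ℝ × T3 => meanPressure T P z.1 * comp T u i z)
      ((volume.restrict (Icc a c)).prod volume) := h2.1.comp_fst.mul hu.1
  refine ⟨hm, ?_⟩
  rw [HasFiniteIntegral, lintegral_prod _ hm.enorm]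
  refine lt_of_le_of_lt (lintegral_mono_ae (g := fun t => ‖meanPressure T P t‖ₑ * M) ?_) ?_
  · filter_upwards [ae_restrict_of_ae (hb i), ae_restrict_of_ae (ae_integrable_slice (S.mixU i).1)]
      with t ht hi
    simp only [enorm_mul]
    rw [lintegral_const_mul' _ _ enorm_ne_top]
    gcongr
    rw [← eLpNorm_one_eq_lintegral_enorm]
    refine (eLpNorm_le_eLpNorm_of_exponent_le (q := .ofReal 2) ?_ hi.1).trans ht
    rw [← ENNReal.ofReal_one]
    exact ENNReal.ofReal_le_ofReal one_le_two
  · rw [lintegral_mul_const' _ _ hM]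
    exact ENNReal.mul_lt_top h2.2 hM.lt_top

/-- On almost every slice u is orthogonal to ∇ψ. Multiplication by the time-dependent mean, however
irregular, cannot change that. -/
lemma integral_mean_flux {ψ : ST → ℝ} (hψ : IsTest T ψ) :
    ∑ i, ∫ z : ST, meanPressure T P z.1 * comp T u i z * sd (some i) ψ z = 0 := by
  have hi : ∀ {Φ : ST → ℝ}, IsTest T Φ → ∀ i : Fin 3,
      Integrable fun z => comp T u i z * sd (some i) Φ z :=
    fun hΦ i => integral_pair_test (S.mixU i).1 (hΦ.sd _)
  have h1 : ∀ i, Integrable fun z : ST =>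
      meanPressure T P z.1 * comp T u i z * sd (some i) ψ z := fun i =>
    (hψ.sd _).integrable_mul_of_loc (S.loc_mean_mul i)
  have hs := integrable_finsetSum Finset.univ fun i _ => h1 i
  rw [← integral_finsetSum _ fun i _ => h1 i]
  simp_rw [mul_assoc, ← Finset.mul_sum] at hs ⊢
  refine integral_time_mul_eq_zero hs ?_
  have hsl := ae_slice_integral_eq_zero (T := T) (g := fun z => ∑ i, comp T u i z * sd (some i) ψ z)
    (fun a c _ _ => (integrable_finsetSum _ fun i _ => hi hψ i).integrableOn) fun χ hχ hc ht => by
      have hχs : SmoothST fun z : ST => χ z.1 := hχ.comp contDiff_fst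
      have := weakDiv_sp_iff.1 S.sol.div_u.weakDiv _ (hψ.mul_smooth hχs)
      simp only [zero_mul, integral_zero] at this
      rw [← this]
      congr with z
      rw [Finset.mul_sum]
      refine Finset.sum_congr rfl fun k _ => ?_
      have h0 : sd (some k) (fun z : ST => χ z.1) z = 0 := by
        rw [show z = (z.1, z.2) from rfl, sd_space_eq hχs]
        simp [pd]
      rw [sd_mul hψ.1 hχs, h0]
      ring
  filter_upwards [hsl] with t h
  by_cases htT : t ∈ Ioo 0 T
  · exact Or.inr (h htT)
  · have h0 : ∀ k x, comp T u k (t, x) = 0 := fun k x => comp_of_notMem (by exact htT)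
    simp [h0]

variable {G : Fin 3 → Fin 3 → ST → ℝ} (hG : IsGradient T m n b G)
include hG

omit S hG in
lemma ext_energyDensity (z : ST) : ext T (energyDensity u b) z =
    (∑ l, (comp T u l z * comp T u l z + comp T b l z * comp T b l z)) / 2 := by
  by_cases hz : z.1 ∈ Ioo 0 T
  · simp only [ext_of_mem hz, comp_of_mem hz, energyDensity, EuclideanSpace.norm_sq_eq,
      Real.norm_eq_abs, sq_abs, Finset.sum_add_distrib]
    simp only [sq]
  · simp [ext_of_notMem hz, comp_of_notMem hz]

omit hG in
lemma loc_energyDensity (a c : ℝ) : IntegrableOn (ext T (energyDensity u b)) (Icc a c ×ˢ univ) := by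
  refine Integrable.integrableOn ?_
  simp_rw [funext ext_energyDensity]
  exact (integrable_finsetSum Finset.univ fun l _ =>
        int_add (S.int_uu l l) (S.int_bb l l)).div_const 2

lemma loc_energyFlux (i : Fin 3) (a c : ℝ) (ha : 0 < a) (hc : c < T) :
    IntegrableOn (comp T (energyFlux u b j (tensorDiv b G) P) i) (Icc a c ×ˢ univ) := by
  simp_rw [funext (comp_energyFlux u b j (tensorDiv b G) P i)]
  exact (S.integrable_flux hG i).integrableOn.add (S.loc_mean_mul i a c ha hc)

lemma isWeakDivTensor : IsWeakDivTensor T b (tensorDiv b G) := by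
  intro η
  obtain ⟨f, hf, rfl⟩ := exists_vecTest_eq η
  rw [stInt_eq_of_isTest (F := fun z => ∑ i, comp T (tensorDiv b G) i z * f i z),
    stInt_eq_of_isTest (F := fun z => ∑ i, ∑ k, comp T b k z * comp T b i z * sd (some k) (f i) z)]
  · rw [integral_finsetSum _ fun i _ => integral_pair_test (S.int_tensorDiv hG i) (hf i),
      integral_finsetSum _ fun i _ => integrable_finsetSum _ fun k _ =>
        integral_pair_test (S.int_bb k i) ((hf i).sd _), ← Finset.sum_neg_distrib]
    refine Finset.sum_congr rfl fun i _ => ?_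
    have := weakDiv_sp_iff.1 ((S.hallData hG).tensor i) _ (hf i)
    rw [this, ← integral_neg]
    simp only [comp_tensorDiv, neg_mul, neg_neg]
  · intro z hz
    simp only [comp_of_mem hz, pd_vecTest]
  · intro z hz
    simp [comp_of_notMem hz]
  · intro z hz
    simp only [PiLp.inner_apply, comp_of_mem hz, vecTest]
    exact Finset.sum_congr rfl fun k _ => mul_comm _ _
  · intro z hz
    simp [comp_of_notMem hz]

lemma memLocLp_cross : MemLocLp T 1 fun t x => cross (tensorDiv b G t x) (b t x) := by
  refine memLocLp_of_comp fun i a c _ _ => Integrable.integrableOn ?_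
  refine (int_sub (S.int_tensorDiv_mul hG (i + 1) (i + 2))
    (S.int_tensorDiv_mul hG (i + 2) (i + 1))).congr (Eventually.of_forall fun z => ?_)
  by_cases hz : z.1 ∈ Ioo 0 T
  · simp only [comp_of_mem hz, cross, crossProduct]
    fin_cases i <;> simp
  · simp [comp_of_notMem hz]

/-- The dissipation distribution, and the local energy equation. -/
theorem exists_balance : ∃ D : TestFn T ℝ →ₗ[ℝ] ℝ, IsDistribution T D ∧
    SatisfiesBalance T (energyDensity u b) (energyFlux u b j (tensorDiv b G) P) D ∧
    ∀ ψ : TestFn T ℝ, D ψ = khmRhs (fun f g => corr f g (stHom 0)) (fun z => ψ.1 z.1 z.2)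
      (comp T u) (comp T b) (comp T j) (press T P) := by
  obtain ⟨D, hD, h⟩ := exists_distribution (T := T) (Q := fun α => α.elim
    (ext T (energyDensity u b)) fun i => comp T (energyFlux u b j (tensorDiv b G) P) i) (by
      rintro (_ | i) a c ha hc
      · exact S.loc_energyDensity a c
      · exact S.loc_energyFlux hG i a c ha hc)
  refine ⟨D, hD, fun ψ => ?_, fun ψ => ?_⟩
  · have hψ := isTest_of_mem ψ
    rw [h, Fintype.sum_option]
    simp only [Option.elim]
    rw [← integral_finsetSum _ fun i _ =>
      (hψ.sd _).integrable_mul_of_loc (S.loc_energyFlux hG i), neg_add, ← sub_eq_add_neg]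
    congr 2
    · refine stInt_eq_of_isTest (fun z hz => ?_) fun z hz => ?_
      · rw [ext_of_mem hz, show z = (z.1, z.2) from rfl, sd_time_eq hψ.1]
      · rw [ext_of_notMem hz, zero_mul]
    · refine stInt_eq_of_isTest (fun z hz => ?_) fun z hz => ?_
      · simp only [comp_of_mem hz, PiLp.inner_apply, sd_space_eq hψ.1, grad]
        exact Finset.sum_congr rfl fun k _ => mul_comm _ _
      · simp [comp_of_notMem hz]
  · have hψ := isTest_of_mem ψ
    have h2 : ∀ i, ∫ z, comp T (energyFlux u b j (tensorDiv b G) P) i z *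
        sd (some i) (fun z => ψ.1 z.1 z.2) z = _ := fun i => by
      simp_rw [comp_energyFlux, add_mul]
      exact integral_add (integral_pair_test (S.integrable_flux hG i) (hψ.sd _))
        ((hψ.sd _).integrable_mul_of_loc (S.loc_mean_mul i))
    rw [h, S.khmRhs_zero hG hψ, Fintype.sum_option]
    simp only [Option.elim, h2, Finset.sum_add_distrib, S.integral_mean_flux hψ,
      funext ext_energyDensity]
    ring

end Setting

end

section

/-! ### Averages of trilinear increments -/

/-- The trilinear increment of three scalar fields. -/
def stIncr (f g h : ST → ℝ) (l : E3) (z : ST) : ℝ :=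
  (f (z + stHom (0, l)) - f z) * ((g (z + stHom (0, l)) - g z) * (h (z + stHom (0, l)) - h z))

/-- The trilinear increment, tested against `ψ`. -/
def incrCorr (ψ f g h : ST → ℝ) (l : E3) : ℝ := ∫ y, ψ y * stIncr f g h l y

/-- The integrand `(θ · δv(s)) (δw(s) · δz(s))`. -/
def incrForm {X : Type*} (θ s : X → E3) (v w z : ℝ → T3 → E3) (t : ℝ) (x : T3) (ξ : X) : ℝ :=
  inner ℝ (θ ξ) (incr v t x (s ξ)) * inner ℝ (incr w t x (s ξ)) (incr z t x (s ξ))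

/-- A purely spatial shift stays on its time slice, so taking increments commutes with extension by
zero. -/
lemma ext_incrForm {X : Type*} {T : ℝ} (θ s : X → E3) (v w z : ℝ → T3 → E3) (ξ : X) (y : ST) :
    ext T (fun t x => incrForm θ s v w z t x ξ) y =
      ∑ k, ∑ i, θ ξ k * stIncr (comp T v k) (comp T w i) (comp T z i) (s ξ) y := by
  have h1 : (y + stHom (0, s ξ)).1 = y.1 := add_zero _
  have h2 : (y + stHom (0, s ξ)).2 = y.2 + proj (s ξ) := rfl
  by_cases hy : y.1 ∈ Ioo 0 T
  · have hy' : (y + stHom (0, s ξ)).1 ∈ Ioo 0 T := by rwa [h1]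
    simp only [ext_of_mem hy, incrForm, stIncr, comp_of_mem hy, comp_of_mem hy', h1, h2,
      PiLp.inner_apply, incr, Finset.sum_mul_sum]
    refine Finset.sum_congr rfl fun k _ => Finset.sum_congr rfl fun i _ => ?_
    simp
    ring
  · have hy' : (y + stHom (0, s ξ)).1 ∉ Ioo 0 T := by rwa [h1]
    simp only [ext_of_notMem hy, stIncr, comp_of_notMem hy, comp_of_notMem hy', sub_zero, mul_zero,
      Finset.sum_const_zero]

section Average

variable {X : Type*} [MeasurableSpace X] {μ : Measure X} [SFinite μ]

/-- Increments of a Hölder triple are bounded in L¹ uniformly in the shift, so any integrable weight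
on the space of shifts gives joint integrability. -/
lemma integrable_stIncr {f g h : ST → ℝ} (hF : Tri ![f, g, h]) {ρ : X → ℝ} (hρ : Integrable ρ μ)
    {s : X → E3} (hs : Measurable s) :
    Integrable (fun y : X × ST => ρ y.1 * stIncr f g h (s y.1) y.2) (μ.prod volume) := by
  have hw : Measurable fun ξ => stHom (0, s ξ) :=
    continuous_stHom.measurable.comp (measurable_const.prodMk hs)
  have hd : ∀ {f : ST → ℝ}, AEStronglyMeasurable f →
      AEStronglyMeasurable (fun y : X × ST => f (y.2 + stHom (0, s y.1)) - f y.2) (μ.prod volume) :=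
    fun hf => (aesm_shift_comp μ hw hf).sub hf.comp_snd
  have hm : AEStronglyMeasurable (fun y : X × ST => ρ y.1 * stIncr f g h (s y.1) y.2)
      (μ.prod volume) :=
    hρ.1.comp_fst.mul ((hd (hF.aesm 0)).mul ((hd (hF.aesm 1)).mul (hd (hF.aesm 2))))
  obtain ⟨K, hK, hb⟩ := hF.exists_bound_incr
  refine ⟨hm, ?_⟩
  rw [HasFiniteIntegral, lintegral_prod _ hm.enorm]
  refine lt_of_le_of_lt (lintegral_mono (g := fun ξ => ‖ρ ξ‖ₑ * K) fun ξ => ?_) ?_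
  · simp only [enorm_mul]
    rw [lintegral_const_mul' _ _ enorm_ne_top]
    gcongr
    refine le_of_eq_of_le ?_ (hb (stHom (0, s ξ)))
    simp [Fin.prod_univ_three, stIncr, enorm_mul, mul_assoc]
  · rw [lintegral_mul_const' _ _ hK]
    exact ENNReal.mul_lt_top hρ.2 hK.lt_top

variable {T : ℝ} {θ s : X → E3} {v w z : ℝ → T3 → E3}

lemma integrable_incrForm (hθ : ∀ k, Integrable (fun ξ => θ ξ k) μ) (hs : Measurable s)
    (hF : ∀ k i, Tri ![comp T v k, comp T w i, comp T z i]) :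
    Integrable (fun y : X × ST => ext T (fun t x => incrForm θ s v w z t x y.1) y.2)
      (μ.prod volume) := by
  simp_rw [ext_incrForm]
  exact integrable_finsetSum _ fun k _ => integrable_finsetSum _ fun i _ =>
    integrable_stIncr (hF k i) (hθ k) hs

lemma ext_integral_incrForm (y : ST) :
    ext T (fun t x => ∫ ξ, incrForm θ s v w z t x ξ ∂μ) y =
      ∫ ξ, ext T (fun t x => incrForm θ s v w z t x ξ) y ∂μ := by
  by_cases hy : y.1 ∈ Ioo 0 T
  · simp only [ext_of_mem hy]
  · simp only [ext_of_notMem hy, integral_zero]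

/-- Fubini. Shifts by vectors of ℝ³ weighted with ∇φ_ε and shifts by points of a sphere weighted
with the normal are two instances of the same average, which settles the mollified integrals and the
structure functions at once. -/
lemma incrForm_wellDefined (hθ : ∀ k, Integrable (fun ξ => θ ξ k) μ) (hs : Measurable s)
    (hF : ∀ k i, Tri ![comp T v k, comp T w i, comp T z i]) :
    (∀ᵐ y ∂(stMeasure T), Integrable (incrForm θ s v w z y.1 y.2) μ) ∧
      Integrable (fun y : ℝ × T3 => ∫ ξ, incrForm θ s v w z y.1 y.2 ξ ∂μ) (stMeasure T) := by
  have h := integrable_incrForm hθ hs hF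
  constructor
  · rw [stMeasure_eq, ae_restrict_iff' (measurableSet_slab T)]
    filter_upwards [h.prod_left_ae] with y hy hyT
    refine hy.congr (Eventually.of_forall fun ξ => ?_)
    exact ext_of_mem hyT.1
  · rw [← integrable_ext_iff (f := fun t x => ∫ ξ, incrForm θ s v w z t x ξ ∂μ)]
    simp_rw [funext ext_integral_incrForm]
    exact h.integral_prod_right

lemma hasInt_incrForm (hθ : ∀ k, Integrable (fun ξ => θ ξ k) μ) (hs : Measurable s)
    (hF : ∀ k i, Tri ![comp T v k, comp T w i, comp T z i]) {ψ : ST → ℝ} (hψ : IsTest T ψ) :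
    (∀ k i, Integrable (fun ξ => θ ξ k *
      incrCorr ψ (comp T v k) (comp T w i) (comp T z i) (s ξ)) μ) ∧
    HasInt ψ (ext T fun t x => ∫ ξ, incrForm θ s v w z t x ξ ∂μ) (∑ k, ∑ i, ∫ ξ, θ ξ k *
      incrCorr ψ (comp T v k) (comp T w i) (comp T z i) (s ξ) ∂μ) := by
  obtain ⟨C, -, hC⟩ := hψ.bound
  have hm : AEStronglyMeasurable (fun y : X × ST => ψ y.2) (μ.prod volume) :=
    (hψ.continuous.measurable.comp measurable_snd).aestronglyMeasurable
  have h0 : Integrable (fun y : X × ST => ψ y.2 *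
      ext T (fun t x => incrForm θ s v w z t x y.1) y.2) (μ.prod volume) :=
    (integrable_incrForm hθ hs hF).bdd_mul hm (Eventually.of_forall fun y => hC y.2)
  have h1 : ∀ k i, Integrable (fun y : X × ST => ψ y.2 * (θ y.1 k *
      stIncr (comp T v k) (comp T w i) (comp T z i) (s y.1) y.2)) (μ.prod volume) := fun k i =>
    (integrable_stIncr (hF k i) (hθ k) hs).bdd_mul hm (Eventually.of_forall fun y => hC y.2)
  have h2 : ∀ k i ξ, ∫ y, ψ y * (θ ξ k * stIncr (comp T v k) (comp T w i) (comp T z i) (s ξ) y) =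
      θ ξ k * incrCorr ψ (comp T v k) (comp T w i) (comp T z i) (s ξ) := fun k i ξ => by
    rw [incrCorr, ← integral_const_mul]
    congr with y
    ring
  refine ⟨fun k i => ?_, ?_, ?_⟩
  · have := (h1 k i).integral_prod_left
    simpa only [h2] using this
  · have := h0.integral_prod_right
    simpa only [ext_integral_incrForm, integral_const_mul] using this
  · simp_rw [ext_integral_incrForm, ← integral_const_mul]
    rw [← integral_prod_symm _ h0]
    simp_rw [ext_incrForm, Finset.mul_sum]
    rw [integral_finsetSum _ fun k _ => integrable_finsetSum _ fun i _ => h1 k i]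
    refine Finset.sum_congr rfl fun k _ => ?_
    rw [integral_finsetSum _ fun i _ => h1 k i]
    refine Finset.sum_congr rfl fun i _ => ?_
    rw [integral_prod _ (h1 k i)]
    simp only [h2]

end Average

end

section

/-! ### The limits of the increments -/

lemma integral_fderiv_apply_eq_zero {φ : E3 → ℝ} (hφ : ContDiff ℝ ∞ φ) (hc : HasCompactSupport φ)
    (v : E3) : ∫ l, fderiv ℝ φ l v = 0 := by
  have h := integral_mul_fderiv_eq_neg_fderiv_mul_of_integrable (μ := (volume : Measure E3))
    (f := fun _ => (1 : ℝ)) (g := φ) (v := v) (by simp)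
    (by simpa using ((hφ.continuous_fderiv (by simp)).clm_apply
      continuous_const).integrable_of_hasCompactSupport (hc.fderiv_apply ℝ v))
    (by simpa using hφ.continuous.integrable_of_hasCompactSupport hc)
    (fun _ _ => by fun_prop) (fun x _ => hφ.differentiable (by simp) x)
  simpa using h

lemma contDiff_rescale {φ : E3 → ℝ} (hφ : ContDiff ℝ ∞ φ) (ε : ℝ) : ContDiff ℝ ∞ (rescale φ ε) :=
  contDiff_const.mul (hφ.comp (contDiff_const_smul ε⁻¹))

lemma hasCompactSupport_rescale {φ : E3 → ℝ} (hc : HasCompactSupport φ) {ε : ℝ} (hε : 0 < ε) :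
    HasCompactSupport (rescale φ ε) :=
  (hc.comp_smul (inv_ne_zero hε.ne')).mul_left

lemma gradient_apply (φ : E3 → ℝ) (l : E3) (k : Fin 3) :
    gradient φ l k = fderiv ℝ φ l (EuclideanSpace.single k 1) := by
  rw [gradient, ← InnerProductSpace.toDual_symm_apply, EuclideanSpace.inner_single_right]
  simp

/-- Substitute l = ε l' and use continuity in ε at zero of the resulting integral. -/
lemma tendsto_integral_rescale {φ : E3 → ℝ} (h : IsMollifier φ) {A : E3 → ℝ} (hA : Continuous A) :
    Tendsto (fun ε => ∫ l, rescale φ ε l * A l) (𝓝[>] 0) (𝓝 (A 0)) := by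
  have hcont := continuous_integral_kernel (X := ℝ) h.smooth.continuous h.compact
    (V := fun y => A (y.1 • y.2)) (hA.comp (by fun_prop))
  have h0 := hcont.tendsto 0
  simp only [zero_smul] at h0
  rw [integral_mul_const, h.integral_eq_one, one_mul] at h0
  refine (h0.mono_left nhdsWithin_le_nhds).congr' ?_
  filter_upwards [self_mem_nhdsWithin] with ε (hε : 0 < ε)
  have := Measure.integral_comp_inv_smul_of_nonneg (volume : Measure E3)
    (fun l => φ l * A (ε • l)) hε.le
  simp only [smul_inv_smul₀ hε.ne', finrank_euclideanSpace_fin, smul_eq_mul] at this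
  simp only [rescale, mul_assoc]
  rw [integral_const_mul, this, inv_mul_cancel_left₀ (pow_pos hε 3).ne']

namespace Setting

variable {T p q m n : ℝ} {u b j : ℝ → T3 → E3} {P : ℝ → T3 → ℝ} (S : Setting T p q m n u b j P)
include S

lemma tri_uuu (k i : Fin 3) : Tri ![comp T u k, comp T u i, comp T u i] :=
  tri3 (S.mixU k) (S.mixU i) (S.mixU i)

lemma tri_ubb (k i : Fin 3) : Tri ![comp T u k, comp T b i, comp T b i] :=
  tri3 (S.mixU k) (S.mixB3 i) (S.mixB3 i)

lemma tri_bub (k i : Fin 3) : Tri ![comp T b k, comp T u i, comp T b i] :=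
  tri3 (S.mixB3 k) (S.mixU i) (S.mixB3 i)

lemma tri_jbb (k i : Fin 3) : Tri ![comp T j k, comp T b i, comp T b i] :=
  S.tri'' (S.mixJ k) (S.mixB i) (S.mixB i)

lemma tri_bjb (k i : Fin 3) : Tri ![comp T b k, comp T j i, comp T b i] :=
  S.tri' (S.mixB k) (S.mixJ i) (S.mixB i)

omit S in
/-- The combination of increments in the dissipation term, tested against `ψ`. -/
def dissCorr (T : ℝ) (u b j : ℝ → T3 → E3) (ψ : ST → ℝ) (k i : Fin 3) (l : E3) : ℝ :=
  -(1 / 4) * incrCorr ψ (comp T u k) (comp T u i) (comp T u i) l -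
    (1 / 4) * incrCorr ψ (comp T u k) (comp T b i) (comp T b i) l +
    (1 / 2) * incrCorr ψ (comp T b k) (comp T u i) (comp T b i) l +
    (1 / 8) * incrCorr ψ (comp T j k) (comp T b i) (comp T b i) l -
    (1 / 4) * incrCorr ψ (comp T b k) (comp T j i) (comp T b i) l

/-- True increments and their expansions differ only by the terms with no shifted factor, which do
not depend on the separation. -/
lemma exists_dissCorr_eq {ψ : ST → ℝ} (hψ : IsTest T ψ) : ∃ c : Fin 3 → ℝ, ∀ k l,
    ∑ i, dissCorr T u b j ψ k i l = (∑ i, dissForm (fun f g => corr f g (stHom (0, l))) ψ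
      (comp T u) (comp T b) (comp T j) k i) - c k := by
  obtain ⟨Q, h⟩ : ∃ Q : (ST → ℝ) → (ST → ℝ) → (ST → ℝ) → ℝ, ∀ {f g h : ST → ℝ}, Tri ![f, g, h] →
      ∀ l, incrCorr ψ f g h l = trilin (fun a b => corr a b (stHom (0, l))) ψ f g h - Q f g h :=
    ⟨fun f g h => ∫ z, ψ z * (f z * (g z * h z)), fun hF l => by
      rw [trilin_corr hF hψ, add_sub_cancel_right]
      rfl⟩
  have key : ∀ k i, ∃ c, ∀ l, dissCorr T u b j ψ k i l = dissForm (fun f g =>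
      corr f g (stHom (0, l))) ψ (comp T u) (comp T b) (comp T j) k i - c := fun k i => by
    refine ⟨-(1 / 4) * Q (comp T u k) (comp T u i) (comp T u i) -
      (1 / 4) * Q (comp T u k) (comp T b i) (comp T b i) +
      (1 / 2) * Q (comp T b k) (comp T u i) (comp T b i) +
      (1 / 8) * Q (comp T j k) (comp T b i) (comp T b i) -
      (1 / 4) * Q (comp T b k) (comp T j i) (comp T b i), fun l => ?_⟩
    simp only [dissCorr, dissForm, h (S.tri_uuu k i), h (S.tri_ubb k i), h (S.tri_bub k i),
      h (S.tri_jbb k i), h (S.tri_bjb k i)]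
    ring
  choose c hc using key
  exact ⟨fun k => ∑ i, c k i, fun k l => by simp only [hc, Finset.sum_sub_distrib]⟩

variable {G : Fin 3 → Fin 3 → ST → ℝ} (hG : IsGradient T m n b G)

include hG in
/-- The Kármán–Howarth–Monin relation in the space variables. -/
lemma exists_source {ψ : ST → ℝ} (hψ : IsTest T ψ) :
    (∀ k, Continuous fun l => ∑ i, dissCorr T u b j ψ k i l) ∧
    ∃ A : E3 → ℝ, Continuous A ∧ A 0 = khmRhs (fun f g => corr f g (stHom 0)) ψ
      (comp T u) (comp T b) (comp T j) (press T P) ∧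
    ∀ φ : E3 → ℝ, ContDiff ℝ ∞ φ → HasCompactSupport φ →
      ∑ k, ∫ l, fderiv ℝ φ l (EuclideanSpace.single k 1) * ∑ i, dissCorr T u b j ψ k i l =
        ∫ l, φ l * A l := by
  obtain ⟨-, a, c, ha, hc, h0⟩ := id hψ
  obtain ⟨τ, hτ, hτa, hτc⟩ := exists_time_margin ha hc
  obtain ⟨d, hd⟩ := S.exists_dissCorr_eq hψ
  have H := S.hallPairs
  have cV : ∀ k, Continuous fun y : STE => ∑ i, dissForm (fun f g => corr f g (stHom y)) ψ
      (comp T u) (comp T b) (comp T j) k i := fun k =>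
    continuous_finsetSum _ fun i _ => H.continuous_dissForm hψ k i
  have cA := H.continuous_khmRhs hψ
  have hl : Continuous fun l : E3 => ((0, l) : STE) := by fun_prop
  have hcd : ∀ k, Continuous fun l => ∑ i, dissCorr T u b j ψ k i l := fun k => by
    simp only [hd]
    exact ((cV k).comp hl).sub continuous_const
  refine ⟨hcd, _, cA.comp hl, rfl, fun φ hφ hφc => ?_⟩
  refine Eq.trans (Finset.sum_congr rfl fun k _ => ?_) (time_diagonal cV cA hτ
    (fun κ hκ hκ0 => H.integral_dk_mul_dissForm (S.hallData hG) hκ hψ hτa hτc h0 hκ0)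
    hφ hφc)
  have hfc : Continuous fun l => fderiv ℝ φ l (EuclideanSpace.single k 1) :=
    (hφ.continuous_fderiv (by simp)).clm_apply continuous_const
  have hfs := hφc.fderiv_apply ℝ (EuclideanSpace.single k (1 : ℝ))
  have hi : Integrable fun l => fderiv ℝ φ l (EuclideanSpace.single k 1) * ∑ i, dissForm (fun f g =>
      corr f g (stHom (0, l))) ψ (comp T u) (comp T b) (comp T j) k i :=
    (hfc.mul ((cV k).comp hl)).integrable_of_hasCompactSupport hfs.mul_right
  -- The constants drop out because derivatives of a compactly supported function integrate to zero.
  simp only [hd, mul_sub]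
  rw [integral_sub hi ((hfc.integrable_of_hasCompactSupport hfs).mul_const _), integral_mul_const,
    integral_fderiv_apply_eq_zero hφ hφc, zero_mul, sub_zero]

/-- Testing an average of increments with ψ is the same as averaging the tested increments. The
parameters θ and s are left free so that the dissipation and the spherical means share the
computation. -/
lemma hasInt_diss {X : Type*} [MeasurableSpace X] {μ : Measure X} [SFinite μ] {θ s : X → E3}
    (hθ : ∀ k, Integrable (fun ξ => θ ξ k) μ) (hs : Measurable s) {ψ : ST → ℝ} (hψ : IsTest T ψ) :
    (∀ k, Integrable (fun ξ => θ ξ k * ∑ i, dissCorr T u b j ψ k i (s ξ)) μ) ∧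
    HasInt ψ (ext T fun t x => -(1 / 4) * (∫ ξ, incrForm θ s u u u t x ξ ∂μ) -
        (1 / 4) * (∫ ξ, incrForm θ s u b b t x ξ ∂μ) + (1 / 2) * (∫ ξ, incrForm θ s b u b t x ξ ∂μ) +
        (1 / 8) * (∫ ξ, incrForm θ s j b b t x ξ ∂μ) - (1 / 4) * ∫ ξ, incrForm θ s b j b t x ξ ∂μ)
      (∑ k, ∫ ξ, θ ξ k * ∑ i, dissCorr T u b j ψ k i (s ξ) ∂μ) := by
  have h1 := hasInt_incrForm hθ hs S.tri_uuu hψ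
  have h2 := hasInt_incrForm hθ hs S.tri_ubb hψ
  have h3 := hasInt_incrForm hθ hs S.tri_bub hψ
  have h4 := hasInt_incrForm hθ hs S.tri_jbb hψ
  have h5 := hasInt_incrForm hθ hs S.tri_bjb hψ
  have key : ∀ k i, HasInt (fun ξ => θ ξ k) (fun ξ => dissCorr T u b j ψ k i (s ξ)) _ μ := fun k i =>
    ((((HasInt.smul ⟨h1.1 k i, rfl⟩ (-(1 / 4))).sub (HasInt.smul ⟨h2.1 k i, rfl⟩ (1 / 4))).add
      (HasInt.smul ⟨h3.1 k i, rfl⟩ (1 / 2))).add (HasInt.smul ⟨h4.1 k i, rfl⟩ (1 / 8))).sub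
      (HasInt.smul ⟨h5.1 k i, rfl⟩ (1 / 4))
  have key' := fun k => HasInt.sum (s := Finset.univ) (key k)
  refine ⟨fun k => (key' k).1, ?_⟩
  simp only [fun k => (key' k).2]
  convert ((((h1.2.smul (-(1 / 4))).sub (h2.2.smul (1 / 4))).add (h3.2.smul (1 / 2))).add
    (h4.2.smul (1 / 8))).sub (h5.2.smul (1 / 4)) using 1
  · funext y
    by_cases hy : y.1 ∈ Ioo 0 T
    · simp only [ext_of_mem hy]
    · simp only [ext_of_notMem hy]
      ring
  · simp only [Finset.sum_add_distrib, Finset.sum_sub_distrib, Finset.mul_sum]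

end Setting

end

section

/-! ### Convergence of the dissipation term and the 4/3 law -/

lemma integrable_gradient_rescale {φ : E3 → ℝ} (h : IsMollifier φ) {ε : ℝ} (hε : 0 < ε) (k : Fin 3) :
    Integrable fun l => gradient (rescale φ ε) l k := by
  simp only [gradient_apply]
  exact (((contDiff_rescale h.smooth ε).continuous_fderiv (by simp)).clm_apply
    continuous_const).integrable_of_hasCompactSupport
    ((hasCompactSupport_rescale h.compact hε).fderiv_apply ℝ _)

lemma integrable_sphere_coord (k : Fin 3) :
    Integrable (fun ζ : Metric.sphere (0 : E3) 1 => (ζ : E3) k) sphereMeasure :=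
  Continuous.integrable_of_hasCompactSupport (by fun_prop) (HasCompactSupport.of_compactSpace _)

lemma drWellDefined_of_tri {T : ℝ} {v w z : ℝ → T3 → E3}
    (hF : ∀ k i, Tri ![comp T v k, comp T w i, comp T z i]) {φ : E3 → ℝ} (h : IsMollifier φ) :
    DRWellDefined T φ v w z := fun _ε hε =>
  incrForm_wellDefined (integrable_gradient_rescale h hε) measurable_id hF

lemma sfWellDefined_of_tri {T : ℝ} {v w z : ℝ → T3 → E3}
    (hF : ∀ k i, Tri ![comp T v k, comp T w i, comp T z i]) : SFWellDefined T v w z := fun r _ => by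
  have h := incrForm_wellDefined (s := fun ζ : Metric.sphere (0 : E3) 1 => r • (ζ : E3))
    integrable_sphere_coord (by fun_prop) hF
  exact ⟨h.1, (h.2.const_mul _).const_mul _⟩

lemma structFn_eq (v w z : ℝ → T3 → E3) (r t : ℝ) (x : T3) : structFn v w z r t x =
    r⁻¹ * ((4 * Real.pi)⁻¹ * ∫ ζ, incrForm (fun ζ : Metric.sphere (0 : E3) 1 => (ζ : E3))
      (fun ζ => r • (ζ : E3)) v w z t x ζ ∂sphereMeasure) := rfl

lemma stInt_mul_test {T : ℝ} (f : ℝ → T3 → ℝ) (ψ : TestFn T ℝ) :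
    stInt T (fun t x => f t x * ψ.1 t x) = ∫ y : ST, ψ.1 y.1 y.2 * ext T f y :=
  stInt_eq_of_isTest (fun y hy => by rw [ext_of_mem hy, mul_comm])
    fun y hy => by rw [ext_of_notMem hy, mul_zero]

lemma hasInt_structFn {T : ℝ} {v w z : ℝ → T3 → E3} (h : SFWellDefined T v w z) {r : ℝ} (hr : 0 < r)
    (ψ : TestFn T ℝ) : HasInt (fun y : ℝ × T3 => ψ.1 y.1 y.2)
      (fun y => -structFn v w z r y.1 y.2)
      (stInt T fun t x => -structFn v w z r t x * ψ.1 t x) (stMeasure T) := by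
  obtain ⟨C, -, hC⟩ := (isTest_of_mem ψ).bound
  exact ⟨(h r hr).2.neg.bdd_mul (isTest_of_mem ψ).continuous.aestronglyMeasurable
    (Eventually.of_forall hC), by simp only [stInt, mul_comm]⟩

/-- The distributional limits of the structure functions combine linearly. -/
lemma structLimit_unique {T : ℝ} {u b j : ℝ → T3 → E3} {L S₁ S₂ S₃ S₄ S₅ : TestFn T ℝ →ₗ[ℝ] ℝ}
    (w₁ : SFWellDefined T j b b) (w₂ : SFWellDefined T b j b) (w₃ : SFWellDefined T u u u)
    (w₄ : SFWellDefined T u b b) (w₅ : SFWellDefined T b u b)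
    (hL : TendstoDistr T (fun r t x => -(structFn u u u r t x + structFn u b b r t x
        - 2 * structFn b u b r t x - (1 / 2) * structFn j b b r t x + structFn b j b r t x)) L)
    (h₁ : IsStructLimit T j b b S₁) (h₂ : IsStructLimit T b j b S₂) (h₃ : IsStructLimit T u u u S₃)
    (h₄ : IsStructLimit T u b b S₄) (h₅ : IsStructLimit T b u b S₅) :
    S₃ + S₄ - (2 : ℝ) • S₅ - (1 / 2 : ℝ) • S₁ + S₂ = L := by
  ext ψ
  refine tendsto_nhds_unique (((((h₃.2 ψ).add (h₄.2 ψ)).sub ((h₅.2 ψ).const_mul 2)).sub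
    ((h₁.2 ψ).const_mul (1 / 2))).add (h₂.2 ψ)) ((hL ψ).congr' ?_)
  filter_upwards [self_mem_nhdsWithin] with r (hr : 0 < r)
  rw [← (((((hasInt_structFn w₃ hr ψ).add (hasInt_structFn w₄ hr ψ)).sub
    ((hasInt_structFn w₅ hr ψ).smul 2)).sub ((hasInt_structFn w₁ hr ψ).smul (1 / 2))).add
    (hasInt_structFn w₂ hr ψ)).2]
  refine integral_congr_ae (Eventually.of_forall fun y => ?_)
  simp only
  ring

namespace Setting

variable {T p q m n : ℝ} {u b j : ℝ → T3 → E3} {P : ℝ → T3 → ℝ} (S : Setting T p q m n u b j P)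
  {G : Fin 3 → Fin 3 → ST → ℝ} (hG : IsGradient T m n b G) {D : TestFn T ℝ →ₗ[ℝ] ℝ}
  (hD : ∀ ψ : TestFn T ℝ, D ψ = khmRhs (fun f g => corr f g (stHom 0)) (fun z => ψ.1 z.1 z.2)
      (comp T u) (comp T b) (comp T j) (press T P))
include S hG hD

/-- The tested dissipation is the left side of the spatial relation with φ = φ_ε, hence equals ∫ φ_ε
A. Its limit A(0) does not see the shape of the mollifier; neither radial symmetry nor evenness is
used. -/
lemma tendsto_dissipation {φ : E3 → ℝ} (h : IsMollifier φ) :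
    TendstoDistr T (dissipation φ u b j) D := by
  intro ψ
  have hψ := isTest_of_mem ψ
  obtain ⟨-, A, hA, hA0, hrel⟩ := S.exists_source hG hψ
  rw [hD, ← hA0]
  refine (tendsto_integral_rescale h hA).congr' ?_
  filter_upwards [self_mem_nhdsWithin] with ε (hε : 0 < ε)
  rw [← hrel _ (contDiff_rescale h.smooth ε) (hasCompactSupport_rescale h.compact hε),
    stInt_mul_test]
  have := (S.hasInt_diss (integrable_gradient_rescale h hε) measurable_id hψ).2.2
  simp only [gradient_apply, id] at this
  exact this.symm

lemma tendsto_structFn : TendstoDistr T (fun r t x => -(structFn u u u r t x + structFn u b b r t x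
    - 2 * structFn b u b r t x - (1 / 2) * structFn j b b r t x + structFn b j b r t x))
    (-(4 / 3 : ℝ) • D) := by
  intro ψ
  have hψ := isTest_of_mem ψ
  obtain ⟨hV, A, hA, hA0, hrel⟩ := S.exists_source hG hψ
  -- The factor 4 turns the coefficients 1/4, 1/4, 1/2, 1/8, 1/4 of the dissipation into the
  -- coefficients 1, 1, 2, 1/2, 1 of the structure functions; combined with the 1/3 from the ball it
  -- gives 4/3.
  have hlim := (tendsto_sphere_flux hV hA hrel).const_mul 4
  rw [LinearMap.smul_apply, hD, ← hA0, smul_eq_mul,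
    show -(4 / 3 : ℝ) * A 0 = 4 * (-(1 / 3) * A 0) by ring]
  refine hlim.congr fun r => ?_
  have := S.hasInt_diss (θ := fun ζ : Metric.sphere (0 : E3) 1 => (ζ : E3)) (s := fun ζ => r • (ζ : E3))
    integrable_sphere_coord (by fun_prop) hψ
  rw [integral_finsetSum _ fun k _ => this.1 k, ← this.2.2, ← mul_assoc, ← mul_assoc,
    ← integral_const_mul, stInt_mul_test]
  congr with y
  by_cases hy : y.1 ∈ Ioo 0 T
  · simp only [ext_of_mem hy]
    simp only [structFn_eq]
    ring
  · simp only [ext_of_notMem hy, mul_zero]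

end Setting

end

end

end HallMHD

/-! ### The local energy equation and the 4/3 law -/

open HallMHD in
theorem theorem1p4 (T : ℝ) (hT : 0 < T) (p q m n : ℝ)
    (hp : 1 < p) (hq : 1 < q) (hm : 1 < m) (hn : 1 < n)
    (hpm : 2 / p + 1 / m = 1) (hqn : 2 / q + 1 / n = 1)
    (u b j : ℝ → T3 → E3) (P : ℝ → T3 → ℝ)
    (hsol : IsWeakSolution T u b j P)
    (hu2 : MemMixed T ⊤ 2 u) (hu3 : MemMixed T 3 3 u)
    (hb2 : MemMixed T ⊤ 2 b) (hbpq : MemMixed T (ENNReal.ofReal p) (ENNReal.ofReal q) b)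
    (hj : MemMixed T (ENNReal.ofReal m) (ENNReal.ofReal n) j) :
    ∃ D : TestFn T ℝ →ₗ[ℝ] ℝ, IsDistribution T D ∧
      -- convergence of the dissipation term
      (∀ φ : E3 → ℝ, IsMollifier φ →
        DRWellDefined T φ u u u ∧ DRWellDefined T φ u b b ∧ DRWellDefined T φ b u b ∧
        DRWellDefined T φ j b b ∧ DRWellDefined T φ b j b ∧
        TendstoDistr T (dissipation φ u b j) D) ∧
      -- the local energy equation
      (∃ F : ℝ → T3 → E3, MemLocLp T 1 F ∧ IsWeakDivTensor T b F ∧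
        MemLocLp T 1 (fun t x => cross (F t x) (b t x)) ∧
        MemLocLp T 1 (energyDensity u b) ∧ MemLocLp T 1 (energyFlux u b j F P) ∧
        SatisfiesBalance T (energyDensity u b) (energyFlux u b j F P) D) ∧
      -- the 4/3 law
      (SFWellDefined T u u u ∧ SFWellDefined T u b b ∧ SFWellDefined T b u b ∧
        SFWellDefined T j b b ∧ SFWellDefined T b j b) ∧
      TendstoDistr T (fun r t x => -(structFn u u u r t x + structFn u b b r t x
        - 2 * structFn b u b r t x - (1 / 2) * structFn j b b r t x + structFn b j b r t x))
        (-(4 / 3 : ℝ) • D) ∧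
      (∀ S₁ S₂ S₃ S₄ S₅ : TestFn T ℝ →ₗ[ℝ] ℝ,
        IsStructLimit T j b b S₁ → IsStructLimit T b j b S₂ → IsStructLimit T u u u S₃ →
        IsStructLimit T u b b S₄ → IsStructLimit T b u b S₅ →
        S₃ + S₄ - (2 : ℝ) • S₅ - (1 / 2 : ℝ) • S₁ + S₂ = -(4 / 3 : ℝ) • D) := by
  have S : Setting T p q m n u b j P :=
    ⟨hT, hp, hq, hm, hn, hpm, hqn, hsol, hu2, hu3, hb2, hbpq, hj⟩
  obtain ⟨G, hG1, hG2, hG3⟩ := S.exists_gradient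
  have hG : Setting.IsGradient T m n b G := ⟨hG1, hG2, hG3⟩
  obtain ⟨D, hD, hbal, hDψ⟩ := S.exists_balance hG
  have w₁ := sfWellDefined_of_tri S.tri_jbb
  have w₂ := sfWellDefined_of_tri S.tri_bjb
  have w₃ := sfWellDefined_of_tri S.tri_uuu
  have w₄ := sfWellDefined_of_tri S.tri_ubb
  have w₅ := sfWellDefined_of_tri S.tri_bub
  have hlaw := S.tendsto_structFn hG hDψ
  refine ⟨D, hD, fun φ hφ => ⟨drWellDefined_of_tri S.tri_uuu hφ, drWellDefined_of_tri S.tri_ubb hφ,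
    drWellDefined_of_tri S.tri_bub hφ, drWellDefined_of_tri S.tri_jbb hφ,
    drWellDefined_of_tri S.tri_bjb hφ, S.tendsto_dissipation hG hDψ hφ⟩,
    ⟨tensorDiv b G, memLocLp_of_comp fun i _ _ _ _ => (S.int_tensorDiv hG i).integrableOn,
      S.isWeakDivTensor hG, S.memLocLp_cross hG,
      memLocLp_of_ext fun a c _ _ => S.loc_energyDensity a c,
      memLocLp_of_comp (S.loc_energyFlux hG), hbal⟩,
    ⟨w₃, w₄, w₅, w₁, w₂⟩, hlaw, fun S₁ S₂ S₃ S₄ S₅ h₁ h₂ h₃ h₄ h₅ =>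
      structLimit_unique w₁ w₂ w₃ w₄ w₅ hlaw h₁ h₂ h₃ h₄ h₅⟩
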